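/- **Setting.** For each $\theta\in\Theta\subset\mathbb R^d$ let $\{X_k,Y_k\}_{k\ge 0}$ be a hidden Markov model: the hidden chain $X_k$ lives in a Polish space $\mathcal X$ and has transition density $q_\theta(x,x')$ with respect to a finite measure $\mu$; given $X_k=x$, the observation $Y_k$ is conditionally independent of everything else and has density $g_\theta(y|x)$ with respect to a measure $\nu$ on $\mathbb R^m$ that is finite on bounded sets and carried by a measurable set $\mathcal Y\subset\mathbb R^m$. The joint chain has a stationary distribution $\pi_\theta$, and $\overline{\mathbb P}_\theta$ denotes the stationary law. The set $\Theta$ is compact and connected, derivatives of functions on $\Theta$ are uniquely determined at all of its points (at each point its tangent directions span $\mathbb R^d$), and for some constant $L$ any two points $a,b\in\Theta$ are joined inside $\Theta$ by a path of length at most $L|a-b|$ (for instance, $\Theta$ is convex with nonempty interior). Let $\theta^*\in\Theta$ be the true parameter, $Y$ an observation under $\overline{\mathbb P}_{\theta^*}$, and $B_y^\epsilon$ the closed ball of radius $\epsilon$ about $y$. Assume: * (A1) $\theta^*$ is an interior point of $\Theta$, and for $\theta\in\Theta$ the law of the observation process under $\overline{\mathbb P}_\theta$ equals that under $\overline{\mathbb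 P}_{\theta^*}$ if and only if $\theta=\theta^*$. * (A2) For all $x,x'\in\mathcal X$, $y\in\mathcal Y$, the maps $\theta\mapsto q_\theta(x,x')$ and $\theta\mapsto g_\theta(y|x)$ are three times continuously differentiable on $\Theta$. * (A3) There are $0<\underline c\le\overline c<\infty$ with $\underline c\le q_\theta(x,x')\le\overline c$ and $g_\theta(y|x)\le\overline c$ for all $\theta\in\Theta$, $x,x'\in\mathcal X$, $y\in\mathcal Y$. * (A4) $|\nabla_\theta\log q_\theta(x,x')|$ and $|\nabla_\theta^2\log q_\theta(x,x')|$ are bounded uniformly in $\theta,x,x'$. * (A5) $0<\int_{\mathcal X}g_\theta(y|x)\,\mu(dx)<\infty$ for all $\theta\in\Theta$, $y\in\mathcal Y$. * (A6) For all $x\in\mathcal X$, $y\in\mathcal Y$, either $g_\theta(y|x)>0$ for all $\theta\in\Theta$ or $g_\theta(y|x)=0$ for all $\theta\in\Theta$ (derivatives of $\log g_\theta(y|x)$ are then read as $0$), and for every $K>0$ $$E_{\theta^*}\Big[\sup_{\theta,x,z}\|\nabla_\theta\log g_\theta(Y+z|x)\|^3\Big],\quad E_{\theta^*}\Big[\sup_{\theta,x,z}\|\nabla_\theta^2\log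 g_\theta(Y+z|x)\|^2\Big],\quad E_{\theta^*}\Big[\sup_{\theta,x,z}\|\nabla_\theta^3\log g_\theta(Y+z|x)\|\Big]<\infty,$$ the suprema being over $\theta\in\Theta$, $x\in\mathcal X$ and $z\in B_0^K$ with $Y+z\in\mathcal Y$. * (A7) There is $R>0$ such that for all $0<\epsilon\le R$ the derivatives below exist and $$E_{\theta^*}\Big[\sup_{x,\theta}\sup_{z\in B_0^\epsilon}\Big|\frac{\nabla_z g_\theta(Y+z|x)}{g_\theta(Y|x)}\Big|^2\Big]<\infty,\qquad E_{\theta^*}\Big[\sup_{x,\theta}\sup_{z\in B_0^\epsilon}\Big|\frac{\nabla_z\nabla_\theta g_\theta(Y+z|x)}{g_\theta(Y|x)}\Big|^2\Big]<\infty$$ (here $g_\theta(\cdot|x)$ is a function on $\mathbb R^m$). For $\epsilon>0$ put $g^\epsilon_\theta(y|x)=\nu(B_y^\epsilon)^{-1}\int_{B_y^\epsilon}g_\theta(y'|x)\,\nu(dy')$, put $g^0_\theta=g_\theta$, and let $p^\epsilon_\theta(\cdot\,|X_0=x)$ be the likelihood of the hidden Markov model with densities $q_\theta$ and $g^\epsilon_\theta$.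 The ABC maximum likelihood estimator $\hat\theta^\epsilon_n$ is any maximiser over $\theta\in\Theta$ of $\mathbb P_\theta(Y_1\in B^\epsilon_{\hat Y_1},\dots,Y_n\in B^\epsilon_{\hat Y_n})$, where the data $\hat Y_1,\hat Y_2,\dots$ come from $\overline{\mathbb P}_{\theta^*}$. **Theorem.** For every $\epsilon\ge0$ there is a (necessarily unique) twice continuously differentiable $l^\epsilon:\Theta\to\mathbb R$ such that, for all $x\in\mathcal X$, $\overline{\mathbb P}_{\theta^*}$-almost surely, $$\frac1n\Big(\log p^\epsilon_\theta(\hat Y_1,\dots,\hat Y_n|X_0=x)-\log p^\epsilon_{\theta^*}(\hat Y_1,\dots,\hat Y_n|X_0=x)\Big)\to l^\epsilon(\theta)\quad\text{uniformly in }\theta\in\Theta .$$ Suppose that $\nabla^2_\theta l^0(\theta^*)$ is strictly negative definite. Then for all sufficiently small $\epsilon>0$ the surface $l^\epsilon$ has a unique maximiser $\theta^{*,\epsilon}$ on $\Theta$; for every initial law of $X_0$ used in the estimator, $\hat\theta^\epsilon_n\to\theta^{*,\epsilon}$ $\overline{\mathbb P}_{\theta^*}$-almost surely as $n\to\infty$;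 and the asymptotic bias satisfies $$|\theta^{*,\epsilon}-\theta^*|=O(\epsilon)\qquad(\epsilon\downarrow0).$$ -/

import Mathlib

open Set Filter Topology MeasureTheory ProbabilityTheory
open scoped ENNReal NNReal

noncomputable section

/-- Any two points of `S` are joined, inside `S`, by a path whose length is at most a constant
multiple of their distance. On such a set a bound on the gradient is a Lipschitz bound. Every
convex set has this property (with `L = 1`). -/
def LengthQuasiconvex {E : Type*} [NormedAddCommGroup E] [NormedSpace ℝ E] (S : Set E) : Prop :=
  ∃ L : ℝ≥0, ∀ a ∈ S, ∀ b ∈ S, ∃ γ : ℝ → E,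
    LipschitzOnWith (L * nndist a b) γ (Icc 0 1) ∧ γ 0 = a ∧ γ 1 = b ∧ MapsTo γ (Icc 0 1) S

/-- `E[F] < ∞` for a nonnegative function `F` that need not be known to be measurable (here a
supremum over uncountably many indices): `F` has a measurable majorant of finite mean. For a
measurable `F` this says that `∫⁻ F < ∞`. -/
def FiniteMean {Ω : Type*} [MeasurableSpace Ω] (P : Measure Ω) (F : Ω → ℝ≥0∞) : Prop :=
  ∃ b : Ω → ℝ≥0∞, Measurable b ∧ (∀ ω, F ω ≤ b ω) ∧ ∫⁻ ω, b ω ∂P < ∞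

/-- A collection of hidden Markov models on a common hidden state space `𝒳` and a common
observation space `𝒴 ⊆ ℝ^m`, parametrised by `θ ∈ Θ ⊆ ℝ^d`: the hidden chain has transition
density `q θ x x'` with respect to the finite measure `μ`, and, given the hidden state `x`, the
observation has density `g θ x y` with respect to the measure `ν`, which is carried by `𝒴`.
(`g θ x` is a function on `ℝ^m`; its values outside `𝒴` are those of an extension.) -/
structure HMMFamily (d m : ℕ) (𝒳 : Type*) [MeasurableSpace 𝒳] where
  /-- the parameter set -/
  Θ : Set (EuclideanSpace ℝ (Fin d))
  /-- the observation space -/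
  𝒴 : Set (EuclideanSpace ℝ (Fin m))
  /-- the dominating measure on the hidden state space -/
  μ : Measure 𝒳
  /-- the dominating measure on the observation space -/
  ν : Measure (EuclideanSpace ℝ (Fin m))
  /-- `q θ x x'` is the transition density from `x` to `x'` -/
  q : EuclideanSpace ℝ (Fin d) → 𝒳 → 𝒳 → ℝ
  /-- `g θ x y` is the conditional density of the observation `y` given the hidden state `x` -/
  g : EuclideanSpace ℝ (Fin d) → 𝒳 → EuclideanSpace ℝ (Fin m) → ℝ
  isCompact_Θ : IsCompact Θ
  isConnected_Θ : IsConnected Θ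
  /-- derivatives on `Θ` are uniquely determined, also at the boundary points -/
  uniqueDiffOn_Θ : UniqueDiffOn ℝ Θ
  lengthQuasiconvex_Θ : LengthQuasiconvex Θ
  isFiniteMeasure_μ : IsFiniteMeasure μ
  /-- balls have finite mass, so that `ν` is σ-finite and averages over balls make sense -/
  isLocallyFiniteMeasure_ν : IsLocallyFiniteMeasure ν
  measurableSet_𝒴 : MeasurableSet 𝒴
  ν_compl_𝒴 : ν 𝒴ᶜ = 0
  measurable_q : ∀ θ ∈ Θ, Measurable (Function.uncurry (q θ))
  measurable_g : ∀ θ ∈ Θ, Measurable (Function.uncurry (g θ))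
  q_nonneg : ∀ θ ∈ Θ, ∀ x x', 0 ≤ q θ x x'
  g_nonneg : ∀ θ ∈ Θ, ∀ x, ∀ y ∈ 𝒴, 0 ≤ g θ x y
  lintegral_q : ∀ θ ∈ Θ, ∀ x, ∫⁻ x', ENNReal.ofReal (q θ x x') ∂μ = 1
  lintegral_g : ∀ θ ∈ Θ, ∀ x, ∫⁻ y, ENNReal.ofReal (g θ x y) ∂ν = 1

namespace HMMFamily

variable {d m : ℕ} {𝒳 : Type*} [MeasurableSpace 𝒳] (M : HMMFamily d m 𝒳)

instance instIsFiniteMeasureMu : IsFiniteMeasure M.μ := M.isFiniteMeasure_μ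

instance instIsLocallyFiniteMeasureNu : IsLocallyFiniteMeasure M.ν := M.isLocallyFiniteMeasure_ν

/-! ### The laws of the models -/

/-- The transition kernel `Q_θ` of the hidden chain. -/
def hiddenKernel (θ : M.Θ) : Kernel 𝒳 𝒳 :=
  (Kernel.const 𝒳 M.μ).withDensity fun x x' => ENNReal.ofReal (M.q θ x x')

/-- The conditional law of an observation given the hidden state. -/
def obsKernel (θ : M.Θ) : Kernel 𝒳 (EuclideanSpace ℝ (Fin m)) :=
  (Kernel.const 𝒳 M.ν).withDensity fun x y => ENNReal.ofReal (M.g θ x y)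

instance instIsMarkovKernelHidden (θ : M.Θ) : IsMarkovKernel (M.hiddenKernel θ) := by
  refine ⟨fun x => ⟨?_⟩⟩
  have h : Measurable (Function.uncurry fun x x' => ENNReal.ofReal (M.q θ x x')) :=
    (M.measurable_q θ θ.2).ennreal_ofReal
  rw [hiddenKernel, Kernel.withDensity_apply' _ h]
  simpa using M.lintegral_q θ θ.2 x

instance instIsMarkovKernelObs (θ : M.Θ) : IsMarkovKernel (M.obsKernel θ) := by
  refine ⟨fun x => ⟨?_⟩⟩
  have h : Measurable (Function.uncurry fun x y => ENNReal.ofReal (M.g θ x y)) :=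
    (M.measurable_g θ θ.2).ennreal_ofReal
  rw [obsKernel, Kernel.withDensity_apply' _ h]
  simpa using M.lintegral_g θ θ.2 x

/-- The transition kernel of the joint chain `(X_k, Y_k)`: from `(x, y)`, draw the next hidden
state `x'` from `Q_θ(x, ·)`, then the observation from its conditional law given `x'`. -/
def jointKernel (θ : M.Θ) :
    Kernel (𝒳 × EuclideanSpace ℝ (Fin m)) (𝒳 × EuclideanSpace ℝ (Fin m)) :=
  (M.hiddenKernel θ ⊗ₖ (M.obsKernel θ).comap Prod.snd measurable_snd).comap Prod.fst measurable_fst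

instance instIsMarkovKernelJoint (θ : M.Θ) : IsMarkovKernel (M.jointKernel θ) := by
  unfold jointKernel; infer_instance

/-- The law of the path `(X_k, Y_k)_{k ≥ 0}` of the model `θ` whose initial pair `(X_0, Y_0)` has
law `init`. -/
def pathLaw (θ : M.Θ) (init : Measure (𝒳 × EuclideanSpace ℝ (Fin m))) :
    Measure (ℕ → 𝒳 × EuclideanSpace ℝ (Fin m)) :=
  Kernel.trajMeasure (X := fun _ => 𝒳 × EuclideanSpace ℝ (Fin m)) init fun n =>
    (M.jointKernel θ).comap
      (fun h : (i : Finset.Iic n) → 𝒳 × EuclideanSpace ℝ (Fin m) =>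
        h ⟨n, Finset.mem_Iic.2 le_rfl⟩)
      (measurable_pi_apply _)

/-- The law of the observations `(Y_k)_{k ≥ 0}`. -/
def obsLaw (θ : M.Θ) (init : Measure (𝒳 × EuclideanSpace ℝ (Fin m))) :
    Measure (ℕ → EuclideanSpace ℝ (Fin m)) :=
  (M.pathLaw θ init).map fun p k => (p k).2

/-- `π` is a stationary distribution of the joint chain `(X_k, Y_k)` of the model `θ`. -/
def IsStationary (θ : M.Θ) (π : Measure (𝒳 × EuclideanSpace ℝ (Fin m))) : Prop :=
  IsProbabilityMeasure π ∧ (M.jointKernel θ).Invariant π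

/-! ### ABC likelihoods and the ABC maximum likelihood estimator -/

/-- `P_θ(Y_1 ∈ B(ω_1, ε), …, Y_n ∈ B(ω_n, ε))`, where the hidden state `X_0` has law `π₀`. -/
def abcProb (θ : M.Θ) (π₀ : Measure 𝒳) (ε : ℝ) (n : ℕ) (ω : ℕ → EuclideanSpace ℝ (Fin m)) :
    ℝ≥0∞ :=
  M.pathLaw θ (π₀ ⊗ₘ M.obsKernel θ)
    {p | ∀ k ∈ Finset.Icc 1 n, (p k).2 ∈ Metric.closedBall (ω k) ε}

/-- `θ` is an ABC maximum likelihood estimate based on the data `ω_1, …, ω_n`. -/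
def IsABCMLE (π₀ : Measure 𝒳) (ε : ℝ) (n : ℕ) (ω : ℕ → EuclideanSpace ℝ (Fin m)) (θ : M.Θ) :
    Prop :=
  ∀ θ' : M.Θ, M.abcProb θ' π₀ ε n ω ≤ M.abcProb θ π₀ ε n ω

/-- The conditional density of the perturbed model: for `ε > 0` the `ν`-average of `g θ x` over the
closed ball of radius `ε` around `y`; for `ε = 0` the density `g θ x y` itself. -/
def gPert (ε : ℝ) (θ : EuclideanSpace ℝ (Fin d)) (x : 𝒳) (y : EuclideanSpace ℝ (Fin m)) : ℝ :=
  if 0 < ε then ⨍ y' in Metric.closedBall y ε, M.g θ x y' ∂M.ν else M.g θ x y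

/-- The likelihood `p_θ^ε(ω_1, …, ω_n | X_0 = x₀)` of the perturbed model. -/
def likelihood (ε : ℝ) (θ : EuclideanSpace ℝ (Fin d)) (x₀ : 𝒳) (n : ℕ)
    (ω : ℕ → EuclideanSpace ℝ (Fin m)) : ℝ :=
  ∫ x : Fin n → 𝒳, ∏ k : Fin n,
      (M.q θ ((Fin.cons x₀ x : Fin (n + 1) → 𝒳) k.castSucc) (x k) *
        M.gPert ε θ (x k) (ω (k + 1)))
    ∂Measure.pi fun _ => M.μ

/-- `l` is the limiting log likelihood surface `l^ε`: it is twice continuously differentiable on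
`Θ` and, for every initial state, almost surely under the stationary law of the model `θs`, the
normalised relative log likelihood surfaces converge to it uniformly on `Θ`.
(This determines `l` on `Θ`.) -/
def IsLimitSurface (θs : M.Θ) (π : Measure (𝒳 × EuclideanSpace ℝ (Fin m))) (ε : ℝ)
    (l : EuclideanSpace ℝ (Fin d) → ℝ) : Prop :=
  ContDiffOn ℝ 2 l M.Θ ∧
  ∀ x₀ : 𝒳, ∀ᵐ ω ∂M.obsLaw θs π,
    TendstoUniformlyOn
      (fun (n : ℕ) θ => (1 / (n : ℝ)) *
        (Real.log (M.likelihood ε θ x₀ n ω) - Real.log (M.likelihood ε θs x₀ n ω)))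
      l atTop M.Θ

/-- `θ` is the limit point of the ABC estimator with tolerance `ε`: it is the one and only
maximiser on `Θ` of the limiting surface `l = l^ε` and, for every initial law, almost surely under
the stationary law of the model `θs`, ABC maximum likelihood estimates converge to it. -/
def IsABCLimitPoint (θs : M.Θ) (π : Measure (𝒳 × EuclideanSpace ℝ (Fin m))) (ε : ℝ)
    (l : EuclideanSpace ℝ (Fin d) → ℝ) (θ : M.Θ) : Prop :=
  (∀ θ' : M.Θ, θ' ≠ θ → l θ' < l θ) ∧
  ∀ π₀ : Measure 𝒳, IsProbabilityMeasure π₀ → ∀ᵐ ω ∂M.obsLaw θs π,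
    ∀ θhat : ℕ → M.Θ, (∀ n, M.IsABCMLE π₀ ε n ω (θhat n)) → Tendsto θhat atTop (𝓝 θ)

/-! ### The assumptions -/

/-- The true parameter is interior, and it is identified by the stationary law of the
observations. -/
def A1 (θs : M.Θ) (π : M.Θ → Measure (𝒳 × EuclideanSpace ℝ (Fin m))) : Prop :=
  (θs : EuclideanSpace ℝ (Fin d)) ∈ interior M.Θ ∧
  ∀ θ : M.Θ, θ = θs ↔ M.obsLaw θ (π θ) = M.obsLaw θs (π θs)

/-- The densities are three times continuously differentiable in the parameter. -/
def A2 : Prop :=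
  (∀ x x', ContDiffOn ℝ 3 (fun θ => M.q θ x x') M.Θ) ∧
  ∀ x, ∀ y ∈ M.𝒴, ContDiffOn ℝ 3 (fun θ => M.g θ x y) M.Θ

def A3 : Prop :=
  ∃ c C : ℝ, 0 < c ∧ ∀ θ ∈ M.Θ,
    (∀ x x', c ≤ M.q θ x x' ∧ M.q θ x x' ≤ C) ∧ ∀ x, ∀ y ∈ M.𝒴, M.g θ x y ≤ C

def A4 : Prop :=
  ∃ C : ℝ, ∀ θ ∈ M.Θ, ∀ x x',
    ‖iteratedFDerivWithin ℝ 1 (fun θ => Real.log (M.q θ x x')) M.Θ θ‖ ≤ C ∧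
    ‖iteratedFDerivWithin ℝ 2 (fun θ => Real.log (M.q θ x x')) M.Θ θ‖ ≤ C

def A5 : Prop :=
  ∀ θ ∈ M.Θ, ∀ y ∈ M.𝒴, Integrable (fun x => M.g θ x y) M.μ ∧ 0 < ∫ x, M.g θ x y ∂M.μ

/-- `sup_θ sup_x sup_z ‖∇_θ^k log g_θ(y + z | x)‖`, over `θ ∈ Θ`, `x ∈ 𝒳` and `|z| ≤ K` with
`y + z ∈ 𝒴`. -/
def supLogDeriv (k : ℕ) (K : ℝ) (y : EuclideanSpace ℝ (Fin m)) : ℝ≥0∞ :=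
  ⨆ θ ∈ M.Θ, ⨆ x : 𝒳, ⨆ y' ∈ Metric.closedBall y K ∩ M.𝒴,
    ‖iteratedFDerivWithin ℝ k (fun θ => Real.log (M.g θ x y')) M.Θ θ‖ₑ

/-- The moment conditions on the derivatives of `log g`, where `Y` has the second marginal of the
stationary law `π` of the true model. For these derivatives to make sense, `g θ x y` is positive
for all `θ`, or vanishes for all `θ`; in the latter case (an observation `y` that is impossible
from the state `x`) they are read as zero. -/
def A6 (π : Measure (𝒳 × EuclideanSpace ℝ (Fin m))) : Prop :=
  (∀ x, ∀ y ∈ M.𝒴, (∀ θ ∈ M.Θ, 0 < M.g θ x y) ∨ (∀ θ ∈ M.Θ, M.g θ x y = 0)) ∧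
  ∀ K : ℝ, 0 < K →
    FiniteMean π.snd (fun y => M.supLogDeriv 1 K y ^ 3) ∧
    FiniteMean π.snd (fun y => M.supLogDeriv 2 K y ^ 2) ∧
    FiniteMean π.snd (fun y => M.supLogDeriv 3 K y)

/-- The gradient `∇_θ g_θ(y | x)`. -/
def gradTheta (θ : EuclideanSpace ℝ (Fin d)) (x : 𝒳) (y : EuclideanSpace ℝ (Fin m)) :
    EuclideanSpace ℝ (Fin d) →L[ℝ] ℝ :=
  fderivWithin ℝ (fun θ => M.g θ x y) M.Θ θ

/-- The Lipschitz-type integrability condition. The ratios are taken in `[0, ∞]`: a nonzero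
derivative over a vanishing density is infinite. -/
def A7 (π : Measure (𝒳 × EuclideanSpace ℝ (Fin m))) : Prop :=
  ∃ R : ℝ, 0 < R ∧ ∀ ε : ℝ, 0 < ε → ε ≤ R →
    (∀ᵐ y ∂π.snd, ∀ θ ∈ M.Θ, ∀ x, ∀ y' ∈ Metric.closedBall y ε,
      DifferentiableAt ℝ (M.g θ x) y' ∧ DifferentiableAt ℝ (M.gradTheta θ x) y') ∧
    FiniteMean π.snd (fun y => ⨆ x : 𝒳, ⨆ θ ∈ M.Θ, ⨆ y' ∈ Metric.closedBall y ε,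
      (‖fderiv ℝ (M.g θ x) y'‖ₑ / ENNReal.ofReal (M.g θ x y)) ^ 2) ∧
    FiniteMean π.snd (fun y => ⨆ x : 𝒳, ⨆ θ ∈ M.Θ, ⨆ y' ∈ Metric.closedBall y ε,
      (‖fderiv ℝ (M.gradTheta θ x) y'‖ₑ / ENNReal.ofReal (M.g θ x y)) ^ 2)

end HMMFamily

end

set_option linter.unusedSectionVars false
set_option maxSynthPendingDepth 3

noncomputable section

/-! ### Averages with respect to probability densities -/

section Averages

variable {𝒳 : Type*} [MeasurableSpace 𝒳] {μ : Measure 𝒳}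
  {V W : Type*} [NormedAddCommGroup V] [NormedSpace ℝ V]
  [NormedAddCommGroup W] [NormedSpace ℝ W]

/-- `k` is a probability density with respect to `μ`. -/
structure IsProbDensity (μ : Measure 𝒳) (k : 𝒳 → ℝ) : Prop where
  measurable : Measurable k
  nonneg : ∀ x, 0 ≤ k x
  integrable : Integrable k μ
  integral_eq : ∫ x, k x ∂μ = 1

/-- Strongly measurable and bounded functions. -/
def BddSM (h : 𝒳 → V) : Prop := StronglyMeasurable h ∧ ∃ M, ∀ x, ‖h x‖ ≤ M

theorem BddSM.add {f g : 𝒳 → V} (hf : BddSM f) (hg : BddSM g) : BddSM fun x => f x + g x := by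
  obtain ⟨hf, M, hM⟩ := hf
  obtain ⟨hg, N, hN⟩ := hg
  exact ⟨hf.add hg, M + N, fun x => (norm_add_le _ _).trans (add_le_add (hM x) (hN x))⟩

theorem BddSM.sub {f g : 𝒳 → V} (hf : BddSM f) (hg : BddSM g) : BddSM fun x => f x - g x := by
  obtain ⟨hf, M, hM⟩ := hf
  obtain ⟨hg, N, hN⟩ := hg
  exact ⟨hf.sub hg, M + N, fun x => (norm_sub_le _ _).trans (add_le_add (hM x) (hN x))⟩

theorem BddSM.const (c : V) : BddSM fun _ : 𝒳 => c :=
  ⟨stronglyMeasurable_const, ‖c‖, fun _ => le_rfl⟩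

theorem BddSM.bilin (β : V →L[ℝ] V →L[ℝ] W) {f g : 𝒳 → V} (hf : BddSM f) (hg : BddSM g) :
    BddSM fun x => β (f x) (g x) := by
  obtain ⟨hf, M, hM⟩ := hf
  obtain ⟨hg, N, hN⟩ := hg
  refine ⟨?_, ‖β‖ * M * N, fun x => ?_⟩
  · exact β.continuous₂.comp_stronglyMeasurable (hf.prodMk hg)
  · refine (β.le_opNorm₂ _ _).trans ?_
    have := (norm_nonneg _).trans (hM x)
    gcongr
    exacts [hM x, hN x]

theorem BddSM.integrable_smul {k : 𝒳 → ℝ} {h : 𝒳 → V} (hh : BddSM h) (hk : Integrable k μ) :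
    Integrable (fun x => k x • h x) μ := by
  obtain ⟨hh, M, hM⟩ := hh
  exact hk.smul_bdd M hh.aestronglyMeasurable (.of_forall hM)

theorem norm_integral_smul_le {k K : 𝒳 → ℝ} {h : 𝒳 → V} {D : ℝ}
    (hK : Integrable K μ) (hkK : ∀ x, |k x| ≤ K x) (hD : ∀ x, ‖h x‖ ≤ D) :
    ‖∫ x, k x • h x ∂μ‖ ≤ (∫ x, K x ∂μ) * D := by
  rw [← integral_mul_const]
  refine norm_integral_le_of_norm_le (hK.mul_const D) (.of_forall fun x => ?_)
  rw [norm_smul, Real.norm_eq_abs]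
  have := (norm_nonneg _).trans (hD x)
  have := (abs_nonneg _).trans (hkK x)
  gcongr
  exacts [hkK x, hD x]

theorem IsProbDensity.nonempty {k : 𝒳 → ℝ} (hk : IsProbDensity μ k) : Nonempty 𝒳 := by
  by_contra h
  rw [not_nonempty_iff] at h
  have := hk.integral_eq
  simp [Measure.eq_zero_of_isEmpty μ] at this

theorem IsProbDensity.norm_avg_le {k : 𝒳 → ℝ} (hk : IsProbDensity μ k) {h : 𝒳 → V} {D : ℝ}
    (hD : ∀ x, ‖h x‖ ≤ D) : ‖∫ x, k x • h x ∂μ‖ ≤ D := by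
  have := norm_integral_smul_le hk.integrable (fun x => (abs_of_nonneg (hk.nonneg x)).le) hD
  rwa [hk.integral_eq, one_mul] at this

variable [CompleteSpace V] [CompleteSpace W]

theorem IsProbDensity.avg_const {k : 𝒳 → ℝ} (hk : IsProbDensity μ k) (c : V) :
    ∫ x, k x • c ∂μ = c := by
  rw [integral_smul_const, hk.integral_eq, one_smul]

theorem IsProbDensity.avg_sub_const {k : 𝒳 → ℝ} (hk : IsProbDensity μ k) {h : 𝒳 → V}
    (hh : BddSM h) (c : V) : ∫ x, k x • (h x - c) ∂μ = ∫ x, k x • h x ∂μ - c := by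
  simp_rw [smul_sub]
  rw [integral_sub (hh.integrable_smul hk.integrable)
    ((BddSM.const c).integrable_smul hk.integrable), hk.avg_const]

theorem IsProbDensity.norm_avg_sub_le {k : 𝒳 → ℝ} (hk : IsProbDensity μ k) {h : 𝒳 → V}
    (hh : BddSM h) {c : V} {D : ℝ} (hD : ∀ x, ‖h x - c‖ ≤ D) :
    ‖∫ x, k x • h x ∂μ - c‖ ≤ D := by
  rw [← hk.avg_sub_const hh]
  exact hk.norm_avg_le hD

theorem IsProbDensity.norm_sub_avg_le {k : 𝒳 → ℝ} (hk : IsProbDensity μ k) {h : 𝒳 → V}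
    (hh : BddSM h) {D : ℝ} (hD : ∀ x z, ‖h x - h z‖ ≤ D) (x : 𝒳) :
    ‖h x - ∫ x, k x • h x ∂μ‖ ≤ D := by
  rw [norm_sub_rev]
  exact hk.norm_avg_sub_le hh fun z => hD z x

/-- Doeblin contraction. -/
theorem IsProbDensity.norm_avg_sub_avg_le_doeblin {k k' : 𝒳 → ℝ} (hk : IsProbDensity μ k)
    (hk' : IsProbDensity μ k') {δ : ℝ} (hδ : ∀ x, δ * k' x ≤ k x) {h : 𝒳 → V} (hh : BddSM h)
    {D : ℝ} (hD : ∀ x z, ‖h x - h z‖ ≤ D) :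
    ‖∫ x, k x • h x ∂μ - ∫ x, k' x • h x ∂μ‖ ≤ (1 - δ) * D := by
  set m := ∫ x, k' x • h x ∂μ with hm
  have hint : Integrable (fun x => k x - δ * k' x) μ := hk.integrable.sub (hk'.integrable.const_mul δ)
  have e : ∫ x, k x • h x ∂μ - m = ∫ x, (k x - δ * k' x) • (h x - m) ∂μ := by
    have hb : BddSM fun x => h x - m := hh.sub (BddSM.const m)
    simp_rw [sub_smul, mul_smul]
    rw [integral_sub (hb.integrable_smul hk.integrable)
      (show Integrable (fun x => δ • k' x • (h x - m)) μ from
        (hb.integrable_smul hk'.integrable).smul δ), integral_smul, hk.avg_sub_const hh,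
      hk'.avg_sub_const hh, ← hm, sub_self, smul_zero, sub_zero]
  rw [e]
  refine (norm_integral_smul_le (K := fun x => k x - δ * k' x) hint
    (fun x => (abs_of_nonneg (sub_nonneg.2 (hδ x))).le) (fun x => hk'.norm_sub_avg_le hh hD x)).trans ?_
  rw [integral_sub hk.integrable (hk'.integrable.const_mul δ), integral_const_mul, hk.integral_eq,
    hk'.integral_eq, mul_one]

/-- Two densities with ratio close to one have close averages. -/
theorem IsProbDensity.norm_avg_sub_avg_le_ratio {k k' : 𝒳 → ℝ} (hk : IsProbDensity μ k)
    (hk' : IsProbDensity μ k') {τ : ℝ} (hτ : ∀ x, |k' x - k x| ≤ τ * k x) {h : 𝒳 → V}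
    (hh : BddSM h) {D : ℝ} (hD : ∀ x z, ‖h x - h z‖ ≤ D) :
    ‖∫ x, k' x • h x ∂μ - ∫ x, k x • h x ∂μ‖ ≤ τ * D := by
  obtain ⟨x₀⟩ := hk.nonempty
  have e : ∫ x, k' x • h x ∂μ - ∫ x, k x • h x ∂μ = ∫ x, (k' x - k x) • (h x - h x₀) ∂μ := by
    have hb : BddSM fun x => h x - h x₀ := hh.sub (BddSM.const _)
    simp_rw [sub_smul]
    rw [integral_sub (hb.integrable_smul hk'.integrable) (hb.integrable_smul hk.integrable),
      hk.avg_sub_const hh, hk'.avg_sub_const hh, sub_sub_sub_cancel_right]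
  rw [e]
  refine (norm_integral_smul_le (hk.integrable.const_mul τ) hτ (fun x => hD x x₀)).trans ?_
  rw [integral_const_mul, hk.integral_eq, mul_one]

/-- The covariance of two functions under a density. -/
def densCov (μ : Measure 𝒳) (β : V →L[ℝ] V →L[ℝ] W) (k : 𝒳 → ℝ) (A B : 𝒳 → V) : W :=
  ∫ x, k x • β (A x) (B x) ∂μ - β (∫ x, k x • A x ∂μ) (∫ x, k x • B x ∂μ)

theorem IsProbDensity.densCov_eq (β : V →L[ℝ] V →L[ℝ] W) {k : 𝒳 → ℝ} (hk : IsProbDensity μ k)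
    {A B : 𝒳 → V} (hA : BddSM A) (hB : BddSM B) (m m' : V) :
    densCov μ β k A B = ∫ x, k x • β (A x - m) (B x - m') ∂μ -
      β (∫ x, k x • A x ∂μ - m) (∫ x, k x • B x ∂μ - m') := by
  have i1 := (hA.bilin β hB).integrable_smul hk.integrable
  have i2 := (hA.bilin β (BddSM.const m')).integrable_smul hk.integrable
  have i3 := ((BddSM.const m).bilin β hB).integrable_smul hk.integrable
  have i4 := ((BddSM.const m).bilin β (BddSM.const m')).integrable_smul hk.integrable
  have e2 : ∫ x, k x • β (A x) m' ∂μ = β (∫ x, k x • A x ∂μ) m' := by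
    have := (β.flip m').integral_comp_comm (hA.integrable_smul hk.integrable)
    simpa using this
  have e3 : ∫ x, k x • β m (B x) ∂μ = β m (∫ x, k x • B x ∂μ) := by
    have := (β m).integral_comp_comm (hB.integrable_smul hk.integrable)
    simpa using this
  have e4 : ∫ x, k x • β m m' ∂μ = β m m' := hk.avg_const _
  have e : ∫ x, k x • β (A x - m) (B x - m') ∂μ = ∫ x, k x • β (A x) (B x) ∂μ
      - β (∫ x, k x • A x ∂μ) m' - (β m (∫ x, k x • B x ∂μ) - β m m') := by
    rw [← e2, ← e3, ← e4, ← integral_sub i1 i2, ← integral_sub i3 i4]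
    have := integral_sub (i1.sub i2) (i3.sub i4)
    simp only [Pi.sub_apply] at this
    rw [← this]
    congr 1 with x
    simp only [map_sub, sub_apply, smul_sub]
    abel
  rw [e, densCov]
  simp only [map_sub, sub_apply]
  abel

theorem IsProbDensity.norm_densCov_le (β : V →L[ℝ] V →L[ℝ] W) (hβ : ‖β‖ ≤ 1) {k : 𝒳 → ℝ}
    (hk : IsProbDensity μ k) {A B : 𝒳 → V} (hA : BddSM A) (hB : BddSM B) {D D' : ℝ}
    (hD : ∀ x z, ‖A x - A z‖ ≤ D) (hD' : ∀ x z, ‖B x - B z‖ ≤ D') :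
    ‖densCov μ β k A B‖ ≤ D * D' := by
  rw [hk.densCov_eq β hA hB (∫ x, k x • A x ∂μ) (∫ x, k x • B x ∂μ)]
  simp only [sub_self, map_zero, sub_zero]
  refine hk.norm_avg_le fun x => (β.le_opNorm₂ _ _).trans ?_
  have h1 := hk.norm_sub_avg_le hA hD x
  have h2 := hk.norm_sub_avg_le hB hD' x
  have := (norm_nonneg _).trans h1
  calc _ ≤ 1 * D * D' := by gcongr
    _ = _ := by ring

theorem IsProbDensity.densCov_sub_densCov (β : V →L[ℝ] V →L[ℝ] W) {k : 𝒳 → ℝ}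
    (hk : IsProbDensity μ k) {A B : 𝒳 → V} (hA : BddSM A) (hB : BddSM B) :
    densCov μ β k B B - densCov μ β k A A =
      densCov μ β k (fun x => B x - A x) B + densCov μ β k A (fun x => B x - A x) := by
  have hAB := hB.sub hA
  have a1 := (hB.bilin β hB).integrable_smul hk.integrable
  have a2 := (hA.bilin β hA).integrable_smul hk.integrable
  have a3 := (hA.bilin β hB).integrable_smul hk.integrable
  have e1 : ∫ x, k x • β (B x - A x) (B x) ∂μ =
      ∫ x, k x • β (B x) (B x) ∂μ - ∫ x, k x • β (A x) (B x) ∂μ := by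
    rw [← integral_sub a1 a3]
    congr 1 with x
    simp [smul_sub]
  have e2 : ∫ x, k x • β (A x) (B x - A x) ∂μ =
      ∫ x, k x • β (A x) (B x) ∂μ - ∫ x, k x • β (A x) (A x) ∂μ := by
    rw [← integral_sub a3 a2]
    congr 1 with x
    simp [smul_sub]
  have e3 : ∫ x, k x • (B x - A x) ∂μ = ∫ x, k x • B x ∂μ - ∫ x, k x • A x ∂μ := by
    rw [← integral_sub (hB.integrable_smul hk.integrable) (hA.integrable_smul hk.integrable)]
    simp_rw [smul_sub]
  simp only [densCov]
  rw [e1, e2, e3]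
  simp only [map_sub, sub_apply]
  abel

theorem IsProbDensity.norm_densCov_sub_densCov_le_ratio (β : V →L[ℝ] V →L[ℝ] W) (hβ : ‖β‖ ≤ 1)
    {k k' : 𝒳 → ℝ} (hk : IsProbDensity μ k) (hk' : IsProbDensity μ k') {τ : ℝ}
    (hτ : ∀ x, |k' x - k x| ≤ τ * k x) {A : 𝒳 → V} (hA : BddSM A) {D : ℝ}
    (hD : ∀ x z, ‖A x - A z‖ ≤ D) :
    ‖densCov μ β k' A A - densCov μ β k A A‖ ≤ 3 * τ * D ^ 2 := by
  set m := ∫ x, k x • A x ∂μ with hm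
  set m' := ∫ x, k' x • A x ∂μ with hm'
  obtain ⟨x₀⟩ := hk.nonempty
  have hD0 : 0 ≤ D := (norm_nonneg _).trans (hD x₀ x₀)
  have h1 : ‖m' - m‖ ≤ τ * D := hk.norm_avg_sub_avg_le_ratio hk' hτ hA hD
  have h2 : ‖m' - m‖ ≤ D := hk'.norm_avg_sub_le hA fun x => hk.norm_sub_avg_le hA hD x
  have hb : BddSM fun x => β (A x - m) (A x - m) :=
    (hA.sub (BddSM.const m)).bilin β (hA.sub (BddSM.const m))
  have hβ' : ∀ v w : V, ‖β v w‖ ≤ ‖v‖ * ‖w‖ := fun v w =>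
    (β.le_opNorm₂ v w).trans (by
      have : ‖β‖ * ‖v‖ * ‖w‖ ≤ 1 * ‖v‖ * ‖w‖ := by gcongr
      simpa using this)
  have hsq : ∀ x, ‖β (A x - m) (A x - m)‖ ≤ D ^ 2 := fun x => by
    refine (hβ' _ _).trans ?_
    have := hk.norm_sub_avg_le hA hD x
    rw [sq]; gcongr
  rw [hk.densCov_eq β hA hA m m, hk'.densCov_eq β hA hA m m, ← hm, ← hm']
  simp only [sub_self, map_zero, sub_zero]
  have h3 := hk.norm_avg_sub_avg_le_ratio hk' hτ hb (D := 2 * D ^ 2)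
    (fun x z => (norm_sub_le _ _).trans (by linarith [hsq x, hsq z]))
  calc _ = ‖(∫ x, k' x • β (A x - m) (A x - m) ∂μ - ∫ x, k x • β (A x - m) (A x - m) ∂μ)
        - β (m' - m) (m' - m)‖ := by congr 1; abel
    _ ≤ τ * (2 * D ^ 2) + (τ * D) * D := by
        refine (norm_sub_le _ _).trans (add_le_add h3 ((hβ' _ _).trans ?_))
        gcongr
        exact (norm_nonneg _).trans h1
    _ = _ := by ring

end Averages

/-! ### Backward recursions in a random environment -/

section Recursion

variable {𝒳 : Type*} [MeasurableSpace 𝒳] {μ : Measure 𝒳}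
  {V W : Type*} [NormedAddCommGroup V] [NormedSpace ℝ V]
  [NormedAddCommGroup W] [NormedSpace ℝ W]

/-- A kernel together with its first and second logarithmic derivatives. -/
@[ext] structure KernelJet (𝒳 V W : Type*) where
  L : 𝒳 → 𝒳 → ℝ
  a : 𝒳 → 𝒳 → V
  b : 𝒳 → 𝒳 → W

/-- A function together with its first and second logarithmic derivatives. -/
@[ext] structure FunJet (𝒳 V W : Type*) where
  p : 𝒳 → ℝ
  u : 𝒳 → V
  w : 𝒳 → W

namespace KernelJet

/-- The density, proportional to `L x x' * p x'`, of the next state given the state `x`. -/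
def dens (μ : Measure 𝒳) (K : KernelJet 𝒳 V W) (p : 𝒳 → ℝ) (x x' : 𝒳) : ℝ :=
  K.L x x' * p x' / ∫ z, K.L x z * p z ∂μ

/-- The logarithmic jet of `x ↦ ∫ L x x' * p x' dμ(x')`. -/
def step (μ : Measure 𝒳) (β : V →L[ℝ] V →L[ℝ] W) (K : KernelJet 𝒳 V W) (J : FunJet 𝒳 V W) :
    FunJet 𝒳 V W where
  p x := ∫ z, K.L x z * J.p z ∂μ
  u x := ∫ z, K.dens μ J.p x z • (K.a x z + J.u z) ∂μ
  w x := ∫ z, K.dens μ J.p x z • (K.b x z + J.w z) ∂μ +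
    densCov μ β (K.dens μ J.p x) (fun z => K.a x z + J.u z) (fun z => K.a x z + J.u z)

/-- Iterate the backward recursion, starting from the constant function one. -/
def iter (μ : Measure 𝒳) (β : V →L[ℝ] V →L[ℝ] W) : ℕ → (ℕ → KernelJet 𝒳 V W) → FunJet 𝒳 V W
  | 0, _ => ⟨fun _ => 1, fun _ => 0, fun _ => 0⟩
  | n + 1, K => (K 0).step μ β (iter μ β n fun k => K (k + 1))

/-- The standing assumptions on a kernel jet: a Harnack inequality with constant `ϰ`, and bounds
for the logarithmic derivatives. -/
structure Good (μ : Measure 𝒳) (ϰ σ : ℝ) (K : KernelJet 𝒳 V W) : Prop where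
  measurable_L : Measurable (Function.uncurry K.L)
  sm_a : StronglyMeasurable (Function.uncurry K.a)
  sm_b : StronglyMeasurable (Function.uncurry K.b)
  nonneg : ∀ x z, 0 ≤ K.L x z
  bdd : ∃ C, ∀ x z, K.L x z ≤ C
  pos : ∀ x, 0 < ∫ z, K.L x z ∂μ
  harnack : ∀ x y z, K.L x z ≤ ϰ * K.L y z
  norm_a : ∀ x z, ‖K.a x z‖ ≤ σ
  norm_b : ∀ x z, ‖K.b x z‖ ≤ σ ^ 2

end KernelJet

/-- The standing assumptions on a function jet. -/
structure FunJet.Good (ϰ : ℝ) (J : FunJet 𝒳 V W) : Prop where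
  measurable_p : Measurable J.p
  pos : ∀ x, 0 < J.p x
  harnack : ∀ x y, J.p x ≤ ϰ * J.p y
  bdd_u : BddSM J.u
  bdd_w : BddSM J.w

namespace KernelJet

variable {ϰ σ : ℝ} {K : KernelJet 𝒳 V W} {J : FunJet 𝒳 V W}

theorem Good.bdd_a (hK : K.Good μ ϰ σ) (x : 𝒳) : BddSM (K.a x) :=
  ⟨hK.sm_a.comp_measurable measurable_prodMk_left, σ, hK.norm_a x⟩

theorem Good.bdd_b (hK : K.Good μ ϰ σ) (x : 𝒳) : BddSM (K.b x) :=
  ⟨hK.sm_b.comp_measurable measurable_prodMk_left, σ ^ 2, hK.norm_b x⟩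

theorem Good.measurable_mul (hK : K.Good μ ϰ σ) {p : 𝒳 → ℝ} (hp : Measurable p) (x : 𝒳) :
    Measurable fun z => K.L x z * p z :=
  (hK.measurable_L.comp measurable_prodMk_left).mul hp

variable [IsFiniteMeasure μ]

theorem Good.integrable_mul (hK : K.Good μ ϰ σ) {p : 𝒳 → ℝ} (hp : Measurable p) (hp0 : ∀ x, 0 ≤ p x)
    {M : ℝ} (hM : ∀ x, p x ≤ M) (x : 𝒳) : Integrable (fun z => K.L x z * p z) μ := by
  obtain ⟨C, hC⟩ := hK.bdd
  refine Integrable.of_bound (hK.measurable_mul hp x).aestronglyMeasurable (C * M)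
    (.of_forall fun z => ?_)
  rw [Real.norm_eq_abs, abs_of_nonneg (mul_nonneg (hK.nonneg x z) (hp0 z))]
  have := (hK.nonneg x z).trans (hC x z)
  exact mul_le_mul (hC x z) (hM z) (hp0 z) this

theorem Good.integrable_L (hK : K.Good μ ϰ σ) (x : 𝒳) : Integrable (K.L x) μ := by
  simpa using hK.integrable_mul (p := fun _ => 1) measurable_const (by simp) (M := 1) (by simp) x

theorem Good.integrable_mul' (hK : K.Good μ ϰ σ) (hJ : J.Good ϰ) (x : 𝒳) :
    Integrable (fun z => K.L x z * J.p z) μ :=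
  hK.integrable_mul hJ.measurable_p (fun x => (hJ.pos x).le) (M := ϰ * J.p x)
    (fun z => hJ.harnack z x) x

theorem Good.step_p_pos (β : V →L[ℝ] V →L[ℝ] W) (hK : K.Good μ ϰ σ) (hJ : J.Good ϰ) (x : 𝒳) :
    0 < (K.step μ β J).p x := by
  have hϰ : 0 < ϰ := by
    by_contra h
    have := hJ.harnack x x
    nlinarith [hJ.pos x]
  have h : ∫ z, K.L x z * (J.p x / ϰ) ∂μ ≤ ∫ z, K.L x z * J.p z ∂μ := by
    refine integral_mono ((hK.integrable_L x).mul_const _) (hK.integrable_mul' hJ x) fun z => ?_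
    refine mul_le_mul_of_nonneg_left ?_ (hK.nonneg x z)
    rw [div_le_iff₀ hϰ, mul_comm]
    exact hJ.harnack x z
  rw [integral_mul_const] at h
  exact (mul_pos (hK.pos x) (div_pos (hJ.pos x) hϰ)).trans_le h

theorem Good.step_p_harnack (β : V →L[ℝ] V →L[ℝ] W) (hK : K.Good μ ϰ σ) (hJ : J.Good ϰ) (x y : 𝒳) :
    (K.step μ β J).p x ≤ ϰ * (K.step μ β J).p y := by
  simp only [step]
  rw [← integral_const_mul]
  refine integral_mono (hK.integrable_mul' hJ x) ((hK.integrable_mul' hJ y).const_mul ϰ) fun z => ?_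
  have := mul_le_mul_of_nonneg_right (hK.harnack x y z) (hJ.pos z).le
  simpa [mul_assoc] using this

theorem Good.isProbDensity_dens (hK : K.Good μ ϰ σ) (hJ : J.Good ϰ) (x : 𝒳) :
    IsProbDensity μ (K.dens μ J.p x) where
  measurable := (hK.measurable_mul hJ.measurable_p x).div_const _
  nonneg z := div_nonneg (mul_nonneg (hK.nonneg x z) (hJ.pos z).le)
    (integral_nonneg fun z => mul_nonneg (hK.nonneg x z) (hJ.pos z).le)
  integrable := (hK.integrable_mul' hJ x).div_const _
  integral_eq := by
    have := hK.step_p_pos (0 : V →L[ℝ] V →L[ℝ] W) hJ x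
    simp only [dens, integral_div]
    exact div_self this.ne'

theorem Good.dens_harnack (hK : K.Good μ ϰ σ) (hJ : J.Good ϰ) (x y z : 𝒳) :
    K.dens μ J.p x z ≤ ϰ ^ 2 * K.dens μ J.p y z := by
  have hx := hK.step_p_pos (0 : V →L[ℝ] V →L[ℝ] W) hJ x
  have hy := hK.step_p_pos (0 : V →L[ℝ] V →L[ℝ] W) hJ y
  have hyx := hK.step_p_harnack (0 : V →L[ℝ] V →L[ℝ] W) hJ y x
  simp only [step] at hx hy hyx
  have h2 := hK.harnack x y z
  have hp := (hJ.pos z).le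
  have hL := hK.nonneg x z
  have hL' := hK.nonneg y z
  simp only [dens]
  rw [← mul_div_assoc, div_le_div_iff₀ hx hy]
  calc K.L x z * J.p z * ∫ z, K.L y z * J.p z ∂μ
      ≤ ϰ * K.L y z * J.p z * (ϰ * ∫ z, K.L x z * J.p z ∂μ) :=
        mul_le_mul (mul_le_mul_of_nonneg_right h2 hp) hyx hy.le
          (mul_nonneg (hL.trans h2) hp)
    _ = _ := by ring

theorem Good.measurable_step_p (β : V →L[ℝ] V →L[ℝ] W) (hK : K.Good μ ϰ σ) (hp : Measurable J.p) :
    Measurable (K.step μ β J).p := by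
  have : StronglyMeasurable (Function.uncurry fun x z => K.L x z * J.p z) :=
    (hK.measurable_L.mul (hp.comp measurable_snd)).stronglyMeasurable
  exact this.integral_prod_right.measurable

theorem Good.measurable_dens (hK : K.Good μ ϰ σ) (hp : Measurable J.p) :
    Measurable (Function.uncurry (K.dens μ J.p)) :=
  (hK.measurable_L.mul (hp.comp measurable_snd)).div
    ((hK.measurable_step_p (0 : V →L[ℝ] V →L[ℝ] W) hp).comp measurable_fst)

theorem Good.bdd_add (hK : K.Good μ ϰ σ) (hJ : J.Good ϰ) (x : 𝒳) :
    BddSM fun z => K.a x z + J.u z := (hK.bdd_a x).add hJ.bdd_u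

theorem Good.bdd_add' (hK : K.Good μ ϰ σ) (hJ : J.Good ϰ) (x : 𝒳) :
    BddSM fun z => K.b x z + J.w z := (hK.bdd_b x).add hJ.bdd_w

/-- A bound `D` for the oscillation of `u` gives one for that of `a x · + u`. -/
theorem Good.osc_add (hK : K.Good μ ϰ σ) {D : ℝ} (hD : ∀ x z, ‖J.u x - J.u z‖ ≤ D) (x z z' : 𝒳) :
    ‖(K.a x z + J.u z) - (K.a x z' + J.u z')‖ ≤ 2 * σ + D := by
  calc _ = ‖(K.a x z - K.a x z') + (J.u z - J.u z')‖ := by congr 1; abel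
    _ ≤ (‖K.a x z‖ + ‖K.a x z'‖) + ‖J.u z - J.u z'‖ :=
      (norm_add_le _ _).trans (by gcongr; exact norm_sub_le _ _)
    _ ≤ _ := by linarith [hK.norm_a x z, hK.norm_a x z', hD z z']

variable [CompleteSpace V] [CompleteSpace W]

theorem Good.step_good {β : V →L[ℝ] V →L[ℝ] W} (hK : K.Good μ ϰ σ) (hJ : J.Good ϰ) :
    (K.step μ β J).Good ϰ where
  measurable_p := hK.measurable_step_p β hJ.measurable_p
  pos := hK.step_p_pos β hJ
  harnack := hK.step_p_harnack β hJ
  bdd_u := by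
    refine ⟨?_, ?_⟩
    · have : StronglyMeasurable (Function.uncurry fun x z => K.dens μ J.p x z • (K.a x z + J.u z)) :=
        (hK.measurable_dens hJ.measurable_p).stronglyMeasurable.smul
          (hK.sm_a.add (hJ.bdd_u.1.comp_measurable measurable_snd))
      exact this.integral_prod_right
    · obtain ⟨M, hM⟩ := hJ.bdd_u.2
      exact ⟨σ + M, fun x => (hK.isProbDensity_dens hJ x).norm_avg_le fun z =>
        (norm_add_le _ _).trans (add_le_add (hK.norm_a x z) (hM z))⟩
  bdd_w := by
    have hd := (hK.measurable_dens hJ.measurable_p).stronglyMeasurable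
    have hau := hK.sm_a.add (hJ.bdd_u.1.comp_measurable measurable_snd)
    refine ⟨?_, ?_⟩
    · have h1 : StronglyMeasurable (Function.uncurry fun x z =>
          K.dens μ J.p x z • (K.b x z + J.w z)) :=
        hd.smul (hK.sm_b.add (hJ.bdd_w.1.comp_measurable measurable_snd))
      have h2 : StronglyMeasurable (Function.uncurry fun x z =>
          K.dens μ J.p x z • β (K.a x z + J.u z) (K.a x z + J.u z)) :=
        hd.smul (β.continuous₂.comp_stronglyMeasurable (hau.prodMk hau))
      have h3 : StronglyMeasurable (Function.uncurry fun x z =>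
          K.dens μ J.p x z • (K.a x z + J.u z)) := hd.smul hau
      exact h1.integral_prod_right.add (h2.integral_prod_right.sub
        (β.continuous₂.comp_stronglyMeasurable
          (h3.integral_prod_right.prodMk h3.integral_prod_right)))
    · obtain ⟨M, hM⟩ := hJ.bdd_w.2
      obtain ⟨N, hN⟩ := hJ.bdd_u.2
      refine ⟨σ ^ 2 + M + (‖β‖ * (σ + N) * (σ + N) + ‖β‖ * (σ + N) * (σ + N)), fun x => ?_⟩
      have hk := hK.isProbDensity_dens hJ x
      have hau' : ∀ z, ‖K.a x z + J.u z‖ ≤ σ + N := fun z =>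
        (norm_add_le _ _).trans (add_le_add (hK.norm_a x z) (hN z))
      have h0 : 0 ≤ σ + N := (norm_nonneg _).trans (hau' x)
      refine (norm_add_le _ _).trans (add_le_add (hk.norm_avg_le fun z =>
        (norm_add_le _ _).trans (add_le_add (hK.norm_b x z) (hM z))) ?_)
      refine (norm_sub_le _ _).trans (add_le_add (hk.norm_avg_le fun z => ?_) ?_)
      · refine (β.le_opNorm₂ _ _).trans ?_
        gcongr <;> exact hau' z
      · refine (β.le_opNorm₂ _ _).trans ?_
        gcongr <;> exact hk.norm_avg_le hau'

theorem iter_zero_good {β : V →L[ℝ] V →L[ℝ] W} (hϰ : 1 ≤ ϰ) (K : ℕ → KernelJet 𝒳 V W) :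
    (iter μ β 0 K).Good ϰ where
  measurable_p := measurable_const
  pos _ := one_pos
  harnack _ _ := by simpa [iter] using hϰ
  bdd_u := BddSM.const 0
  bdd_w := BddSM.const 0

theorem iter_good {β : V →L[ℝ] V →L[ℝ] W} (hϰ : 1 ≤ ϰ) (n : ℕ) {σ : ℕ → ℝ}
    {K : ℕ → KernelJet 𝒳 V W} (hK : ∀ k, (K k).Good μ ϰ (σ k)) : (iter μ β n K).Good ϰ := by
  induction n generalizing K σ with
  | zero => exact iter_zero_good hϰ K
  | succ n ih => exact (hK 0).step_good (ih (K := fun k => K (k + 1)) fun k => hK (k + 1))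

end KernelJet

end Recursion

section Comparison

variable {𝒳 : Type*} [MeasurableSpace 𝒳] {μ : Measure 𝒳} [IsFiniteMeasure μ]
  {V W : Type*} [NormedAddCommGroup V] [NormedSpace ℝ V] [CompleteSpace V]
  [NormedAddCommGroup W] [NormedSpace ℝ W] [CompleteSpace W]

namespace KernelJet

variable {ϰ σ τ : ℝ} {K : KernelJet 𝒳 V W} {J J' : FunJet 𝒳 V W} {β : V →L[ℝ] V →L[ℝ] W}

theorem _root_.FunJet.Good.one_le (hJ : J.Good ϰ) (x : 𝒳) : 1 ≤ ϰ := by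
  have := hJ.harnack x x
  have h := hJ.pos x
  by_contra! h'
  nlinarith

theorem _root_.FunJet.Good.ratio_pos (hJ : J.Good ϰ) (hJ' : J'.Good ϰ) (x : 𝒳) :
    0 < J'.p x / J.p x := div_pos (hJ'.pos x) (hJ.pos x)

theorem _root_.FunJet.Good.ratio_le (hJ : J.Good ϰ) (hJ' : J'.Good ϰ) (x y : 𝒳) :
    J'.p x / J.p x ≤ ϰ ^ 2 * (J'.p y / J.p y) := by
  have h1 := hJ.harnack y x
  have h2 := hJ'.harnack x y
  have hx := hJ.pos x
  have hy := hJ.pos y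
  have hy' := hJ'.pos y
  have h0 := hJ.one_le x
  rw [← mul_div_assoc, div_le_div_iff₀ hx hy]
  calc J'.p x * J.p y ≤ (ϰ * J'.p y) * (ϰ * J.p x) :=
        mul_le_mul h2 h1 hy.le (by positivity)
    _ = _ := by ring

theorem _root_.FunJet.Good.bdd_ratio (hJ : J.Good ϰ) (hJ' : J'.Good ϰ) :
    BddSM fun x => J'.p x / J.p x := by
  refine ⟨(hJ'.measurable_p.div hJ.measurable_p).stronglyMeasurable, ?_⟩
  rcases isEmpty_or_nonempty 𝒳 with h | ⟨⟨y⟩⟩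
  · exact ⟨0, fun x => h.elim x⟩
  · exact ⟨_, fun x => by
      rw [Real.norm_of_nonneg (hJ.ratio_pos hJ' x).le]
      exact hJ.ratio_le hJ' x y⟩

theorem Good.dens_doeblin (hK : K.Good μ ϰ σ) (hJ : J.Good ϰ) (x y z : 𝒳) :
    (ϰ ^ 2)⁻¹ * K.dens μ J.p y z ≤ K.dens μ J.p x z := by
  have h := hK.dens_harnack hJ y x z
  have h1 := hJ.one_le x
  rw [inv_mul_le_iff₀ (by positivity)]
  exact h

/-- The ratio of two functions after one step is the average of the ratio before. -/
theorem step_ratio_eq (hJ : J.Good ϰ) (x : 𝒳) :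
    (K.step μ β J').p x / (K.step μ β J).p x =
      ∫ z, K.dens μ J.p x z • (J'.p z / J.p z) ∂μ := by
  simp only [step, dens, smul_eq_mul]
  rw [← integral_div]
  congr 1 with z
  have := (hJ.pos z).ne'
  field_simp

theorem Good.step_ratio_osc (hK : K.Good μ ϰ σ) (hJ : J.Good ϰ) (hJ' : J'.Good ϰ)
    (hτ : ∀ x z y, |J'.p x / J.p x - J'.p z / J.p z| ≤ τ * (J'.p y / J.p y)) (x z y : 𝒳) :
    |(K.step μ β J').p x / (K.step μ β J).p x - (K.step μ β J').p z / (K.step μ β J).p z| ≤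
      (1 - (ϰ ^ 2)⁻¹) * τ * ((K.step μ β J').p y / (K.step μ β J).p y) := by
  have hk := hK.isProbDensity_dens hJ
  have hR := hJ.bdd_ratio hJ'
  simp only [step_ratio_eq hJ]
  have key : ∀ v, |∫ y, K.dens μ J.p x y • (J'.p y / J.p y) ∂μ -
      ∫ y, K.dens μ J.p z y • (J'.p y / J.p y) ∂μ| ≤ (1 - (ϰ ^ 2)⁻¹) * (τ * (J'.p v / J.p v)) :=
    fun v => (hk x).norm_avg_sub_avg_le_doeblin (hk z) (hK.dens_doeblin hJ x z) hR
      fun x z => hτ x z v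
  have := integral_mono ((hk y).integrable.smul_const _)
    ((hR.integrable_smul (hk y).integrable).const_mul ((1 - (ϰ ^ 2)⁻¹) * τ))
    fun v => by
      have := mul_le_mul_of_nonneg_left (key v) ((hk y).nonneg v)
      calc _ ≤ _ := this
        _ = (1 - (ϰ ^ 2)⁻¹) * τ * (K.dens μ J.p y v • (J'.p v / J.p v)) := by
          simp only [smul_eq_mul]; ring
  rwa [integral_smul_const, (hk y).integral_eq, one_smul, integral_const_mul] at this

theorem Good.dens_ratio (hK : K.Good μ ϰ σ) (hJ : J.Good ϰ) (hJ' : J'.Good ϰ)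
    (hτ : ∀ x z y, |J'.p x / J.p x - J'.p z / J.p z| ≤ τ * (J'.p y / J.p y)) (x z : 𝒳) :
    |K.dens μ J'.p x z - K.dens μ J.p x z| ≤ τ * K.dens μ J.p x z := by
  have hk := hK.isProbDensity_dens hJ x
  have hR := hJ.bdd_ratio hJ'
  set R : ℝ := (K.step μ (0 : V →L[ℝ] V →L[ℝ] W) J').p x /
    (K.step μ (0 : V →L[ℝ] V →L[ℝ] W) J).p x with hRdef
  have p1 := hK.step_p_pos (0 : V →L[ℝ] V →L[ℝ] W) hJ x
  have p2 := hK.step_p_pos (0 : V →L[ℝ] V →L[ℝ] W) hJ' x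
  have hRpos : 0 < R := div_pos p2 p1
  have hReq : R = ∫ z, K.dens μ J.p x z • (J'.p z / J.p z) ∂μ := step_ratio_eq hJ x
  have h1 : ∀ v, |J'.p z / J.p z - R| ≤ τ * (J'.p v / J.p v) := fun v => by
    rw [hReq]
    exact hk.norm_sub_avg_le hR (fun x z => hτ x z v) z
  have h2 : |J'.p z / J.p z - R| ≤ τ * R := by
    have := integral_mono (hk.integrable.smul_const _)
      ((hR.integrable_smul hk.integrable).const_mul τ)
      fun v => by
        have := mul_le_mul_of_nonneg_left (h1 v) (hk.nonneg v)
        calc _ ≤ _ := this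
          _ = τ * (K.dens μ J.p x v • (J'.p v / J.p v)) := by
            simp only [smul_eq_mul]; ring
    rwa [integral_smul_const, hk.integral_eq, one_smul, integral_const_mul, ← hReq] at this
  have h3 : K.dens μ J'.p x z - K.dens μ J.p x z =
      K.dens μ J.p x z * ((J'.p z / J.p z - R) / R) := by
    have := (hJ.pos z).ne'
    rw [hRdef]
    simp only [step] at p1 p2
    simp only [dens, step]
    field_simp
  rw [h3, abs_mul, abs_of_nonneg (hk.nonneg z), abs_div, abs_of_pos hRpos, mul_comm τ]
  exact mul_le_mul_of_nonneg_left ((div_le_iff₀ hRpos).2 h2) (hk.nonneg z)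

variable (hβ : ‖β‖ ≤ 1)
include hβ

theorem Good.step_osc_u (hK : K.Good μ ϰ σ) (hJ : J.Good ϰ) {O : ℝ}
    (hO : ∀ x z, ‖J.u x - J.u z‖ ≤ O) (x z : 𝒳) :
    ‖(K.step μ β J).u x - (K.step μ β J).u z‖ ≤ 2 * σ + (1 - (ϰ ^ 2)⁻¹) * O := by
  have hk := hK.isProbDensity_dens hJ
  have split : ∀ x, (K.step μ β J).u x = ∫ y, K.dens μ J.p x y • K.a x y ∂μ +
      ∫ y, K.dens μ J.p x y • J.u y ∂μ := fun x => by
    rw [← integral_add ((hK.bdd_a x).integrable_smul (hk x).integrable)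
      (hJ.bdd_u.integrable_smul (hk x).integrable)]
    simp only [step, smul_add]
  rw [split, split]
  calc _ = ‖(∫ y, K.dens μ J.p x y • K.a x y ∂μ - ∫ y, K.dens μ J.p z y • K.a z y ∂μ) +
        (∫ y, K.dens μ J.p x y • J.u y ∂μ - ∫ y, K.dens μ J.p z y • J.u y ∂μ)‖ := by
          congr 1; abel
    _ ≤ (σ + σ) + (1 - (ϰ ^ 2)⁻¹) * O := by
        refine (norm_add_le _ _).trans (add_le_add ((norm_sub_le _ _).trans (add_le_add
          ((hk x).norm_avg_le (hK.norm_a x)) ((hk z).norm_avg_le (hK.norm_a z)))) ?_)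
        exact (hk x).norm_avg_sub_avg_le_doeblin (hk z) (hK.dens_doeblin hJ x z) hJ.bdd_u hO
    _ = _ := by ring

theorem Good.step_osc_w (hK : K.Good μ ϰ σ) (hJ : J.Good ϰ) {O P : ℝ}
    (hO : ∀ x z, ‖J.u x - J.u z‖ ≤ O) (hP : ∀ x z, ‖J.w x - J.w z‖ ≤ P) (x z : 𝒳) :
    ‖(K.step μ β J).w x - (K.step μ β J).w z‖ ≤
      2 * σ ^ 2 + (1 - (ϰ ^ 2)⁻¹) * P + 2 * (2 * σ + O) ^ 2 := by
  have hk := hK.isProbDensity_dens hJ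
  have hcov : ∀ x, ‖densCov μ β (K.dens μ J.p x) (fun z => K.a x z + J.u z)
      (fun z => K.a x z + J.u z)‖ ≤ (2 * σ + O) * (2 * σ + O) := fun x =>
    (hk x).norm_densCov_le β hβ (hK.bdd_add hJ x) (hK.bdd_add hJ x) (hK.osc_add hO x)
      (hK.osc_add hO x)
  have split : ∀ x, (K.step μ β J).w x = ∫ y, K.dens μ J.p x y • K.b x y ∂μ +
      ∫ y, K.dens μ J.p x y • J.w y ∂μ + densCov μ β (K.dens μ J.p x)
        (fun z => K.a x z + J.u z) (fun z => K.a x z + J.u z) := fun x => by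
    rw [← integral_add ((hK.bdd_b x).integrable_smul (hk x).integrable)
      (hJ.bdd_w.integrable_smul (hk x).integrable)]
    simp only [step, smul_add]
  rw [split, split]
  calc _ = ‖(∫ y, K.dens μ J.p x y • K.b x y ∂μ - ∫ y, K.dens μ J.p z y • K.b z y ∂μ) +
        (∫ y, K.dens μ J.p x y • J.w y ∂μ - ∫ y, K.dens μ J.p z y • J.w y ∂μ) +
        (densCov μ β (K.dens μ J.p x) (fun z => K.a x z + J.u z) (fun z => K.a x z + J.u z) -
        densCov μ β (K.dens μ J.p z) (fun y => K.a z y + J.u y) (fun y => K.a z y + J.u y))‖ := by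
          congr 1; abel
    _ ≤ (σ ^ 2 + σ ^ 2) + (1 - (ϰ ^ 2)⁻¹) * P + ((2 * σ + O) * (2 * σ + O) +
          (2 * σ + O) * (2 * σ + O)) := by
        refine norm_add₃_le.trans (add_le_add (add_le_add ((norm_sub_le _ _).trans (add_le_add
          ((hk x).norm_avg_le (hK.norm_b x)) ((hk z).norm_avg_le (hK.norm_b z)))) ?_)
          ((norm_sub_le _ _).trans (add_le_add (hcov x) (hcov z))))
        exact (hk x).norm_avg_sub_avg_le_doeblin (hk z) (hK.dens_doeblin hJ x z) hJ.bdd_w hP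
    _ = _ := by ring

theorem Good.step_u_sub_eq (hK : K.Good μ ϰ σ) (hJ : J.Good ϰ) (hJ' : J'.Good ϰ) (x : 𝒳) :
    (K.step μ β J').u x - (K.step μ β J).u x =
      ∫ y, K.dens μ J'.p x y • (J'.u y - J.u y) ∂μ +
      (∫ y, K.dens μ J'.p x y • (K.a x y + J.u y) ∂μ -
        ∫ y, K.dens μ J.p x y • (K.a x y + J.u y) ∂μ) := by
  have hk' := hK.isProbDensity_dens hJ' x
  have : (K.step μ β J').u x = ∫ y, K.dens μ J'.p x y • (J'.u y - J.u y) ∂μ +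
      ∫ y, K.dens μ J'.p x y • (K.a x y + J.u y) ∂μ := by
    rw [← integral_add ((hJ'.bdd_u.sub hJ.bdd_u).integrable_smul hk'.integrable)
      ((hK.bdd_add hJ x).integrable_smul hk'.integrable)]
    simp only [step, ← smul_add]
    congr 1 with y
    congr 1; abel
  rw [this]; simp only [step]; abel

theorem Good.step_w_sub_eq (hK : K.Good μ ϰ σ) (hJ : J.Good ϰ) (hJ' : J'.Good ϰ) (x : 𝒳) :
    (K.step μ β J').w x - (K.step μ β J).w x =
      ∫ y, K.dens μ J'.p x y • (J'.w y - J.w y) ∂μ +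
      ((∫ y, K.dens μ J'.p x y • (K.b x y + J.w y) ∂μ -
        ∫ y, K.dens μ J.p x y • (K.b x y + J.w y) ∂μ) +
      (densCov μ β (K.dens μ J'.p x) (fun z => K.a x z + J'.u z) (fun z => K.a x z + J'.u z) -
      densCov μ β (K.dens μ J.p x) (fun z => K.a x z + J.u z) (fun z => K.a x z + J.u z))) := by
  have hk' := hK.isProbDensity_dens hJ' x
  have : ∫ y, K.dens μ J'.p x y • (K.b x y + J'.w y) ∂μ =
      ∫ y, K.dens μ J'.p x y • (J'.w y - J.w y) ∂μ +
      ∫ y, K.dens μ J'.p x y • (K.b x y + J.w y) ∂μ := by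
    rw [← integral_add ((hJ'.bdd_w.sub hJ.bdd_w).integrable_smul hk'.integrable)
      ((hK.bdd_add' hJ x).integrable_smul hk'.integrable)]
    simp only [← smul_add]
    congr 1 with y
    congr 1; abel
  simp only [step]
  rw [this]; abel

theorem Good.norm_densCov_sub_le (hK : K.Good μ ϰ σ) (hJ : J.Good ϰ) (hJ' : J'.Good ϰ)
    (hτ : ∀ x z y, |J'.p x / J.p x - J'.p z / J.p z| ≤ τ * (J'.p y / J.p y)) {O d : ℝ}
    (hO : ∀ x z, ‖J.u x - J.u z‖ ≤ O) (hO' : ∀ x z, ‖J'.u x - J'.u z‖ ≤ O)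
    (hd : ∀ x z, ‖(J'.u x - J.u x) - (J'.u z - J.u z)‖ ≤ d) (x : 𝒳) :
    ‖densCov μ β (K.dens μ J'.p x) (fun z => K.a x z + J'.u z) (fun z => K.a x z + J'.u z) -
      densCov μ β (K.dens μ J.p x) (fun z => K.a x z + J.u z) (fun z => K.a x z + J.u z)‖ ≤
      2 * d * (2 * σ + O) + 3 * τ * (2 * σ + O) ^ 2 := by
  have hk := hK.isProbDensity_dens hJ x
  have hk' := hK.isProbDensity_dens hJ' x
  have hA := hK.bdd_add hJ x
  have hA' := hK.bdd_add hJ' x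
  have h1 := hk.norm_densCov_sub_densCov_le_ratio β hβ hk' (hK.dens_ratio hJ hJ' hτ x)
    hA (hK.osc_add hO x)
  have hd' : ∀ y z, ‖((K.a x y + J'.u y) - (K.a x y + J.u y)) -
      ((K.a x z + J'.u z) - (K.a x z + J.u z))‖ ≤ d := fun y z => by
    simpa only [add_sub_add_left_eq_sub] using hd y z
  have h2 := hk'.norm_densCov_le β hβ (hA'.sub hA) hA' hd' (hK.osc_add hO' x)
  have h3 := hk'.norm_densCov_le β hβ hA (hA'.sub hA) (hK.osc_add hO x) hd'
  have e := hk'.densCov_sub_densCov β hA hA'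
  calc _ = ‖(densCov μ β (K.dens μ J'.p x) (fun z => K.a x z + J'.u z)
          (fun z => K.a x z + J'.u z) - densCov μ β (K.dens μ J'.p x) (fun z => K.a x z + J.u z)
          (fun z => K.a x z + J.u z)) + (densCov μ β (K.dens μ J'.p x) (fun z => K.a x z + J.u z)
          (fun z => K.a x z + J.u z) - densCov μ β (K.dens μ J.p x) (fun z => K.a x z + J.u z)
          (fun z => K.a x z + J.u z))‖ := by congr 1; abel
    _ ≤ (d * (2 * σ + O) + (2 * σ + O) * d) + 3 * τ * (2 * σ + O) ^ 2 := by
        refine (norm_add_le _ _).trans (add_le_add ?_ h1)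
        rw [e]
        exact (norm_add_le _ _).trans (add_le_add h2 h3)
    _ = _ := by ring

variable (hK : K.Good μ ϰ σ) (hJ : J.Good ϰ) (hJ' : J'.Good ϰ)
    (hτ : ∀ x z y, |J'.p x / J.p x - J'.p z / J.p z| ≤ τ * (J'.p y / J.p y)) {O d P e : ℝ}
    (hO : ∀ x z, ‖J.u x - J.u z‖ ≤ O) (hO' : ∀ x z, ‖J'.u x - J'.u z‖ ≤ O)
    (hd : ∀ x z, ‖(J'.u x - J.u x) - (J'.u z - J.u z)‖ ≤ d)
    (hP : ∀ x z, ‖J.w x - J.w z‖ ≤ P)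
    (he : ∀ x z, ‖(J'.w x - J.w x) - (J'.w z - J.w z)‖ ≤ e)
include hK hJ hJ' hτ hO hd

theorem Good.step_osc_u_sub (x z : 𝒳) :
    ‖((K.step μ β J').u x - (K.step μ β J).u x) - ((K.step μ β J').u z - (K.step μ β J).u z)‖ ≤
      (1 - (ϰ ^ 2)⁻¹) * d + 2 * τ * (2 * σ + O) := by
  have hk := hK.isProbDensity_dens hJ
  have hk' := hK.isProbDensity_dens hJ'
  have h1 := fun x => (hk x).norm_avg_sub_avg_le_ratio (hk' x) (hK.dens_ratio hJ hJ' hτ x)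
    (hK.bdd_add hJ x) (hK.osc_add hO x)
  have h2 := (hk' x).norm_avg_sub_avg_le_doeblin (hk' z) (hK.dens_doeblin hJ' x z)
    (hJ'.bdd_u.sub hJ.bdd_u) hd
  rw [hK.step_u_sub_eq hβ hJ hJ', hK.step_u_sub_eq hβ hJ hJ', add_sub_add_comm]
  refine (norm_add_le _ _).trans ((add_le_add h2 ((norm_sub_le _ _).trans
    (add_le_add (h1 x) (h1 z)))).trans_eq ?_)
  ring

theorem Good.step_u_sub_sub (x z : 𝒳) :
    ‖((K.step μ β J').u x - (K.step μ β J).u x) - (J'.u z - J.u z)‖ ≤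
      d + τ * (2 * σ + O) := by
  have hk := hK.isProbDensity_dens hJ
  have hk' := hK.isProbDensity_dens hJ'
  have h1 := (hk x).norm_avg_sub_avg_le_ratio (hk' x) (hK.dens_ratio hJ hJ' hτ x)
    (hK.bdd_add hJ x) (hK.osc_add hO x)
  have h2 := (hk' x).norm_avg_sub_le (hJ'.bdd_u.sub hJ.bdd_u) (fun y => hd y z)
  rw [hK.step_u_sub_eq hβ hJ hJ', add_sub_right_comm]
  exact (norm_add_le _ _).trans (add_le_add h2 h1)

include hO' hP he

theorem Good.step_osc_w_sub (x z : 𝒳) :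
    ‖((K.step μ β J').w x - (K.step μ β J).w x) - ((K.step μ β J').w z - (K.step μ β J).w z)‖ ≤
      (1 - (ϰ ^ 2)⁻¹) * e + 2 * (τ * (2 * σ ^ 2 + P)) +
        2 * (2 * d * (2 * σ + O) + 3 * τ * (2 * σ + O) ^ 2) := by
  have hk := hK.isProbDensity_dens hJ
  have hk' := hK.isProbDensity_dens hJ'
  have hosc : ∀ x y y', ‖(K.b x y + J.w y) - (K.b x y' + J.w y')‖ ≤ 2 * σ ^ 2 + P :=
    fun x y y' => by
      rw [add_sub_add_comm]
      refine (norm_add_le _ _).trans (add_le_add ((norm_sub_le _ _).trans ?_) (hP y y'))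
      linarith [hK.norm_b x y, hK.norm_b x y']
  have h1 := fun x => (hk x).norm_avg_sub_avg_le_ratio (hk' x) (hK.dens_ratio hJ hJ' hτ x)
    (hK.bdd_add' hJ x) (hosc x)
  have h2 := (hk' x).norm_avg_sub_avg_le_doeblin (hk' z) (hK.dens_doeblin hJ' x z)
    (hJ'.bdd_w.sub hJ.bdd_w) he
  have h3 := hK.norm_densCov_sub_le hβ hJ hJ' hτ hO hO' hd
  rw [hK.step_w_sub_eq hβ hJ hJ', hK.step_w_sub_eq hβ hJ hJ', add_sub_add_comm]
  refine (norm_add_le _ _).trans ((add_le_add h2 ((norm_sub_le _ _).trans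
    (add_le_add ((norm_add_le _ _).trans (add_le_add (h1 x) (h3 x)))
    ((norm_add_le _ _).trans (add_le_add (h1 z) (h3 z)))))).trans_eq ?_)
  ring

theorem Good.step_w_sub_sub (x z : 𝒳) :
    ‖((K.step μ β J').w x - (K.step μ β J).w x) - (J'.w z - J.w z)‖ ≤
      e + (τ * (2 * σ ^ 2 + P)) + (2 * d * (2 * σ + O) + 3 * τ * (2 * σ + O) ^ 2) := by
  have hk := hK.isProbDensity_dens hJ
  have hk' := hK.isProbDensity_dens hJ'
  have hosc : ∀ x y y', ‖(K.b x y + J.w y) - (K.b x y' + J.w y')‖ ≤ 2 * σ ^ 2 + P :=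
    fun x y y' => by
      rw [add_sub_add_comm]
      refine (norm_add_le _ _).trans (add_le_add ((norm_sub_le _ _).trans ?_) (hP y y'))
      linarith [hK.norm_b x y, hK.norm_b x y']
  have h1 := (hk x).norm_avg_sub_avg_le_ratio (hk' x) (hK.dens_ratio hJ hJ' hτ x)
    (hK.bdd_add' hJ x) (hosc x)
  have h2 := (hk' x).norm_avg_sub_le (hJ'.bdd_w.sub hJ.bdd_w) (fun y => he y z)
  have h3 := hK.norm_densCov_sub_le hβ hJ hJ' hτ hO hO' hd x
  rw [hK.step_w_sub_eq hβ hJ hJ', add_sub_right_comm]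
  refine (norm_add_le _ _).trans ((add_le_add h2 ((norm_add_le _ _).trans
    (add_le_add h1 h3))).trans_eq ?_)
  ring

end KernelJet

/-! ### Geometric bounds for the iterates -/

/-- The exponentially weighted sum `c * ∑_{k < n} r ^ k * σ k`. -/
def expSum (r c : ℝ) : ℕ → (ℕ → ℝ) → ℝ
  | 0, _ => 0
  | n + 1, σ => r * expSum r c n (fun k => σ (k + 1)) + c * σ 0

theorem expSum_succ (r c : ℝ) (n : ℕ) (σ : ℕ → ℝ) :
    expSum r c (n + 1) σ = r * expSum r c n (fun k => σ (k + 1)) + c * σ 0 := rfl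

theorem expSum_nonneg {r c : ℝ} (hr : 0 ≤ r) (hc : 0 ≤ c) (n : ℕ) {σ : ℕ → ℝ} (hσ : ∀ k, 0 ≤ σ k) :
    0 ≤ expSum r c n σ := by
  induction n generalizing σ with
  | zero => exact le_rfl
  | succ n ih => exact add_nonneg (mul_nonneg hr (ih fun k => hσ _)) (mul_nonneg hc (hσ 0))

theorem expSum_le_succ {r c : ℝ} (hr : 0 ≤ r) (hc : 0 ≤ c) (n : ℕ) {σ : ℕ → ℝ} (hσ : ∀ k, 0 ≤ σ k) :
    expSum r c n σ ≤ expSum r c (n + 1) σ := by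
  induction n generalizing σ with
  | zero => exact expSum_nonneg hr hc 1 hσ
  | succ n ih => exact add_le_add_left (mul_le_mul_of_nonneg_left (ih fun k => hσ _) hr) _

namespace KernelJet

variable {ϰ r : ℝ} {β : V →L[ℝ] V →L[ℝ] W} {σ : ℕ → ℝ} {K : ℕ → KernelJet 𝒳 V W}
  (hβ : ‖β‖ ≤ 1) (hϰ : 1 ≤ ϰ) (hr0 : 0 < r) (hr1 : r < 1) (hr : 1 - (ϰ ^ 2)⁻¹ ≤ r ^ 4)
include hβ hϰ hr0 hr1 hr

theorem iter_osc_u (n : ℕ) (hσ : ∀ k, 1 ≤ σ k) (hK : ∀ k, (K k).Good μ ϰ (σ k)) (x z : 𝒳) :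
    ‖(iter μ β n K).u x - (iter μ β n K).u z‖ ≤ expSum r 2 n σ := by
  induction n generalizing σ K x z with
  | zero => simp [iter, expSum]
  | succ n ih =>
    refine ((hK 0).step_osc_u hβ (iter_good hϰ n fun k => hK (k + 1))
      (ih (fun k => hσ _) (fun k => hK _)) x z).trans ?_
    have h0 := expSum_nonneg hr0.le zero_le_two n (σ := fun k => σ (k + 1))
      fun k => zero_le_one.trans (hσ _)
    have : r ^ 4 ≤ r := pow_le_of_le_one hr0.le hr1.le (by norm_num)
    simp only [expSum]
    nlinarith

/-- The constant in the bound for the oscillation of the second logarithmic derivative. -/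
def oscConst (r : ℝ) : ℝ := 5 / (r ^ 2 * (1 - r ^ 2))

theorem iter_osc_w (n : ℕ) (hσ : ∀ k, 1 ≤ σ k) (hK : ∀ k, (K k).Good μ ϰ (σ k)) (x z : 𝒳) :
    ‖(iter μ β n K).w x - (iter μ β n K).w z‖ ≤ oscConst r * expSum r 2 n σ ^ 2 := by
  induction n generalizing σ K x z with
  | zero => simp [iter, expSum]
  | succ n ih =>
    refine ((hK 0).step_osc_w hβ (iter_good hϰ n fun k => hK (k + 1))
      (iter_osc_u hβ hϰ hr0 hr1 hr n (fun k => hσ (k + 1)) (fun k => hK (k + 1)))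
      (ih (fun k => hσ _) (fun k => hK _)) x z).trans ?_
    have h0 := expSum_nonneg hr0.le zero_le_two n (σ := fun k => σ (k + 1))
      fun k => zero_le_one.trans (hσ _)
    simp only [expSum]
    set O := expSum r 2 n fun k => σ (k + 1)
    have hs := hσ 0
    have hr2 : r ^ 2 < 1 := pow_lt_one₀ hr0.le hr1 two_ne_zero
    have hden : 0 < r ^ 2 * (1 - r ^ 2) := mul_pos (by positivity) (by linarith)
    set B := oscConst r with hB
    have hB1 : B * (r ^ 2 - r ^ 4) = 5 := by
      have : 1 - r ^ 2 ≠ 0 := by linarith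
      rw [hB, oscConst]; field_simp
    have hB5 : 5 ≤ B := by
      rw [hB, oscConst, le_div_iff₀ hden]
      nlinarith
    have e1 : (1 - (ϰ ^ 2)⁻¹) * (B * O ^ 2) ≤ r ^ 4 * (B * O ^ 2) :=
      mul_le_mul_of_nonneg_right hr (by positivity)
    have e2 : 0 ≤ B * (4 * r * O * σ 0) := by positivity
    have e3 : 0 ≤ (B - 5) * (σ 0) ^ 2 := mul_nonneg (by linarith) (by positivity)
    have e4 := sq_nonneg (2 * σ 0 - O)
    have e5 : B * (r ^ 2 - r ^ 4) * O ^ 2 = 5 * O ^ 2 := by rw [hB1]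
    nlinarith [sq_nonneg (σ 0), sq_nonneg O]

end KernelJet

end Comparison

section Differences

variable {𝒳 : Type*} [MeasurableSpace 𝒳] {μ : Measure 𝒳} [IsFiniteMeasure μ]
  {V W : Type*} [NormedAddCommGroup V] [NormedSpace ℝ V] [CompleteSpace V]
  [NormedAddCommGroup W] [NormedSpace ℝ W] [CompleteSpace W]

namespace KernelJet

theorem Good.step_ratio_sub {ϰ σ τ : ℝ} {K : KernelJet 𝒳 V W} {J J' : FunJet 𝒳 V W}
    {β : V →L[ℝ] V →L[ℝ] W} (hK : K.Good μ ϰ σ) (hJ : J.Good ϰ) (hJ' : J'.Good ϰ)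
    (hτ : ∀ x z y, |J'.p x / J.p x - J'.p z / J.p z| ≤ τ * (J'.p y / J.p y)) (x z : 𝒳) :
    |(Real.log ((K.step μ β J').p x) - Real.log ((K.step μ β J).p x)) -
      (Real.log (J'.p z) - Real.log (J.p z))| ≤ τ := by
  have hk := hK.isProbDensity_dens hJ x
  have hR := hJ.bdd_ratio hJ'
  have p1 := hK.step_p_pos β hJ x
  have p2 := hK.step_p_pos β hJ' x
  rw [← Real.log_div p2.ne' p1.ne', ← Real.log_div (hJ'.pos z).ne' (hJ.pos z).ne']
  have hz := hJ.ratio_pos hJ' z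
  have hx : 0 < (K.step μ β J').p x / (K.step μ β J).p x := div_pos p2 p1
  have h1 : ∀ v, |(K.step μ β J').p x / (K.step μ β J).p x - J'.p z / J.p z| ≤
      τ * (J'.p v / J.p v) := fun v => by
    rw [step_ratio_eq hJ, abs_sub_comm]
    exact hk.norm_sub_avg_le hR (fun x z => hτ x z v) z
  have h2 : |(K.step μ β J').p x / (K.step μ β J).p x - J'.p z / J.p z| ≤
      τ * ((K.step μ β J').p x / (K.step μ β J).p x) := by
    have := integral_mono (hk.integrable.smul_const _)
      ((hR.integrable_smul hk.integrable).const_mul τ)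
      fun v => by
        have := mul_le_mul_of_nonneg_left (h1 v) (hk.nonneg v)
        calc _ ≤ _ := this
          _ = τ * (K.dens μ J.p x v • (J'.p v / J.p v)) := by
            simp only [smul_eq_mul]; ring
    rwa [integral_smul_const, hk.integral_eq, one_smul, integral_const_mul,
      ← step_ratio_eq (β := β) hJ] at this
  have h3 := h1 z
  set a := (K.step μ β J').p x / (K.step μ β J).p x
  set b := J'.p z / J.p z
  rw [abs_le] at h2 h3 ⊢
  rw [← Real.log_div hx.ne' hz.ne']
  constructor
  · have := Real.log_le_sub_one_of_pos (div_pos hz hx)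
    rw [← inv_div, Real.log_inv] at this
    have h4 : b / a ≤ 1 + τ := by
      rw [div_le_iff₀ hx]; linarith
    rw [inv_div] at this
    linarith
  · have := Real.log_le_sub_one_of_pos (div_pos hx hz)
    have h4 : a / b ≤ 1 + τ := by
      rw [div_le_iff₀ hz]; linarith
    linarith

variable {ϰ r : ℝ} {β : V →L[ℝ] V →L[ℝ] W} {σ : ℕ → ℝ} {K : ℕ → KernelJet 𝒳 V W}

theorem iter_ratio (hϰ : 1 ≤ ϰ) (hr0 : 0 < r) (hr : 1 - (ϰ ^ 2)⁻¹ ≤ r) (n : ℕ)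
    (hK : ∀ k, (K k).Good μ ϰ (σ k)) (x z y : 𝒳) :
    |(iter μ β (n + 1) K).p x / (iter μ β n K).p x -
      (iter μ β (n + 1) K).p z / (iter μ β n K).p z| ≤
      ϰ ^ 2 * r ^ n * ((iter μ β (n + 1) K).p y / (iter μ β n K).p y) := by
  induction n generalizing σ K x z y with
  | zero =>
    have h0 := iter_good (β := β) hϰ 0 hK
    have h1 := iter_good (β := β) hϰ 1 hK
    have a := h0.ratio_le h1 x y
    have b := h0.ratio_le h1 z y
    have a' := h0.ratio_pos h1 x
    have b' := h0.ratio_pos h1 z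
    simp only [zero_add] at *
    rw [abs_le, pow_zero, mul_one]
    constructor <;> linarith
  | succ n ih =>
    have h0 := iter_good (β := β) hϰ n fun k => hK (k + 1)
    have h1 := iter_good (β := β) hϰ (n + 1) fun k => hK (k + 1)
    refine ((hK 0).step_ratio_osc (β := β) h0 h1 (ih fun k => hK (k + 1)) x z y).trans ?_
    have := ((iter_good (β := β) hϰ (n + 1) hK).ratio_pos
      (iter_good (β := β) hϰ (n + 2) hK) y).le
    have h2 : (1 - (ϰ ^ 2)⁻¹) * (ϰ ^ 2 * r ^ n) ≤ ϰ ^ 2 * r ^ (n + 1) := by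
      calc _ ≤ r * (ϰ ^ 2 * r ^ n) := mul_le_mul_of_nonneg_right hr (by positivity)
        _ = _ := by ring
    exact mul_le_mul_of_nonneg_right h2 this

/-- Constant in the bound for the change of the first logarithmic derivative. -/
def diffConst₁ (ϰ r : ℝ) : ℝ := 2 * ϰ ^ 2 / (r ^ 2 * (1 - r ^ 2))

/-- Constant in the bound for the change of the second logarithmic derivative. -/
def diffConst₂ (ϰ r : ℝ) : ℝ :=
  (52 * ϰ ^ 2 + 2 * ϰ ^ 2 * oscConst r + 8 * diffConst₁ ϰ r) / (r ^ 3 * (1 - r))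

/-- Constant in the bound for second differences. -/
def diffConst (ϰ r : ℝ) : ℝ :=
  diffConst₂ ϰ r + 14 * ϰ ^ 2 + ϰ ^ 2 * oscConst r + 5 * diffConst₁ ϰ r

variable (hβ : ‖β‖ ≤ 1) (hϰ : 1 ≤ ϰ) (hr0 : 0 < r) (hr1 : r < 1) (hr : 1 - (ϰ ^ 2)⁻¹ ≤ r ^ 4)

include hr0 hr1 in
theorem oscConst_nonneg : 0 ≤ oscConst r := by
  have hr2 : r ^ 2 < 1 := pow_lt_one₀ hr0.le hr1 two_ne_zero
  have : 0 < r ^ 2 * (1 - r ^ 2) := mul_pos (by positivity) (by linarith)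
  unfold oscConst; positivity

include hr0 hr1 in
theorem diffConst₁_nonneg : 0 ≤ diffConst₁ ϰ r := by
  have hr2 : r ^ 2 < 1 := pow_lt_one₀ hr0.le hr1 two_ne_zero
  have : 0 < r ^ 2 * (1 - r ^ 2) := mul_pos (by positivity) (by linarith)
  unfold diffConst₁; positivity

include hr0 hr1 in
theorem diffConst₂_nonneg : 0 ≤ diffConst₂ ϰ r := by
  have : 0 < r ^ 3 * (1 - r) := mul_pos (by positivity) (by linarith)
  have := oscConst_nonneg hr0 hr1
  have := diffConst₁_nonneg (ϰ := ϰ) hr0 hr1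
  unfold diffConst₂; positivity

include hr0 hr1 in
theorem diffConst_nonneg : 0 ≤ diffConst ϰ r := by
  have := oscConst_nonneg hr0 hr1
  have := diffConst₁_nonneg (ϰ := ϰ) hr0 hr1
  have := diffConst₂_nonneg (ϰ := ϰ) hr0 hr1
  unfold diffConst; positivity

include hβ hϰ hr0 hr1 hr

theorem iter_osc_u_diff (n : ℕ) (hσ : ∀ k, 1 ≤ σ k) (hK : ∀ k, (K k).Good μ ϰ (σ k)) (x z : 𝒳) :
    ‖((iter μ β (n + 1) K).u x - (iter μ β n K).u x) -
      ((iter μ β (n + 1) K).u z - (iter μ β n K).u z)‖ ≤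
      diffConst₁ ϰ r * r ^ n * expSum r 2 (n + 1) σ := by
  have hr2 : r ^ 2 < 1 := pow_lt_one₀ hr0.le hr1 two_ne_zero
  have hr2' : 1 - r ^ 2 ≠ 0 := by linarith
  have hden : 0 < r ^ 2 * (1 - r ^ 2) := mul_pos (by positivity) (by linarith)
  have hr41 : r ^ 4 ≤ r := pow_le_of_le_one hr0.le hr1.le (by norm_num)
  have hB : diffConst₁ ϰ r * (r ^ 2 - r ^ 4) = 2 * ϰ ^ 2 := by
    rw [diffConst₁]; field_simp
  have hB' : 2 * ϰ ^ 2 ≤ diffConst₁ ϰ r * r := by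
    rw [← hB]
    refine mul_le_mul_of_nonneg_left ?_ (diffConst₁_nonneg hr0 hr1)
    nlinarith [pow_pos hr0 4]
  have hϰ2 : 1 ≤ ϰ ^ 2 := one_le_pow₀ hϰ
  induction n generalizing σ K x z with
  | zero =>
    have h1 := iter_osc_u hβ hϰ hr0 hr1 hr 1 hσ hK x z
    have h0 := expSum_nonneg hr0.le zero_le_two 1 (σ := σ) fun k => zero_le_one.trans (hσ _)
    have : (iter μ β 0 K).u = fun _ => 0 := rfl
    simp only [zero_add, pow_zero, mul_one, this, sub_zero] at *
    refine h1.trans (le_mul_of_one_le_left h0 ?_)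
    have := diffConst₁_nonneg (ϰ := ϰ) hr0 hr1
    nlinarith
  | succ n ih =>
    have h0 := iter_good (β := β) hϰ n fun k => hK (k + 1)
    have h1 := iter_good (β := β) hϰ (n + 1) fun k => hK (k + 1)
    have hs0 : ∀ k, 0 ≤ σ (k + 1) := fun k => zero_le_one.trans (hσ _)
    have hO1 := expSum_le_succ hr0.le zero_le_two n hs0
    have hO0 := expSum_nonneg hr0.le zero_le_two (n + 1) hs0
    refine ((hK 0).step_osc_u_sub hβ h0 h1
      (iter_ratio hϰ hr0 (hr.trans hr41) n fun k => hK (k + 1))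
      (fun x z => (iter_osc_u hβ hϰ hr0 hr1 hr n (fun k => hσ (k + 1))
        (fun k => hK (k + 1)) x z).trans hO1)
      (ih (fun k => hσ _) fun k => hK (k + 1)) x z).trans ?_
    rw [expSum_succ r 2 (n + 1) σ]
    set O := expSum r 2 (n + 1) fun k => σ (k + 1)
    set B := diffConst₁ ϰ r
    have hBn : 0 ≤ B := diffConst₁_nonneg hr0 hr1
    have hs := hσ 0
    have e1 : (1 - (ϰ ^ 2)⁻¹) * (B * r ^ n * O) ≤ r ^ 4 * (B * r ^ n * O) :=
      mul_le_mul_of_nonneg_right hr (by positivity)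
    have e2 : r ^ 4 * (B * O) + 2 * ϰ ^ 2 * (2 * σ 0 + O) ≤ B * r * (r * O + 2 * σ 0) := by
      have e3 : B * (r ^ 2 - r ^ 4) * O = 2 * ϰ ^ 2 * O := by rw [hB]
      have e4 : 2 * ϰ ^ 2 * (2 * σ 0) ≤ B * r * (2 * σ 0) :=
        mul_le_mul_of_nonneg_right hB' (by linarith)
      nlinarith
    have e3 := mul_le_mul_of_nonneg_left e2 (pow_nonneg hr0.le n)
    calc _ ≤ r ^ 4 * (B * r ^ n * O) + 2 * (ϰ ^ 2 * r ^ n) * (2 * σ 0 + O) := by gcongr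
      _ = r ^ n * (r ^ 4 * (B * O) + 2 * ϰ ^ 2 * (2 * σ 0 + O)) := by ring
      _ ≤ _ := e3
      _ = _ := by ring

theorem iter_osc_w_diff (n : ℕ) (hσ : ∀ k, 1 ≤ σ k) (hK : ∀ k, (K k).Good μ ϰ (σ k)) (x z : 𝒳) :
    ‖((iter μ β (n + 1) K).w x - (iter μ β n K).w x) -
      ((iter μ β (n + 1) K).w z - (iter μ β n K).w z)‖ ≤
      diffConst₂ ϰ r * r ^ n * expSum r 2 (n + 1) σ ^ 2 := by
  have hr41 : r ^ 4 ≤ r := pow_le_of_le_one hr0.le hr1.le (by norm_num)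
  have hden : 0 < r ^ 3 * (1 - r) := mul_pos (by positivity) (by linarith)
  have hr1' : 1 - r ≠ 0 := by linarith
  have hC0 := oscConst_nonneg hr0 hr1
  have hB0 := diffConst₁_nonneg (ϰ := ϰ) hr0 hr1
  have hD0 := diffConst₂_nonneg (ϰ := ϰ) hr0 hr1
  have hϰ2 : 1 ≤ ϰ ^ 2 := one_le_pow₀ hϰ
  have hB : diffConst₂ ϰ r * (r ^ 3 - r ^ 4) =
      52 * ϰ ^ 2 + 2 * ϰ ^ 2 * oscConst r + 8 * diffConst₁ ϰ r := by
    rw [diffConst₂]; field_simp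
  have hB' : 52 * ϰ ^ 2 + 2 * ϰ ^ 2 * oscConst r + 8 * diffConst₁ ϰ r ≤ diffConst₂ ϰ r * r := by
    rw [← hB]
    refine mul_le_mul_of_nonneg_left ?_ hD0
    have : r ^ 3 ≤ r := pow_le_of_le_one hr0.le hr1.le (by norm_num)
    linarith [pow_pos hr0 4]
  have hCD : oscConst r ≤ diffConst₂ ϰ r := by
    have : diffConst₂ ϰ r * r ≤ diffConst₂ ϰ r * 1 := mul_le_mul_of_nonneg_left hr1.le hD0
    nlinarith
  induction n generalizing σ K x z with
  | zero =>
    have h1 := iter_osc_w hβ hϰ hr0 hr1 hr 1 hσ hK x z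
    have : (iter μ β 0 K).w = fun _ => 0 := rfl
    simp only [zero_add, pow_zero, mul_one, this, sub_zero] at *
    exact h1.trans (mul_le_mul_of_nonneg_right hCD (sq_nonneg _))
  | succ n ih =>
    have h0 := iter_good (β := β) hϰ n fun k => hK (k + 1)
    have h1 := iter_good (β := β) hϰ (n + 1) fun k => hK (k + 1)
    have hs0 : ∀ k, 0 ≤ σ (k + 1) := fun k => zero_le_one.trans (hσ _)
    have hO1 := expSum_le_succ hr0.le zero_le_two n hs0
    have hO0 := expSum_nonneg hr0.le zero_le_two (n + 1) hs0
    have hO00 := expSum_nonneg hr0.le zero_le_two n hs0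
    have hP : ∀ x z, ‖(iter μ β n fun k => K (k + 1)).w x -
        (iter μ β n fun k => K (k + 1)).w z‖ ≤
          oscConst r * expSum r 2 (n + 1) (fun k => σ (k + 1)) ^ 2 := fun x z =>
      (iter_osc_w hβ hϰ hr0 hr1 hr n (fun k => hσ (k + 1)) (fun k => hK (k + 1)) x z).trans (by
        gcongr)
    refine ((hK 0).step_osc_w_sub hβ h0 h1
      (iter_ratio hϰ hr0 (hr.trans hr41) n fun k => hK (k + 1))
      (fun x z => (iter_osc_u hβ hϰ hr0 hr1 hr n (fun k => hσ (k + 1))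
        (fun k => hK (k + 1)) x z).trans hO1)
      (iter_osc_u hβ hϰ hr0 hr1 hr (n + 1) (fun k => hσ (k + 1)) (fun k => hK (k + 1)))
      (iter_osc_u_diff hβ hϰ hr0 hr1 hr n (fun k => hσ (k + 1)) (fun k => hK (k + 1)))
      hP (ih (fun k => hσ _) fun k => hK (k + 1)) x z).trans ?_
    rw [expSum_succ r 2 (n + 1) σ]
    set O := expSum r 2 (n + 1) fun k => σ (k + 1)
    set B := diffConst₁ ϰ r
    set C := oscConst r
    set D := diffConst₂ ϰ r
    have hs := hσ 0
    have e1 : (1 - (ϰ ^ 2)⁻¹) * (D * r ^ n * O ^ 2) ≤ r ^ 4 * (D * r ^ n * O ^ 2) :=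
      mul_le_mul_of_nonneg_right hr (by positivity)
    have e2 : r ^ 4 * (D * O ^ 2) + 2 * (ϰ ^ 2 * (2 * σ 0 ^ 2 + C * O ^ 2)) +
        2 * (2 * (B * O) * (2 * σ 0 + O) + 3 * ϰ ^ 2 * (2 * σ 0 + O) ^ 2) ≤
        D * r * (r * O + 2 * σ 0) ^ 2 := by
      have e3 : D * (r ^ 3 - r ^ 4) * O ^ 2 =
          (52 * ϰ ^ 2 + 2 * ϰ ^ 2 * C + 8 * B) * O ^ 2 := by rw [hB]
      have e4 : (52 * ϰ ^ 2 + 2 * ϰ ^ 2 * C + 8 * B) * (4 * σ 0 ^ 2) ≤ D * r * (4 * σ 0 ^ 2) :=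
        mul_le_mul_of_nonneg_right hB' (by positivity)
      have e5 : 0 ≤ D * r * (r * O * σ 0) := by positivity
      have e6 : B * (O * σ 0) ≤ B * ((O ^ 2 + σ 0 ^ 2) / 2) :=
        mul_le_mul_of_nonneg_left (by nlinarith [sq_nonneg (O - σ 0)]) hB0
      have e7 : ϰ ^ 2 * (O * σ 0) ≤ ϰ ^ 2 * ((O ^ 2 + σ 0 ^ 2) / 2) :=
        mul_le_mul_of_nonneg_left (by nlinarith [sq_nonneg (O - σ 0)]) (by positivity)
      have e8 : 0 ≤ ϰ ^ 2 * C * σ 0 ^ 2 := by positivity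
      have e9 : 0 ≤ B * σ 0 ^ 2 := by positivity
      have e10 : 0 ≤ B * O ^ 2 := by positivity
      have e11 : 0 ≤ ϰ ^ 2 * σ 0 ^ 2 := by positivity
      have e12 : 0 ≤ ϰ ^ 2 * O ^ 2 := by positivity
      linarith
    have e3 := mul_le_mul_of_nonneg_left e2 (pow_nonneg hr0.le n)
    calc _ ≤ r ^ 4 * (D * r ^ n * O ^ 2) + 2 * (ϰ ^ 2 * r ^ n * (2 * σ 0 ^ 2 + C * O ^ 2)) +
        2 * (2 * (B * r ^ n * O) * (2 * σ 0 + O) + 3 * (ϰ ^ 2 * r ^ n) * (2 * σ 0 + O) ^ 2) := by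
          gcongr
      _ = r ^ n * (r ^ 4 * (D * O ^ 2) + 2 * (ϰ ^ 2 * (2 * σ 0 ^ 2 + C * O ^ 2)) +
        2 * (2 * (B * O) * (2 * σ 0 + O) + 3 * ϰ ^ 2 * (2 * σ 0 + O) ^ 2)) := by ring
      _ ≤ _ := e3
      _ = _ := by ring

/-- Second differences (in the number of observations and along the environment) of the
logarithms, and of their first and second derivatives, decay geometrically. -/
theorem iter_second_diff (n : ℕ) (hσ : ∀ k, 1 ≤ σ k) (hK : ∀ k, (K k).Good μ ϰ (σ k)) (x z : 𝒳) :
    |(Real.log ((iter μ β (n + 2) K).p x) - Real.log ((iter μ β (n + 1) K).p x)) -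
      (Real.log ((iter μ β (n + 1) fun k => K (k + 1)).p z) -
        Real.log ((iter μ β n fun k => K (k + 1)).p z))| ≤ ϰ ^ 2 * r ^ n ∧
    ‖((iter μ β (n + 2) K).u x - (iter μ β (n + 1) K).u x) -
      ((iter μ β (n + 1) fun k => K (k + 1)).u z - (iter μ β n fun k => K (k + 1)).u z)‖ ≤
      diffConst ϰ r * r ^ n * (σ 0 + expSum r 2 (n + 1) fun k => σ (k + 1)) ^ 2 ∧
    ‖((iter μ β (n + 2) K).w x - (iter μ β (n + 1) K).w x) -
      ((iter μ β (n + 1) fun k => K (k + 1)).w z - (iter μ β n fun k => K (k + 1)).w z)‖ ≤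
      diffConst ϰ r * r ^ n * (σ 0 + expSum r 2 (n + 1) fun k => σ (k + 1)) ^ 2 := by
  have hr41 : r ^ 4 ≤ r := pow_le_of_le_one hr0.le hr1.le (by norm_num)
  have hC0 := oscConst_nonneg hr0 hr1
  have hB0 := diffConst₁_nonneg (ϰ := ϰ) hr0 hr1
  have hD0 := diffConst₂_nonneg (ϰ := ϰ) hr0 hr1
  have h0 := iter_good (β := β) hϰ n fun k => hK (k + 1)
  have h1 := iter_good (β := β) hϰ (n + 1) fun k => hK (k + 1)
  have hs0 : ∀ k, 0 ≤ σ (k + 1) := fun k => zero_le_one.trans (hσ _)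
  have hO1 := expSum_le_succ hr0.le zero_le_two n hs0
  have hO0 := expSum_nonneg hr0.le zero_le_two (n + 1) hs0
  have hO00 := expSum_nonneg hr0.le zero_le_two n hs0
  have hR := iter_ratio (β := β) hϰ hr0 (hr.trans hr41) n fun k => hK (k + 1)
  have hosc : ∀ x z, ‖(iter μ β n fun k => K (k + 1)).u x -
      (iter μ β n fun k => K (k + 1)).u z‖ ≤ expSum r 2 (n + 1) (fun k => σ (k + 1)) :=
    fun x z => (iter_osc_u hβ hϰ hr0 hr1 hr n (fun k => hσ (k + 1))
        (fun k => hK (k + 1)) x z).trans hO1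
  have hP : ∀ x z, ‖(iter μ β n fun k => K (k + 1)).w x -
      (iter μ β n fun k => K (k + 1)).w z‖ ≤
        oscConst r * expSum r 2 (n + 1) (fun k => σ (k + 1)) ^ 2 := fun x z =>
    (iter_osc_w hβ hϰ hr0 hr1 hr n (fun k => hσ (k + 1)) (fun k => hK (k + 1)) x z).trans (by
      gcongr)
  have hd := iter_osc_u_diff hβ hϰ hr0 hr1 hr n (fun k => hσ (k + 1)) (fun k => hK (k + 1))
  have hrn : 0 < r ^ n := pow_pos hr0 n
  have hs := hσ 0
  refine ⟨(hK 0).step_ratio_sub h0 h1 hR x z,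
    ((hK 0).step_u_sub_sub hβ h0 h1 hR hosc hd x z).trans ?_,
    ((hK 0).step_w_sub_sub hβ h0 h1 hR hosc
      (iter_osc_u hβ hϰ hr0 hr1 hr (n + 1) (fun k => hσ (k + 1)) (fun k => hK (k + 1))) hd hP
      (iter_osc_w_diff hβ hϰ hr0 hr1 hr n (fun k => hσ (k + 1)) (fun k => hK (k + 1)))
      x z).trans ?_⟩
  all_goals
    set O := expSum r 2 (n + 1) fun k => σ (k + 1)
    set B := diffConst₁ ϰ r
    set C := oscConst r
    set D := diffConst₂ ϰ r
    have a1 : 0 ≤ B * O ^ 2 := by positivity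
    have a2 : 0 ≤ ϰ ^ 2 * O ^ 2 := by positivity
    have a3 : 0 ≤ C * ϰ ^ 2 * (2 * O * σ 0 + σ 0 ^ 2) := by positivity
    have a4 : 0 ≤ D * (2 * O * σ 0 + σ 0 ^ 2) := by positivity
    have a5 : 0 ≤ B * (O * σ 0) := by positivity
    have a6 : 0 ≤ B * (σ 0 ^ 2) := by positivity
    have a7 : 0 ≤ ϰ ^ 2 * (O * σ 0) := by positivity
    have a8 : 0 ≤ ϰ ^ 2 * (σ 0 ^ 2) := by positivity
  · have e : B * O + ϰ ^ 2 * (2 * σ 0 + O) ≤ diffConst ϰ r * (σ 0 + O) ^ 2 := by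
      have h1 : 1 ≤ σ 0 + O := by linarith
      have h2 : σ 0 + O ≤ (σ 0 + O) ^ 2 := by nlinarith
      have h3 : B + 2 * ϰ ^ 2 ≤ diffConst ϰ r := by
        unfold diffConst
        nlinarith [mul_nonneg (sq_nonneg ϰ) hC0, sq_nonneg ϰ]
      calc _ ≤ (B + 2 * ϰ ^ 2) * (σ 0 + O) := by nlinarith [mul_nonneg hB0 hO0, sq_nonneg ϰ]
        _ ≤ diffConst ϰ r * (σ 0 + O) ^ 2 :=
          mul_le_mul h3 h2 (by linarith) (diffConst_nonneg hr0 hr1)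
    have := mul_le_mul_of_nonneg_left e hrn.le
    linarith
  · have e : D * O ^ 2 + ϰ ^ 2 * (2 * σ 0 ^ 2 + C * O ^ 2) +
        (2 * (B * O) * (2 * σ 0 + O) + 3 * ϰ ^ 2 * (2 * σ 0 + O) ^ 2) ≤
        diffConst ϰ r * (σ 0 + O) ^ 2 := by
      unfold diffConst
      linarith
    have := mul_le_mul_of_nonneg_left e hrn.le
    linarith

/-- Crude bounds for the logarithmic derivatives. -/
theorem iter_norm_le (n : ℕ) (hσ : ∀ k, 1 ≤ σ k) (hK : ∀ k, (K k).Good μ ϰ (σ k)) (x : 𝒳) :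
    ‖(iter μ β n K).u x‖ ≤ ∑ k ∈ Finset.range n, σ k ∧
    ‖(iter μ β n K).w x‖ ≤ 5 * n * (∑ k ∈ Finset.range n, σ k) ^ 2 := by
  induction n generalizing σ K x with
  | zero => simp [iter]
  | succ n ih =>
    have h0 := iter_good (β := β) hϰ n fun k => hK (k + 1)
    have hk := (hK 0).isProbDensity_dens h0 x
    have ih' := fun x => ih (σ := fun k => σ (k + 1)) (K := fun k => K (k + 1))
      (fun k => hσ (k + 1)) (fun k => hK (k + 1)) x
    rw [Finset.sum_range_succ']
    set S := ∑ k ∈ Finset.range n, σ (k + 1)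
    have hS : 0 ≤ S := Finset.sum_nonneg fun k _ => zero_le_one.trans (hσ _)
    have hs := hσ 0
    have hau : ∀ z, ‖(K 0).a x z + (iter μ β n fun k => K (k + 1)).u z‖ ≤ σ 0 + S := fun z =>
      (norm_add_le _ _).trans (add_le_add ((hK 0).norm_a x z) (ih' z).1)
    have hau' := (hK 0).bdd_add h0 x
    have hosc : ∀ z z', ‖((K 0).a x z + (iter μ β n fun k => K (k + 1)).u z) -
        ((K 0).a x z' + (iter μ β n fun k => K (k + 1)).u z')‖ ≤ 2 * (σ 0 + S) := fun z z' =>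
      (norm_sub_le _ _).trans (by linarith [hau z, hau z'])
    constructor
    · exact (hk.norm_avg_le hau).trans_eq (add_comm _ _)
    · refine (norm_add_le _ _).trans ((add_le_add (hk.norm_avg_le fun z =>
        (norm_add_le _ _).trans (add_le_add ((hK 0).norm_b x z) (ih' z).2))
        (hk.norm_densCov_le β hβ hau' hau' hosc hosc)).trans ?_)
      push_cast
      have : (0 : ℝ) ≤ n := n.cast_nonneg
      have h1 : 5 * (n : ℝ) * S ^ 2 ≤ 5 * n * (S + σ 0) ^ 2 := by gcongr; linarith
      nlinarith [mul_nonneg hS (zero_le_one.trans hs)]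

end KernelJet

end Differences

section Perturbation

variable {𝒳 : Type*} [MeasurableSpace 𝒳] {μ : Measure 𝒳} [IsFiniteMeasure μ]
  {V W : Type*} [NormedAddCommGroup V] [NormedSpace ℝ V] [CompleteSpace V]
  [NormedAddCommGroup W] [NormedSpace ℝ W] [CompleteSpace W]

namespace KernelJet

variable {ϰ σ δ T : ℝ} {K K' : KernelJet 𝒳 V W} {J J' : FunJet 𝒳 V W} {β : V →L[ℝ] V →L[ℝ] W}
  (hK : K.Good μ ϰ σ) (hK' : K'.Good μ ϰ σ) (hJ : J.Good ϰ) (hJ' : J'.Good ϰ)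
  (hδ : ∀ x z, |K'.L x z - K.L x z| ≤ δ * K.L x z)

include hK hK' hJ hδ in
theorem Good.abs_step_p_sub_le (x : 𝒳) :
    |(K'.step μ β J).p x - (K.step μ β J).p x| ≤ δ * (K.step μ β J).p x := by
  simp only [step]
  rw [← integral_sub (hK'.integrable_mul' hJ x) (hK.integrable_mul' hJ x), ← integral_const_mul,
    ← Real.norm_eq_abs]
  refine norm_integral_le_of_norm_le ((hK.integrable_mul' hJ x).const_mul δ)
    (.of_forall fun z => ?_)
  rw [← sub_mul, Real.norm_eq_abs, abs_mul, abs_of_pos (hJ.pos z), ← mul_assoc]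
  exact mul_le_mul_of_nonneg_right (hδ x z) (hJ.pos z).le

include hK hK' hJ hJ' hδ in
theorem Good.step_ratio_osc_perturb
    (hT : ∀ x z y, |J'.p x / J.p x - J'.p z / J.p z| ≤ T * (J'.p y / J.p y)) (x z y : 𝒳) :
    |(K'.step μ β J').p x / (K.step μ β J).p x - (K'.step μ β J').p z / (K.step μ β J).p z| ≤
      ((1 - (ϰ ^ 2)⁻¹) * T + 6 * ϰ ^ 2 * δ) * ((K'.step μ β J').p y / (K.step μ β J).p y) := by
  have hϰ : 1 ≤ ϰ ^ 2 := one_le_pow₀ (hJ.one_le x)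
  have hT0 : 0 ≤ T := by
    by_contra! h
    exact absurd (hT x x x) (by
      have := mul_neg_of_neg_of_pos h (hJ.ratio_pos hJ' x)
      simpa using this)
  have hρ : 0 ≤ 1 - (ϰ ^ 2)⁻¹ := by
    have := inv_le_one_of_one_le₀ hϰ
    linarith
  have g := hK.step_good (β := β) hJ
  have g' := hK.step_good (β := β) hJ'
  have g'' := hK'.step_good (β := β) hJ'
  rcases le_or_gt δ (1 / 2) with hd | hd
  · have ha := hK.abs_step_p_sub_le (β := β) hK' hJ' hδ
    have hb := hK.step_ratio_osc (β := β) hJ hJ' hT x z y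
    have hbx := g.ratio_le g' x y
    have hbz := g.ratio_le g' z y
    have hpx := g.ratio_pos g' x
    have hpz := g.ratio_pos g' z
    have hpy := g.ratio_pos g' y
    have e : ∀ x, |(K'.step μ β J').p x / (K.step μ β J).p x -
        (K.step μ β J').p x / (K.step μ β J).p x| ≤
        δ * ((K.step μ β J').p x / (K.step μ β J).p x) := fun x => by
      rw [← sub_div, abs_div, abs_of_pos (g.pos x), ← mul_div_assoc]
      exact div_le_div_of_nonneg_right (ha x) (g.pos x).le
    have ex := e x
    have ez := e z
    have ey := e y
    set bx := (K.step μ β J').p x / (K.step μ β J).p x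
    set bz := (K.step μ β J').p z / (K.step μ β J).p z
    set b := (K.step μ β J').p y / (K.step μ β J).p y
    set cx := (K'.step μ β J').p x / (K.step μ β J).p x
    set cz := (K'.step μ β J').p z / (K.step μ β J).p z
    set c := (K'.step μ β J').p y / (K.step μ β J).p y
    have hδ0 : 0 ≤ δ := by
      have := (abs_nonneg _).trans ex
      by_contra! h
      nlinarith
    have hc : (1 - δ) * b ≤ c := by
      have := (abs_le.1 ey).1
      linarith
    have hbc : b ≤ (1 + 2 * δ) * c := by
      have h1 : 1 ≤ (1 + 2 * δ) * (1 - δ) := by nlinarith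
      calc b ≤ (1 + 2 * δ) * (1 - δ) * b := le_mul_of_one_le_left hpy.le h1
        _ = (1 + 2 * δ) * ((1 - δ) * b) := by ring
        _ ≤ _ := mul_le_mul_of_nonneg_left hc (by linarith)
    have hc0 : 0 ≤ c := le_trans (mul_nonneg (by linarith) hpy.le) hc
    have hb2 : |bx - bz| ≤ ϰ ^ 2 * b := by
      rw [abs_le]; constructor <;> linarith
    have hbc2 : b ≤ 2 * c := by nlinarith
    have hm : |bx - bz| ≤ ((1 - (ϰ ^ 2)⁻¹) * T + 2 * ϰ ^ 2 * δ) * c := by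
      rcases le_or_gt ((1 - (ϰ ^ 2)⁻¹) * T) (ϰ ^ 2) with h | h
      · calc |bx - bz| ≤ (1 - (ϰ ^ 2)⁻¹) * T * b := hb
          _ ≤ (1 - (ϰ ^ 2)⁻¹) * T * ((1 + 2 * δ) * c) :=
            mul_le_mul_of_nonneg_left hbc (by positivity)
          _ = ((1 - (ϰ ^ 2)⁻¹) * T + (1 - (ϰ ^ 2)⁻¹) * T * (2 * δ)) * c := by ring
          _ ≤ ((1 - (ϰ ^ 2)⁻¹) * T + ϰ ^ 2 * (2 * δ)) * c := by gcongr
          _ = _ := by ring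
      · calc |bx - bz| ≤ ϰ ^ 2 * b := hb2
          _ ≤ ϰ ^ 2 * ((1 + 2 * δ) * c) := mul_le_mul_of_nonneg_left hbc (by positivity)
          _ = (ϰ ^ 2 + 2 * ϰ ^ 2 * δ) * c := by ring
          _ ≤ _ := by gcongr
    calc |cx - cz| ≤ |cx - bx| + |bx - bz| + |cz - bz| := by
          rw [abs_sub_comm cz]
          exact (abs_sub_le cx bz cz).trans (by gcongr; exact abs_sub_le _ _ _)
      _ ≤ δ * bx + ((1 - (ϰ ^ 2)⁻¹) * T + 2 * ϰ ^ 2 * δ) * c + δ * bz := by gcongr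
      _ ≤ δ * (ϰ ^ 2 * (2 * c)) + ((1 - (ϰ ^ 2)⁻¹) * T + 2 * ϰ ^ 2 * δ) * c +
          δ * (ϰ ^ 2 * (2 * c)) := by
            have : ϰ ^ 2 * b ≤ ϰ ^ 2 * (2 * c) := mul_le_mul_of_nonneg_left hbc2 (by positivity)
            gcongr <;> linarith
      _ = _ := by ring
  · have hx := g.ratio_le g'' x y
    have hz := g.ratio_le g'' z y
    have hpx := g.ratio_pos g'' x
    have hpz := g.ratio_pos g'' z
    have hpy := g.ratio_pos g'' y
    set c := (K'.step μ β J').p y / (K.step μ β J).p y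
    have h1 : ϰ ^ 2 * c ≤ ((1 - (ϰ ^ 2)⁻¹) * T + 6 * ϰ ^ 2 * δ) * c := by
      refine mul_le_mul_of_nonneg_right ?_ hpy.le
      nlinarith [mul_nonneg hρ hT0]
    rw [abs_le]; constructor <;> linarith

include hK hK' hJ hJ' hδ in
theorem Good.norm_avg_sub_le_perturb
    (hT : ∀ x z y, |J'.p x / J.p x - J'.p z / J.p z| ≤ T * (J'.p y / J.p y))
    {X : Type*} [NormedAddCommGroup X] [NormedSpace ℝ X] [CompleteSpace X]
    {h : 𝒳 → X} (hh : BddSM h) {D : ℝ} (hD : ∀ x z, ‖h x - h z‖ ≤ D) (x : 𝒳) :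
    ‖∫ z, K'.dens μ J'.p x z • h z ∂μ - ∫ z, K.dens μ J.p x z • h z ∂μ‖ ≤ (T + 4 * δ) * D := by
  have hk := hK.isProbDensity_dens hJ x
  have hk' := hK.isProbDensity_dens hJ' x
  have hk'' := hK'.isProbDensity_dens hJ' x
  have h1 := hk.norm_avg_sub_avg_le_ratio hk' (hK.dens_ratio hJ hJ' hT x) hh hD
  have hD0 : 0 ≤ D := (norm_nonneg _).trans (hD x x)
  have h2 : ‖∫ z, K'.dens μ J'.p x z • h z ∂μ - ∫ z, K.dens μ J'.p x z • h z ∂μ‖ ≤ 4 * δ * D := by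
    rcases le_or_gt δ (1 / 2) with hd | hd
    · refine hk'.norm_avg_sub_avg_le_ratio hk'' (fun z => ?_) hh hD
      have hp := hK.step_p_pos (0 : V →L[ℝ] V →L[ℝ] W) hJ' x
      have hp' := hK'.step_p_pos (0 : V →L[ℝ] V →L[ℝ] W) hJ' x
      have ha := hK.abs_step_p_sub_le (β := (0 : V →L[ℝ] V →L[ℝ] W)) hK' hJ' hδ x
      have hL := hδ x z
      have hL0 := hK.nonneg x z
      have hpz := hJ'.pos z
      simp only [step] at hp hp' ha
      simp only [dens]
      set P := ∫ z, K.L x z * J'.p z ∂μ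
      set P' := ∫ z, K'.L x z * J'.p z ∂μ
      have hδ0 : 0 ≤ δ := by
        have := (abs_nonneg _).trans ha
        by_contra! h
        nlinarith
      have hPP : P ≤ 2 * P' := by
        have := (abs_le.1 ha).1
        nlinarith
      rw [div_sub_div _ _ hp'.ne' hp.ne', abs_div, abs_of_pos (mul_pos hp' hp),
        div_le_iff₀ (mul_pos hp' hp)]
      have e : K'.L x z * J'.p z * P - P' * (K.L x z * J'.p z) =
          (K'.L x z - K.L x z) * (J'.p z * P) - (P' - P) * (K.L x z * J'.p z) := by ring
      rw [e]
      calc _ ≤ |K'.L x z - K.L x z| * (J'.p z * P) + |P' - P| * (K.L x z * J'.p z) := by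
            refine (abs_sub _ _).trans_eq ?_
            rw [abs_mul, abs_mul (P' - P), abs_of_pos (mul_pos hpz hp), abs_of_nonneg (mul_nonneg hL0 hpz.le)]
        _ ≤ δ * K.L x z * (J'.p z * P) + δ * P * (K.L x z * J'.p z) := by gcongr
        _ = 2 * δ * (K.L x z * J'.p z) * P := by ring
        _ ≤ 2 * δ * (K.L x z * J'.p z) * (2 * P') := by gcongr
        _ = _ := by field_simp; ring
    · refine (hk''.norm_avg_sub_le hh fun z => hk'.norm_sub_avg_le hh hD z).trans ?_
      nlinarith
  calc _ = ‖(∫ z, K'.dens μ J'.p x z • h z ∂μ - ∫ z, K.dens μ J'.p x z • h z ∂μ) +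
      (∫ z, K.dens μ J'.p x z • h z ∂μ - ∫ z, K.dens μ J.p x z • h z ∂μ)‖ := by congr 1; abel
    _ ≤ 4 * δ * D + T * D := (norm_add_le _ _).trans (add_le_add h2 h1)
    _ = _ := by ring

/-- The bound for the change of the first logarithmic derivative under a perturbation of the
kernels by the relative amounts `δ k`, and of their logarithmic derivatives by `η k`. -/
def perturbSum (ϰ r : ℝ) : ℕ → (ℕ → ℝ) → (ℕ → ℝ) → (ℕ → ℝ) → ℝ
  | 0, _, _, _ => 0
  | n + 1, σ, δ, η =>
    perturbSum ϰ r n (fun k => σ (k + 1)) (fun k => δ (k + 1)) (fun k => η (k + 1)) + η 0 +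
      (expSum r (6 * ϰ ^ 2) n (fun k => δ (k + 1)) + 4 * δ 0) *
        (2 * σ 0 + expSum r 2 n fun k => σ (k + 1))

theorem iter_perturb_ratio {r : ℝ} (hϰ : 1 ≤ ϰ) (hr0 : 0 < r) (hr : 1 - (ϰ ^ 2)⁻¹ ≤ r)
    (n : ℕ) {σ δ : ℕ → ℝ} {K K' : ℕ → KernelJet 𝒳 V W}
    (hδ0 : ∀ k, 0 ≤ δ k) (hK : ∀ k, (K k).Good μ ϰ (σ k)) (hK' : ∀ k, (K' k).Good μ ϰ (σ k))
    (hδ : ∀ k x z, |(K' k).L x z - (K k).L x z| ≤ δ k * (K k).L x z) (x z y : 𝒳) :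
    |(iter μ β n K').p x / (iter μ β n K).p x - (iter μ β n K').p z / (iter μ β n K).p z| ≤
      expSum r (6 * ϰ ^ 2) n δ * ((iter μ β n K').p y / (iter μ β n K).p y) := by
  induction n generalizing σ δ K K' x z y with
  | zero => simp [iter, expSum]
  | succ n ih =>
    have g := iter_good (β := β) hϰ n fun k => hK (k + 1)
    have g' := iter_good (β := β) hϰ n fun k => hK' (k + 1)
    refine ((hK 0).step_ratio_osc_perturb (β := β) (hK' 0) g g' (hδ 0)
      (ih (fun k => hδ0 _) (fun k => hK (k + 1)) (fun k => hK' (k + 1)) fun k => hδ (k + 1))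
      x z y).trans ?_
    rw [expSum_succ]
    refine mul_le_mul_of_nonneg_right ?_
      (((iter_good (β := β) hϰ (n + 1) hK).ratio_pos
      (iter_good (β := β) hϰ (n + 1) hK') y).le)
    have := expSum_nonneg (c := 6 * ϰ ^ 2) hr0.le (by positivity) n (σ := fun k => δ (k + 1))
      fun k => hδ0 _
    gcongr

theorem iter_perturb_u {r : ℝ} (hβ : ‖β‖ ≤ 1) (hϰ : 1 ≤ ϰ) (hr0 : 0 < r) (hr1 : r < 1)
    (hr : 1 - (ϰ ^ 2)⁻¹ ≤ r ^ 4)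
    (n : ℕ) {σ δ η : ℕ → ℝ} {K K' : ℕ → KernelJet 𝒳 V W} (hσ : ∀ k, 1 ≤ σ k)
    (hδ0 : ∀ k, 0 ≤ δ k) (hK : ∀ k, (K k).Good μ ϰ (σ k)) (hK' : ∀ k, (K' k).Good μ ϰ (σ k))
    (hδ : ∀ k x z, |(K' k).L x z - (K k).L x z| ≤ δ k * (K k).L x z)
    (hη : ∀ k x z, ‖(K' k).a x z - (K k).a x z‖ ≤ η k) (x : 𝒳) :
    ‖(iter μ β n K').u x - (iter μ β n K).u x‖ ≤ perturbSum ϰ r n σ δ η := by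
  have hr41 : r ^ 4 ≤ r := pow_le_of_le_one hr0.le hr1.le (by norm_num)
  induction n generalizing σ δ η K K' x with
  | zero => simp [iter, perturbSum]
  | succ n ih =>
    have g := iter_good (β := β) hϰ n fun k => hK (k + 1)
    have g' := iter_good (β := β) hϰ n fun k => hK' (k + 1)
    have ih' := ih (σ := fun k => σ (k + 1)) (fun k => hσ _) (fun k => hδ0 (k + 1))
      (fun k => hK (k + 1)) (fun k => hK' (k + 1))
      (fun k => hδ (k + 1)) (fun k => hη (k + 1))
    have hk' := (hK' 0).isProbDensity_dens g' x
    have h1 := (hK 0).norm_avg_sub_le_perturb (hK' 0) g g' (hδ 0)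
      (iter_perturb_ratio (β := β) hϰ hr0 (hr.trans hr41) n (fun k => hδ0 (k + 1))
        (fun k => hK (k + 1)) (fun k => hK' (k + 1)) fun k => hδ (k + 1))
      ((hK 0).bdd_add g x)
      ((hK 0).osc_add (iter_osc_u hβ hϰ hr0 hr1 hr n (fun k => hσ (k + 1))
        fun k => hK (k + 1)) x) x
    have e : (iter μ β (n + 1) K').u x =
        ∫ z, (K' 0).dens μ (iter μ β n fun k => K' (k + 1)).p x z •
          (((K' 0).a x z - (K 0).a x z) + ((iter μ β n fun k => K' (k + 1)).u z -
            (iter μ β n fun k => K (k + 1)).u z)) ∂μ +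
        ∫ z, (K' 0).dens μ (iter μ β n fun k => K' (k + 1)).p x z •
          ((K 0).a x z + (iter μ β n fun k => K (k + 1)).u z) ∂μ := by
      rw [← integral_add ((((hK' 0).bdd_a x).sub ((hK 0).bdd_a x)).add
        (g'.bdd_u.sub g.bdd_u) |>.integrable_smul hk'.integrable)
        (((hK 0).bdd_add g x).integrable_smul hk'.integrable)]
      simp only [iter, step, ← smul_add]
      congr 1 with z
      congr 1; abel
    rw [e, add_sub_assoc]
    refine (norm_add_le _ _).trans ((add_le_add (hk'.norm_avg_le fun z => (norm_add_le _ _).trans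
      (add_le_add (hη 0 x z) (ih' z))) h1).trans_eq ?_)
    rw [perturbSum]; ring

end KernelJet

end Perturbation

/-! ### Calculus within a quasiconvex set -/

section WithinCalculus

variable {E W : Type*} [NormedAddCommGroup E] [NormedSpace ℝ E] [NormedAddCommGroup W]
  [NormedSpace ℝ W] {S : Set E}

/-- A mean value inequality along a Lipschitz path. -/
theorem norm_sub_le_of_path {f : E → W} {f' : E → E →L[ℝ] W} {γ : ℝ → E} {ℓ : ℝ≥0} {η : ℝ}
    (hγ : LipschitzOnWith ℓ γ (Icc 0 1)) (hS : MapsTo γ (Icc 0 1) S)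
    (hf : ∀ x ∈ S, HasFDerivWithinAt f (f' x) S x)
    (hη : ∀ t ∈ Icc (0 : ℝ) 1, ‖f' (γ t)‖ ≤ η) : ‖f (γ 1) - f (γ 0)‖ ≤ η * ℓ := by
  have hη0 : 0 ≤ η := (norm_nonneg _).trans (hη 0 (by simp))
  have hγc := hγ.continuousOn
  have hc : ContinuousOn (fun t => f (γ t) - f (γ 0)) (Icc 0 1) :=
    (ContinuousOn.comp (fun x hx => (hf x hx).continuousWithinAt) hγc hS).sub continuousOn_const
  refine le_of_forall_pos_le_add fun e he => ?_
  have key := image_norm_le_of_liminf_right_slope_norm_lt_deriv_boundary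
    (f := fun t => f (γ t) - f (γ 0)) (f' := fun _ => η * ℓ) (B := fun t => (η * ℓ + e) * t)
    (B' := fun _ => η * ℓ + e) hc (fun t ht r hr => ?_) (by simp) (by fun_prop)
    (fun t _ => by simpa using ((hasDerivAt_id t).const_mul (η * ℓ + e)).hasDerivWithinAt)
    (fun _ _ _ => by linarith) (x := 1) (by simp)
  · simpa using key
  · obtain ⟨e', he', her⟩ : ∃ e' > 0, (η + e') * ℓ < r := by
      refine ⟨(r - η * ℓ) / (2 * (ℓ + 1)), by
        have : (0 : ℝ) ≤ ℓ := ℓ.2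
        have := sub_pos.2 hr
        positivity, ?_⟩
      have h0 : (0 : ℝ) ≤ ℓ := ℓ.2
      have h1 : (r - η * ℓ) / (2 * (ℓ + 1)) * ℓ ≤ (r - η * ℓ) / 2 := by
        rw [div_mul_eq_mul_div, div_le_div_iff₀ (by positivity) two_pos]
        nlinarith [sub_pos.2 hr]
      rw [add_mul]
      linarith [sub_pos.2 hr]
    have htS : γ t ∈ S := hS ⟨ht.1, ht.2.le⟩
    have ho := (hf _ htS).isLittleO.def he'
    have hIcc : Icc (0 : ℝ) 1 ∈ 𝓝[>] t := Icc_mem_nhdsGT_of_mem ht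
    have htend : Tendsto γ (𝓝[>] t) (𝓝[S] (γ t)) := by
      refine tendsto_nhdsWithin_iff.2 ⟨?_, ?_⟩
      · exact (hγc t ⟨ht.1, ht.2.le⟩).mono_left (nhdsWithin_le_of_mem hIcc)
      · filter_upwards [hIcc] with s hs using hS hs
    refine Eventually.frequently ?_
    filter_upwards [htend.eventually ho, hIcc, self_mem_nhdsWithin] with s hs hs01 hst
    have hst' : 0 < s - t := sub_pos.2 hst
    have h1 : ‖f (γ s) - f (γ t)‖ ≤ (η + e') * (ℓ * (s - t)) := by
      have h2 : ‖γ s - γ t‖ ≤ ℓ * (s - t) := by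
        have := hγ.dist_le_mul s hs01 t ⟨ht.1, ht.2.le⟩
        rwa [dist_eq_norm, Real.dist_eq, abs_of_pos hst'] at this
      calc _ = ‖(f (γ s) - f (γ t) - f' (γ t) (γ s - γ t)) + f' (γ t) (γ s - γ t)‖ := by
            congr 1; abel
        _ ≤ e' * ‖γ s - γ t‖ + η * ‖γ s - γ t‖ := by
            refine (norm_add_le _ _).trans (add_le_add hs ?_)
            refine ((f' (γ t)).le_opNorm _).trans ?_
            gcongr
            exact hη t ⟨ht.1, ht.2.le⟩
        _ = (η + e') * ‖γ s - γ t‖ := by ring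
        _ ≤ _ := by gcongr
    rw [slope_def_field, div_lt_iff₀ hst']
    calc (norm ∘ fun t => f (γ t) - f (γ 0)) s - (norm ∘ fun t => f (γ t) - f (γ 0)) t
        ≤ ‖f (γ s) - f (γ t)‖ := by
          refine (norm_sub_norm_le _ _).trans_eq ?_
          rw [sub_sub_sub_cancel_right]
      _ ≤ (η + e') * ℓ * (s - t) := by rw [mul_assoc]; exact h1
      _ < _ := by gcongr

/-- The mean value inequality on a quasiconvex set. -/
theorem LengthQuasiconvex.exists_mvt (hS : LengthQuasiconvex S) :
    ∃ L : ℝ, 1 ≤ L ∧ ∀ {W : Type*} [NormedAddCommGroup W] [NormedSpace ℝ W] (f : E → W)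
      (f' : E → E →L[ℝ] W), (∀ x ∈ S, HasFDerivWithinAt f (f' x) S x) → ∀ a ∈ S, ∀ b ∈ S,
      ∀ (A : E →L[ℝ] W) (η : ℝ), (∀ x ∈ S, ‖x - a‖ ≤ L * ‖b - a‖ → ‖f' x - A‖ ≤ η) →
      ‖f b - f a - A (b - a)‖ ≤ η * (L * ‖b - a‖) := by
  obtain ⟨L, hL⟩ := hS
  refine ⟨max L 1, le_max_right _ _, fun f f' hf a ha b hb A η hη => ?_⟩
  obtain ⟨γ, hγ, h0, h1, hm⟩ := hL a ha b hb
  have hγ' : ∀ t ∈ Icc (0 : ℝ) 1, ‖γ t - a‖ ≤ max (L : ℝ) 1 * ‖b - a‖ := fun t ht => by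
    have := hγ.dist_le_mul t ht 0 (by simp)
    rw [h0, dist_eq_norm, Real.dist_eq, sub_zero, abs_of_nonneg ht.1] at this
    refine this.trans ?_
    rw [NNReal.coe_mul, coe_nndist, dist_comm, dist_eq_norm]
    calc (L : ℝ) * ‖b - a‖ * t ≤ L * ‖b - a‖ * 1 := by
          gcongr; exact ht.2
      _ ≤ _ := by rw [mul_one]; gcongr; exact le_max_left _ _
  have key := norm_sub_le_of_path (f := fun x => f x - A x) (f' := fun x => f' x - A) hγ hm
    (fun x hx => (hf x hx).sub A.hasFDerivWithinAt) (η := η)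
    (fun t ht => hη _ (hm ht) (hγ' t ht))
  simp only [h0, h1] at key
  have hη0 : 0 ≤ η := (norm_nonneg _).trans (hη a ha (by
    rw [sub_self, norm_zero]; positivity))
  calc _ = ‖f b - A b - (f a - A a)‖ := by rw [map_sub]; congr 1; abel
    _ ≤ η * (L * nndist a b) := by exact_mod_cast key
    _ ≤ _ := by
      rw [coe_nndist, dist_comm, dist_eq_norm]
      gcongr
      exact le_max_left _ _

theorem mem_tangentConeAt_exists_seq {x v : E} (hv : v ∈ tangentConeAt ℝ S x) :
    ∃ (c : ℕ → ℝ) (d : ℕ → E), Tendsto d atTop (𝓝 0) ∧ (∀ n, x + d n ∈ S) ∧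
      Tendsto (fun n => c n • d n) atTop (𝓝 v) := by
  obtain ⟨α, l, hl, c, d, hd, hS, hcd⟩ := exists_fun_of_mem_tangentConeAt hv
  let G : Filter (ℝ × E) :=
    (𝓝 ((0 : E), v)).comap (fun p : ℝ × E => (p.2, p.1 • p.2)) ⊓ 𝓟 {p | x + p.2 ∈ S}
  have hG : Tendsto (fun a => (c a, d a)) l G := by
    refine tendsto_inf.2 ⟨tendsto_comap_iff.2 ?_, tendsto_principal.2 hS⟩
    rw [nhds_prod_eq]
    exact hd.prodMk hcd
  have : G.NeBot := hG.neBot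
  obtain ⟨s, hs⟩ := G.exists_seq_tendsto
  obtain ⟨hs1, hs2⟩ := tendsto_inf.1 hs
  have h1 := tendsto_comap_iff.1 hs1
  rw [nhds_prod_eq] at h1
  obtain ⟨N, hN⟩ := eventually_atTop.1 (tendsto_principal.1 hs2)
  refine ⟨fun n => (s (n + N)).1, fun n => (s (n + N)).2, ?_, fun n => hN _ (by omega), ?_⟩
  · exact (tendsto_fst.comp h1).comp (tendsto_add_atTop_nat N)
  · exact (tendsto_snd.comp h1).comp (tendsto_add_atTop_nat N)

/-- A derivative within a set is a limit of fixed finite combinations of values. -/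
theorem UniqueDiffWithinAt.exists_approx [FiniteDimensional ℝ E] (W : Type*)
    [NormedAddCommGroup W] [NormedSpace ℝ W] {x : E} (hx : UniqueDiffWithinAt ℝ S x) :
    ∃ (ι : Type) (_ : Fintype ι) (φ : ι → E →L[ℝ] ℝ) (c : ℕ → ι → ℝ) (y : ℕ → ι → E),
      (∀ n i, y n i ∈ S) ∧ ∀ (f : E → W) (f' : E →L[ℝ] W), HasFDerivWithinAt f f' S x →
        Tendsto (fun n => ∑ i, (φ i).smulRight (c n i • (f (y n i) - f x))) atTop (𝓝 f') := by
  have hspan : Submodule.span ℝ (tangentConeAt ℝ S x) = ⊤ := by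
    have h1 := hx.1
    have h2 : IsClosed (Submodule.span ℝ (tangentConeAt ℝ S x) : Set E) :=
      Submodule.closed_of_finiteDimensional _
    exact SetLike.coe_injective (by rw [← h2.closure_eq, h1.closure_eq]; rfl)
  let b₀ := Module.Basis.ofSpan hspan.ge
  let b := b₀.reindex (b₀.indexEquiv (Module.finBasis ℝ E))
  have hb : ∀ i, b i ∈ tangentConeAt ℝ S x := fun i => by
    simp only [b, Module.Basis.reindex_apply]
    exact Module.Basis.ofSpan_subset hspan.ge (mem_range_self _)
  choose c d hd hdS hcd using fun i => mem_tangentConeAt_exists_seq (hb i)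
  refine ⟨_, inferInstance, fun i => LinearMap.toContinuousLinearMap (b.coord i),
    fun n i => c i n, fun n i => x + d i n, fun n i => hdS i n, fun f f' hf => ?_⟩
  have h1 : ∀ i, Tendsto (fun n => c i n • (f (x + d i n) - f x)) atTop (𝓝 (f' (b i))) := fun i =>
    hf.lim (hd i) (.of_forall (hdS i)) (hcd i)
  have h2 : f' = ∑ i, (LinearMap.toContinuousLinearMap (b.coord i)).smulRight (f' (b i)) := by
    ext v
    simp only [sum_apply, ContinuousLinearMap.smulRight_apply,
      LinearMap.coe_toContinuousLinearMap', Module.Basis.coord_apply]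
    conv_lhs => rw [← b.sum_repr v, map_sum]
    simp only [map_smul]
  rw [h2]
  refine tendsto_finsetSum _ fun i _ => ?_
  exact ((ContinuousLinearMap.smulRightL ℝ E W
    (LinearMap.toContinuousLinearMap (b.coord i))).continuous.tendsto _).comp (h1 i)

theorem UniqueDiffWithinAt.stronglyMeasurable [FiniteDimensional ℝ E] {Ω : Type*}
    [MeasurableSpace Ω] {x : E} (hxS : x ∈ S) (hx : UniqueDiffWithinAt ℝ S x) {f : E → Ω → W}
    {f' : Ω → E →L[ℝ] W} (hf : ∀ y ∈ S, StronglyMeasurable (f y))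
    (hf' : ∀ ω, HasFDerivWithinAt (fun y => f y ω) (f' ω) S x) : StronglyMeasurable f' := by
  obtain ⟨ι, _, φ, c, y, hy, h⟩ := hx.exists_approx W
  refine stronglyMeasurable_of_tendsto atTop (f := fun n ω =>
    ∑ i, (φ i).smulRight (c n i • (f (y n i) ω - f x ω))) (fun n => ?_)
    (tendsto_pi_nhds.2 fun ω => h (fun y => f y ω) (f' ω) (hf' ω))
  refine Finset.stronglyMeasurable_fun_sum _ fun i _ => ?_
  exact (ContinuousLinearMap.smulRightL ℝ E W (φ i)).continuous.comp_stronglyMeasurable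
    (((hf _ (hy n i)).sub (hf x hxS)).const_smul (c n i))

theorem UniqueDiffWithinAt.aestronglyMeasurable [FiniteDimensional ℝ E] {Ω : Type*}
    [MeasurableSpace Ω] {m : Measure Ω} {x : E} (hxS : x ∈ S) (hx : UniqueDiffWithinAt ℝ S x)
    {f : E → Ω → W} {f' : Ω → E →L[ℝ] W} (hf : ∀ y ∈ S, AEStronglyMeasurable (f y) m)
    (hf' : ∀ᵐ ω ∂m, HasFDerivWithinAt (fun y => f y ω) (f' ω) S x) :
    AEStronglyMeasurable f' m := by
  obtain ⟨ι, _, φ, c, y, hy, h⟩ := hx.exists_approx W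
  refine aestronglyMeasurable_of_tendsto_ae atTop (f := fun n ω =>
    ∑ i, (φ i).smulRight (c n i • (f (y n i) ω - f x ω))) (fun n => ?_)
    (by filter_upwards [hf'] with ω hω using h (fun y => f y ω) (f' ω) hω)
  refine Finset.aestronglyMeasurable_fun_sum _ fun i _ => ?_
  exact (ContinuousLinearMap.smulRightL ℝ E W (φ i)).continuous.comp_aestronglyMeasurable
    (((hf _ (hy n i)).sub (hf x hxS)).const_smul (c n i))

/-- Differentiation under the integral sign within a quasiconvex set. -/
theorem hasFDerivWithinAt_integral [FiniteDimensional ℝ E] {W : Type}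
    [NormedAddCommGroup W] [NormedSpace ℝ W] {Ω : Type*} [MeasurableSpace Ω] {m : Measure Ω}
    (hS : LengthQuasiconvex S) (hU : UniqueDiffOn ℝ S) {f : E → Ω → W} {f' : E → Ω → E →L[ℝ] W}
    {b : Ω → ℝ} (hf : ∀ x ∈ S, Integrable (f x) m)
    (hd : ∀ᵐ ω ∂m, ∀ x ∈ S, HasFDerivWithinAt (fun y => f y ω) (f' x ω) S x)
    (hb : ∀ᵐ ω ∂m, ∀ x ∈ S, ‖f' x ω‖ ≤ b ω) (hbi : Integrable b m) {x : E} (hx : x ∈ S) :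
    Integrable (f' x) m ∧
      HasFDerivWithinAt (fun y => ∫ ω, f y ω ∂m) (∫ ω, f' x ω ∂m) S x := by
  have hm : AEStronglyMeasurable (f' x) m :=
    (hU x hx).aestronglyMeasurable hx (fun y hy => (hf y hy).aestronglyMeasurable)
      (by filter_upwards [hd] with ω hω using hω x hx)
  have hi : Integrable (f' x) m := hbi.mono' hm (by filter_upwards [hb] with ω hω using hω x hx)
  refine ⟨hi, ?_⟩
  obtain ⟨L, hL1, hL⟩ := hS.exists_mvt
  rw [hasFDerivWithinAt_iff_tendsto]
  have hrem : ∀ y ∈ S, Integrable (fun ω => f y ω - f x ω - f' x ω (y - x)) m := fun y hy =>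
    ((hf y hy).sub (hf x hx)).sub (hi.apply_continuousLinearMap (y - x))
  have key : Tendsto (fun y => ∫ ω, ‖y - x‖⁻¹ * ‖f y ω - f x ω - f' x ω (y - x)‖ ∂m)
      (𝓝[S] x) (𝓝 (∫ _, 0 ∂m)) := by
    refine tendsto_integral_filter_of_dominated_convergence (fun ω => 2 * b ω * L) ?_ ?_
      ((hbi.const_mul 2).mul_const L) ?_
    · filter_upwards [self_mem_nhdsWithin] with y hy
      exact ((hrem y hy).norm.const_mul _).aestronglyMeasurable
    · filter_upwards [self_mem_nhdsWithin] with y hy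
      filter_upwards [hd, hb] with ω h1 h2
      have h3 := hL (fun y => f y ω) (fun y => f' y ω) h1 x hx y hy (f' x ω) (2 * b ω)
        fun z hz _ => (norm_sub_le _ _).trans (by linarith [h2 z hz, h2 x hx])
      have hb0 : 0 ≤ b ω := (norm_nonneg _).trans (h2 x hx)
      rw [norm_mul, norm_inv, norm_norm, norm_norm]
      rcases eq_or_ne (‖y - x‖) 0 with h0 | h0
      · rw [h0]; simp only [inv_zero, zero_mul]; positivity
      · rw [inv_mul_le_iff₀ (lt_of_le_of_ne (norm_nonneg _) h0.symm)]
        linarith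
    · filter_upwards [hd] with ω h1
      exact hasFDerivWithinAt_iff_tendsto.1 (h1 x hx)
  rw [integral_zero] at key
  refine squeeze_zero' (.of_forall fun y => by positivity) ?_ key
  filter_upwards [self_mem_nhdsWithin] with y hy
  rw [integral_const_mul]
  refine mul_le_mul_of_nonneg_left ?_ (by positivity)
  have e : ∫ ω, f y ω ∂m - ∫ ω, f x ω ∂m - (∫ ω, f' x ω ∂m) (y - x) =
      ∫ ω, (f y ω - f x ω - f' x ω (y - x)) ∂m := by
    have h1 := integral_sub ((hf y hy).sub (hf x hx)) (hi.apply_continuousLinearMap (y - x))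
    have h2 := integral_sub (hf y hy) (hf x hx)
    simp only [Pi.sub_apply] at h1 h2
    rw [h1, h2, ContinuousLinearMap.integral_apply hi]
  rw [e]
  exact norm_integral_le_integral_norm _

/-- Limits of functions with uniformly convergent continuous derivatives. -/
theorem hasFDerivWithinAt_of_tendsto {W : Type} [NormedAddCommGroup W] [NormedSpace ℝ W]
    (hS : LengthQuasiconvex S) {f : ℕ → E → W} {f' : ℕ → E → E →L[ℝ] W} {g : E → W}
    {g' : E → E →L[ℝ] W} (hd : ∀ n, ∀ x ∈ S, HasFDerivWithinAt (f n) (f' n x) S x)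
    (hc : ∀ n, ContinuousOn (f' n) S) (hf : ∀ x ∈ S, Tendsto (fun n => f n x) atTop (𝓝 (g x)))
    (hf' : TendstoUniformlyOn f' g' atTop S) {x : E} (hx : x ∈ S) :
    HasFDerivWithinAt g (g' x) S x := by
  obtain ⟨L, hL1, hL⟩ := hS.exists_mvt
  have hg' : ContinuousOn g' S := hf'.continuousOn (.of_forall hc)
  have hg'x := hg' x hx
  refine HasFDerivWithinAt.of_isLittleO ?_
  rw [Asymptotics.isLittleO_iff]
  intro e he
  have he' : 0 < e / (2 * L) := by positivity
  obtain ⟨r, hr, hball⟩ := Metric.continuousWithinAt_iff.1 hg'x (e / (2 * L)) he'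
  have hr' : 0 < r / L := by positivity
  filter_upwards [self_mem_nhdsWithin, mem_nhdsWithin_of_mem_nhds (Metric.ball_mem_nhds x hr')]
    with y hyS hy
  have hyx : ‖y - x‖ < r / L := by rwa [← dist_eq_norm]
  have key : ∀ᶠ n in atTop, ‖f n y - f n x - g' x (y - x)‖ ≤ e / L * (L * ‖y - x‖) := by
    filter_upwards [Metric.tendstoUniformlyOn_iff.1 hf' _ he'] with n hn
    refine hL (f n) (f' n) (hd n) x hx y hyS (g' x) _ fun z hz hzx => ?_
    have h1 := (hn z hz).le
    have h2 : dist (g' z) (g' x) < e / (2 * L) := by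
      refine hball hz ?_
      rw [dist_eq_norm]
      refine hzx.trans_lt ?_
      rw [lt_div_iff₀ (by positivity)] at hyx
      linarith
    rw [dist_comm, dist_eq_norm] at h1
    rw [dist_eq_norm] at h2
    calc ‖f' n z - g' x‖ ≤ ‖f' n z - g' z‖ + ‖g' z - g' x‖ := norm_sub_le_norm_sub_add_norm_sub ..
      _ ≤ e / (2 * L) + e / (2 * L) := add_le_add h1 h2.le
      _ = e / L := by field_simp; norm_num
  have hlim := (((hf y hyS).sub (hf x hx)).sub_const (g' x (y - x))).norm
  refine (le_of_tendsto hlim key).trans_eq ?_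
  field_simp

/-- Functions with continuous first and second derivatives within a set are `C²`. -/
theorem contDiffOn_two_of_hasFDerivWithinAt {f : E → W} {f' : E → E →L[ℝ] W}
    {f'' : E → E →L[ℝ] E →L[ℝ] W} (hU : UniqueDiffOn ℝ S)
    (h1 : ∀ x ∈ S, HasFDerivWithinAt f (f' x) S x) (h2 : ∀ x ∈ S, HasFDerivWithinAt f' (f'' x) S x)
    (h3 : ContinuousOn f'' S) : ContDiffOn ℝ 2 f S := by
  have e1 : ∀ x ∈ S, fderivWithin ℝ f S x = f' x := fun x hx => (h1 x hx).fderivWithin (hU x hx)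
  have e2 : ∀ x ∈ S, fderivWithin ℝ f' S x = f'' x := fun x hx => (h2 x hx).fderivWithin (hU x hx)
  have c1 : ContDiffOn ℝ 1 f' S := by
    rw [show (1 : WithTop ℕ∞) = 0 + 1 from (zero_add 1).symm,
      contDiffOn_succ_iff_fderivWithin hU]
    refine ⟨fun x hx => (h2 x hx).differentiableWithinAt, by simp, ?_⟩
    rw [contDiffOn_zero]
    exact h3.congr e2
  rw [show (2 : WithTop ℕ∞) = 1 + 1 from one_add_one_eq_two.symm,
    contDiffOn_succ_iff_fderivWithin hU]
  exact ⟨fun x hx => (h1 x hx).differentiableWithinAt, by simp, c1.congr e1⟩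

end WithinCalculus

/-! ### Logarithmic jets -/

section LogJet

variable {E : Type} [NormedAddCommGroup E] [NormedSpace ℝ E] {S : Set E}

/-- The outer product of covectors. -/
def outer (E : Type) [NormedAddCommGroup E] [NormedSpace ℝ E] :
    (E →L[ℝ] ℝ) →L[ℝ] (E →L[ℝ] ℝ) →L[ℝ] E →L[ℝ] E →L[ℝ] ℝ :=
  ContinuousLinearMap.smulRightL ℝ E (E →L[ℝ] ℝ)

theorem outer_apply (A B : E →L[ℝ] ℝ) : outer E A B = A.smulRight B := rfl

theorem norm_outer_le : ‖outer E‖ ≤ 1 := ContinuousLinearMap.norm_smulRightL_le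

theorem ContinuousOn.outer {X : Type*} [TopologicalSpace X] {T : Set X} {A B : X → E →L[ℝ] ℝ}
    (hA : ContinuousOn A T) (hB : ContinuousOn B T) :
    ContinuousOn (fun x => outer E (A x) (B x)) T :=
  (_root_.outer E).continuous₂.comp_continuousOn (hA.prodMk hB)

theorem norm_outer_apply (A B : E →L[ℝ] ℝ) : ‖outer E A B‖ = ‖A‖ * ‖B‖ := by
  rw [outer_apply, ContinuousLinearMap.norm_smulRight_apply]

/-- `A` and `B` are the first and second derivatives of `log f` within `S`, in a form that makes
sense also where `f` vanishes. -/
structure HasLogJet (S : Set E) (f : E → ℝ) (A : E → E →L[ℝ] ℝ) (B : E → E →L[ℝ] E →L[ℝ] ℝ) :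
    Prop where
  d1 : ∀ x ∈ S, HasFDerivWithinAt f (f x • A x) S x
  d2 : ∀ x ∈ S, HasFDerivWithinAt (fun x => f x • A x) (f x • (B x + outer E (A x) (A x))) S x
  cont : ContinuousOn (fun x => f x • (B x + outer E (A x) (A x))) S

variable {f g : E → ℝ} {A A' : E → E →L[ℝ] ℝ} {B B' : E → E →L[ℝ] E →L[ℝ] ℝ}

theorem HasLogJet.congr (h : HasLogJet S f A B) (hA : ∀ x ∈ S, f x • A' x = f x • A x)
    (hB : ∀ x ∈ S, f x • (B' x + outer E (A' x) (A' x)) = f x • (B x + outer E (A x) (A x))) :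
    HasLogJet S f A' B' where
  d1 x hx := by rw [hA x hx]; exact h.d1 x hx
  d2 x hx := by
    rw [hB x hx]
    exact (h.d2 x hx).congr (fun y hy => hA y hy) (hA x hx)
  cont := h.cont.congr hB

theorem HasLogJet.one : HasLogJet S (fun _ => 1) (fun _ => 0) (fun _ => 0) where
  d1 x _ := by simpa using hasFDerivWithinAt_const (1 : ℝ) x S
  d2 x _ := by simpa using hasFDerivWithinAt_const (0 : E →L[ℝ] ℝ) x S
  cont := continuousOn_const

theorem HasLogJet.zero : HasLogJet S (fun _ => 0) A B where
  d1 x _ := by simpa using hasFDerivWithinAt_const (0 : ℝ) x S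
  d2 x _ := by simpa using hasFDerivWithinAt_const (0 : E →L[ℝ] ℝ) x S
  cont := by simpa using continuousOn_const

theorem HasLogJet.continuousOn (h : HasLogJet S f A B) : ContinuousOn f S :=
  fun x hx => (h.d1 x hx).continuousWithinAt

theorem HasLogJet.continuousOn₁ (h : HasLogJet S f A B) : ContinuousOn (fun x => f x • A x) S :=
  fun x hx => (h.d2 x hx).continuousWithinAt

theorem HasLogJet.mul (h : HasLogJet S f A B) (h' : HasLogJet S g A' B') :
    HasLogJet S (fun x => f x * g x) (fun x => A x + A' x) (fun x => B x + B' x) := by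
  have e1 : ∀ x, (f x * g x) • (A x + A' x) = f x • (g x • A' x) + g x • (f x • A x) := fun x => by
    simp only [smul_add, smul_smul, mul_comm (g x)]
    abel
  have e2 : ∀ x, (f x * g x) • ((B x + B' x) + outer E (A x + A' x) (A x + A' x)) =
      (f x • (g x • (B' x + outer E (A' x) (A' x))) + (f x • A x).smulRight (g x • A' x)) +
      (g x • (f x • (B x + outer E (A x) (A x))) + (g x • A' x).smulRight (f x • A x)) := fun x => by
    ext v w
    simp only [outer_apply, smul_apply, add_apply, ContinuousLinearMap.smulRight_apply,
      smul_eq_mul]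
    ring
  refine ⟨fun x hx => ?_, fun x hx => ?_, ?_⟩
  · rw [e1]
    exact (h.d1 x hx).mul (h'.d1 x hx)
  · simp only [e1]
    rw [e2]
    exact ((h.d1 x hx).smul (h'.d2 x hx)).add ((h'.d1 x hx).smul (h.d2 x hx))
  · simp only [e2]
    have s1 : ContinuousOn (fun x => outer E (f x • A x) (g x • A' x)) S :=
      h.continuousOn₁.outer h'.continuousOn₁
    have s2 : ContinuousOn (fun x => outer E (g x • A' x) (f x • A x)) S :=
      h'.continuousOn₁.outer h.continuousOn₁
    exact ((h.continuousOn.smul h'.cont).add s1).add ((h'.continuousOn.smul h.cont).add s2)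

theorem HasLogJet.log (h : HasLogJet S f A B) (hf : ∀ x ∈ S, 0 < f x) :
    (∀ x ∈ S, HasFDerivWithinAt (fun x => Real.log (f x)) (A x) S x) ∧
    (∀ x ∈ S, HasFDerivWithinAt A (B x) S x) ∧ ContinuousOn B S := by
  have hinv : ∀ x ∈ S, HasFDerivWithinAt (fun x => (f x)⁻¹) (-(f x ^ 2)⁻¹ • (f x • A x)) S x :=
    fun x hx => (hasDerivAt_inv (hf x hx).ne').comp_hasFDerivWithinAt x (h.d1 x hx)
  have eA : ∀ x ∈ S, A x = (f x)⁻¹ • (f x • A x) := fun x hx =>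
    (inv_smul_smul₀ (hf x hx).ne' _).symm
  have eB : ∀ x ∈ S, B x = (f x)⁻¹ • (f x • (B x + outer E (A x) (A x))) - outer E (A x) (A x) :=
    fun x hx => by rw [inv_smul_smul₀ (hf x hx).ne', add_sub_cancel_right]
  have dA : ∀ x ∈ S, HasFDerivWithinAt A (B x) S x := fun x hx => by
    have h1 := (hinv x hx).smul (h.d2 x hx)
    refine (h1.congr_fderiv ?_).congr eA (eA x hx)
    have := (hf x hx).ne'
    ext v w
    simp only [outer_apply, smul_apply, add_apply, ContinuousLinearMap.smulRight_apply,
      smul_eq_mul]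
    field_simp
    ring
  refine ⟨fun x hx => ?_, dA, ?_⟩
  · have := (h.d1 x hx).log (hf x hx).ne'
    rwa [inv_smul_smul₀ (hf x hx).ne'] at this
  · refine ContinuousOn.congr ?_ eB
    have cA : ContinuousOn A S := fun x hx => (dA x hx).continuousWithinAt
    exact ((h.continuousOn.inv₀ fun x hx => (hf x hx).ne').smul h.cont).sub
      (cA.outer cA)

theorem HasLogJet.of_log (h1 : ∀ x ∈ S, HasFDerivWithinAt (fun x => Real.log (f x)) (A x) S x)
    (h2 : ∀ x ∈ S, HasFDerivWithinAt A (B x) S x) (h3 : ContinuousOn B S)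
    (hf : ∀ x ∈ S, 0 < f x) : HasLogJet S f A B := by
  have d1 : ∀ x ∈ S, HasFDerivWithinAt f (f x • A x) S x := fun x hx => by
    have h := (h1 x hx).exp
    rw [Real.exp_log (hf x hx)] at h
    exact h.congr (fun y hy => (Real.exp_log (hf y hy)).symm) (Real.exp_log (hf x hx)).symm
  refine ⟨d1, fun x hx => ?_, ?_⟩
  · refine ((d1 x hx).smul (h2 x hx)).congr_fderiv ?_
    ext v w
    simp only [outer_apply, smul_apply, add_apply, ContinuousLinearMap.smulRight_apply,
      smul_eq_mul]
    ring
  · have cA : ContinuousOn A S := fun x hx => (h2 x hx).continuousWithinAt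
    have cf : ContinuousOn f S := fun x hx => (d1 x hx).continuousWithinAt
    exact cf.smul (h3.add (cA.outer cA))

/-- The logarithmic jet of a `C²` function that is positive, or zero, on `S`. -/
theorem HasLogJet.of_contDiffOn (hU : UniqueDiffOn ℝ S) (hf : ContDiffOn ℝ 2 f S)
    (h0 : (∀ x ∈ S, 0 < f x) ∨ (∀ x ∈ S, f x = 0)) :
    HasLogJet S f (fderivWithin ℝ (fun x => Real.log (f x)) S)
      (fderivWithin ℝ (fderivWithin ℝ (fun x => Real.log (f x)) S) S) := by
  rcases h0 with h0 | h0
  · have hl : ContDiffOn ℝ 2 (fun x => Real.log (f x)) S := hf.log fun x hx => (h0 x hx).ne'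
    rw [show (2 : WithTop ℕ∞) = 1 + 1 from one_add_one_eq_two.symm,
      contDiffOn_succ_iff_fderivWithin hU] at hl
    obtain ⟨hl1, -, hl2⟩ := hl
    rw [show (1 : WithTop ℕ∞) = 0 + 1 from (zero_add 1).symm,
      contDiffOn_succ_iff_fderivWithin hU] at hl2
    exact .of_log (fun x hx => (hl1 x hx).hasFDerivWithinAt)
      (fun x hx => (hl2.1 x hx).hasFDerivWithinAt) (contDiffOn_zero.1 hl2.2.2) h0
  · have hz := HasLogJet.zero (S := S) (A := fderivWithin ℝ (fun x => Real.log (f x)) S)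
      (B := fderivWithin ℝ (fderivWithin ℝ (fun x => Real.log (f x)) S) S)
    refine ⟨fun x hx => ?_, fun x hx => ?_, ?_⟩
    · rw [h0 x hx]
      exact (hz.d1 x hx).congr h0 (h0 x hx)
    · rw [h0 x hx]
      exact (hz.d2 x hx).congr (fun y hy => by rw [h0 y hy]) (by rw [h0 x hx])
    · exact hz.cont.congr fun x hx => by rw [h0 x hx]

/-- The first logarithmic derivative of an integral. -/
def avgJet₁ {Ω : Type*} [MeasurableSpace Ω] (m : Measure Ω) (f : Ω → ℝ) (A : Ω → E →L[ℝ] ℝ) :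
    E →L[ℝ] ℝ := (∫ ω, f ω ∂m)⁻¹ • ∫ ω, f ω • A ω ∂m

/-- The second logarithmic derivative of an integral. -/
def avgJet₂ {Ω : Type*} [MeasurableSpace Ω] (m : Measure Ω) (f : Ω → ℝ) (A : Ω → E →L[ℝ] ℝ)
    (B : Ω → E →L[ℝ] E →L[ℝ] ℝ) : E →L[ℝ] E →L[ℝ] ℝ :=
  (∫ ω, f ω ∂m)⁻¹ • ∫ ω, f ω • (B ω + outer E (A ω) (A ω)) ∂m -
    outer E (avgJet₁ m f A) (avgJet₁ m f A)

theorem integral_smul_avgJet₁ {Ω : Type*} [MeasurableSpace Ω] {m : Measure Ω} {f : Ω → ℝ}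
    (hf : Integrable f m) (h0 : 0 ≤ᵐ[m] f) {V : Type*} [NormedAddCommGroup V] [NormedSpace ℝ V]
    (h : Ω → V) : (∫ ω, f ω ∂m) • ((∫ ω, f ω ∂m)⁻¹ • ∫ ω, f ω • h ω ∂m) = ∫ ω, f ω • h ω ∂m := by
  rcases eq_or_ne (∫ ω, f ω ∂m) 0 with h1 | h1
  · rw [h1, zero_smul, eq_comm]
    rw [integral_eq_zero_iff_of_nonneg_ae h0 hf] at h1
    refine integral_eq_zero_of_ae ?_
    filter_upwards [h1] with ω hω
    simp only [hω, Pi.zero_apply, zero_smul]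
  · rw [smul_inv_smul₀ h1]

theorem HasLogJet.integral [FiniteDimensional ℝ E] {Ω : Type*} [MeasurableSpace Ω] {m : Measure Ω}
    (hS : LengthQuasiconvex S) (hU : UniqueDiffOn ℝ S) {f : E → Ω → ℝ} {A : E → Ω → E →L[ℝ] ℝ}
    {B : E → Ω → E →L[ℝ] E →L[ℝ] ℝ} {b : Ω → ℝ}
    (hf : ∀ x ∈ S, AEStronglyMeasurable (f x) m)
    (h0 : ∀ᵐ ω ∂m, ∀ x ∈ S, 0 ≤ f x ω)
    (hj : ∀ᵐ ω ∂m, HasLogJet S (fun x => f x ω) (fun x => A x ω) (fun x => B x ω))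
    (hb0 : ∀ᵐ ω ∂m, ∀ x ∈ S, f x ω ≤ b ω)
    (hb1 : ∀ᵐ ω ∂m, ∀ x ∈ S, ‖f x ω • A x ω‖ ≤ b ω)
    (hb2 : ∀ᵐ ω ∂m, ∀ x ∈ S, ‖f x ω • (B x ω + outer E (A x ω) (A x ω))‖ ≤ b ω)
    (hbi : Integrable b m) :
    HasLogJet S (fun x => ∫ ω, f x ω ∂m) (fun x => avgJet₁ m (f x) (A x))
      (fun x => avgJet₂ m (f x) (A x) (B x)) := by
  have i0 : ∀ x ∈ S, Integrable (f x) m := fun x hx => hbi.mono' (hf x hx) (by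
    filter_upwards [h0, hb0] with ω h1 h2
    rw [Real.norm_of_nonneg (h1 x hx)]
    exact h2 x hx)
  have h0' : ∀ x ∈ S, 0 ≤ᵐ[m] f x := fun x hx => by
    filter_upwards [h0] with ω h1 using h1 x hx
  have D1 := fun x (hx : x ∈ S) => hasFDerivWithinAt_integral hS hU i0 (by
    filter_upwards [hj] with ω h using h.d1) hb1 hbi hx
  have D2 := fun x (hx : x ∈ S) => hasFDerivWithinAt_integral hS hU (fun x hx => (D1 x hx).1) (by
    filter_upwards [hj] with ω h using h.d2) hb2 hbi hx
  have C2 : ContinuousOn (fun x => ∫ ω, f x ω • (B x ω + outer E (A x ω) (A x ω)) ∂m) S :=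
    continuousOn_of_dominated (fun x hx => (D2 x hx).1.aestronglyMeasurable)
      (fun x hx => by filter_upwards [hb2] with ω h using h x hx) hbi
      (by filter_upwards [hj] with ω h using h.cont)
  have e1 : ∀ x ∈ S, (∫ ω, f x ω ∂m) • avgJet₁ m (f x) (A x) = ∫ ω, f x ω • A x ω ∂m :=
    fun x hx => integral_smul_avgJet₁ (i0 x hx) (h0' x hx) _
  have e2 : ∀ x ∈ S, (∫ ω, f x ω ∂m) • (avgJet₂ m (f x) (A x) (B x) +
      outer E (avgJet₁ m (f x) (A x)) (avgJet₁ m (f x) (A x))) =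
      ∫ ω, f x ω • (B x ω + outer E (A x ω) (A x ω)) ∂m :=
    fun x hx => by
      rw [avgJet₂, sub_add_cancel]
      exact integral_smul_avgJet₁ (i0 x hx) (h0' x hx) _
  refine ⟨fun x hx => ?_, fun x hx => ?_, C2.congr e2⟩
  · rw [e1 x hx]; exact (D1 x hx).2
  · rw [e2 x hx]
    exact (D2 x hx).2.congr e1 (e1 x hx)

theorem norm_avgJet₁_le {Ω : Type*} [MeasurableSpace Ω] {m : Measure Ω} {f : Ω → ℝ}
    {A : Ω → E →L[ℝ] ℝ} {s : ℝ} (hs : 0 ≤ s) (hf : Integrable f m) (h0 : 0 ≤ᵐ[m] f)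
    (hA : ∀ᵐ ω ∂m, ‖A ω‖ ≤ s) : ‖avgJet₁ m f A‖ ≤ s := by
  have hI : 0 ≤ ∫ ω, f ω ∂m := integral_nonneg_of_ae h0
  rw [avgJet₁, norm_smul, norm_inv, Real.norm_of_nonneg hI]
  rcases hI.eq_or_lt with h | h
  · rw [← h]; simpa
  · rw [inv_mul_le_iff₀ h, ← integral_mul_const]
    refine norm_integral_le_of_norm_le (hf.mul_const s) ?_
    filter_upwards [h0, hA] with ω h1 h2
    rw [norm_smul, Real.norm_of_nonneg h1]
    exact mul_le_mul_of_nonneg_left h2 h1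

theorem norm_avgJet₂_le {Ω : Type*} [MeasurableSpace Ω] {m : Measure Ω} {f : Ω → ℝ}
    {A : Ω → E →L[ℝ] ℝ} {B : Ω → E →L[ℝ] E →L[ℝ] ℝ} {s t : ℝ} (hs : 0 ≤ s) (ht : 0 ≤ t)
    (hf : Integrable f m) (h0 : 0 ≤ᵐ[m] f)
    (hA : ∀ᵐ ω ∂m, ‖A ω‖ ≤ s) (hB : ∀ᵐ ω ∂m, ‖B ω‖ ≤ t) :
    ‖avgJet₂ m f A B‖ ≤ t + 2 * s ^ 2 := by
  have hI : 0 ≤ ∫ ω, f ω ∂m := integral_nonneg_of_ae h0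
  have h1 := norm_avgJet₁_le hs hf h0 hA
  have h2 : ‖outer E (avgJet₁ m f A) (avgJet₁ m f A)‖ ≤ s ^ 2 := by
    rw [norm_outer_apply, sq]; gcongr
  have h3 : ‖(∫ ω, f ω ∂m)⁻¹ • ∫ ω, f ω • (B ω + outer E (A ω) (A ω)) ∂m‖ ≤ t + s ^ 2 := by
    rw [norm_smul, norm_inv, Real.norm_of_nonneg hI]
    rcases hI.eq_or_lt with h | h
    · rw [← h]
      simp only [inv_zero, zero_mul]
      positivity
    · rw [inv_mul_le_iff₀ h, ← integral_mul_const]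
      refine norm_integral_le_of_norm_le (hf.mul_const _) ?_
      filter_upwards [h0, hA, hB] with ω h1 h2 h3
      rw [norm_smul, Real.norm_of_nonneg h1]
      refine mul_le_mul_of_nonneg_left ((norm_add_le _ _).trans (add_le_add h3 ?_)) h1
      rw [norm_outer_apply, sq]; gcongr
  rw [avgJet₂]
  exact (norm_sub_le _ _).trans (by linarith)

end LogJet

/-! ### Parametrised families of kernel jets, driven by a sequence of observations -/

/-- A family of kernel jets that depends on a parameter `θ ∈ Θ` and on an observation `y`. The
second and third component of `K θ y` are the logarithmic derivatives in `θ` of the first. -/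
structure JetSystem {E : Type} [NormedAddCommGroup E] [NormedSpace ℝ E] {𝒳 Y : Type*}
    [MeasurableSpace 𝒳] [MeasurableSpace Y] (Θ : Set E) (μ : Measure 𝒳) (ϰ : ℝ) (σ : Y → ℝ)
    (K : E → Y → KernelJet 𝒳 (E →L[ℝ] ℝ) (E →L[ℝ] E →L[ℝ] ℝ)) : Prop where
  one_le_ϰ : 1 ≤ ϰ
  one_le_σ : ∀ y, 1 ≤ σ y
  measurable_σ : Measurable σ
  good : ∀ θ ∈ Θ, ∀ y, (K θ y).Good μ ϰ (σ y)
  jet : ∀ y x z, HasLogJet Θ (fun θ => (K θ y).L x z) (fun θ => (K θ y).a x z)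
    (fun θ => (K θ y).b x z)
  measurable : ∀ θ ∈ Θ, Measurable fun t : (Y × 𝒳) × 𝒳 => (K θ t.1.1).L t.1.2 t.2
  bdd : ∀ y, ∃ C, ∀ θ ∈ Θ, ∀ x z, (K θ y).L x z ≤ C

namespace JetSystem

variable {E : Type} [NormedAddCommGroup E] [NormedSpace ℝ E] [FiniteDimensional ℝ E]
  {𝒳 Y : Type*} [MeasurableSpace 𝒳] [MeasurableSpace Y] {Θ : Set E} {μ : Measure 𝒳}
  [IsFiniteMeasure μ] {ϰ : ℝ} {σ : Y → ℝ}
  {K : E → Y → KernelJet 𝒳 (E →L[ℝ] ℝ) (E →L[ℝ] E →L[ℝ] ℝ)}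

/-- The jet of the likelihood of `n` observations. -/
def lik (μ : Measure 𝒳) (K : E → Y → KernelJet 𝒳 (E →L[ℝ] ℝ) (E →L[ℝ] E →L[ℝ] ℝ)) (n : ℕ) (θ : E)
    (ω : ℕ → Y) : FunJet 𝒳 (E →L[ℝ] ℝ) (E →L[ℝ] E →L[ℝ] ℝ) :=
  KernelJet.iter μ (outer E) n fun k => K θ (ω k)

theorem lik_succ (n : ℕ) (θ : E) (ω : ℕ → Y) : lik μ K (n + 1) θ ω =
    (K θ (ω 0)).step μ (outer E) (lik μ K n θ fun k => ω (k + 1)) := rfl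

/-- A rate for the geometric loss of memory. -/
theorem exists_rate {ϰ : ℝ} (hϰ : 1 ≤ ϰ) : ∃ r : ℝ, 0 < r ∧ r < 1 ∧ 1 - (ϰ ^ 2)⁻¹ ≤ r ^ 4 := by
  have h1 : 0 < (ϰ ^ 2)⁻¹ := by positivity
  refine ⟨1 - (ϰ ^ 2)⁻¹ / 4, ?_, by linarith, ?_⟩
  · have : (ϰ ^ 2)⁻¹ ≤ 1 := inv_le_one_of_one_le₀ (one_le_pow₀ hϰ)
    linarith
  · have h2 : (ϰ ^ 2)⁻¹ ≤ 1 := inv_le_one_of_one_le₀ (one_le_pow₀ hϰ)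
    have := one_add_mul_le_pow (a := -((ϰ ^ 2)⁻¹ / 4)) (by linarith) 4
    norm_num at this
    rw [sub_eq_add_neg 1 ((ϰ ^ 2)⁻¹ / 4)]
    linarith

section Deterministic

variable (H : JetSystem Θ μ ϰ σ K)

include H

theorem lik_good (n : ℕ) {θ : E} (hθ : θ ∈ Θ) (ω : ℕ → Y) : (lik μ K n θ ω).Good ϰ :=
  KernelJet.iter_good H.one_le_ϰ n fun k => H.good θ hθ (ω k)

theorem lik_le (n : ℕ) (ω : ℕ → Y) : ∃ C, ∀ θ ∈ Θ, ∀ x, (lik μ K n θ ω).p x ≤ C := by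
  induction n generalizing ω with
  | zero => exact ⟨1, fun θ _ x => le_rfl⟩
  | succ n ih =>
    obtain ⟨C, hC⟩ := ih fun k => ω (k + 1)
    obtain ⟨C', hC'⟩ := H.bdd (ω 0)
    refine ⟨∫ _, C' * C ∂μ, fun θ hθ x => ?_⟩
    have g := H.lik_good n hθ fun k => ω (k + 1)
    have hK := H.good θ hθ (ω 0)
    rw [lik_succ]
    refine integral_mono (hK.integrable_mul' g x) (integrable_const _) fun z => ?_
    have := hK.nonneg x z
    exact mul_le_mul (hC' θ hθ x z) (hC θ hθ z) (g.pos z).le (this.trans (hC' θ hθ x z))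

theorem lik_norm_le (n : ℕ) {θ : E} (hθ : θ ∈ Θ) (ω : ℕ → Y) (x : 𝒳) :
    ‖(lik μ K n θ ω).u x‖ ≤ ∑ k ∈ Finset.range n, σ (ω k) ∧
    ‖(lik μ K n θ ω).w x‖ ≤ 5 * n * (∑ k ∈ Finset.range n, σ (ω k)) ^ 2 := by
  obtain ⟨r, hr0, hr1, hr⟩ := exists_rate H.one_le_ϰ
  exact KernelJet.iter_norm_le norm_outer_le H.one_le_ϰ hr0 hr1 hr n (fun k => H.one_le_σ (ω k))
    (fun k => H.good θ hθ (ω k)) x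

theorem hasLogJet (hS : LengthQuasiconvex Θ) (hU : UniqueDiffOn ℝ Θ) (n : ℕ) (ω : ℕ → Y) (x : 𝒳) :
    HasLogJet Θ (fun θ => (lik μ K n θ ω).p x) (fun θ => (lik μ K n θ ω).u x)
      (fun θ => (lik μ K n θ ω).w x) := by
  induction n generalizing ω x with
  | zero => exact HasLogJet.one
  | succ n ih =>
    set ω' := fun k => ω (k + 1) with hω'
    obtain ⟨C, hC⟩ := H.lik_le n ω'
    obtain ⟨C', hC'⟩ := H.bdd (ω 0)
    set s := ∑ k ∈ Finset.range n, σ (ω' k)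
    set τ := σ (ω 0)
    have hg : ∀ θ ∈ Θ, (lik μ K n θ ω').Good ϰ := fun θ hθ => H.lik_good n hθ ω'
    have hk : ∀ θ ∈ Θ, (K θ (ω 0)).Good μ ϰ τ := fun θ hθ => H.good θ hθ (ω 0)
    have hp : ∀ θ ∈ Θ, ∀ z, 0 ≤ (K θ (ω 0)).L x z * (lik μ K n θ ω').p z := fun θ hθ z =>
      mul_nonneg ((hk θ hθ).nonneg x z) ((hg θ hθ).pos z).le
    have hpC : ∀ θ ∈ Θ, ∀ z, (K θ (ω 0)).L x z * (lik μ K n θ ω').p z ≤ C' * C := fun θ hθ z =>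
      mul_le_mul (hC' θ hθ x z) (hC θ hθ z) ((hg θ hθ).pos z).le
        (((hk θ hθ).nonneg x z).trans (hC' θ hθ x z))
    have hA : ∀ θ ∈ Θ, ∀ z, ‖(K θ (ω 0)).a x z + (lik μ K n θ ω').u z‖ ≤ τ + s := fun θ hθ z =>
      (norm_add_le _ _).trans (add_le_add ((hk θ hθ).norm_a x z) (H.lik_norm_le n hθ ω' z).1)
    have hB : ∀ θ ∈ Θ, ∀ z, ‖(K θ (ω 0)).b x z + (lik μ K n θ ω').w z‖ ≤
        τ ^ 2 + 5 * n * s ^ 2 := fun θ hθ z =>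
      (norm_add_le _ _).trans (add_le_add ((hk θ hθ).norm_b x z) (H.lik_norm_le n hθ ω' z).2)
    rcases Θ.eq_empty_or_nonempty with rfl | ⟨θ₀, hθ₀⟩
    · exact ⟨by simp, by simp, by simp⟩
    have hts : 0 ≤ τ + s := (norm_nonneg _).trans (hA θ₀ hθ₀ x)
    have hCC : 0 ≤ C' * C := (hp θ₀ hθ₀ x).trans (hpC θ₀ hθ₀ x)
    have key := HasLogJet.integral (m := μ) hS hU
      (f := fun θ z => (K θ (ω 0)).L x z * (lik μ K n θ ω').p z)
      (A := fun θ z => (K θ (ω 0)).a x z + (lik μ K n θ ω').u z)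
      (B := fun θ z => (K θ (ω 0)).b x z + (lik μ K n θ ω').w z)
      (b := fun _ => C' * C * (1 + (τ + s) + (τ ^ 2 + 5 * n * s ^ 2 + (τ + s) ^ 2)))
      (fun θ hθ => ((hk θ hθ).integrable_mul' (hg θ hθ) x).aestronglyMeasurable)
      (.of_forall fun z θ hθ => hp θ hθ z)
      (.of_forall fun z => (H.jet (ω 0) x z).mul (ih ω' z))
      (.of_forall fun z θ hθ => (hpC θ hθ z).trans (by
        refine le_mul_of_one_le_right hCC ?_
        have : 0 ≤ 5 * (n : ℝ) * s ^ 2 := by positivity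
        nlinarith [sq_nonneg τ, sq_nonneg (τ + s)]))
      (.of_forall fun z θ hθ => by
        rw [norm_smul, Real.norm_of_nonneg (hp θ hθ z)]
        refine mul_le_mul (hpC θ hθ z) ((hA θ hθ z).trans ?_) (norm_nonneg _) hCC
        have : 0 ≤ 5 * (n : ℝ) * s ^ 2 := by positivity
        nlinarith [sq_nonneg τ, sq_nonneg (τ + s)])
      (.of_forall fun z θ hθ => by
        rw [norm_smul, Real.norm_of_nonneg (hp θ hθ z)]
        refine mul_le_mul (hpC θ hθ z) (((norm_add_le _ _).trans (add_le_add (hB θ hθ z)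
          (?_ : _ ≤ (τ + s) ^ 2))).trans ?_) (norm_nonneg _) hCC
        · rw [norm_outer_apply, sq]
          exact mul_le_mul (hA θ hθ z) (hA θ hθ z) (norm_nonneg _) hts
        · linarith)
      (integrable_const _)
    have e1 : ∀ θ, avgJet₁ μ (fun z => (K θ (ω 0)).L x z * (lik μ K n θ ω').p z)
        (fun z => (K θ (ω 0)).a x z + (lik μ K n θ ω').u z) = (lik μ K (n + 1) θ ω).u x := fun θ => by
      rw [lik_succ]
      simp only [avgJet₁, KernelJet.step, KernelJet.dens]
      rw [← integral_smul]
      congr 1; ext1 z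
      rw [smul_smul, div_eq_inv_mul]
    have e2 : ∀ θ ∈ Θ, avgJet₂ μ (fun z => (K θ (ω 0)).L x z * (lik μ K n θ ω').p z)
        (fun z => (K θ (ω 0)).a x z + (lik μ K n θ ω').u z)
        (fun z => (K θ (ω 0)).b x z + (lik μ K n θ ω').w z) = (lik μ K (n + 1) θ ω).w x :=
      fun θ hθ => by
        have hd := ((hk θ hθ).isProbDensity_dens (hg θ hθ) x).integrable
        have ha := (hk θ hθ).bdd_add (hg θ hθ) x
        have hb := (hk θ hθ).bdd_add' (hg θ hθ) x
        rw [avgJet₂, e1, lik_succ]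
        simp only [KernelJet.step, densCov]
        rw [← add_sub_assoc]
        congr 1
        rw [← integral_add (hb.integrable_smul hd) ((ha.bilin (outer E) ha).integrable_smul hd),
          ← integral_smul]
        congr 1; ext1 z
        rw [smul_smul, ← smul_add, KernelJet.dens, div_eq_inv_mul]
    refine key.congr (fun θ hθ => ?_) (fun θ hθ => ?_)
    · rw [e1]
    · rw [e1, e2 θ hθ]

theorem measurable_lik (n : ℕ) {θ : E} (hθ : θ ∈ Θ) :
    Measurable fun t : (ℕ → Y) × 𝒳 => (lik μ K n θ t.1).p t.2 := by
  induction n with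
  | zero => exact measurable_const
  | succ n ih =>
    have h1 : Measurable fun t : ((ℕ → Y) × 𝒳) × 𝒳 => (K θ (t.1.1 0)).L t.1.2 t.2 :=
      (H.measurable θ hθ).comp (by fun_prop :
        Measurable fun t : ((ℕ → Y) × 𝒳) × 𝒳 => ((t.1.1 0, t.1.2), t.2))
    have h2 : Measurable fun t : ((ℕ → Y) × 𝒳) × 𝒳 => (lik μ K n θ fun k => t.1.1 (k + 1)).p t.2 :=
      ih.comp (by fun_prop : Measurable fun t : ((ℕ → Y) × 𝒳) × 𝒳 => ((fun k => t.1.1 (k + 1)), t.2))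
    exact (h1.mul h2).stronglyMeasurable.integral_prod_right.measurable

theorem measurable_lik_left (n : ℕ) {θ : E} (hθ : θ ∈ Θ) (x : 𝒳) :
    Measurable fun ω : ℕ → Y => (lik μ K n θ ω).p x :=
  (H.measurable_lik n hθ).comp measurable_prodMk_right

/-- The log likelihood as a differentiable function. -/
theorem log_lik (hS : LengthQuasiconvex Θ) (hU : UniqueDiffOn ℝ Θ) (n : ℕ) (ω : ℕ → Y) (x : 𝒳) :
    (∀ θ ∈ Θ, HasFDerivWithinAt (fun θ => Real.log ((lik μ K n θ ω).p x))
      ((lik μ K n θ ω).u x) Θ θ) ∧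
    (∀ θ ∈ Θ, HasFDerivWithinAt (fun θ => (lik μ K n θ ω).u x) ((lik μ K n θ ω).w x) Θ θ) ∧
    ContinuousOn (fun θ => (lik μ K n θ ω).w x) Θ :=
  (H.hasLogJet hS hU n ω x).log fun _ hθ => (H.lik_good n hθ ω).pos x

theorem abs_log_lik_sub_le (hU : UniqueDiffOn ℝ Θ) (hS : LengthQuasiconvex Θ) :
    ∃ L : ℝ, 0 ≤ L ∧ ∀ (n : ℕ) (ω : ℕ → Y) (x : 𝒳), ∀ θ ∈ Θ, ∀ θ' ∈ Θ,
      |Real.log ((lik μ K n θ' ω).p x) - Real.log ((lik μ K n θ ω).p x)| ≤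
        L * ‖θ' - θ‖ * ∑ k ∈ Finset.range n, σ (ω k) := by
  obtain ⟨L, hL1, hL⟩ := hS.exists_mvt
  refine ⟨L, by linarith, fun n ω x θ hθ θ' hθ' => ?_⟩
  have := hL _ _ (H.log_lik hS hU n ω x).1 θ hθ θ' hθ' 0 (∑ k ∈ Finset.range n, σ (ω k))
    fun θ hθ _ => by simpa using (H.lik_norm_le n hθ ω x).1
  simpa [mul_comm, mul_left_comm, mul_assoc] using this

theorem abs_log_lik_sub_le_harnack (n : ℕ) {θ : E} (hθ : θ ∈ Θ) (ω : ℕ → Y) (x z : 𝒳) :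
    |Real.log ((lik μ K n θ ω).p x) - Real.log ((lik μ K n θ ω).p z)| ≤ Real.log ϰ := by
  have g := H.lik_good n hθ ω
  have hϰ : ϰ ≠ 0 := by linarith [H.one_le_ϰ]
  have key : ∀ x z, Real.log ((lik μ K n θ ω).p x) ≤ Real.log ϰ + Real.log ((lik μ K n θ ω).p z) :=
    fun x z => by
      rw [← Real.log_mul hϰ (g.pos z).ne']
      exact Real.log_le_log (g.pos x) (g.harnack x z)
  rw [abs_le]
  constructor <;> linarith [key x z, key z x]

end Deterministic

end JetSystem

/-! ### Stationary sequences -/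

section Shift

variable {Y : Type*} [MeasurableSpace Y]

/-- Drop the first `i` entries of a sequence. -/
def shiftBy (i : ℕ) (ω : ℕ → Y) : ℕ → Y := fun k => ω (k + i)

theorem measurable_shiftBy (i : ℕ) : Measurable (shiftBy (Y := Y) i) :=
  measurable_pi_lambda _ fun k => measurable_pi_apply (k + i)

theorem shiftBy_add (i j : ℕ) (ω : ℕ → Y) : shiftBy i (shiftBy j ω) = shiftBy (i + j) ω := by
  funext k; simp [shiftBy, add_assoc]

variable {P : Measure (ℕ → Y)} (hP : MeasurePreserving (shiftBy 1) P P)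

include hP

theorem measurePreserving_shiftBy (i : ℕ) : MeasurePreserving (shiftBy i) P P := by
  induction i with
  | zero => exact MeasurePreserving.id P
  | succ i ih =>
    have := ih.comp hP
    convert this using 1
    funext ω
    exact (shiftBy_add i 1 ω).symm

theorem integral_comp_shiftBy {V : Type*} [NormedAddCommGroup V] [NormedSpace ℝ V] (i : ℕ)
    {F : (ℕ → Y) → V} (hF : AEStronglyMeasurable F P) : ∫ ω, F (shiftBy i ω) ∂P = ∫ ω, F ω ∂P := by
  have h := measurePreserving_shiftBy hP i
  conv_rhs => rw [← h.map_eq]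
  rw [integral_map h.aemeasurable (by rwa [h.map_eq])]

variable {h : Y → ℝ} (hh : MemLp (fun ω => h (ω 0)) 2 P)

include hh

theorem memLp_coord (k : ℕ) : MemLp (fun ω => h (ω k)) 2 P := by
  have := hh.comp_measurePreserving (measurePreserving_shiftBy hP k)
  simpa [Function.comp_def, shiftBy] using this

theorem memLp_sum_coord (n : ℕ) : MemLp (fun ω => ∑ k ∈ Finset.range n, h (ω k)) 2 P :=
  memLp_finsetSum _ fun k _ => memLp_coord hP hh k

theorem memLp_expSum (r c : ℝ) (n : ℕ) : MemLp (fun ω => expSum r c n fun k => h (ω k)) 2 P := by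
  induction n with
  | zero => exact MemLp.zero'
  | succ n ih =>
    have := ih.comp_measurePreserving hP
    exact (this.const_mul r).add (hh.const_mul c)

theorem integral_expSum_sq_le {r c : ℝ} (hr0 : 0 < r) (hr1 : r < 1) (n : ℕ) :
    ∫ ω, (expSum r c n fun k => h (ω k)) ^ 2 ∂P ≤
      c ^ 2 / (1 - r) ^ 2 * ∫ ω, h (ω 0) ^ 2 ∂P := by
  have h1r : 0 < 1 - r := by linarith
  have hM : 0 ≤ ∫ ω, h (ω 0) ^ 2 ∂P := integral_nonneg fun ω => sq_nonneg _
  induction n with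
  | zero =>
    simp only [expSum, ne_eq, OfNat.ofNat_ne_zero, not_false_eq_true, zero_pow, integral_zero]
    positivity
  | succ n ih =>
    have hi := (memLp_expSum hP hh r c n).integrable_sq
    have hi' : Integrable (fun ω => (expSum r c n fun k => h (shiftBy 1 ω k)) ^ 2) P :=
      (hP.integrable_comp hi.aestronglyMeasurable).2 hi
    have step : ∀ ω : ℕ → Y, (expSum r c (n + 1) fun k => h (ω k)) ^ 2 ≤
        r * (expSum r c n fun k => h (shiftBy 1 ω k)) ^ 2 + c ^ 2 / (1 - r) * h (ω 0) ^ 2 :=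
      fun ω => by
        rw [expSum_succ]
        change (r * (expSum r c n fun k => h (shiftBy 1 ω k)) + _) ^ 2 ≤ _
        set X := expSum r c n fun k => h (shiftBy 1 ω k)
        have : c ^ 2 / (1 - r) * h (ω 0) ^ 2 = (1 - r) * (c * h (ω 0) / (1 - r)) ^ 2 := by
          field_simp
        rw [this]
        set Z := c * h (ω 0) / (1 - r) with hZ
        have hZ' : c * h (ω 0) = (1 - r) * Z := by rw [hZ]; field_simp
        rw [hZ']
        nlinarith [mul_nonneg (mul_nonneg hr0.le h1r.le) (sq_nonneg (X - Z))]
    calc ∫ ω, (expSum r c (n + 1) fun k => h (ω k)) ^ 2 ∂P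
        ≤ ∫ ω, (r * (expSum r c n fun k => h (shiftBy 1 ω k)) ^ 2 +
            c ^ 2 / (1 - r) * h (ω 0) ^ 2) ∂P :=
          integral_mono (memLp_expSum hP hh r c (n + 1)).integrable_sq
            ((hi'.const_mul r).add (hh.integrable_sq.const_mul _)) step
      _ = r * ∫ ω, (expSum r c n fun k => h (ω k)) ^ 2 ∂P +
            c ^ 2 / (1 - r) * ∫ ω, h (ω 0) ^ 2 ∂P := by
          rw [integral_add (hi'.const_mul r) (hh.integrable_sq.const_mul _), integral_const_mul,
            integral_const_mul, integral_comp_shiftBy hP 1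
              (F := fun ω => (expSum r c n fun k => h (ω k)) ^ 2) hi.aestronglyMeasurable]
      _ ≤ r * (c ^ 2 / (1 - r) ^ 2 * ∫ ω, h (ω 0) ^ 2 ∂P) +
            c ^ 2 / (1 - r) * ∫ ω, h (ω 0) ^ 2 ∂P := by gcongr
      _ = _ := by field_simp; ring

/-- The mean square of the bound in `KernelJet.iter_second_diff`. -/
theorem integral_memory_sq_le {r : ℝ} (hr0 : 0 < r) (hr1 : r < 1) (n : ℕ) :
    Integrable (fun ω => (h (ω 0) + expSum r 2 n fun k => h (ω (k + 1))) ^ 2) P ∧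
    ∫ ω, (h (ω 0) + expSum r 2 n fun k => h (ω (k + 1))) ^ 2 ∂P ≤
      10 / (1 - r) ^ 2 * ∫ ω, h (ω 0) ^ 2 ∂P := by
  have h1r : 0 < 1 - r := by linarith
  have hM : 0 ≤ ∫ ω, h (ω 0) ^ 2 ∂P := integral_nonneg fun ω => sq_nonneg _
  have hX := memLp_expSum hP hh r 2 n
  have hX' := hX.comp_measurePreserving hP
  have hi := hX.integrable_sq
  have hi' : Integrable (fun ω => (expSum r 2 n fun k => h (shiftBy 1 ω k)) ^ 2) P :=
    hX'.integrable_sq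
  have hint : Integrable (fun ω => (h (ω 0) + expSum r 2 n fun k => h (ω (k + 1))) ^ 2) P :=
    (hh.add hX').integrable_sq
  refine ⟨hint, ?_⟩
  calc _ ≤ ∫ ω, (2 * h (ω 0) ^ 2 + 2 * (expSum r 2 n fun k => h (shiftBy 1 ω k)) ^ 2) ∂P := by
        refine integral_mono hint ((hh.integrable_sq.const_mul 2).add (hi'.const_mul 2)) fun ω => ?_
        change (h (ω 0) + expSum r 2 n fun k => h (shiftBy 1 ω k)) ^ 2 ≤ _
        nlinarith [sq_nonneg (h (ω 0) - expSum r 2 n fun k => h (shiftBy 1 ω k))]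
    _ = 2 * ∫ ω, h (ω 0) ^ 2 ∂P + 2 * ∫ ω, (expSum r 2 n fun k => h (ω k)) ^ 2 ∂P := by
        rw [integral_add (hh.integrable_sq.const_mul 2) (hi'.const_mul 2), integral_const_mul,
            integral_const_mul]
        congr 2
        exact integral_comp_shiftBy hP 1
              (F := fun ω => (expSum r 2 n fun k => h (ω k)) ^ 2) hi.aestronglyMeasurable
    _ ≤ 2 * ∫ ω, h (ω 0) ^ 2 ∂P + 2 * (2 ^ 2 / (1 - r) ^ 2 * ∫ ω, h (ω 0) ^ 2 ∂P) := by
        gcongr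
        exact integral_expSum_sq_le hP hh hr0 hr1 n
    _ ≤ _ := by
        have : 1 ≤ 1 / (1 - r) ^ 2 := by
          rw [le_div_iff₀ (by positivity)]
          nlinarith
        have h2 := mul_le_mul_of_nonneg_right this hM
        have e : 10 / (1 - r) ^ 2 * ∫ ω, h (ω 0) ^ 2 ∂P =
          10 * (1 / (1 - r) ^ 2 * ∫ ω, h (ω 0) ^ 2 ∂P) := by ring
        have e' : 2 ^ 2 / (1 - r) ^ 2 * ∫ ω, h (ω 0) ^ 2 ∂P =
          4 * (1 / (1 - r) ^ 2 * ∫ ω, h (ω 0) ^ 2 ∂P) := by ring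
        rw [e, e']
        linarith

end Shift

/-- Uniform convergence of uniformly Lipschitz functions from convergence on a dense set. -/
theorem tendstoUniformlyOn_of_lipschitz {E : Type*} [NormedAddCommGroup E] {S T : Set E}
    (hS : IsCompact S) (hTS : T ⊆ S) (hT : S ⊆ closure T) {f : ℕ → E → ℝ} {l : E → ℝ} {C : ℝ}
    (hf : ∀ n, ∀ x ∈ S, ∀ y ∈ S, |f n y - f n x| ≤ C * ‖y - x‖)
    (hl : ContinuousOn l S) (h : ∀ x ∈ T, Tendsto (fun n => f n x) atTop (𝓝 (l x))) :
    TendstoUniformlyOn f l atTop S := by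
  rw [← tendstoLocallyUniformlyOn_iff_tendstoUniformlyOn_of_compact hS,
    Metric.tendstoLocallyUniformlyOn_iff]
  intro e he x hx
  obtain ⟨d, hd, hld⟩ := Metric.continuousWithinAt_iff.1 (hl x hx) (e / 8) (by positivity)
  set ρ := min d (e / (8 * (|C| + 1))) with hρ
  have hρ0 : 0 < ρ := by positivity
  obtain ⟨t, ht, hxt⟩ := Metric.mem_closure_iff.1 (hT hx) ρ hρ0
  refine ⟨S ∩ Metric.ball x ρ, inter_mem_nhdsWithin _ (Metric.ball_mem_nhds x hρ0), ?_⟩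
  filter_upwards [Metric.tendsto_nhds.1 (h t ht) (e / 4) (by positivity)] with n hn y hy
  have h1 : |f n y - f n t| ≤ e / 4 := by
    refine (hf n t (hTS ht) y hy.1).trans ?_
    have h2 : ‖y - t‖ ≤ 2 * (e / (8 * (|C| + 1))) := by
      rw [← dist_eq_norm]
      have := dist_triangle y x t
      have h3 := Metric.mem_ball.1 hy.2
      have := min_le_right d (e / (8 * (|C| + 1)))
      linarith
    calc C * ‖y - t‖ ≤ (|C| + 1) * (2 * (e / (8 * (|C| + 1)))) := by
          have := le_abs_self C
          gcongr
          linarith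
      _ = e / 4 := by field_simp; norm_num
  have h2 := hld (hTS ht) (by rw [dist_comm]; exact hxt.trans_le (min_le_left _ _))
  have h3 := hld hy.1 ((Metric.mem_ball.1 hy.2).trans_le (min_le_left _ _))
  rw [Real.dist_eq] at *
  rw [abs_lt] at *
  rw [abs_le] at h1
  constructor <;> linarith [hn.1, hn.2, h1.1, h1.2, h2.1, h2.2, h3.1, h3.2]

namespace JetSystem

variable {E : Type} [NormedAddCommGroup E] [NormedSpace ℝ E] [FiniteDimensional ℝ E]
  {𝒳 Y : Type*} [MeasurableSpace 𝒳] [MeasurableSpace Y] {Θ : Set E} {μ : Measure 𝒳}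
  [IsFiniteMeasure μ] {ϰ : ℝ} {σ : Y → ℝ}
  {K : E → Y → KernelJet 𝒳 (E →L[ℝ] ℝ) (E →L[ℝ] E →L[ℝ] ℝ)}

/-- The log likelihood of `n` observations relative to that of the parameter `θ₀`. -/
def logRatio (μ : Measure 𝒳) (K : E → Y → KernelJet 𝒳 (E →L[ℝ] ℝ) (E →L[ℝ] E →L[ℝ] ℝ))
    (θ₀ : E) (x : 𝒳) (n : ℕ) (θ : E) (ω : ℕ → Y) : ℝ :=
  Real.log ((lik μ K n θ ω).p x) - Real.log ((lik μ K n θ₀ ω).p x)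

/-- The contribution of the first observation to the relative log likelihood. -/
def logIncr (μ : Measure 𝒳) (K : E → Y → KernelJet 𝒳 (E →L[ℝ] ℝ) (E →L[ℝ] E →L[ℝ] ℝ))
    (θ₀ : E) (x : 𝒳) (n : ℕ) (θ : E) (ω : ℕ → Y) : ℝ :=
  logRatio μ K θ₀ x (n + 1) θ ω - logRatio μ K θ₀ x n θ (shiftBy 1 ω)

theorem lik_congr (n : ℕ) (θ : E) {ω ω' : ℕ → Y} (h : ∀ k < n, ω k = ω' k) :
    lik μ K n θ ω = lik μ K n θ ω' := by
  induction n generalizing ω ω' with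
  | zero => rfl
  | succ n ih =>
    rw [lik_succ, lik_succ, h 0 n.succ_pos, ih (ω := fun k => ω (k + 1)) (ω' := fun k => ω' (k + 1))
      fun k hk => h (k + 1) (by omega)]

theorem logIncr_congr (θ₀ : E) (x : 𝒳) (n : ℕ) (θ : E) {ω ω' : ℕ → Y}
    (h : ∀ k < n + 1, ω k = ω' k) : logIncr μ K θ₀ x n θ ω = logIncr μ K θ₀ x n θ ω' := by
  have h' : ∀ k < n, shiftBy 1 ω k = shiftBy 1 ω' k := fun k hk => h (k + 1) (by omega)
  simp only [logIncr, logRatio]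
  rw [lik_congr (n + 1) θ h, lik_congr (n + 1) θ₀ h, lik_congr n θ h', lik_congr n θ₀ h']

variable (H : JetSystem Θ μ ϰ σ K) {θ₀ : E} (hθ₀ : θ₀ ∈ Θ)

section Pointwise

variable {r : ℝ} (hr0 : 0 < r) (hr1 : r < 1) (hr : 1 - (ϰ ^ 2)⁻¹ ≤ r ^ 4)

include H hr0 hr1 hr

theorem second_diff (n : ℕ) {θ : E} (hθ : θ ∈ Θ) (ω : ℕ → Y) (x : 𝒳) :
    ‖((lik μ K (n + 2) θ ω).u x - (lik μ K (n + 1) θ ω).u x) -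
      ((lik μ K (n + 1) θ (shiftBy 1 ω)).u x - (lik μ K n θ (shiftBy 1 ω)).u x)‖ ≤
      KernelJet.diffConst ϰ r * r ^ n * (σ (ω 0) + expSum r 2 (n + 1) fun k => σ (ω (k + 1))) ^ 2 ∧
    ‖((lik μ K (n + 2) θ ω).w x - (lik μ K (n + 1) θ ω).w x) -
      ((lik μ K (n + 1) θ (shiftBy 1 ω)).w x - (lik μ K n θ (shiftBy 1 ω)).w x)‖ ≤
      KernelJet.diffConst ϰ r * r ^ n * (σ (ω 0) + expSum r 2 (n + 1) fun k => σ (ω (k + 1))) ^ 2 :=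
  (KernelJet.iter_second_diff norm_outer_le H.one_le_ϰ hr0 hr1 hr n (fun k => H.one_le_σ (ω k))
    (fun k => H.good θ hθ (ω k)) x x).2

include hθ₀

theorem abs_logIncr_succ_sub_le (n : ℕ) {θ : E} (hθ : θ ∈ Θ) (ω : ℕ → Y) (x : 𝒳) :
    |logIncr μ K θ₀ x (n + 1) θ ω - logIncr μ K θ₀ x n θ ω| ≤ 2 * ϰ ^ 2 * r ^ n := by
  have h1 := (KernelJet.iter_second_diff norm_outer_le H.one_le_ϰ hr0 hr1 hr n
    (fun k => H.one_le_σ (ω k)) (fun k => H.good θ hθ (ω k)) x x).1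
  have h2 := (KernelJet.iter_second_diff norm_outer_le H.one_le_ϰ hr0 hr1 hr n
    (fun k => H.one_le_σ (ω k)) (fun k => H.good θ₀ hθ₀ (ω k)) x x).1
  simp only [logIncr, logRatio, lik, shiftBy]
  rw [abs_le] at *
  constructor <;> linarith [h1.1, h1.2, h2.1, h2.2]

theorem abs_logIncr_sub_le (i j : ℕ) {θ : E} (hθ : θ ∈ Θ) (ω : ℕ → Y) (x : 𝒳) :
    |logIncr μ K θ₀ x i θ ω - logIncr μ K θ₀ x j θ ω| ≤
      2 * ϰ ^ 2 / (1 - r) * (r ^ i + r ^ j) := by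
  have h := fun n => H.abs_logIncr_succ_sub_le hθ₀ hr0 hr1 hr n hθ ω x
  have h' : ∀ n, dist (logIncr μ K θ₀ x n θ ω) (logIncr μ K θ₀ x (n + 1) θ ω) ≤
      2 * ϰ ^ 2 * r ^ n := fun n => by rw [dist_comm, Real.dist_eq]; exact h n
  obtain ⟨a, ha⟩ := cauchySeq_tendsto_of_complete (cauchySeq_of_le_geometric r _ hr1 h')
  have hi := dist_le_of_le_geometric_of_tendsto r _ hr1 h' ha i
  have hj := dist_le_of_le_geometric_of_tendsto r _ hr1 h' ha j
  rw [← Real.dist_eq]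
  refine (dist_triangle_right _ _ a).trans ((add_le_add hi hj).trans (le_of_eq ?_))
  ring

theorem abs_logRatio_sub_sum_le (N n : ℕ) {θ : E} (hθ : θ ∈ Θ) (ω : ℕ → Y) (x : 𝒳) :
    |logRatio μ K θ₀ x n θ ω - ∑ i ∈ Finset.range n, logIncr μ K θ₀ x N θ (shiftBy i ω)| ≤
      2 * ϰ ^ 2 / (1 - r) * ((1 - r)⁻¹ + n * r ^ N) := by
  have h1r : 0 < 1 - r := by linarith
  have key : |logRatio μ K θ₀ x n θ ω -
      ∑ i ∈ Finset.range n, logIncr μ K θ₀ x N θ (shiftBy i ω)| ≤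
      ∑ j ∈ Finset.range n, 2 * ϰ ^ 2 / (1 - r) * (r ^ j + r ^ N) := by
    induction n generalizing ω with
    | zero => simp [logRatio, lik, KernelJet.iter]
    | succ n ih =>
      rw [Finset.sum_range_succ', Finset.sum_range_succ]
      have e : logRatio μ K θ₀ x (n + 1) θ ω =
          logIncr μ K θ₀ x n θ ω + logRatio μ K θ₀ x n θ (shiftBy 1 ω) := by simp [logIncr]
      have h1 := ih (shiftBy 1 ω)
      simp only [shiftBy_add] at h1
      have h2 := H.abs_logIncr_sub_le hθ₀ hr0 hr1 hr n N hθ ω x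
      rw [e, show shiftBy 0 ω = ω from rfl]
      rw [abs_le] at *
      constructor <;> linarith [h1.1, h1.2, h2.1, h2.2]
  refine key.trans ?_
  rw [← Finset.mul_sum, Finset.sum_add_distrib, Finset.sum_const, Finset.card_range, nsmul_eq_mul]
  have : ∑ i ∈ Finset.range n, r ^ i ≤ (1 - r)⁻¹ := by
    rw [← tsum_geometric_of_lt_one hr0.le hr1]
    exact (summable_geometric_of_lt_one hr0.le hr1).sum_le_tsum _ fun i _ => by positivity
  gcongr

end Pointwise

end JetSystem

/-- The law of large numbers for square integrable functions of finitely many entries of a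
sequence. -/
def HasLLN {Y : Type*} [MeasurableSpace Y] (P : Measure (ℕ → Y)) : Prop :=
  ∀ (N : ℕ) (F : (ℕ → Y) → ℝ), Measurable F → (∀ ω ω', (∀ k < N, ω k = ω' k) → F ω = F ω') →
    MemLp F 2 P → ∀ᵐ ω ∂P,
      Tendsto (fun n : ℕ => (1 / (n : ℝ)) * ∑ i ∈ Finset.range n, F (shiftBy i ω)) atTop
        (𝓝 (∫ ω, F ω ∂P))

theorem norm_integral_incr_sub_le {Y V : Type*} [MeasurableSpace Y] [NormedAddCommGroup V]
    [NormedSpace ℝ V] {P : Measure (ℕ → Y)} (hP : MeasurePreserving (shiftBy 1) P P)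
    {F : ℕ → (ℕ → Y) → V} (h : ∀ n, Integrable (F n) P) {b : (ℕ → Y) → ℝ} (hb : Integrable b P)
    (n : ℕ) (hF : ∀ ω, ‖(F (n + 2) ω - F (n + 1) ω) -
      (F (n + 1) (shiftBy 1 ω) - F n (shiftBy 1 ω))‖ ≤ b ω) :
    ‖(∫ ω, F (n + 2) ω ∂P - ∫ ω, F (n + 1) ω ∂P) - (∫ ω, F (n + 1) ω ∂P - ∫ ω, F n ω ∂P)‖ ≤
      ∫ ω, b ω ∂P := by
  have h' : ∀ n, Integrable (fun ω => F n (shiftBy 1 ω)) P := fun n =>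
    (hP.integrable_comp (h n).aestronglyMeasurable).2 (h n)
  have e : (∫ ω, F (n + 2) ω ∂P - ∫ ω, F (n + 1) ω ∂P) - (∫ ω, F (n + 1) ω ∂P - ∫ ω, F n ω ∂P) =
      ∫ ω, ((F (n + 2) ω - F (n + 1) ω) - (F (n + 1) (shiftBy 1 ω) - F n (shiftBy 1 ω))) ∂P := by
    have e1 := integral_sub (h (n + 2)) (h (n + 1))
    have e2 := integral_sub (h' (n + 1)) (h' n)
    have e3 := integral_sub ((h (n + 2)).sub (h (n + 1))) ((h' (n + 1)).sub (h' n))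
    rw [integral_comp_shiftBy hP 1 (h (n + 1)).aestronglyMeasurable,
      integral_comp_shiftBy hP 1 (h n).aestronglyMeasurable] at e2
    rw [← e1, ← e2]
    exact e3.symm
  rw [e]
  exact norm_integral_le_of_norm_le hb (.of_forall hF)

namespace JetSystem

variable {E : Type} [NormedAddCommGroup E] [NormedSpace ℝ E] [FiniteDimensional ℝ E]
  {𝒳 Y : Type*} [MeasurableSpace 𝒳] [MeasurableSpace Y] {Θ : Set E} {μ : Measure 𝒳}
  [IsFiniteMeasure μ] {ϰ : ℝ} {σ : Y → ℝ}
  {K : E → Y → KernelJet 𝒳 (E →L[ℝ] ℝ) (E →L[ℝ] E →L[ℝ] ℝ)}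

/-- The mean relative log likelihood of `n` observations. -/
def meanLog (μ : Measure 𝒳) (K : E → Y → KernelJet 𝒳 (E →L[ℝ] ℝ) (E →L[ℝ] E →L[ℝ] ℝ))
    (P : Measure (ℕ → Y)) (θ₀ : E) (x : 𝒳) (n : ℕ) (θ : E) : ℝ :=
  ∫ ω, logRatio μ K θ₀ x n θ ω ∂P

/-- The mean gradient of the log likelihood of `n` observations. -/
def meanGrad (μ : Measure 𝒳) (K : E → Y → KernelJet 𝒳 (E →L[ℝ] ℝ) (E →L[ℝ] E →L[ℝ] ℝ))
    (P : Measure (ℕ → Y)) (x : 𝒳) (n : ℕ) (θ : E) : E →L[ℝ] ℝ :=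
  ∫ ω, (lik μ K n θ ω).u x ∂P

/-- The mean Hessian of the log likelihood of `n` observations. -/
def meanHess (μ : Measure 𝒳) (K : E → Y → KernelJet 𝒳 (E →L[ℝ] ℝ) (E →L[ℝ] E →L[ℝ] ℝ))
    (P : Measure (ℕ → Y)) (x : 𝒳) (n : ℕ) (θ : E) : E →L[ℝ] E →L[ℝ] ℝ :=
  ∫ ω, (lik μ K n θ ω).w x ∂P

variable {P : Measure (ℕ → Y)}

theorem measurable_logRatio (H : JetSystem Θ μ ϰ σ K) {θ₀ : E} (hθ₀ : θ₀ ∈ Θ) (x : 𝒳) (n : ℕ)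
    {θ : E} (hθ : θ ∈ Θ) : Measurable (logRatio μ K θ₀ x n θ) :=
  (H.measurable_lik_left n hθ x).log.sub (H.measurable_lik_left n hθ₀ x).log

theorem measurable_logIncr (H : JetSystem Θ μ ϰ σ K) {θ₀ : E} (hθ₀ : θ₀ ∈ Θ) (x : 𝒳) (n : ℕ)
    {θ : E} (hθ : θ ∈ Θ) : Measurable (logIncr μ K θ₀ x n θ) :=
  (H.measurable_logRatio hθ₀ x (n + 1) hθ).sub
    ((H.measurable_logRatio hθ₀ x n hθ).comp (measurable_shiftBy 1))

section Integrated

variable (H : JetSystem Θ μ ϰ σ K) {θ₀ : E} (hθ₀ : θ₀ ∈ Θ) (hS : LengthQuasiconvex Θ)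
  (hU : UniqueDiffOn ℝ Θ) (hP : MeasurePreserving (shiftBy 1) P P)
  (hσ : MemLp (fun ω => σ (ω 0)) 2 P)

include H hS hU hP hσ

theorem memLp_logRatio (hθ₀ : θ₀ ∈ Θ) (x : 𝒳) (n : ℕ) {θ : E} (hθ : θ ∈ Θ) :
    MemLp (logRatio μ K θ₀ x n θ) 2 P := by
  obtain ⟨L, hL0, hL⟩ := H.abs_log_lik_sub_le hU hS
  refine ((memLp_sum_coord hP hσ n).const_mul (L * ‖θ - θ₀‖)).of_le
    (H.measurable_logRatio hθ₀ x n hθ).aestronglyMeasurable (.of_forall fun ω => ?_)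
  refine (hL n ω x θ₀ hθ₀ θ hθ).trans (le_abs_self _)

theorem memLp_logIncr (hθ₀ : θ₀ ∈ Θ) (x : 𝒳) (n : ℕ) {θ : E} (hθ : θ ∈ Θ) :
    MemLp (logIncr μ K θ₀ x n θ) 2 P :=
  (H.memLp_logRatio hS hU hP hσ hθ₀ x (n + 1) hθ).sub
    ((H.memLp_logRatio hS hU hP hσ hθ₀ x n hθ).comp_measurePreserving hP)

theorem hasFDerivWithinAt_meanLog [IsFiniteMeasure P] (hθ₀ : θ₀ ∈ Θ) (x : 𝒳) (n : ℕ) {θ : E}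
    (hθ : θ ∈ Θ) :
    Integrable (fun ω => (lik μ K n θ ω).u x) P ∧
    HasFDerivWithinAt (meanLog μ K P θ₀ x n) (meanGrad μ K P x n θ) Θ θ :=
  hasFDerivWithinAt_integral hS hU
    (fun _ hθ => (H.memLp_logRatio hS hU hP hσ hθ₀ x n hθ).integrable one_le_two)
    (.of_forall fun ω _ hθ => ((H.log_lik hS hU n ω x).1 _ hθ).sub_const _)
    (.of_forall fun ω _ hθ => (H.lik_norm_le n hθ ω x).1)
    ((memLp_sum_coord hP hσ n).integrable one_le_two) hθ

theorem hasFDerivWithinAt_meanGrad [IsFiniteMeasure P] (x : 𝒳) (n : ℕ) {θ : E} (hθ : θ ∈ Θ) :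
    Integrable (fun ω => (lik μ K n θ ω).w x) P ∧
    HasFDerivWithinAt (meanGrad μ K P x n) (meanHess μ K P x n θ) Θ θ :=
  hasFDerivWithinAt_integral hS hU
    (fun _ hθ => (H.hasFDerivWithinAt_meanLog hS hU hP hσ hθ x n hθ).1)
    (.of_forall fun ω _ hθ => (H.log_lik hS hU n ω x).2.1 _ hθ)
    (.of_forall fun ω _ hθ => (H.lik_norm_le n hθ ω x).2)
    ((memLp_sum_coord hP hσ n).integrable_sq.const_mul _) hθ

theorem continuousOn_meanHess [IsFiniteMeasure P] (x : 𝒳) (n : ℕ) :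
    ContinuousOn (meanHess μ K P x n) Θ :=
  continuousOn_of_dominated
    (fun _ hθ => (H.hasFDerivWithinAt_meanGrad hS hU hP hσ x n hθ).1.aestronglyMeasurable)
    (fun _ hθ => .of_forall fun ω => (H.lik_norm_le n hθ ω x).2)
    ((memLp_sum_coord hP hσ n).integrable_sq.const_mul _)
    (.of_forall fun ω => (H.log_lik hS hU n ω x).2.2)

theorem integral_logIncr [IsFiniteMeasure P] (hθ₀ : θ₀ ∈ Θ) (x : 𝒳) (n : ℕ) {θ : E} (hθ : θ ∈ Θ) :
    ∫ ω, logIncr μ K θ₀ x n θ ω ∂P = meanLog μ K P θ₀ x (n + 1) θ - meanLog μ K P θ₀ x n θ := by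
  have h1 := (H.memLp_logRatio hS hU hP hσ hθ₀ x (n + 1) hθ).integrable one_le_two
  have h2 := (H.memLp_logRatio hS hU hP hσ hθ₀ x n hθ).integrable one_le_two
  have h3 : Integrable (fun ω => logRatio μ K θ₀ x n θ (shiftBy 1 ω)) P :=
    (hP.integrable_comp h2.aestronglyMeasurable).2 h2
  simp only [logIncr]
  rw [integral_sub h1 h3, integral_comp_shiftBy hP 1 h2.aestronglyMeasurable]
  rfl

variable {r : ℝ} (hr0 : 0 < r) (hr1 : r < 1) (hr : 1 - (ϰ ^ 2)⁻¹ ≤ r ^ 4)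

include hr0 hr1 hr

theorem abs_meanLog_incr_sub_le [IsProbabilityMeasure P] (hθ₀ : θ₀ ∈ Θ) (x : 𝒳) (n : ℕ) {θ : E}
    (hθ : θ ∈ Θ) :
    |(meanLog μ K P θ₀ x (n + 2) θ - meanLog μ K P θ₀ x (n + 1) θ) -
      (meanLog μ K P θ₀ x (n + 1) θ - meanLog μ K P θ₀ x n θ)| ≤ 2 * ϰ ^ 2 * r ^ n := by
  have h := fun n => (H.memLp_logIncr hS hU hP hσ hθ₀ x n hθ).integrable one_le_two
  rw [← H.integral_logIncr hS hU hP hσ hθ₀ x (n + 1) hθ,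
    ← H.integral_logIncr hS hU hP hσ hθ₀ x n hθ, ← integral_sub (h _) (h _), ← Real.norm_eq_abs]
  refine (norm_integral_le_of_norm_le (integrable_const (2 * ϰ ^ 2 * r ^ n))
    (.of_forall fun ω => H.abs_logIncr_succ_sub_le hθ₀ hr0 hr1 hr n hθ ω x)).trans ?_
  simp

/-- The constant in the rate of convergence of the means. -/
def _root_.memoryConst (ϰ r M : ℝ) : ℝ := KernelJet.diffConst ϰ r * (10 / (1 - r) ^ 2 * M)

theorem norm_meanGrad_incr_sub_le [IsProbabilityMeasure P] (x : 𝒳) (n : ℕ) {θ : E}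
    (hθ : θ ∈ Θ) :
    ‖(meanGrad μ K P x (n + 2) θ - meanGrad μ K P x (n + 1) θ) -
      (meanGrad μ K P x (n + 1) θ - meanGrad μ K P x n θ)‖ ≤
      memoryConst ϰ r (∫ ω, σ (ω 0) ^ 2 ∂P) * r ^ n := by
  have h := fun n => (H.hasFDerivWithinAt_meanLog hS hU hP hσ hθ x n hθ).1
  have hm := integral_memory_sq_le hP hσ hr0 hr1 (n + 1)
  have hC := KernelJet.diffConst_nonneg (ϰ := ϰ) hr0 hr1
  refine (norm_integral_incr_sub_le hP h (hm.1.const_mul (KernelJet.diffConst ϰ r * r ^ n)) n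
    fun ω => (H.second_diff hr0 hr1 hr n hθ ω x).1).trans ?_
  rw [integral_const_mul]
  calc _ ≤ KernelJet.diffConst ϰ r * r ^ n * (10 / (1 - r) ^ 2 * ∫ ω, σ (ω 0) ^ 2 ∂P) := by
        gcongr; exact hm.2
    _ = _ := by rw [memoryConst]; ring

theorem norm_meanHess_incr_sub_le [IsProbabilityMeasure P] (x : 𝒳) (n : ℕ) {θ : E}
    (hθ : θ ∈ Θ) :
    ‖(meanHess μ K P x (n + 2) θ - meanHess μ K P x (n + 1) θ) -
      (meanHess μ K P x (n + 1) θ - meanHess μ K P x n θ)‖ ≤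
      memoryConst ϰ r (∫ ω, σ (ω 0) ^ 2 ∂P) * r ^ n := by
  have h := fun n => (H.hasFDerivWithinAt_meanGrad hS hU hP hσ x n hθ).1
  have hm := integral_memory_sq_le hP hσ hr0 hr1 (n + 1)
  have hC := KernelJet.diffConst_nonneg (ϰ := ϰ) hr0 hr1
  refine (norm_integral_incr_sub_le hP h (hm.1.const_mul (KernelJet.diffConst ϰ r * r ^ n)) n
    fun ω => (H.second_diff hr0 hr1 hr n hθ ω x).2).trans ?_
  rw [integral_const_mul]
  calc _ ≤ KernelJet.diffConst ϰ r * r ^ n * (10 / (1 - r) ^ 2 * ∫ ω, σ (ω 0) ^ 2 ∂P) := by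
        gcongr; exact hm.2
    _ = _ := by rw [memoryConst]; ring

end Integrated

end JetSystem

/-- Increments whose differences decay geometrically. -/
theorem exists_limit_of_geometric {α V : Type*} [NormedAddCommGroup V] [CompleteSpace V] {S : Set α}
    {r C : ℝ} (hr1 : r < 1) {I : ℕ → α → V}
    (h : ∀ n, ∀ x ∈ S, ‖I (n + 1) x - I n x‖ ≤ C * r ^ n) :
    ∃ l : α → V, ∀ n, ∀ x ∈ S, ‖I n x - l x‖ ≤ C / (1 - r) * r ^ n := by
  have key : ∀ x, ∃ a, x ∈ S → ∀ n, ‖I n x - a‖ ≤ C / (1 - r) * r ^ n := fun x => by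
    by_cases hx : x ∈ S
    · have h' : ∀ n, dist (I n x) (I (n + 1) x) ≤ C * r ^ n := fun n => by
        rw [dist_comm, dist_eq_norm]; exact h n x hx
      obtain ⟨a, ha⟩ := cauchySeq_tendsto_of_complete (cauchySeq_of_le_geometric r _ hr1 h')
      refine ⟨a, fun _ n => ?_⟩
      rw [← dist_eq_norm]
      refine (dist_le_of_le_geometric_of_tendsto r _ hr1 h' ha n).trans (le_of_eq (by ring))
    · exact ⟨0, fun h => absurd h hx⟩
  choose l hl using key
  exact ⟨l, fun n x hx => hl x hx n⟩

theorem tendstoUniformlyOn_of_geometric {α V : Type*} [NormedAddCommGroup V] {S : Set α}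
    {r C : ℝ} (hr0 : 0 ≤ r) (hr1 : r < 1) {I : ℕ → α → V} {l : α → V}
    (h : ∀ n, ∀ x ∈ S, ‖I n x - l x‖ ≤ C * r ^ n) : TendstoUniformlyOn I l atTop S := by
  rw [Metric.tendstoUniformlyOn_iff]
  intro e he
  have : Tendsto (fun n : ℕ => C * r ^ n) atTop (𝓝 (C * 0)) :=
    (tendsto_pow_atTop_nhds_zero_of_lt_one hr0 hr1).const_mul C
  rw [mul_zero] at this
  filter_upwards [this.eventually (gt_mem_nhds he)] with n hn x hx
  rw [dist_comm, dist_eq_norm]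
  exact (h n x hx).trans_lt hn

/-- The partial sums of increments that converge geometrically grow linearly, up to a constant. -/
theorem norm_sub_smul_le_of_geometric {V : Type*} [NormedAddCommGroup V] [NormedSpace ℝ V]
    {r C : ℝ} (hr0 : 0 ≤ r) (hr1 : r < 1) (hC : 0 ≤ C) {A : ℕ → V} {l : V} (h0 : A 0 = 0)
    (h : ∀ n, ‖A (n + 1) - A n - l‖ ≤ C * r ^ n) (n : ℕ) : ‖A n - (n : ℝ) • l‖ ≤ C / (1 - r) := by
  have key : ‖A n - (n : ℝ) • l‖ ≤ C * ∑ i ∈ Finset.range n, r ^ i := by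
    induction n with
    | zero => simp [h0]
    | succ n ih =>
      rw [Finset.sum_range_succ, mul_add]
      calc ‖A (n + 1) - ((n + 1 : ℕ) : ℝ) • l‖
          = ‖(A n - (n : ℝ) • l) + (A (n + 1) - A n - l)‖ := by
            congr 1; push_cast; rw [add_smul, one_smul]; abel
        _ ≤ _ := (norm_add_le _ _).trans (add_le_add ih (h n))
  refine key.trans ?_
  rw [div_eq_mul_inv, ← tsum_geometric_of_lt_one hr0 hr1]
  gcongr
  exact (summable_geometric_of_lt_one hr0 hr1).sum_le_tsum _ fun i _ => by positivity

namespace JetSystem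

variable {E : Type} [NormedAddCommGroup E] [NormedSpace ℝ E] [FiniteDimensional ℝ E]
  {𝒳 Y : Type*} [MeasurableSpace 𝒳] [MeasurableSpace Y] {Θ : Set E} {μ : Measure 𝒳}
  [IsFiniteMeasure μ] {ϰ : ℝ} {σ : Y → ℝ}
  {K : E → Y → KernelJet 𝒳 (E →L[ℝ] ℝ) (E →L[ℝ] E →L[ℝ] ℝ)} {P : Measure (ℕ → Y)}

/-- `l` is the limit of the mean relative log likelihoods per observation, with derivatives `l'`
and `l''`. -/
structure IsLimit (Θ : Set E) (μ : Measure 𝒳) (ϰ : ℝ) (σ : Y → ℝ)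
    (K : E → Y → KernelJet 𝒳 (E →L[ℝ] ℝ) (E →L[ℝ] E →L[ℝ] ℝ)) (P : Measure (ℕ → Y)) (θ₀ : E)
    (x : 𝒳) (r : ℝ) (l : E → ℝ) (l' : E → E →L[ℝ] ℝ) (l'' : E → E →L[ℝ] E →L[ℝ] ℝ) : Prop where
  d1 : ∀ θ ∈ Θ, HasFDerivWithinAt l (l' θ) Θ θ
  d2 : ∀ θ ∈ Θ, HasFDerivWithinAt l' (l'' θ) Θ θ
  cont : ContinuousOn l'' Θ
  incr : ∀ n, ∀ θ ∈ Θ, |meanLog μ K P θ₀ x (n + 1) θ - meanLog μ K P θ₀ x n θ - l θ| ≤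
    2 * ϰ ^ 2 / (1 - r) * r ^ n
  incr₁ : ∀ n, ∀ θ ∈ Θ, ‖meanGrad μ K P x (n + 1) θ - meanGrad μ K P x n θ - l' θ‖ ≤
    memoryConst ϰ r (∫ ω, σ (ω 0) ^ 2 ∂P) / (1 - r) * r ^ n
  incr₂ : ∀ n, ∀ θ ∈ Θ, ‖meanHess μ K P x (n + 1) θ - meanHess μ K P x n θ - l'' θ‖ ≤
    memoryConst ϰ r (∫ ω, σ (ω 0) ^ 2 ∂P) / (1 - r) * r ^ n

section Limit

variable [IsProbabilityMeasure P] (H : JetSystem Θ μ ϰ σ K) {θ₀ : E} (hθ₀ : θ₀ ∈ Θ)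
  (hS : LengthQuasiconvex Θ)
  (hU : UniqueDiffOn ℝ Θ) (hP : MeasurePreserving (shiftBy 1) P P)
  (hσ : MemLp (fun ω => σ (ω 0)) 2 P)
  {r : ℝ} (hr0 : 0 < r) (hr1 : r < 1) (hr : 1 - (ϰ ^ 2)⁻¹ ≤ r ^ 4)

include H hθ₀ hS hU hP hσ hr0 hr1 hr

theorem exists_isLimit (x : 𝒳) : ∃ l l' l'', IsLimit Θ μ ϰ σ K P θ₀ x r l l' l'' := by
  obtain ⟨l, hl⟩ := exists_limit_of_geometric (S := Θ) (C := 2 * ϰ ^ 2) hr1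
    (I := fun n θ => meanLog μ K P θ₀ x (n + 1) θ - meanLog μ K P θ₀ x n θ)
    fun n θ hθ => H.abs_meanLog_incr_sub_le hS hU hP hσ hr0 hr1 hr hθ₀ x n hθ
  obtain ⟨l', hl'⟩ := exists_limit_of_geometric (S := Θ) hr1
    (I := fun n θ => meanGrad μ K P x (n + 1) θ - meanGrad μ K P x n θ)
    fun n θ hθ => H.norm_meanGrad_incr_sub_le hS hU hP hσ hr0 hr1 hr x n hθ
  obtain ⟨l'', hl''⟩ := exists_limit_of_geometric (S := Θ) hr1
    (I := fun n θ => meanHess μ K P x (n + 1) θ - meanHess μ K P x n θ)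
    fun n θ hθ => H.norm_meanHess_incr_sub_le hS hU hP hσ hr0 hr1 hr x n hθ
  have u := tendstoUniformlyOn_of_geometric hr0.le hr1 hl
  have u' := tendstoUniformlyOn_of_geometric hr0.le hr1 hl'
  have u'' := tendstoUniformlyOn_of_geometric hr0.le hr1 hl''
  have c'' : ∀ n, ContinuousOn
      (fun θ => meanHess μ K P x (n + 1) θ - meanHess μ K P x n θ) Θ := fun n =>
    (H.continuousOn_meanHess hS hU hP hσ x (n + 1)).sub (H.continuousOn_meanHess hS hU hP hσ x n)
  have d2 : ∀ n, ∀ θ ∈ Θ, HasFDerivWithinAt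
      (fun θ => meanGrad μ K P x (n + 1) θ - meanGrad μ K P x n θ)
      (meanHess μ K P x (n + 1) θ - meanHess μ K P x n θ) Θ θ := fun n θ hθ =>
    (H.hasFDerivWithinAt_meanGrad hS hU hP hσ x (n + 1) hθ).2.sub
      (H.hasFDerivWithinAt_meanGrad hS hU hP hσ x n hθ).2
  have d1 : ∀ n, ∀ θ ∈ Θ, HasFDerivWithinAt
      (fun θ => meanLog μ K P θ₀ x (n + 1) θ - meanLog μ K P θ₀ x n θ)
      (meanGrad μ K P x (n + 1) θ - meanGrad μ K P x n θ) Θ θ := fun n θ hθ =>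
    (H.hasFDerivWithinAt_meanLog hS hU hP hσ hθ₀ x (n + 1) hθ).2.sub
      (H.hasFDerivWithinAt_meanLog hS hU hP hσ hθ₀ x n hθ).2
  refine ⟨l, l', l'', fun θ hθ => ?_, fun θ hθ => ?_, u''.continuousOn (.of_forall c''),
    hl, hl', hl''⟩
  · exact hasFDerivWithinAt_of_tendsto hS d1
      (fun n θ hθ => (d2 n θ hθ).continuousWithinAt) (fun θ hθ => u.tendsto_at hθ) u' hθ
  · exact hasFDerivWithinAt_of_tendsto hS d2 c'' (fun θ hθ => u'.tendsto_at hθ) u'' hθ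

/-- Almost surely, the relative log likelihoods per observation converge uniformly. -/
theorem ae_tendstoUniformlyOn (hΘ : IsCompact Θ) (hlln : HasLLN P) {x : 𝒳} {l : E → ℝ}
    {l' : E → E →L[ℝ] ℝ} {l'' : E → E →L[ℝ] E →L[ℝ] ℝ}
    (hl : IsLimit Θ μ ϰ σ K P θ₀ x r l l' l'') (x₀ : 𝒳) :
    ∀ᵐ ω ∂P, TendstoUniformlyOn (fun (n : ℕ) θ => (1 / (n : ℝ)) * logRatio μ K θ₀ x₀ n θ ω) l
      atTop Θ := by
  have h1r : 0 < 1 - r := by linarith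
  obtain ⟨T, hTS, hTc, hT⟩ : ∃ T ⊆ Θ, T.Countable ∧ Θ ⊆ closure T :=
    (TopologicalSpace.IsSeparable.of_separableSpace Θ).exists_countable_dense_subset
  obtain ⟨L, hL0, hL⟩ := H.abs_log_lik_sub_le hU hS
  have hinc : ∀ᵐ ω ∂P, ∀ θ ∈ T, ∀ N : ℕ, Tendsto (fun n : ℕ => (1 / (n : ℝ)) *
      ∑ i ∈ Finset.range n, logIncr μ K θ₀ x N θ (shiftBy i ω)) atTop
        (𝓝 (meanLog μ K P θ₀ x (N + 1) θ - meanLog μ K P θ₀ x N θ)) := by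
    rw [ae_ball_iff hTc]
    intro θ hθ
    rw [ae_all_iff]
    intro N
    rw [← H.integral_logIncr hS hU hP hσ hθ₀ x N (hTS hθ)]
    exact hlln (N + 1) _ (H.measurable_logIncr hθ₀ x N (hTS hθ))
      (fun ω ω' h => logIncr_congr θ₀ x N θ h)
      (H.memLp_logIncr hS hU hP hσ hθ₀ x N (hTS hθ))
  have hsum := hlln 1 (fun ω => σ (ω 0)) (H.measurable_σ.comp (measurable_pi_apply 0))
    (fun ω ω' h => by rw [h 0 one_pos]) hσ
  filter_upwards [hinc, hsum] with ω hω hσω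
  obtain ⟨B, hB⟩ := hσω.bddAbove_range
  refine tendstoUniformlyOn_of_lipschitz (C := L * B) hΘ hTS hT (fun n θ hθ θ' hθ' => ?_)
    (fun θ hθ => (hl.d1 θ hθ).continuousWithinAt) fun θ hθ => ?_
  · rw [← mul_sub, abs_mul, abs_of_nonneg (by positivity)]
    have h1 := hL n ω x₀ θ hθ θ' hθ'
    have h2 : (1 / (n : ℝ)) * ∑ k ∈ Finset.range n, σ (ω k) ≤ B := by
      have := hB ⟨n, rfl⟩
      simpa [shiftBy] using this
    calc (1 / (n : ℝ)) * |logRatio μ K θ₀ x₀ n θ' ω - logRatio μ K θ₀ x₀ n θ ω|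
        ≤ (1 / (n : ℝ)) * (L * ‖θ' - θ‖ * ∑ k ∈ Finset.range n, σ (ω k)) := by
          gcongr
          simpa [logRatio] using h1
      _ = L * ‖θ' - θ‖ * ((1 / (n : ℝ)) * ∑ k ∈ Finset.range n, σ (ω k)) := by ring
      _ ≤ L * ‖θ' - θ‖ * B := by gcongr
      _ = _ := by ring
  · rw [Metric.tendsto_atTop]
    intro e he
    set C := 2 * ϰ ^ 2 / (1 - r) with hC
    have hC0 : 0 ≤ C := by have := H.one_le_ϰ; positivity
    have hpow : Tendsto (fun N : ℕ => C * r ^ N) atTop (𝓝 (C * 0)) :=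
      (tendsto_pow_atTop_nhds_zero_of_lt_one hr0.le hr1).const_mul C
    rw [mul_zero] at hpow
    obtain ⟨N, hN⟩ := (hpow.eventually (gt_mem_nhds (by positivity : 0 < e / 4))).exists
    have hlim : Tendsto (fun n : ℕ => (1 / (n : ℝ)) * (C * (1 - r)⁻¹ + 2 * Real.log ϰ)) atTop
        (𝓝 (0 * (C * (1 - r)⁻¹ + 2 * Real.log ϰ))) :=
      tendsto_one_div_atTop_nhds_zero_nat.mul_const _
    rw [zero_mul] at hlim
    obtain ⟨n₁, hn₁⟩ := eventually_atTop.1 (hlim.eventually (gt_mem_nhds (by positivity : 0 < e / 4)))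
    obtain ⟨n₂, hn₂⟩ := Metric.tendsto_atTop.1 (hω θ hθ N) (e / 4) (by positivity)
    refine ⟨max (max n₁ n₂) 1, fun n hn => ?_⟩
    have hn1 : 1 ≤ n := (le_max_right _ _).trans hn
    have hn0 : (0 : ℝ) < n := by exact_mod_cast hn1
    have a1 := hn₁ n ((le_max_left _ _).trans ((le_max_left _ _).trans hn))
    have a2 := hn₂ n ((le_max_right _ _).trans ((le_max_left _ _).trans hn))
    have a3 := hl.incr N θ (hTS hθ)
    have a4 := H.abs_logRatio_sub_sum_le hθ₀ hr0 hr1 hr N n (hTS hθ) ω x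
    have a5 : |logRatio μ K θ₀ x₀ n θ ω - logRatio μ K θ₀ x n θ ω| ≤ 2 * Real.log ϰ := by
      have b1 := H.abs_log_lik_sub_le_harnack n (hTS hθ) ω x₀ x
      have b2 := H.abs_log_lik_sub_le_harnack n hθ₀ ω x₀ x
      simp only [logRatio]
      rw [abs_le] at *
      constructor <;> linarith [b1.1, b1.2, b2.1, b2.2]
    set s := ∑ i ∈ Finset.range n, logIncr μ K θ₀ x N θ (shiftBy i ω)
    have a6 : |logRatio μ K θ₀ x₀ n θ ω - s| ≤ C * (1 - r)⁻¹ + 2 * Real.log ϰ + n * (C * r ^ N) := by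
      refine (abs_sub_le _ (logRatio μ K θ₀ x n θ ω) _).trans ((add_le_add a5 a4).trans
        (le_of_eq ?_))
      ring
    have a7 : |1 / (n : ℝ) * logRatio μ K θ₀ x₀ n θ ω - 1 / (n : ℝ) * s| ≤
        1 / (n : ℝ) * (C * (1 - r)⁻¹ + 2 * Real.log ϰ) + C * r ^ N := by
      rw [← mul_sub, abs_mul, abs_of_pos (by positivity)]
      calc _ ≤ 1 / (n : ℝ) * (C * (1 - r)⁻¹ + 2 * Real.log ϰ + n * (C * r ^ N)) := by gcongr
        _ = _ := by field_simp
    rw [Real.dist_eq] at *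
    rw [abs_lt] at *
    rw [abs_le] at a3 a7
    constructor <;> linarith [a2.1, a2.2, a3.1, a3.2, a7.1, a7.2]

theorem abs_meanLog_sub_le {x : 𝒳} {l : E → ℝ}
    {l' : E → E →L[ℝ] ℝ} {l'' : E → E →L[ℝ] E →L[ℝ] ℝ}
    (hl : IsLimit Θ μ ϰ σ K P θ₀ x r l l' l'') (n : ℕ) {θ : E} (hθ : θ ∈ Θ) :
    |meanLog μ K P θ₀ x n θ - n * l θ| ≤ 2 * ϰ ^ 2 / (1 - r) / (1 - r) := by
  have h1r : 0 < 1 - r := by linarith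
  exact norm_sub_smul_le_of_geometric (V := ℝ) hr0.le hr1 (by have := H.one_le_ϰ; positivity)
    (A := fun n => meanLog μ K P θ₀ x n θ) (by simp [meanLog, logRatio, lik, KernelJet.iter])
    (fun n => hl.incr n θ hθ) n

theorem norm_meanGrad_sub_le {x : 𝒳} {l : E → ℝ}
    {l' : E → E →L[ℝ] ℝ} {l'' : E → E →L[ℝ] E →L[ℝ] ℝ}
    (hl : IsLimit Θ μ ϰ σ K P θ₀ x r l l' l'') (n : ℕ) {θ : E} (hθ : θ ∈ Θ) :
    ‖meanGrad μ K P x n θ - (n : ℝ) • l' θ‖ ≤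
      memoryConst ϰ r (∫ ω, σ (ω 0) ^ 2 ∂P) / (1 - r) / (1 - r) := by
  have h1r : 0 < 1 - r := by linarith
  have hC := KernelJet.diffConst_nonneg (ϰ := ϰ) hr0 hr1
  have hM : 0 ≤ ∫ ω, σ (ω 0) ^ 2 ∂P := integral_nonneg fun ω => sq_nonneg _
  exact norm_sub_smul_le_of_geometric hr0.le hr1 (by rw [memoryConst]; positivity)
    (A := fun n => meanGrad μ K P x n θ) (by simp [meanGrad, lik, KernelJet.iter])
    (fun n => hl.incr₁ n θ hθ) n

end Limit

end JetSystem

/-! ### Homogeneous Markov chains -/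

section Chain

variable {Z : Type*} [MeasurableSpace Z]

/-- Prepend an element to a sequence. -/
def consSeq (z : Z) (ω : ℕ → Z) : ℕ → Z
  | 0 => z
  | k + 1 => ω k

theorem measurable_consSeq : Measurable fun p : Z × (ℕ → Z) => consSeq p.1 p.2 := by
  refine measurable_pi_lambda _ fun k => ?_
  cases k with
  | zero => exact measurable_fst
  | succ k => exact (measurable_pi_apply k).comp measurable_snd

theorem shiftBy_consSeq (z : Z) (ω : ℕ → Z) : shiftBy 1 (consSeq z ω) = ω := rfl

/-- A finite measure on sequences is determined by its values on boxes. -/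
theorem measure_ext_of_boxes {P Q : Measure (ℕ → Z)} [IsProbabilityMeasure P]
    [IsProbabilityMeasure Q] (h : ∀ (n : ℕ) (t : ℕ → Set Z), (∀ k, MeasurableSet (t k)) →
      ∫⁻ ω, ∏ k ∈ Finset.range (n + 1), (t k).indicator 1 (ω k) ∂P =
      ∫⁻ ω, ∏ k ∈ Finset.range (n + 1), (t k).indicator 1 (ω k) ∂Q) : P = Q := by
  classical
  refine ext_of_generate_finite (squareCylinders fun _ : ℕ => {s : Set Z | MeasurableSet s})
    (generateFrom_squareCylinders (α := fun _ : ℕ => Z)).symm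
    (isPiSystem_squareCylinders (fun _ => MeasurableSpace.isPiSystem_measurableSet)
      fun _ => MeasurableSet.univ) ?_ (by simp)
  rintro _ ⟨s, t, ht, rfl⟩
  set n := s.sup id
  let t' : ℕ → Set Z := fun k => if k ∈ s then t k else univ
  have ht' : ∀ k, MeasurableSet (t' k) := fun k => by
    by_cases hk : k ∈ s
    · simpa [t', hk] using ht k trivial
    · simp [t', hk]
  have hs : ∀ k ∈ s, k < n + 1 := fun k hk => Nat.lt_succ_of_le (Finset.le_sup (f := id) hk)
  have e : ∀ ω : ℕ → Z, ∏ k ∈ Finset.range (n + 1), (t' k).indicator (1 : Z → ℝ≥0∞) (ω k) =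
      ((s : Set ℕ).pi t).indicator 1 ω := fun ω => by
    by_cases hω : ω ∈ (s : Set ℕ).pi t
    · rw [indicator_of_mem hω]
      refine Finset.prod_eq_one fun k _ => ?_
      by_cases hks : k ∈ s
      · have : ω k ∈ t' k := by simpa [t', hks] using hω k hks
        rw [indicator_of_mem this, Pi.one_apply]
      · simp [t', hks]
    · rw [indicator_of_notMem hω]
      obtain ⟨k, hk, hk'⟩ : ∃ k ∈ s, ω k ∉ t k := by
        by_contra! hcon
        exact hω fun k hk => hcon k hk
      refine Finset.prod_eq_zero (Finset.mem_range.2 (hs k hk)) ?_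
      rw [indicator_of_notMem]
      simpa [t', hk] using hk'
  have hm : MeasurableSet ((s : Set ℕ).pi t) :=
    MeasurableSet.pi s.countable_toSet fun k _ => ht k trivial
  have := h n t' ht'
  simp only [e] at this
  rwa [lintegral_indicator_one hm, lintegral_indicator_one hm] at this

variable (J : Kernel Z Z) [IsMarkovKernel J]

/-- The law of the Markov chain with transition kernel `J` and initial law `init`. -/
def chainLaw (init : Measure Z) : Measure (ℕ → Z) :=
  Kernel.trajMeasure (X := fun _ => Z) init fun n =>
    J.comap (fun h : (i : Finset.Iic n) → Z => h ⟨n, Finset.mem_Iic.2 le_rfl⟩)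
      (measurable_pi_apply _)

instance (init : Measure Z) [IsProbabilityMeasure init] : IsProbabilityMeasure (chainLaw J init) :=
  inferInstanceAs (IsProbabilityMeasure (Kernel.trajMeasure (X := fun _ => Z) init _))

/-- The law of the Markov chain as a function of the initial state. -/
def chainKernel : Kernel Z (ℕ → Z) :=
  (Kernel.traj (X := fun _ => Z) (fun n =>
    J.comap (fun h : (i : Finset.Iic n) → Z => h ⟨n, Finset.mem_Iic.2 le_rfl⟩)
      (measurable_pi_apply _)) 0).comap
    (MeasurableEquiv.piUnique fun _ : Finset.Iic 0 => Z).symm (MeasurableEquiv.measurable _)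

instance : IsMarkovKernel (chainKernel J) := by
  unfold chainKernel; infer_instance

theorem chainLaw_eq_bind (init : Measure Z) : chainLaw J init = init.bind (chainKernel J) := by
  rw [chainLaw, Kernel.trajMeasure, chainKernel]
  ext s hs
  rw [Measure.bind_apply hs (Kernel.aemeasurable _), Measure.bind_apply hs (Kernel.aemeasurable _),
    lintegral_map (Kernel.measurable_coe _ hs) (MeasurableEquiv.measurable _)]
  rfl

theorem chainLaw_dirac (z : Z) : chainLaw J (Measure.dirac z) = chainKernel J z := by
  rw [chainLaw_eq_bind, Measure.dirac_bind (Kernel.measurable _)]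

theorem lintegral_chainLaw (init : Measure Z) {F : (ℕ → Z) → ℝ≥0∞} (hF : Measurable F) :
    ∫⁻ ω, F ω ∂chainLaw J init = ∫⁻ z, ∫⁻ ω, F ω ∂chainKernel J z ∂init := by
  rw [chainLaw_eq_bind, Measure.lintegral_bind (Kernel.aemeasurable _) hF.aemeasurable]

theorem map_eval_zero_chainKernel (z : Z) :
    (chainKernel J z).map (fun ω => ω 0) = Measure.dirac z := by
  have h := Kernel.traj_map_frestrictLe (X := fun _ => Z) (κ := fun n =>
    J.comap (fun h : (i : Finset.Iic n) → Z => h ⟨n, Finset.mem_Iic.2 le_rfl⟩)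
      (measurable_pi_apply _)) 0 0
  rw [Kernel.partialTraj_self] at h
  have h2 := congrArg (fun κ => (κ ((MeasurableEquiv.piUnique fun _ : Finset.Iic 0 => Z).symm z)).map
    (fun w : (i : Finset.Iic 0) → Z => w ⟨0, Finset.mem_Iic.2 le_rfl⟩)) h
  simp only [Kernel.id_apply] at h2
  rw [Kernel.map_apply _ (by fun_prop), Measure.map_map (by fun_prop) (by fun_prop),
    Measure.map_dirac' (measurable_pi_apply _)] at h2
  exact h2

theorem lintegral_mul_chainLaw {init : Measure Z} [IsProbabilityMeasure init] (n : ℕ)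
    {f : ℕ → Z → ℝ≥0∞} (hf : ∀ k, Measurable (f k)) :
    ∫⁻ ω, ∏ k ∈ Finset.range (n + 2), f k (ω k) ∂chainLaw J init =
      ∫⁻ ω, (∏ k ∈ Finset.range (n + 1), f k (ω k)) * ∫⁻ z, f (n + 1) z ∂J (ω n)
        ∂chainLaw J init := by
  have h := Kernel.map_frestrictLe_trajMeasure_compProd_eq_map_trajMeasure (X := fun _ => Z)
    (μ₀ := init) (κ := fun n =>
      J.comap (fun h : (i : Finset.Iic n) → Z => h ⟨n, Finset.mem_Iic.2 le_rfl⟩)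
        (measurable_pi_apply _)) (a := n)
  change (chainLaw J init).map _ ⊗ₘ _ = (chainLaw J init).map _ at h
  let G : ((i : Finset.Iic n) → Z) × Z → ℝ≥0∞ := fun p =>
    (∏ k : Finset.Iic n, f k (p.1 k)) * f (n + 1) p.2
  have hG : Measurable G := by
    refine Measurable.mul (Finset.measurable_prod _ fun k _ => (hf k).comp ?_) ((hf _).comp ?_)
    all_goals fun_prop
  have h2 := congrArg (fun m => ∫⁻ p, G p ∂m) h
  rw [lintegral_map hG (by fun_prop), Measure.lintegral_compProd hG,
    lintegral_map (Measurable.lintegral_kernel_prod_right' hG) (by fun_prop)] at h2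
  have e : ∀ ω : ℕ → Z, ∏ k : Finset.Iic n, f k (Preorder.frestrictLe (π := fun _ => Z) n ω k) =
      ∏ k ∈ Finset.range (n + 1), f k (ω k) := fun ω => by
    rw [Nat.range_succ_eq_Iic]
    exact Finset.prod_coe_sort (Finset.Iic n) (fun k => f k (ω k))
  have e2 : ∀ ω : ℕ → Z, G (Preorder.frestrictLe (π := fun _ => Z) n ω, ω (n + 1)) =
      ∏ k ∈ Finset.range (n + 2), f k (ω k) := fun ω => by
    simp only [G, e]
    rw [Finset.prod_range_succ _ (n + 1)]
  simp only [e2] at h2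
  rw [← h2]
  refine lintegral_congr fun ω => ?_
  simp only [G, e]
  rw [lintegral_const_mul _ (hf _)]
  rfl

/-- The mean of `∏ k ≤ n, f k (Z k)` as a function of the initial state. -/
def boxFun : ℕ → (ℕ → Z → ℝ≥0∞) → Z → ℝ≥0∞
  | 0, f, z => f 0 z
  | n + 1, f, z => f 0 z * ∫⁻ z', boxFun n (fun k => f (k + 1)) z' ∂J z

theorem boxFun_update (n : ℕ) (f : ℕ → Z → ℝ≥0∞) (z : Z) :
    boxFun J n (Function.update f n fun z => f n z * ∫⁻ z', f (n + 1) z' ∂J z) z =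
      boxFun J (n + 1) f z := by
  induction n generalizing f z with
  | zero => simp [boxFun]
  | succ n ih =>
    rw [boxFun, boxFun]
    rw [Function.update_of_ne (by simp)]
    congr 1
    refine lintegral_congr fun z' => ?_
    rw [← ih]
    congr 1
    funext k
    rcases eq_or_ne k n with rfl | hk
    · simp
    · rw [Function.update_of_ne hk, Function.update_of_ne (by simpa using hk)]

theorem lintegral_box {init : Measure Z} [IsProbabilityMeasure init] (n : ℕ)
    {f : ℕ → Z → ℝ≥0∞} (hf : ∀ k, Measurable (f k)) :
    ∫⁻ ω, ∏ k ∈ Finset.range (n + 1), f k (ω k) ∂chainLaw J init = ∫⁻ z, boxFun J n f z ∂init := by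
  induction n generalizing f with
  | zero =>
    simp only [zero_add, Finset.range_one, Finset.prod_singleton, boxFun]
    have h0 : Measurable fun ω : ℕ → Z => f 0 (ω 0) := (hf 0).comp (measurable_pi_apply 0)
    rw [lintegral_chainLaw J init h0]
    refine lintegral_congr fun z => ?_
    rw [← lintegral_map (f := f 0) (hf 0) (measurable_pi_apply 0), map_eval_zero_chainKernel,
      lintegral_dirac' _ (hf 0)]
  | succ n ih =>
    rw [lintegral_mul_chainLaw J n hf]
    have hf' : ∀ k, Measurable (Function.update f n
        (fun z => f n z * ∫⁻ z', f (n + 1) z' ∂J z) k) := fun k => by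
      rcases eq_or_ne k n with rfl | hk
      · rw [Function.update_self]
        exact (hf k).mul (hf (k + 1)).lintegral_kernel
      · simpa [hk] using hf k
    have := ih hf'
    simp only [boxFun_update] at this
    rw [← this]
    refine lintegral_congr fun ω => ?_
    rw [Finset.prod_range_succ, Finset.prod_range_succ, Function.update_self, mul_assoc]
    congr 1
    refine Finset.prod_congr rfl fun k hk => ?_
    rw [Function.update_of_ne (Finset.mem_range.1 hk).ne]

theorem lintegral_box_chainKernel (n : ℕ) {f : ℕ → Z → ℝ≥0∞} (hf : ∀ k, Measurable (f k)) (z : Z)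
    (hm : Measurable (boxFun J n f)) :
    ∫⁻ ω, ∏ k ∈ Finset.range (n + 1), f k (ω k) ∂chainKernel J z = boxFun J n f z := by
  rw [← chainLaw_dirac, lintegral_box J n hf, lintegral_dirac' _ hm]

theorem measurable_boxFun (n : ℕ) {f : ℕ → Z → ℝ≥0∞} (hf : ∀ k, Measurable (f k)) :
    Measurable (boxFun J n f) := by
  induction n generalizing f with
  | zero => exact hf 0
  | succ n ih => exact (hf 0).mul (ih fun k => hf (k + 1)).lintegral_kernel

/-- The Markov property at time one. -/
theorem chainKernel_eq (z : Z) :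
    chainKernel J z = ((J z).bind (chainKernel J)).map (consSeq z) := by
  have hc : Measurable (consSeq z) := measurable_consSeq.comp measurable_prodMk_left
  have : IsProbabilityMeasure ((J z).bind (chainKernel J)) := by
    rw [← chainLaw_eq_bind]; infer_instance
  have : IsProbabilityMeasure (((J z).bind (chainKernel J)).map (consSeq z)) :=
    Measure.isProbabilityMeasure_map hc.aemeasurable
  refine measure_ext_of_boxes fun n t ht => ?_
  have hf : ∀ k, Measurable ((t k).indicator (1 : Z → ℝ≥0∞)) := fun k =>
    measurable_one.indicator (ht k)
  have hm : Measurable fun ω : ℕ → Z =>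
      ∏ k ∈ Finset.range (n + 1), (t k).indicator (1 : Z → ℝ≥0∞) (ω k) :=
    Finset.measurable_prod _ fun k _ => (hf k).comp (measurable_pi_apply k)
  rw [lintegral_box_chainKernel J n hf z (measurable_boxFun J n hf), lintegral_map hm hc,
    ← chainLaw_eq_bind]
  cases n with
  | zero => simp [boxFun, consSeq]
  | succ n =>
    rw [boxFun]
    simp only [Finset.prod_range_succ' _ (n + 1), consSeq]
    have hm' : Measurable fun ω : ℕ → Z =>
        ∏ k ∈ Finset.range (n + 1), (t (k + 1)).indicator (1 : Z → ℝ≥0∞) (ω k) :=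
      Finset.measurable_prod _ fun k _ => (hf (k + 1)).comp (measurable_pi_apply k)
    rw [lintegral_mul_const _ hm', mul_comm]
    congr 1
    exact (lintegral_box J n fun k => hf (k + 1)).symm

theorem lintegral_chainKernel (z : Z) {F : (ℕ → Z) → ℝ≥0∞} (hF : Measurable F) :
    ∫⁻ ω, F ω ∂chainKernel J z = ∫⁻ z', ∫⁻ ω, F (consSeq z ω) ∂chainKernel J z' ∂J z := by
  have hc : Measurable (consSeq z) := measurable_consSeq.comp measurable_prodMk_left
  have hFc : Measurable fun ω => F (consSeq z ω) := hF.comp hc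
  rw [chainKernel_eq, lintegral_map hF hc,
    Measure.lintegral_bind (Kernel.aemeasurable _) hFc.aemeasurable]

theorem measurePreserving_shiftBy_chainLaw {π : Measure Z} (hπ : J.Invariant π) :
    MeasurePreserving (shiftBy 1) (chainLaw J π) (chainLaw J π) := by
  refine ⟨measurable_shiftBy 1, Measure.ext fun s hs => ?_⟩
  have hF : Measurable (s.indicator (1 : (ℕ → Z) → ℝ≥0∞)) := measurable_one.indicator hs
  have hF' : Measurable fun ω => s.indicator (1 : (ℕ → Z) → ℝ≥0∞) (shiftBy 1 ω) :=
    hF.comp (measurable_shiftBy 1)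
  rw [← lintegral_indicator_one hs, ← lintegral_indicator_one hs,
    lintegral_map hF (measurable_shiftBy 1), lintegral_chainLaw J π hF',
    lintegral_chainLaw J π hF]
  simp_rw [lintegral_chainKernel J _ hF', shiftBy_consSeq]
  rw [← Measure.lintegral_bind (Kernel.aemeasurable J) hF.lintegral_kernel.aemeasurable, hπ]

/-- The Markov property at a later time. -/
theorem lintegral_mul_shiftBy (n : ℕ) {F G : (ℕ → Z) → ℝ≥0∞} (hF : Measurable F)
    (hF' : ∀ ω ω', (∀ k < n + 1, ω k = ω' k) → F ω = F ω') (hG : Measurable G) (z : Z) :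
    ∫⁻ ω, F ω * G (shiftBy (n + 1) ω) ∂chainKernel J z =
      ∫⁻ ω, F ω * ∫⁻ z', ∫⁻ ω', G ω' ∂chainKernel J z' ∂J (ω n) ∂chainKernel J z := by
  have hG1 : Measurable fun ω => G (shiftBy (n + 1) ω) := hG.comp (measurable_shiftBy _)
  have hG2 : Measurable fun z => ∫⁻ z', ∫⁻ ω', G ω' ∂chainKernel J z' ∂J z :=
    hG.lintegral_kernel.lintegral_kernel
  have hG3 : Measurable fun ω : ℕ → Z => ∫⁻ z', ∫⁻ ω', G ω' ∂chainKernel J z' ∂J (ω n) :=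
    hG2.comp (measurable_pi_apply n)
  have m1 : Measurable fun ω => F ω * G (shiftBy (n + 1) ω) := hF.mul hG1
  have m2 : Measurable fun ω : ℕ → Z => F ω * ∫⁻ z', ∫⁻ ω', G ω' ∂chainKernel J z' ∂J (ω n) :=
    hF.mul hG3
  rw [lintegral_chainKernel J z m1, lintegral_chainKernel J z m2]
  clear m1 m2
  induction n generalizing F z with
  | zero =>
    have e : ∀ ω, F (consSeq z ω) = F fun _ => z := fun ω => hF' _ _ fun k hk => by
      obtain rfl : k = 0 := by omega
      rfl
    simp only [e]
    have : ∀ ω : ℕ → Z, shiftBy (0 + 1) (consSeq z ω) = ω := fun _ => rfl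
    simp only [this]
    simp only [lintegral_const_mul _ hG, lintegral_const, measure_univ, mul_one, consSeq]
    rw [lintegral_const_mul _ hG.lintegral_kernel]
  | succ n ih =>
    refine lintegral_congr fun z' => ?_
    have hc : Measurable (consSeq z) := measurable_consSeq.comp measurable_prodMk_left
    have hFc := hF.comp hc
    have hG1 : Measurable fun ω => G (shiftBy (n + 1) ω) := hG.comp (measurable_shiftBy _)
    have := ih hFc (fun ω ω' h => hF' _ _ fun k hk => by
      cases k with
      | zero => rfl
      | succ k => exact h k (by omega)) z' hG1 (hG2.comp (measurable_pi_apply n))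
    have e1 := lintegral_chainKernel J z' (hFc.mul hG1)
    have e2 := lintegral_chainKernel J z' (hFc.mul (hG2.comp (measurable_pi_apply n)))
    exact e1.trans (this.trans e2.symm)

end Chain

/-! ### Mixing, and the law of large numbers -/

theorem lintegral_add_le_of_minorization {Z : Type*} [MeasurableSpace Z] {π ν : Measure Z}
    [IsProbabilityMeasure π] [IsProbabilityMeasure ν] {κ : ℝ≥0} (hκ : κ ≠ 0) (h : π ≤ κ • ν)
    {φ : Z → ℝ≥0∞} (hφ : Measurable φ) {m e : ℝ≥0} (hm : ∫⁻ z, φ z ∂π = m)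
    (he : ∀ z, φ z ≤ m + e) : ∫⁻ z, φ z ∂ν + (κ⁻¹ * e : ℝ≥0) ≤ m + e := by
  have hψ : Measurable fun z => ((m : ℝ≥0∞) + e) - φ z := measurable_const.sub hφ
  have e1 : ∫⁻ z, φ z ∂ν + ∫⁻ z, (((m : ℝ≥0∞) + e) - φ z) ∂ν = m + e := by
    rw [← lintegral_add_left hφ]
    simp [add_tsub_cancel_of_le (he _)]
  have e2 : (m : ℝ≥0∞) + ∫⁻ z, (((m : ℝ≥0∞) + e) - φ z) ∂π = m + e := by
    rw [← hm, ← lintegral_add_left hφ, hm]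
    simp [add_tsub_cancel_of_le (he _)]
  have e3 := (ENNReal.add_right_inj ENNReal.coe_ne_top).1 e2
  have e4 : (e : ℝ≥0∞) ≤ κ * ∫⁻ z, (((m : ℝ≥0∞) + e) - φ z) ∂ν := by
    refine e3.symm.le.trans ((lintegral_mono' h le_rfl).trans (le_of_eq ?_))
    rw [lintegral_smul_measure]
    rfl
  rw [← e1]
  gcongr
  rw [ENNReal.coe_mul, ENNReal.coe_inv hκ, mul_comm, ← div_eq_mul_inv]
  exact ENNReal.div_le_of_le_mul' e4

section Mixing

variable {Z : Type*} [MeasurableSpace Z] {J : Kernel Z Z} [IsMarkovKernel J] {π : Measure Z}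
  [IsProbabilityMeasure π] {κ ρ : ℝ≥0}

theorem lintegral_shiftBy_le (hπ : J.Invariant π) (hJ : ∀ z z', J z ≤ κ • J z') (hκ : κ ≠ 0)
    (hρ : ρ + κ⁻¹ = 1) {G : (ℕ → Z) → ℝ≥0∞} (hG : Measurable G) {m : ℝ≥0}
    (hm : ∫⁻ ω, G ω ∂chainLaw J π = m) (t : ℕ) (z : Z) :
    ∫⁻ z', ∫⁻ ω, G (shiftBy t ω) ∂chainKernel J z' ∂J z ≤ m + (ρ ^ t * (κ * m) : ℝ≥0) := by
  have hGt : ∀ t, Measurable fun ω => G (shiftBy t ω) := fun t => hG.comp (measurable_shiftBy t)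
  have hs : ∀ t, ∫⁻ ω, G (shiftBy t ω) ∂chainLaw J π = m := fun t => by
    rw [← hm]
    exact (measurePreserving_shiftBy (measurePreserving_shiftBy_chainLaw J hπ) t).lintegral_comp hG
  have hmean : ∀ t, ∫⁻ z, ∫⁻ z', ∫⁻ ω, G (shiftBy t ω) ∂chainKernel J z' ∂J z ∂π = m := fun t => by
    rw [← Measure.lintegral_bind (Kernel.aemeasurable J) (hGt t).lintegral_kernel.aemeasurable, hπ,
      ← lintegral_chainLaw J π (hGt t), hs]
  have hmeas : ∀ t, Measurable fun z => ∫⁻ z', ∫⁻ ω, G (shiftBy t ω) ∂chainKernel J z' ∂J z :=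
    fun t => (hGt t).lintegral_kernel.lintegral_kernel
  have hπJ : ∀ z, π ≤ κ • J z := fun z => by
    refine Measure.le_intro fun s hs _ => ?_
    rw [← hπ, Measure.bind_apply hs (Kernel.aemeasurable J)]
    calc ∫⁻ z', J z' s ∂π ≤ ∫⁻ _, (κ • J z) s ∂π := lintegral_mono fun z' => hJ z' z s
      _ = _ := by simp
  induction t generalizing z with
  | zero =>
    rw [pow_zero, one_mul]
    refine le_trans ?_ le_add_self
    calc _ = ∫⁻ _, (∫⁻ z', ∫⁻ ω, G (shiftBy 0 ω) ∂chainKernel J z' ∂J z) ∂π := by simp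
      _ ≤ ∫⁻ z₁, κ * (∫⁻ z', ∫⁻ ω, G (shiftBy 0 ω) ∂chainKernel J z' ∂J z₁) ∂π := by
        refine lintegral_mono fun z₁ => ?_
        refine (lintegral_mono' (hJ z z₁) le_rfl).trans (le_of_eq ?_)
        rw [lintegral_smul_measure]
        rfl
      _ = _ := by rw [lintegral_const_mul _ (hmeas 0), hmean, ENNReal.coe_mul]
  | succ t ih =>
    have e : ∀ z', ∫⁻ ω, G (shiftBy (t + 1) ω) ∂chainKernel J z' =
        ∫⁻ z'', ∫⁻ ω, G (shiftBy t ω) ∂chainKernel J z'' ∂J z' := fun z' => by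
      rw [lintegral_chainKernel J z' (hGt (t + 1))]
      rfl
    simp only [e]
    have h1 := lintegral_add_le_of_minorization hκ (hπJ z) (hmeas t) (hmean t) ih
    refine (ENNReal.add_le_add_iff_right
      (ENNReal.coe_ne_top (r := κ⁻¹ * (ρ ^ t * (κ * m))))).1 (h1.trans (le_of_eq ?_))
    norm_cast
    calc m + ρ ^ t * (κ * m) = m + (ρ + κ⁻¹) * (ρ ^ t * (κ * m)) := by rw [hρ, one_mul]
      _ = _ := by ring

theorem lintegral_mul_shiftBy_le (hπ : J.Invariant π) (hJ : ∀ z z', J z ≤ κ • J z') (hκ : κ ≠ 0)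
    (hρ : ρ + κ⁻¹ = 1) (n : ℕ) {F G : (ℕ → Z) → ℝ≥0∞} (hF : Measurable F)
    (hF' : ∀ ω ω', (∀ k < n + 1, ω k = ω' k) → F ω = F ω') (hG : Measurable G) {m : ℝ≥0}
    (hm : ∫⁻ ω, G ω ∂chainLaw J π = m) (t : ℕ) :
    ∫⁻ ω, F ω * G (shiftBy (t + (n + 1)) ω) ∂chainLaw J π ≤
      (∫⁻ ω, F ω ∂chainLaw J π) * (m + (ρ ^ t * (κ * m) : ℝ≥0)) := by
  have hGt : ∀ t, Measurable fun ω => G (shiftBy t ω) := fun t => hG.comp (measurable_shiftBy t)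
  have hm1 : Measurable fun ω => F ω * G (shiftBy (t + (n + 1)) ω) := hF.mul (hGt _)
  rw [lintegral_chainLaw J π hm1, lintegral_chainLaw J π hF,
    ← lintegral_mul_const _ hF.lintegral_kernel]
  refine lintegral_mono fun z => ?_
  have := lintegral_mul_shiftBy J n hF hF' (hGt t) z
  simp only [shiftBy_add] at this
  rw [this, ← lintegral_mul_const _ hF]
  refine lintegral_mono fun ω => ?_
  dsimp only
  gcongr
  exact lintegral_shiftBy_le hπ hJ hκ hρ hG hm t (ω n)

end Mixing

section SecondMoment

variable {Y : Type*} [MeasurableSpace Y] {P : Measure (ℕ → Y)} [IsProbabilityMeasure P]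
  (hP : MeasurePreserving (shiftBy 1) P P) {F : (ℕ → Y) → ℝ} (hF2 : MemLp F 2 P) {A ρ : ℝ}
  (hρ0 : 0 ≤ ρ) (hρ1 : ρ < 1) (hA : 0 ≤ A)
  (hc : ∀ k, ∫ ω, F ω * F (shiftBy k ω) ∂P ≤ (∫ ω, F ω ∂P) ^ 2 + A * ρ ^ k)

include hP hF2

theorem memLp_shiftBy (k : ℕ) : MemLp (fun ω => F (shiftBy k ω)) 2 P :=
  hF2.comp_measurePreserving (measurePreserving_shiftBy hP k)

theorem memLp_sum_shiftBy (n : ℕ) :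
    MemLp (fun ω => ∑ i ∈ Finset.range n, F (shiftBy i ω)) 2 P :=
  memLp_finsetSum _ fun k _ => memLp_shiftBy hP hF2 k

include hρ0 hρ1 hA hc

theorem integral_sum_sq_le (n : ℕ) :
    ∫ ω, (∑ i ∈ Finset.range n, F (shiftBy i ω)) ^ 2 ∂P ≤
      n ^ 2 * (∫ ω, F ω ∂P) ^ 2 + n * (A + 2 * (A / (1 - ρ))) := by
  induction n with
  | zero => simp
  | succ n ih =>
    set m := ∫ ω, F ω ∂P
    have h1 := memLp_sum_shiftBy hP hF2 n
    have i0 : Integrable (fun ω => F ω * F (shiftBy 0 ω)) P :=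
      hF2.integrable_mul (memLp_shiftBy hP hF2 0)
    have i1 : ∀ i, Integrable (fun ω => F ω * F (shiftBy (i + 1) ω)) P := fun i =>
      hF2.integrable_mul (memLp_shiftBy hP hF2 (i + 1))
    have i1' : Integrable (fun ω => ∑ i ∈ Finset.range n, F ω * F (shiftBy (i + 1) ω)) P :=
      integrable_finsetSum _ fun i _ => i1 i
    have i2 : Integrable (fun ω => (∑ i ∈ Finset.range n, F (shiftBy i (shiftBy 1 ω))) ^ 2) P :=
      (h1.comp_measurePreserving hP).integrable_sq
    have e : ∀ ω, (∑ i ∈ Finset.range (n + 1), F (shiftBy i ω)) ^ 2 =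
        F ω * F (shiftBy 0 ω) + 2 * ∑ i ∈ Finset.range n, F ω * F (shiftBy (i + 1) ω) +
          (∑ i ∈ Finset.range n, F (shiftBy i (shiftBy 1 ω))) ^ 2 := fun ω => by
      rw [Finset.sum_range_succ', ← Finset.mul_sum]
      simp only [shiftBy_add]
      rw [show shiftBy 0 ω = ω from rfl]
      ring
    simp only [e]
    have i12 : Integrable (fun ω => F ω * F (shiftBy 0 ω) +
      2 * ∑ i ∈ Finset.range n, F ω * F (shiftBy (i + 1) ω)) P := i0.add (i1'.const_mul 2)
    rw [integral_add i12 i2, integral_add i0 (i1'.const_mul 2), integral_const_mul,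
      integral_finsetSum _ fun i _ => i1 i, integral_comp_shiftBy hP 1
        (F := fun ω => (∑ i ∈ Finset.range n, F (shiftBy i ω)) ^ 2)
        h1.integrable_sq.aestronglyMeasurable]
    have hsum : ∑ i ∈ Finset.range n, ∫ ω, F ω * F (shiftBy (i + 1) ω) ∂P ≤
        n * m ^ 2 + A / (1 - ρ) := by
      calc _ ≤ ∑ i ∈ Finset.range n, (m ^ 2 + A * ρ ^ i) := by
            refine Finset.sum_le_sum fun i _ => (hc (i + 1)).trans ?_
            have : ρ ^ (i + 1) ≤ ρ ^ i := pow_le_pow_of_le_one hρ0 hρ1.le (Nat.le_succ i)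
            gcongr
        _ = n * m ^ 2 + A * ∑ i ∈ Finset.range n, ρ ^ i := by
            rw [Finset.sum_add_distrib, Finset.sum_const, Finset.card_range, nsmul_eq_mul,
              Finset.mul_sum]
        _ ≤ _ := by
            rw [div_eq_mul_inv, ← tsum_geometric_of_lt_one hρ0 hρ1]
            gcongr
            exact (summable_geometric_of_lt_one hρ0 hρ1).sum_le_tsum _ fun i _ => by positivity
    have h0 := hc 0
    push_cast
    nlinarith

theorem integral_sum_sub_sq_le (n : ℕ) :
    ∫ ω, (∑ i ∈ Finset.range n, F (shiftBy i ω) - n * ∫ ω, F ω ∂P) ^ 2 ∂P ≤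
      n * (A + 2 * (A / (1 - ρ))) := by
  set m := ∫ ω, F ω ∂P with hm
  have h1 := memLp_sum_shiftBy hP hF2 n
  have h2 := h1.integrable one_le_two
  have es : ∫ ω, ∑ i ∈ Finset.range n, F (shiftBy i ω) ∂P = n * m := by
    rw [integral_finsetSum _ fun i _ => (memLp_shiftBy hP hF2 i).integrable one_le_two]
    simp only [integral_comp_shiftBy hP _ hF2.aestronglyMeasurable, Finset.sum_const,
      Finset.card_range, nsmul_eq_mul, hm]
  have e : ∀ ω, (∑ i ∈ Finset.range n, F (shiftBy i ω) - n * m) ^ 2 =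
      (∑ i ∈ Finset.range n, F (shiftBy i ω)) ^ 2 -
        2 * (n * m) * ∑ i ∈ Finset.range n, F (shiftBy i ω) + (n * m) ^ 2 := fun ω => by ring
  simp only [e]
  have i12 : Integrable (fun ω => (∑ i ∈ Finset.range n, F (shiftBy i ω)) ^ 2 -
        2 * (n * m) * ∑ i ∈ Finset.range n, F (shiftBy i ω)) P :=
    h1.integrable_sq.sub (h2.const_mul _)
  rw [integral_add i12 (integrable_const _), integral_sub h1.integrable_sq (h2.const_mul _),
    integral_const_mul, es, integral_const]
  have := integral_sum_sq_le hP hF2 hρ0 hρ1 hA hc n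
  simp only [probReal_univ, smul_eq_mul, one_mul]
  nlinarith

theorem ae_tendsto_avg (hF0 : ∀ ω, 0 ≤ F ω) : ∀ᵐ ω ∂P,
    Tendsto (fun n : ℕ => (1 / (n : ℝ)) * ∑ i ∈ Finset.range n, F (shiftBy i ω)) atTop
      (𝓝 (∫ ω, F ω ∂P)) := by
  set m := ∫ ω, F ω ∂P
  set C := A + 2 * (A / (1 - ρ)) with hC
  have hC0 : 0 ≤ C := by
    have : 0 < 1 - ρ := by linarith
    positivity
  let D : ℕ → (ℕ → Y) → ℝ := fun k ω =>
    ((∑ i ∈ Finset.range ((k + 1) ^ 2), F (shiftBy i ω)) / ((k + 1 : ℕ) ^ 2 : ℕ) - m) ^ 2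
  have hDm : ∀ k, AEMeasurable (fun ω => ENNReal.ofReal (D k ω)) P := fun k =>
    ((((memLp_sum_shiftBy hP hF2 ((k + 1) ^ 2)).aestronglyMeasurable.aemeasurable.div_const
      _).sub_const m).pow_const 2).ennreal_ofReal
  have hDle : ∀ k, ∫⁻ ω, ENNReal.ofReal (D k ω) ∂P ≤ ENNReal.ofReal (C * (1 / ((k + 1 : ℕ) : ℝ) ^ 2)) :=
    fun k => by
      have hk : (0 : ℝ) < ((k + 1 : ℕ) : ℝ) := by positivity
      have h2 := integral_sum_sub_sq_le hP hF2 hρ0 hρ1 hA hc ((k + 1) ^ 2)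
      have hi : Integrable (fun ω => (∑ i ∈ Finset.range ((k + 1) ^ 2), F (shiftBy i ω) -
          (((k + 1) ^ 2 : ℕ) : ℝ) * m) ^ 2) P :=
        ((memLp_sum_shiftBy hP hF2 ((k + 1) ^ 2)).sub (memLp_const _)).integrable_sq
      have e : ∀ ω, D k ω = 1 / ((k + 1 : ℕ) : ℝ) ^ 4 *
          (∑ i ∈ Finset.range ((k + 1) ^ 2), F (shiftBy i ω) -
            (((k + 1) ^ 2 : ℕ) : ℝ) * m) ^ 2 := fun ω => by
        simp only [D]
        push_cast at hk ⊢
        field_simp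
      simp only [e]
      rw [← ofReal_integral_eq_lintegral_ofReal (hi.const_mul _)
        (.of_forall fun ω => by positivity), integral_const_mul]
      refine ENNReal.ofReal_le_ofReal ?_
      calc _ ≤ 1 / ((k + 1 : ℕ) : ℝ) ^ 4 * ((((k + 1) ^ 2 : ℕ) : ℝ) * C) := by gcongr
        _ = _ := by push_cast at hk ⊢; field_simp
  have hsum : ∫⁻ ω, ∑' k, ENNReal.ofReal (D k ω) ∂P ≠ ∞ := by
    rw [lintegral_tsum hDm]
    refine ne_top_of_le_ne_top ?_ (ENNReal.tsum_le_tsum hDle)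
    have hs : Summable fun k : ℕ => C * (1 / ((k + 1 : ℕ) : ℝ) ^ 2) :=
      ((summable_nat_add_iff 1).2 (Real.summable_one_div_nat_pow.2 one_lt_two)).mul_left C
    rw [← ENNReal.ofReal_tsum_of_nonneg (fun k => by positivity) hs]
    exact ENNReal.ofReal_ne_top
  filter_upwards [ae_lt_top' (AEMeasurable.tsum hDm) hsum] with ω hω
  have hD : Tendsto (fun k => D k ω) atTop (𝓝 0) := by
    have h1 := ENNReal.tendsto_atTop_zero_of_tsum_ne_top hω.ne
    have h2 := (ENNReal.tendsto_toReal ENNReal.zero_ne_top).comp h1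
    refine h2.congr fun k => ?_
    simp only [Function.comp_apply]
    exact ENNReal.toReal_ofReal (sq_nonneg _)
  have hD2 : Tendsto (fun k : ℕ =>
      (∑ i ∈ Finset.range ((k + 1) ^ 2), F (shiftBy i ω)) / ((k + 1 : ℕ) ^ 2 : ℕ)) atTop (𝓝 m) := by
    have h1 := hD.sqrt
    rw [Real.sqrt_zero] at h1
    rw [tendsto_iff_norm_sub_tendsto_zero]
    refine h1.congr fun k => ?_
    rw [Real.norm_eq_abs]
    exact Real.sqrt_sq_eq_abs _
  have hD3 : Tendsto (fun k : ℕ =>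
      (∑ i ∈ Finset.range (k ^ 2), F (shiftBy i ω)) / (k ^ 2 : ℕ)) atTop (𝓝 m) :=
    (tendsto_add_atTop_iff_nat 1).1 hD2
  have hmono : Monotone fun n => ∑ i ∈ Finset.range n, F (shiftBy i ω) :=
    monotone_nat_of_le_succ fun n => by
      rw [Finset.sum_range_succ]
      linarith [hF0 (shiftBy n ω)]
  have := tendsto_div_of_monotone_of_exists_subseq_tendsto_div _ m hmono fun a ha => by
    refine ⟨fun k => k ^ 2, ?_, tendsto_pow_atTop two_ne_zero, hD3⟩
    have hlim : Tendsto (fun k : ℕ => (1 + 1 / (k : ℝ)) ^ 2) atTop (𝓝 ((1 + 0) ^ 2)) :=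
      (tendsto_one_div_atTop_nhds_zero_nat.const_add 1).pow 2
    rw [add_zero, one_pow] at hlim
    filter_upwards [hlim.eventually (gt_mem_nhds ha), eventually_gt_atTop 0] with k hk hk0
    have hk0' : (0 : ℝ) < k := by exact_mod_cast hk0
    push_cast
    calc ((k : ℝ) + 1) ^ 2 = (1 + 1 / (k : ℝ)) ^ 2 * (k : ℝ) ^ 2 := by field_simp
      _ ≤ _ := by gcongr
  refine this.congr fun n => ?_
  rw [div_eq_inv_mul, one_div]

end SecondMoment

section ChainLLN

variable {Z : Type*} [MeasurableSpace Z] {J : Kernel Z Z} [IsMarkovKernel J] {π : Measure Z}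
  [IsProbabilityMeasure π] {κ : ℝ≥0}

theorem ae_tendsto_avg_chainLaw (hπ : J.Invariant π) (hJ : ∀ z z', J z ≤ κ • J z') (hκ : 1 < κ)
    (N : ℕ) {F : (ℕ → Z) → ℝ} (hF : Measurable F) (hF0 : ∀ ω, 0 ≤ F ω)
    (hF' : ∀ ω ω', (∀ k < N, ω k = ω' k) → F ω = F ω') (hF2 : MemLp F 2 (chainLaw J π)) :
    ∀ᵐ ω ∂chainLaw J π,
      Tendsto (fun n : ℕ => (1 / (n : ℝ)) * ∑ i ∈ Finset.range n, F (shiftBy i ω)) atTop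
        (𝓝 (∫ ω, F ω ∂chainLaw J π)) := by
  set P := chainLaw J π
  have hP := measurePreserving_shiftBy_chainLaw J hπ
  have hκ0 : κ ≠ 0 := (zero_lt_one.trans hκ).ne'
  set ρ : ℝ≥0 := 1 - κ⁻¹ with hρdef
  have hinv : κ⁻¹ < 1 := inv_lt_one_of_one_lt₀ hκ
  have hρ : ρ + κ⁻¹ = 1 := tsub_add_cancel_of_le hinv.le
  have hρ0 : (0 : ℝ) < ρ := by exact_mod_cast tsub_pos_of_lt hinv
  have hρ1 : (ρ : ℝ) < 1 := by
    have : ρ < 1 := tsub_lt_self one_pos (by positivity)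
    exact_mod_cast this
  set m := ∫ ω, F ω ∂P with hm
  have hm0 : 0 ≤ m := integral_nonneg hF0
  set Q := ∫ ω, F ω ^ 2 ∂P with hQ
  have hQ0 : 0 ≤ Q := integral_nonneg fun ω => sq_nonneg _
  have hFi := hF2.integrable one_le_two
  set A := (Q + κ * m ^ 2) / (ρ : ℝ) ^ (N + 1) with hA
  have hA0 : 0 ≤ A := by positivity
  have hAρ : ∀ k, k ≤ N + 1 → Q + κ * m ^ 2 ≤ A * (ρ : ℝ) ^ k := fun k hk => by
    rw [hA, div_mul_eq_mul_div, le_div_iff₀ (by positivity)]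
    exact mul_le_mul_of_nonneg_left (pow_le_pow_of_le_one hρ0.le hρ1.le hk) (by positivity)
  refine ae_tendsto_avg hP hF2 hρ0.le hρ1 hA0 (fun k => ?_) hF0
  rcases lt_or_ge k (N + 1) with hk | hk
  · have i1 := memLp_shiftBy hP hF2 k
    calc ∫ ω, F ω * F (shiftBy k ω) ∂P
        ≤ ∫ ω, ((1 / 2) * F ω ^ 2 + (1 / 2) * F (shiftBy k ω) ^ 2) ∂P := by
          refine integral_mono (hF2.integrable_mul i1)
            ((hF2.integrable_sq.const_mul _).add (i1.integrable_sq.const_mul _)) fun ω => ?_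
          dsimp only
          nlinarith [sq_nonneg (F ω - F (shiftBy k ω))]
      _ = Q := by
          rw [integral_add (hF2.integrable_sq.const_mul _) (i1.integrable_sq.const_mul _),
            integral_const_mul, integral_const_mul, integral_comp_shiftBy hP k
              (F := fun ω => F ω ^ 2) hF2.integrable_sq.aestronglyMeasurable]
          ring
      _ ≤ _ := by
          have := hAρ k hk.le
          have : 0 ≤ κ * m ^ 2 := by positivity
          nlinarith [sq_nonneg m]
  · obtain ⟨t, rfl⟩ := Nat.exists_eq_add_of_le' hk
    set m' : ℝ≥0 := m.toNNReal
    have hm' : (m' : ℝ) = m := Real.coe_toNNReal m hm0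
    have hml : ∫⁻ ω, ENNReal.ofReal (F ω) ∂P = m' := by
      rw [← ofReal_integral_eq_lintegral_ofReal hFi (.of_forall hF0)]
      rfl
    have h1 := lintegral_mul_shiftBy_le hπ hJ hκ0 hρ N hF.ennreal_ofReal
      (fun ω ω' h => by rw [hF' ω ω' fun k hk => h k (by omega)]) hF.ennreal_ofReal hml t
    rw [hml] at h1
    have i1 : Integrable (fun ω => F ω * F (shiftBy (t + (N + 1)) ω)) P :=
      hF2.integrable_mul (memLp_shiftBy hP hF2 (t + (N + 1)))
    simp only [← ENNReal.ofReal_mul (hF0 _)] at h1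
    rw [← ofReal_integral_eq_lintegral_ofReal i1 (.of_forall fun ω => mul_nonneg (hF0 _) (hF0 _))]
      at h1
    have h2 : ((m' : ℝ≥0∞) * (m' + (ρ ^ t * (κ * m') : ℝ≥0))) =
        ENNReal.ofReal (m * (m + ρ ^ t * (κ * m))) := by
      rw [← ENNReal.ofReal_coe_nnreal, ← ENNReal.ofReal_coe_nnreal, ← ENNReal.ofReal_add
        (by positivity) (by positivity), ← ENNReal.ofReal_mul (by positivity)]
      push_cast
      rw [hm']
    rw [h2, ENNReal.ofReal_le_ofReal_iff (by positivity)] at h1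
    refine h1.trans ?_
    have h3 := mul_le_mul_of_nonneg_right (hAρ (N + 1) le_rfl) (by positivity : 0 ≤ (ρ : ℝ) ^ t)
    have h4 : 0 ≤ Q * (ρ : ℝ) ^ t := by positivity
    calc m * (m + ρ ^ t * (κ * m)) = m ^ 2 + κ * m ^ 2 * ρ ^ t := by ring
      _ ≤ m ^ 2 + A * ρ ^ (N + 1) * ρ ^ t := by linarith
      _ = _ := by rw [pow_add]; ring

/-- The law of large numbers for the observations of a uniformly ergodic Markov chain. -/
theorem hasLLN_map {Y : Type*} [MeasurableSpace Y] (hπ : J.Invariant π)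
    (hJ : ∀ z z', J z ≤ κ • J z') (hκ : 1 < κ) {g : Z → Y} (hg : Measurable g) :
    HasLLN ((chainLaw J π).map fun p k => g (p k)) := by
  intro N F hF hF' hF2
  have hg' : Measurable fun (p : ℕ → Z) (k : ℕ) => g (p k) :=
    measurable_pi_lambda _ fun k => hg.comp (measurable_pi_apply k)
  have key : ∀ G : (ℕ → Y) → ℝ, Measurable G → (∀ ω, 0 ≤ G ω) →
      (∀ ω ω', (∀ k < N, ω k = ω' k) → G ω = G ω') →
      MemLp G 2 ((chainLaw J π).map fun p k => g (p k)) →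
      ∀ᵐ ω ∂(chainLaw J π).map fun p k => g (p k),
      Tendsto (fun n : ℕ => (1 / (n : ℝ)) * ∑ i ∈ Finset.range n, G (shiftBy i ω)) atTop
        (𝓝 (∫ ω, G ω ∂(chainLaw J π).map fun p k => g (p k))) := by
    intro G hG hG0 hG' hG2
    have h1 := ae_tendsto_avg_chainLaw hπ hJ hκ N (F := fun p => G fun k => g (p k)) (hG.comp hg')
      (fun p => hG0 _) (fun p p' h => hG' _ _ fun k hk => by rw [h k hk])
      (hG2.comp_of_map hg'.aemeasurable)
    have hms : MeasurableSet {ω : ℕ → Y | Tendsto (fun n : ℕ => (1 / (n : ℝ)) *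
        ∑ i ∈ Finset.range n, G (shiftBy i ω)) atTop
          (𝓝 (∫ ω, G ω ∂(chainLaw J π).map fun p k => g (p k)))} := by
      refine measurableSet_tendsto _ fun n => ?_
      exact (Finset.measurable_fun_sum _ fun i _ => hG.comp (measurable_shiftBy i)).const_mul _
    rw [ae_map_iff hg'.aemeasurable hms, integral_map hg'.aemeasurable hG.aestronglyMeasurable]
    exact h1
  have kp := key (fun ω => max (F ω) 0) (hF.max measurable_const) (fun ω => le_max_right _ _)
    (fun ω ω' h => by rw [hF' ω ω' h]) hF2.pos_part
  have kn := key (fun ω => max (-F ω) 0) (hF.neg.max measurable_const) (fun ω => le_max_right _ _)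
    (fun ω ω' h => by rw [hF' ω ω' h]) hF2.neg_part
  have : IsProbabilityMeasure ((chainLaw J π).map fun p k => g (p k)) :=
    Measure.isProbabilityMeasure_map hg'.aemeasurable
  have e : ∀ a : ℝ, a = max a 0 - max (-a) 0 := fun a => by
    rcases le_total a 0 with h | h
    · rw [max_eq_right h, max_eq_left (by linarith)]; ring
    · rw [max_eq_left h, max_eq_right (by linarith)]; ring
  have eI : ∫ ω, F ω ∂((chainLaw J π).map fun p k => g (p k)) =
      ∫ ω, max (F ω) 0 ∂((chainLaw J π).map fun p k => g (p k)) -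
      ∫ ω, max (-F ω) 0 ∂((chainLaw J π).map fun p k => g (p k)) := by
    rw [← integral_sub (hF2.pos_part.integrable one_le_two) (hF2.neg_part.integrable one_le_two)]
    exact integral_congr_ae (.of_forall fun ω => e _)
  rw [eI]
  filter_upwards [kp, kn] with ω h1 h2
  refine (h1.sub h2).congr fun n => ?_
  rw [← mul_sub, ← Finset.sum_sub_distrib]
  congr 1
  exact Finset.sum_congr rfl fun i _ => (e _).symm

end ChainLLN

section

variable {E : Type} [NormedAddCommGroup E] [NormedSpace ℝ E] {S : Set E}

/-- The gradient of `log f` within `S`. -/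
def logGrad (S : Set E) (f : E → ℝ) : E → E →L[ℝ] ℝ := fderivWithin ℝ (fun x => Real.log (f x)) S

/-- The Hessian of `log f` within `S`. -/
def logHess (S : Set E) (f : E → ℝ) : E → E →L[ℝ] E →L[ℝ] ℝ := fderivWithin ℝ (logGrad S f) S

theorem norm_logGrad (hU : UniqueDiffOn ℝ S) (f : E → ℝ) {x : E} (hx : x ∈ S) :
    ‖logGrad S f x‖ = ‖iteratedFDerivWithin ℝ 1 (fun x => Real.log (f x)) S x‖ :=
  (norm_iteratedFDerivWithin_one (𝕜 := ℝ) (fun x => Real.log (f x)) (hU x hx)).symm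

theorem norm_logHess (hU : UniqueDiffOn ℝ S) (f : E → ℝ) {x : E} (hx : x ∈ S) :
    ‖logHess S f x‖ = ‖iteratedFDerivWithin ℝ 2 (fun x => Real.log (f x)) S x‖ := by
  rw [logHess, ← norm_iteratedFDerivWithin_one _ (hU x hx), logGrad,
    norm_iteratedFDerivWithin_fderivWithin hU hx]

theorem logGrad_eq_zero {f : E → ℝ} (h : ∀ x ∈ S, f x = 0) : EqOn (logGrad S f) 0 S :=
  fun x hx => by
    have e : EqOn (fun x => Real.log (f x)) (fun _ => 0) S := fun y hy => by simp [h y hy]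
    rw [logGrad, fderivWithin_congr e (e hx), fderivWithin_fun_const]

theorem logHess_eq_zero {f : E → ℝ} (h : ∀ x ∈ S, f x = 0) : EqOn (logHess S f) 0 S :=
  fun x hx => by
    have e := logGrad_eq_zero h
    rw [logHess, fderivWithin_congr e (e hx)]
    exact congrFun (fderivWithin_fun_const (𝕜 := ℝ) (s := S) (0 : E →L[ℝ] ℝ)) x

theorem HasLogJet.const (c : ℝ) : HasLogJet S (fun _ => c) (fun _ => 0) (fun _ => 0) where
  d1 x _ := by simpa using hasFDerivWithinAt_const c x S
  d2 x _ := by simpa using hasFDerivWithinAt_const (0 : E →L[ℝ] ℝ) x S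
  cont := by simpa using continuousOn_const

/-- Measurability of logarithmic derivatives in a parameter. -/
theorem HasLogJet.stronglyMeasurable [FiniteDimensional ℝ E] (hU : UniqueDiffOn ℝ S) {Ω : Type*}
    [MeasurableSpace Ω] {f : E → Ω → ℝ} {A : E → Ω → E →L[ℝ] ℝ} {B : E → Ω → E →L[ℝ] E →L[ℝ] ℝ}
    (hj : ∀ ω, HasLogJet S (fun x => f x ω) (fun x => A x ω) (fun x => B x ω))
    (hf : ∀ x ∈ S, StronglyMeasurable (f x))
    (h0 : ∀ x ∈ S, ∀ ω, f x ω = 0 → A x ω = 0 ∧ B x ω = 0) {x : E} (hx : x ∈ S) :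
    StronglyMeasurable (A x) ∧ StronglyMeasurable (B x) := by
  have h1 : ∀ x ∈ S, StronglyMeasurable fun ω => f x ω • A x ω := fun x hx =>
    (hU x hx).stronglyMeasurable hx hf fun ω => (hj ω).d1 x hx
  have h2 : ∀ x ∈ S, StronglyMeasurable fun ω => f x ω • (B x ω + outer E (A x ω) (A x ω)) :=
    fun x hx => (hU x hx).stronglyMeasurable hx h1 fun ω => (hj ω).d2 x hx
  have hinv : StronglyMeasurable fun ω => (f x ω)⁻¹ := (hf x hx).measurable.inv.stronglyMeasurable
  have hA : StronglyMeasurable (A x) := by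
    have e : A x = fun ω => (f x ω)⁻¹ • (f x ω • A x ω) := by
      funext ω
      by_cases h : f x ω = 0
      · simp [(h0 x hx ω h).1]
      · rw [inv_smul_smul₀ h]
    rw [e]
    exact hinv.smul (h1 x hx)
  refine ⟨hA, ?_⟩
  have hO : StronglyMeasurable fun ω => outer E (A x ω) (A x ω) :=
    (outer E).continuous₂.comp_stronglyMeasurable (hA.prodMk hA)
  have e : B x = fun ω => (f x ω)⁻¹ • (f x ω • (B x ω + outer E (A x ω) (A x ω))) -
      outer E (A x ω) (A x ω) := by
    funext ω
    by_cases h : f x ω = 0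
    · rw [h, (h0 x hx ω h).1, (h0 x hx ω h).2]
      simp
    · rw [inv_smul_smul₀ h, add_sub_cancel_right]
  rw [e]
  exact (hinv.smul (h2 x hx)).sub hO

end

/-- A real majorant of a function whose power has finite mean. -/
theorem FiniteMean.exists_majorant {Y : Type*} [MeasurableSpace Y] {P : Measure Y}
    [IsFiniteMeasure P] {F : Y → ℝ≥0∞} {k : ℕ} (hk : k ≠ 0)
    (h : FiniteMean P fun y => F y ^ k) :
    ∃ (s : Y → ℝ) (A : Set Y), Measurable s ∧ (∀ y, 0 ≤ s y) ∧ MemLp s k P ∧ MeasurableSet A ∧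
      (∀ᵐ y ∂P, y ∈ A) ∧ ∀ y ∈ A, F y ≤ ENNReal.ofReal (s y) := by
  obtain ⟨b, hb, hFb, hbi⟩ := h
  have hk' : (0 : ℝ) < k := by positivity
  let t : Y → ℝ≥0∞ := fun y => b y ^ (k : ℝ)⁻¹
  have ht : Measurable t := hb.pow_const _
  have htop : ∀ y, b y ≠ ∞ → t y ≠ ∞ := fun y hy =>
    ENNReal.rpow_ne_top_of_nonneg (by positivity) hy
  refine ⟨fun y => (t y).toReal, {y | b y ≠ ∞}, ht.ennreal_toReal, fun y => ENNReal.toReal_nonneg,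
    ?_, hb (measurableSet_singleton ∞).compl, ?_, fun y hy => ?_⟩
  · refine ⟨ht.ennreal_toReal.aestronglyMeasurable, ?_⟩
    rw [eLpNorm_lt_top_iff_lintegral_rpow_enorm_lt_top (by exact_mod_cast hk) (by simp)]
    refine lt_of_le_of_lt (lintegral_mono fun y => ?_) hbi
    rw [ENNReal.toReal_natCast, Real.enorm_of_nonneg ENNReal.toReal_nonneg]
    refine (ENNReal.rpow_le_rpow ENNReal.ofReal_toReal_le hk'.le).trans (le_of_eq ?_)
    rw [← ENNReal.rpow_mul, inv_mul_cancel₀ hk'.ne', ENNReal.rpow_one]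
  · filter_upwards [ae_lt_top hb hbi.ne] with y hy using hy.ne
  · rw [ENNReal.ofReal_toReal (htop y hy), ENNReal.le_rpow_inv_iff hk', ENNReal.rpow_natCast]
    exact hFb y

namespace HMMFamily

variable {d m : ℕ} {𝒳 : Type*} [MeasurableSpace 𝒳] (M : HMMFamily d m 𝒳)

/-- Uniform bounds for the densities, and the logarithmic derivatives of the transition
densities. -/
structure Bounds (c C D : ℝ) : Prop where
  pos : 0 < c
  q_lower : ∀ θ ∈ M.Θ, ∀ x x', c ≤ M.q θ x x'
  q_upper : ∀ θ ∈ M.Θ, ∀ x x', M.q θ x x' ≤ C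
  g_upper : ∀ θ ∈ M.Θ, ∀ x, ∀ y ∈ M.𝒴, M.g θ x y ≤ C
  grad_q : ∀ θ ∈ M.Θ, ∀ x x', ‖logGrad M.Θ (fun θ => M.q θ x x') θ‖ ≤ D
  hess_q : ∀ θ ∈ M.Θ, ∀ x x', ‖logHess M.Θ (fun θ => M.q θ x x') θ‖ ≤ D
  smooth_q : ∀ x x', ContDiffOn ℝ 3 (fun θ => M.q θ x x') M.Θ
  smooth_g : ∀ x, ∀ y ∈ M.𝒴, ContDiffOn ℝ 3 (fun θ => M.g θ x y) M.Θ
  integral_g : ∀ θ ∈ M.Θ, ∀ y ∈ M.𝒴, Integrable (fun x => M.g θ x y) M.μ ∧ 0 < ∫ x, M.g θ x y ∂M.μ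
  dichotomy : ∀ x, ∀ y ∈ M.𝒴, (∀ θ ∈ M.Θ, 0 < M.g θ x y) ∨ (∀ θ ∈ M.Θ, M.g θ x y = 0)

variable {M} in
theorem exists_bounds (h2 : M.A2) (h3 : M.A3) (h4 : M.A4) (h5 : M.A5)
    (h6 : ∀ x, ∀ y ∈ M.𝒴, (∀ θ ∈ M.Θ, 0 < M.g θ x y) ∨ (∀ θ ∈ M.Θ, M.g θ x y = 0)) :
    ∃ c C D, M.Bounds c C D := by
  obtain ⟨c, C, hc, h3⟩ := h3
  obtain ⟨D, h4⟩ := h4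
  refine ⟨c, C, D, hc, fun θ hθ x x' => ((h3 θ hθ).1 x x').1, fun θ hθ x x' => ((h3 θ hθ).1 x x').2,
    fun θ hθ => (h3 θ hθ).2, fun θ hθ x x' => ?_, fun θ hθ x x' => ?_, h2.1, h2.2, h5, h6⟩
  · rw [norm_logGrad M.uniqueDiffOn_Θ _ hθ]
    exact (h4 θ hθ x x').1
  · rw [norm_logHess M.uniqueDiffOn_Θ _ hθ]
    exact (h4 θ hθ x x').2

/-- On the set `G` of observations, the logarithmic derivatives of the observation densities are
bounded by `s₁` and `s₂`, uniformly on balls of radius `K`. -/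
structure GoodObs (K : ℝ) (s₁ s₂ : EuclideanSpace ℝ (Fin m) → ℝ)
    (G : Set (EuclideanSpace ℝ (Fin m))) : Prop where
  measurableSet : MeasurableSet G
  subset : G ⊆ M.𝒴
  measure_pos : ∀ y ∈ G, ∀ r, 0 < r → 0 < M.ν (Metric.closedBall y r)
  measurable₁ : Measurable s₁
  measurable₂ : Measurable s₂
  nonneg₁ : ∀ y, 0 ≤ s₁ y
  nonneg₂ : ∀ y, 0 ≤ s₂ y
  bound₁ : ∀ y ∈ G, ∀ θ ∈ M.Θ, ∀ x, ∀ y' ∈ Metric.closedBall y K ∩ M.𝒴,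
    ‖logGrad M.Θ (fun θ => M.g θ x y') θ‖ ≤ s₁ y
  bound₂ : ∀ y ∈ G, ∀ θ ∈ M.Θ, ∀ x, ∀ y' ∈ Metric.closedBall y K ∩ M.𝒴,
    ‖logHess M.Θ (fun θ => M.g θ x y') θ‖ ≤ s₂ y

/-- The gradient of `log gPert`. -/
def pertGrad (ε : ℝ) (θ : EuclideanSpace ℝ (Fin d)) (x : 𝒳) (y : EuclideanSpace ℝ (Fin m)) :
    EuclideanSpace ℝ (Fin d) →L[ℝ] ℝ :=
  if 0 < ε then avgJet₁ (M.ν.restrict (Metric.closedBall y ε)) (M.g θ x)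
    fun y' => logGrad M.Θ (fun θ => M.g θ x y') θ
  else logGrad M.Θ (fun θ => M.g θ x y) θ

/-- The Hessian of `log gPert`. -/
def pertHess (ε : ℝ) (θ : EuclideanSpace ℝ (Fin d)) (x : 𝒳) (y : EuclideanSpace ℝ (Fin m)) :
    EuclideanSpace ℝ (Fin d) →L[ℝ] EuclideanSpace ℝ (Fin d) →L[ℝ] ℝ :=
  if 0 < ε then avgJet₂ (M.ν.restrict (Metric.closedBall y ε)) (M.g θ x)
    (fun y' => logGrad M.Θ (fun θ => M.g θ x y') θ) fun y' => logHess M.Θ (fun θ => M.g θ x y') θ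
  else logHess M.Θ (fun θ => M.g θ x y) θ

theorem ae_mem_𝒴 (s : Set (EuclideanSpace ℝ (Fin m))) : ∀ᵐ y ∂M.ν.restrict s, y ∈ M.𝒴 :=
  ae_restrict_of_ae (mem_ae_iff.2 M.ν_compl_𝒴 : M.𝒴 ∈ ae M.ν)

instance instIsFiniteMeasureRestrictBall (y : EuclideanSpace ℝ (Fin m)) (ε : ℝ) :
    IsFiniteMeasure (M.ν.restrict (Metric.closedBall y ε)) :=
  ⟨by rw [Measure.restrict_apply_univ]; exact (isCompact_closedBall y ε).measure_lt_top⟩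

variable {M} {c C D : ℝ} (hB : M.Bounds c C D) {K : ℝ}
  {s₁ s₂ : EuclideanSpace ℝ (Fin m) → ℝ} {G : Set (EuclideanSpace ℝ (Fin m))}
  (hG : M.GoodObs K s₁ s₂ G) {ε : ℝ} (hε : ε ≤ K)

theorem measurable_g_right {θ : EuclideanSpace ℝ (Fin d)} (hθ : θ ∈ M.Θ) (x : 𝒳) :
    Measurable (M.g θ x) :=
  (M.measurable_g θ hθ).comp measurable_prodMk_left

theorem gPert_nonneg {θ : EuclideanSpace ℝ (Fin d)} (hθ : θ ∈ M.Θ) (x : 𝒳)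
    {y : EuclideanSpace ℝ (Fin m)} (hy : y ∈ M.𝒴) : 0 ≤ M.gPert ε θ x y := by
  unfold gPert
  split_ifs
  · rw [average_eq]
    refine smul_nonneg (by positivity) (integral_nonneg_of_ae ?_)
    filter_upwards [M.ae_mem_𝒴 (Metric.closedBall y ε)] with y' hy' using M.g_nonneg θ hθ x y' hy'
  · exact M.g_nonneg θ hθ x y hy

theorem measurable_gPert {θ : EuclideanSpace ℝ (Fin d)} (hθ : θ ∈ M.Θ) :
    Measurable fun p : 𝒳 × EuclideanSpace ℝ (Fin m) => M.gPert ε θ p.1 p.2 := by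
  unfold gPert
  split_ifs
  · have h1 : Measurable fun y : EuclideanSpace ℝ (Fin m) => M.ν (Metric.closedBall y ε) := by
      have hs : MeasurableSet {p : EuclideanSpace ℝ (Fin m) × EuclideanSpace ℝ (Fin m) |
          dist p.2 p.1 ≤ ε} := measurableSet_le (by fun_prop) measurable_const
      exact measurable_measure_prodMk_left hs
    have h2 : StronglyMeasurable fun p : 𝒳 × EuclideanSpace ℝ (Fin m) =>
        ∫ y', (Metric.closedBall p.2 ε).indicator (M.g θ p.1) y' ∂M.ν := by
      have hs : MeasurableSet {t : (𝒳 × EuclideanSpace ℝ (Fin m)) × EuclideanSpace ℝ (Fin m) |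
          dist t.2 t.1.2 ≤ ε} := measurableSet_le (by fun_prop) measurable_const
      have hg : Measurable fun t : (𝒳 × EuclideanSpace ℝ (Fin m)) × EuclideanSpace ℝ (Fin m) =>
          M.g θ t.1.1 t.2 := (M.measurable_g θ hθ).comp
            (by fun_prop : Measurable fun t : (𝒳 × EuclideanSpace ℝ (Fin m)) ×
              EuclideanSpace ℝ (Fin m) => (t.1.1, t.2))
      have hi := (hg.indicator hs).stronglyMeasurable
      exact StronglyMeasurable.integral_prod_right
        (f := fun (p : 𝒳 × EuclideanSpace ℝ (Fin m)) y' =>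
          (Metric.closedBall p.2 ε).indicator (M.g θ p.1) y') hi
    have e : (fun p : 𝒳 × EuclideanSpace ℝ (Fin m) =>
        ⨍ y' in Metric.closedBall p.2 ε, M.g θ p.1 y' ∂M.ν) = fun p =>
        (M.ν (Metric.closedBall p.2 ε)).toReal⁻¹ *
          ∫ y', (Metric.closedBall p.2 ε).indicator (M.g θ p.1) y' ∂M.ν := by
      funext p
      rw [setAverage_eq, integral_indicator measurableSet_closedBall]
      rfl
    rw [e]
    exact ((h1.comp measurable_snd).ennreal_toReal.inv).mul h2.measurable
  · exact M.measurable_g θ hθ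

theorem measurable_gPert_left {θ : EuclideanSpace ℝ (Fin d)} (hθ : θ ∈ M.Θ)
    (y : EuclideanSpace ℝ (Fin m)) : Measurable fun x => M.gPert ε θ x y := by
  have h : Measurable (Function.uncurry (M.gPert ε θ)) := measurable_gPert hθ
  exact h.of_uncurry_right

include hB

theorem Bounds.hasLogJet_q (x x' : 𝒳) : HasLogJet M.Θ (fun θ => M.q θ x x')
    (logGrad M.Θ fun θ => M.q θ x x') (logHess M.Θ fun θ => M.q θ x x') :=
  .of_contDiffOn M.uniqueDiffOn_Θ ((hB.smooth_q x x').of_le (by norm_num))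
    (.inl fun θ hθ => hB.pos.trans_le (hB.q_lower θ hθ x x'))

theorem Bounds.hasLogJet_g (x : 𝒳) {y : EuclideanSpace ℝ (Fin m)} (hy : y ∈ M.𝒴) :
    HasLogJet M.Θ (fun θ => M.g θ x y) (logGrad M.Θ fun θ => M.g θ x y)
      (logHess M.Θ fun θ => M.g θ x y) :=
  .of_contDiffOn M.uniqueDiffOn_Θ ((hB.smooth_g x y hy).of_le (by norm_num)) (hB.dichotomy x y hy)

theorem Bounds.integrable_g {θ : EuclideanSpace ℝ (Fin d)} (hθ : θ ∈ M.Θ) (x : 𝒳)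
    (y : EuclideanSpace ℝ (Fin m)) (ε : ℝ) :
    Integrable (M.g θ x) (M.ν.restrict (Metric.closedBall y ε)) := by
  refine Integrable.of_bound (measurable_g_right hθ x).aestronglyMeasurable C ?_
  filter_upwards [M.ae_mem_𝒴 (Metric.closedBall y ε)] with y' hy'
  rw [Real.norm_of_nonneg (M.g_nonneg θ hθ x y' hy')]
  exact hB.g_upper θ hθ x y' hy'

include hG hε

theorem Bounds.gPert_le {θ : EuclideanSpace ℝ (Fin d)} (hθ : θ ∈ M.Θ) (x : 𝒳)
    {y : EuclideanSpace ℝ (Fin m)} (hy : y ∈ G) : M.gPert ε θ x y ≤ C := by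
  unfold gPert
  split_ifs with h
  · have hpos : 0 < M.ν.real (Metric.closedBall y ε) :=
      ENNReal.toReal_pos (hG.measure_pos y hy ε h).ne' (isCompact_closedBall y ε).measure_lt_top.ne
    rw [setAverage_eq, smul_eq_mul, inv_mul_le_iff₀ hpos]
    calc _ ≤ ∫ _ in Metric.closedBall y ε, C ∂M.ν := by
          refine integral_mono_ae (hB.integrable_g hθ x y ε) (integrable_const _) ?_
          filter_upwards [M.ae_mem_𝒴 (Metric.closedBall y ε)] with y' hy'
            using hB.g_upper θ hθ x y' hy'
      _ = _ := by simp [Measure.real]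
  · exact hB.g_upper θ hθ x y (hG.subset hy)

theorem Bounds.pert_zero {θ : EuclideanSpace ℝ (Fin d)} (hθ : θ ∈ M.Θ) (x : 𝒳)
    {y : EuclideanSpace ℝ (Fin m)} (hy : y ∈ G) (h0 : M.gPert ε θ x y = 0) :
    M.pertGrad ε θ x y = 0 ∧ M.pertHess ε θ x y = 0 := by
  unfold gPert at h0
  unfold pertGrad pertHess
  split_ifs at h0 ⊢ with h
  · have hpos : 0 < M.ν.real (Metric.closedBall y ε) :=
      ENNReal.toReal_pos (hG.measure_pos y hy ε h).ne' (isCompact_closedBall y ε).measure_lt_top.ne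
    rw [setAverage_eq, smul_eq_zero] at h0
    have h1 : ∫ y', M.g θ x y' ∂M.ν.restrict (Metric.closedBall y ε) = 0 :=
      h0.resolve_left (inv_ne_zero hpos.ne')
    have h2 : avgJet₁ (M.ν.restrict (Metric.closedBall y ε)) (M.g θ x)
        (fun y' => logGrad M.Θ (fun θ => M.g θ x y') θ) = 0 := by
      rw [avgJet₁, h1, inv_zero, zero_smul]
    refine ⟨h2, ?_⟩
    rw [avgJet₂, h2, h1, inv_zero, zero_smul]
    simp
  · rcases hB.dichotomy x y (hG.subset hy) with h' | h'
    · exact absurd h0 (h' θ hθ).ne'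
    · exact ⟨logGrad_eq_zero h' hθ, logHess_eq_zero h' hθ⟩

theorem Bounds.ae_bound₁ {θ : EuclideanSpace ℝ (Fin d)} (hθ : θ ∈ M.Θ) (x : 𝒳)
    {y : EuclideanSpace ℝ (Fin m)} (hy : y ∈ G) :
    ∀ᵐ y' ∂M.ν.restrict (Metric.closedBall y ε),
      ‖logGrad M.Θ (fun θ => M.g θ x y') θ‖ ≤ s₁ y ∧
      ‖logHess M.Θ (fun θ => M.g θ x y') θ‖ ≤ s₂ y ∧ 0 ≤ M.g θ x y' := by
  filter_upwards [M.ae_mem_𝒴 (Metric.closedBall y ε), ae_restrict_mem measurableSet_closedBall]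
    with y' hy' hb
  have := Metric.closedBall_subset_closedBall hε hb
  exact ⟨hG.bound₁ y hy θ hθ x y' ⟨this, hy'⟩, hG.bound₂ y hy θ hθ x y' ⟨this, hy'⟩,
    M.g_nonneg θ hθ x y' hy'⟩

theorem Bounds.norm_pertGrad_le {θ : EuclideanSpace ℝ (Fin d)} (hK : 0 < K) (hθ : θ ∈ M.Θ) (x : 𝒳)
    {y : EuclideanSpace ℝ (Fin m)} (hy : y ∈ G) : ‖M.pertGrad ε θ x y‖ ≤ s₁ y := by
  have h := hB.ae_bound₁ hG hε hθ x hy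
  unfold pertGrad
  split_ifs
  · exact norm_avgJet₁_le (hG.nonneg₁ y) (hB.integrable_g hθ x y ε)
      (by filter_upwards [h] with y' h' using h'.2.2) (by filter_upwards [h] with y' h' using h'.1)
  · exact hG.bound₁ y hy θ hθ x y ⟨Metric.mem_closedBall_self hK.le, hG.subset hy⟩

theorem Bounds.norm_pertHess_le {θ : EuclideanSpace ℝ (Fin d)} (hK : 0 < K) (hθ : θ ∈ M.Θ) (x : 𝒳)
    {y : EuclideanSpace ℝ (Fin m)} (hy : y ∈ G) :
    ‖M.pertHess ε θ x y‖ ≤ s₂ y + 2 * s₁ y ^ 2 := by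
  have h := hB.ae_bound₁ hG hε hθ x hy
  unfold pertHess
  split_ifs
  · exact norm_avgJet₂_le (hG.nonneg₁ y) (hG.nonneg₂ y) (hB.integrable_g hθ x y ε)
      (by filter_upwards [h] with y' h' using h'.2.2) (by filter_upwards [h] with y' h' using h'.1)
      (by filter_upwards [h] with y' h' using h'.2.1)
  · have := hG.bound₂ y hy θ hθ x y ⟨Metric.mem_closedBall_self hK.le, hG.subset hy⟩
    nlinarith [sq_nonneg (s₁ y)]

theorem Bounds.hasLogJet_gPert (x : 𝒳) {y : EuclideanSpace ℝ (Fin m)} (hy : y ∈ G) :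
    HasLogJet M.Θ (fun θ => M.gPert ε θ x y) (fun θ => M.pertGrad ε θ x y)
      (fun θ => M.pertHess ε θ x y) := by
  unfold gPert pertGrad pertHess
  split_ifs
  · have hs : ∀ᵐ y' ∂M.ν.restrict (Metric.closedBall y ε), y' ∈ Metric.closedBall y K ∩ M.𝒴 := by
      filter_upwards [M.ae_mem_𝒴 (Metric.closedBall y ε),
        ae_restrict_mem measurableSet_closedBall] with y' hy' hb
      exact ⟨Metric.closedBall_subset_closedBall hε hb, hy'⟩
    have hs0 := hG.nonneg₁ y
    have hs2 := hG.nonneg₂ y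
    have hC : ∀ θ ∈ M.Θ, 0 ≤ C := fun θ hθ =>
      (M.g_nonneg θ hθ x y (hG.subset hy)).trans (hB.g_upper θ hθ x y (hG.subset hy))
    have h1 : HasLogJet M.Θ (fun θ => ∫ y', M.g θ x y' ∂M.ν.restrict (Metric.closedBall y ε))
        (fun θ => avgJet₁ (M.ν.restrict (Metric.closedBall y ε)) (M.g θ x)
          fun y' => logGrad M.Θ (fun θ => M.g θ x y') θ)
        (fun θ => avgJet₂ (M.ν.restrict (Metric.closedBall y ε)) (M.g θ x)
          (fun y' => logGrad M.Θ (fun θ => M.g θ x y') θ)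
          fun y' => logHess M.Θ (fun θ => M.g θ x y') θ) :=
      HasLogJet.integral (f := fun θ y' => M.g θ x y')
        (A := fun θ y' => logGrad M.Θ (fun θ => M.g θ x y') θ)
        (B := fun θ y' => logHess M.Θ (fun θ => M.g θ x y') θ)
        (b := fun _ => C * (1 + s₁ y + (s₂ y + s₁ y ^ 2)))
        M.lengthQuasiconvex_Θ M.uniqueDiffOn_Θ
        (fun θ hθ => (hB.integrable_g hθ x y ε).aestronglyMeasurable)
        (by filter_upwards [hs] with y' hy' θ hθ using M.g_nonneg θ hθ x y' hy'.2)
        (by filter_upwards [hs] with y' hy' using hB.hasLogJet_g x hy'.2)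
        (by
          filter_upwards [hs] with y' hy' θ hθ
          refine (hB.g_upper θ hθ x y' hy'.2).trans (le_mul_of_one_le_right (hC θ hθ) ?_)
          nlinarith [sq_nonneg (s₁ y)])
        (by
          filter_upwards [hs] with y' hy' θ hθ
          rw [norm_smul, Real.norm_of_nonneg (M.g_nonneg θ hθ x y' hy'.2)]
          refine mul_le_mul (hB.g_upper θ hθ x y' hy'.2)
            ((hG.bound₁ y hy θ hθ x y' hy').trans ?_) (norm_nonneg _) (hC θ hθ)
          nlinarith [sq_nonneg (s₁ y)])
        (by
          filter_upwards [hs] with y' hy' θ hθ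
          rw [norm_smul, Real.norm_of_nonneg (M.g_nonneg θ hθ x y' hy'.2)]
          have b1 := hG.bound₁ y hy θ hθ x y' hy'
          have b2 := hG.bound₂ y hy θ hθ x y' hy'
          refine mul_le_mul (hB.g_upper θ hθ x y' hy'.2)
            (((norm_add_le _ _).trans (add_le_add b2 (?_ : _ ≤ s₁ y ^ 2))).trans ?_)
            (norm_nonneg _) (hC θ hθ)
          · rw [norm_outer_apply, sq]
            gcongr
          · linarith)
        (integrable_const _)
    have h2 := (HasLogJet.const (S := M.Θ) (M.ν.real (Metric.closedBall y ε))⁻¹).mul h1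
    simp only [zero_add] at h2
    simp only [setAverage_eq, smul_eq_mul]
    exact h2
  · exact hB.hasLogJet_g x (hG.subset hy)

theorem Bounds.integral_gPert_pos {θ : EuclideanSpace ℝ (Fin d)} (hθ : θ ∈ M.Θ)
    {y : EuclideanSpace ℝ (Fin m)} (hy : y ∈ G) :
    Integrable (fun x => M.gPert ε θ x y) M.μ ∧ 0 < ∫ x, M.gPert ε θ x y ∂M.μ := by
  have hm : Measurable fun x => M.gPert ε θ x y := measurable_gPert_left hθ y
  have hi : Integrable (fun x => M.gPert ε θ x y) M.μ :=
    Integrable.of_bound hm.aestronglyMeasurable C (.of_forall fun x => by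
      rw [Real.norm_of_nonneg (gPert_nonneg hθ x (hG.subset hy))]
      exact hB.gPert_le hG hε hθ x hy)
  refine ⟨hi, ?_⟩
  by_cases h : 0 < ε
  · set n := M.ν.restrict (Metric.closedBall y ε) with hn
    have hpos : 0 < M.ν.real (Metric.closedBall y ε) :=
      ENNReal.toReal_pos (hG.measure_pos y hy ε h).ne' (isCompact_closedBall y ε).measure_lt_top.ne
    have hsw : Integrable (Function.uncurry (M.g θ)) (M.μ.prod n) := by
      refine Integrable.of_bound (M.measurable_g θ hθ).aestronglyMeasurable C ?_
      have : ∀ᵐ p ∂M.μ.prod n, p.2 ∈ M.𝒴 :=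
        Measure.quasiMeasurePreserving_snd.ae (M.ae_mem_𝒴 _)
      filter_upwards [this] with p hp
      rw [Function.uncurry, Real.norm_of_nonneg (M.g_nonneg θ hθ p.1 p.2 hp)]
      exact hB.g_upper θ hθ p.1 p.2 hp
    have e : ∫ x, M.gPert ε θ x y ∂M.μ =
        (M.ν.real (Metric.closedBall y ε))⁻¹ * ∫ y', ∫ x, M.g θ x y' ∂M.μ ∂n := by
      rw [← integral_integral_swap hsw, ← integral_const_mul]
      refine integral_congr_ae (.of_forall fun x => ?_)
      simp only [gPert, if_pos h, setAverage_eq, smul_eq_mul, hn]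
    rw [e]
    refine mul_pos (inv_pos.2 hpos) ?_
    have h0 : ∀ᵐ y' ∂n, 0 < ∫ x, M.g θ x y' ∂M.μ := by
      filter_upwards [M.ae_mem_𝒴 (Metric.closedBall y ε)] with y' hy'
        using (hB.integral_g θ hθ y' hy').2
    have hin : Integrable (fun y' => ∫ x, M.g θ x y' ∂M.μ) n := hsw.integral_prod_right
    rw [integral_pos_iff_support_of_nonneg_ae (by filter_upwards [h0] with y' h' using h'.le) hin]
    have hfull : n (Function.support fun y' => ∫ x, M.g θ x y' ∂M.μ) = n univ := by
      refine measure_congr ?_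
      filter_upwards [h0] with y' h'
      exact propext ⟨fun _ => trivial, fun _ => h'.ne'⟩
    rw [hfull, hn, Measure.restrict_apply_univ]
    exact hG.measure_pos y hy ε h
  · simp only [gPert, if_neg h]
    exact (hB.integral_g θ hθ y (hG.subset hy)).2

end HMMFamily

/-! ### The likelihood as an iterated integral -/

section PathIntegral

variable {𝒳 : Type*} [MeasurableSpace 𝒳] {μ : Measure 𝒳} [IsFiniteMeasure μ]

theorem prod_path_cons (n : ℕ) (L : ℕ → 𝒳 → 𝒳 → ℝ) (x₀ x₁ : 𝒳) (x : Fin n → 𝒳) :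
    ∏ k : Fin (n + 1), L k ((Fin.cons x₀ (Fin.cons x₁ x : Fin (n + 1) → 𝒳) : Fin (n + 2) → 𝒳)
      k.castSucc) ((Fin.cons x₁ x : Fin (n + 1) → 𝒳) k) =
    L 0 x₀ x₁ * ∏ k : Fin n, L (k + 1) ((Fin.cons x₁ x : Fin (n + 1) → 𝒳) k.castSucc) (x k) := by
  rw [Fin.prod_univ_succ]
  simp only [Fin.castSucc_zero, Fin.cons_zero, Fin.cons_succ, Fin.val_zero, Fin.val_succ,
    ← Fin.succ_castSucc]

theorem measurable_prod_path (n : ℕ) {L : ℕ → 𝒳 → 𝒳 → ℝ}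
    (hL : ∀ k, Measurable (Function.uncurry (L k))) :
    Measurable fun p : 𝒳 × (Fin n → 𝒳) =>
      ∏ k : Fin n, L k ((Fin.cons p.1 p.2 : Fin (n + 1) → 𝒳) k.castSucc) (p.2 k) := by
  refine Finset.measurable_fun_prod _ fun k _ => ?_
  have h : ∀ j : Fin (n + 1), Measurable fun p : 𝒳 × (Fin n → 𝒳) =>
      (Fin.cons p.1 p.2 : Fin (n + 1) → 𝒳) j := fun j => by
    refine Fin.cases ?_ (fun i => ?_) j
    · simpa using measurable_fst
    · simp only [Fin.cons_succ]
      exact (measurable_pi_apply i).comp measurable_snd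
  exact (hL k).comp ((h k.castSucc).prodMk ((measurable_pi_apply k).comp measurable_snd))

theorem integral_prod_path {V W : Type*} [NormedAddCommGroup V] [NormedSpace ℝ V]
    [NormedAddCommGroup W] [NormedSpace ℝ W] (β : V →L[ℝ] V →L[ℝ] W) (n : ℕ)
    {K : ℕ → KernelJet 𝒳 V W} (hm : ∀ k, Measurable (Function.uncurry (K k).L))
    (h0 : ∀ k x z, 0 ≤ (K k).L x z) (hb : ∀ k, ∃ C, ∀ x z, (K k).L x z ≤ C) (x₀ : 𝒳) :
    ∫ x : Fin n → 𝒳, ∏ k : Fin n, (K k).L ((Fin.cons x₀ x : Fin (n + 1) → 𝒳) k.castSucc) (x k)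
      ∂Measure.pi (fun _ => μ) = (KernelJet.iter μ β n K).p x₀ := by
  induction n generalizing K x₀ with
  | zero => simp [KernelJet.iter, Measure.real]
  | succ n ih =>
    choose C hC using hb
    have hC' : ∀ k, ∃ C', 0 ≤ C' ∧ ∀ x z, (K k).L x z ≤ C' := fun k =>
      ⟨max (C k) 0, le_max_right _ _, fun x z => (hC k x z).trans (le_max_left _ _)⟩
    choose C' hC'0 hC' using hC'
    have hmp := (measurePreserving_piFinSuccAbove (fun _ : Fin (n + 1) => μ) 0).symm
    rw [← hmp.integral_comp (MeasurableEquiv.measurableEmbedding _)]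
    have e : ∀ p : 𝒳 × (Fin n → 𝒳),
        (MeasurableEquiv.piFinSuccAbove (fun _ : Fin (n + 1) => 𝒳) 0).symm p =
          (Fin.cons p.1 p.2 : Fin (n + 1) → 𝒳) := fun p => by
      simp [MeasurableEquiv.piFinSuccAbove, Fin.insertNthEquiv]
    have hmeas := measurable_prod_path n (L := fun k => (K (k + 1)).L) fun k => hm (k + 1)
    have hint : Integrable (fun p : 𝒳 × (Fin n → 𝒳) => (K 0).L x₀ p.1 *
        ∏ k : Fin n, (K (k + 1)).L ((Fin.cons p.1 p.2 : Fin (n + 1) → 𝒳) k.castSucc) (p.2 k))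
        (μ.prod (Measure.pi fun _ : Fin n => μ)) := by
      refine Integrable.of_bound (((hm 0).of_uncurry_left.comp
        measurable_fst).mul hmeas).aestronglyMeasurable (C' 0 * ∏ k : Fin n, C' (k + 1))
        (.of_forall fun p => ?_)
      have hp : 0 ≤ ∏ k : Fin n,
          (K (k + 1)).L ((Fin.cons p.1 p.2 : Fin (n + 1) → 𝒳) k.castSucc) (p.2 k) :=
        Finset.prod_nonneg fun k _ => h0 _ _ _
      rw [Real.norm_of_nonneg (mul_nonneg (h0 _ _ _) hp)]
      exact mul_le_mul (hC' 0 _ _) (Finset.prod_le_prod (fun k _ => h0 _ _ _)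
        fun k _ => hC' (k + 1) _ _) hp (hC'0 0)
    calc _ = ∫ p : 𝒳 × (Fin n → 𝒳), (K 0).L x₀ p.1 *
          ∏ k : Fin n, (K (k + 1)).L ((Fin.cons p.1 p.2 : Fin (n + 1) → 𝒳) k.castSucc) (p.2 k)
          ∂(μ.prod (Measure.pi fun _ : Fin n => μ)) := by
          refine integral_congr_ae (.of_forall fun p => ?_)
          simp only [e]
          exact prod_path_cons n (fun k => (K k).L) x₀ p.1 p.2
      _ = ∫ x₁, (K 0).L x₀ x₁ * ∫ x : Fin n → 𝒳, ∏ k : Fin n,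
          (K (k + 1)).L ((Fin.cons x₁ x : Fin (n + 1) → 𝒳) k.castSucc) (x k)
          ∂(Measure.pi fun _ : Fin n => μ) ∂μ := by
          rw [integral_prod _ hint]
          simp only [integral_const_mul]
      _ = _ := by
          simp only [KernelJet.iter, KernelJet.step]
          refine integral_congr_ae (.of_forall fun x₁ => ?_)
          dsimp only
          rw [ih (K := fun k => K (k + 1)) (fun k => hm (k + 1)) (fun k => h0 (k + 1))
            (fun k => ⟨C (k + 1), hC (k + 1)⟩) x₁]

end PathIntegral

namespace HMMFamily

variable {d m : ℕ} {𝒳 : Type*} [MeasurableSpace 𝒳] (M : HMMFamily d m 𝒳)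

open Classical in
/-- The kernel jet of the perturbed model given an observation in `G`, and a trivial one given any
other observation. -/
def kernelJet (G : Set (EuclideanSpace ℝ (Fin m))) (ε : ℝ) (θ : EuclideanSpace ℝ (Fin d))
    (y : EuclideanSpace ℝ (Fin m)) : KernelJet 𝒳 (EuclideanSpace ℝ (Fin d) →L[ℝ] ℝ)
      (EuclideanSpace ℝ (Fin d) →L[ℝ] EuclideanSpace ℝ (Fin d) →L[ℝ] ℝ) :=
  if y ∈ G then
    { L := fun x z => M.q θ x z * M.gPert ε θ z y
      a := fun x z => logGrad M.Θ (fun θ => M.q θ x z) θ + M.pertGrad ε θ z y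
      b := fun x z => logHess M.Θ (fun θ => M.q θ x z) θ + M.pertHess ε θ z y }
  else
    { L := fun _ _ => 1
      a := fun _ _ => 0
      b := fun _ _ => 0 }

/-- The scale of the logarithmic derivatives given an observation. -/
def obsScale (D : ℝ) (s₁ s₂ : EuclideanSpace ℝ (Fin m) → ℝ) (y : EuclideanSpace ℝ (Fin m)) : ℝ :=
  1 + |D| + 2 * s₁ y + s₂ y

variable {M}

open Classical in
theorem measurable_kernelJet {G : Set (EuclideanSpace ℝ (Fin m))} (hG : MeasurableSet G) {ε : ℝ}
    {θ : EuclideanSpace ℝ (Fin d)} (hθ : θ ∈ M.Θ) :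
    Measurable fun t : (EuclideanSpace ℝ (Fin m) × 𝒳) × 𝒳 =>
      (M.kernelJet G ε θ t.1.1).L t.1.2 t.2 := by
  have e : (fun t : (EuclideanSpace ℝ (Fin m) × 𝒳) × 𝒳 => (M.kernelJet G ε θ t.1.1).L t.1.2 t.2) =
      fun t => if t.1.1 ∈ G then Function.uncurry (M.q θ) (t.1.2, t.2) *
        Function.uncurry (M.gPert ε θ) (t.2, t.1.1) else 1 := by
    funext t
    unfold kernelJet
    split_ifs <;> rfl
  have hm : MeasurableSet {t : (EuclideanSpace ℝ (Fin m) × 𝒳) × 𝒳 | t.1.1 ∈ G} :=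
    (measurable_fst.comp measurable_fst) hG
  have hg : Measurable (Function.uncurry (M.gPert ε θ)) := measurable_gPert hθ
  rw [e]
  exact Measurable.ite hm (((M.measurable_q θ hθ).comp
    ((measurable_snd.comp measurable_fst).prodMk measurable_snd)).mul
    (hg.comp (measurable_snd.prodMk (measurable_fst.comp measurable_fst)))) measurable_const

variable {c C D : ℝ} (hB : M.Bounds c C D) {K : ℝ}
  {s₁ s₂ : EuclideanSpace ℝ (Fin m) → ℝ} {G : Set (EuclideanSpace ℝ (Fin m))}
  (hG : M.GoodObs K s₁ s₂ G) {ε : ℝ} (hε : ε ≤ K) (hK : 0 < K) {ϰ : ℝ} (hϰ : 1 ≤ ϰ)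
  (hC : C ≤ ϰ * c)

theorem μ_ne_zero {θ : EuclideanSpace ℝ (Fin d)} (hθ : θ ∈ M.Θ) (x : 𝒳) : M.μ ≠ 0 := fun h => by
  have := M.lintegral_q θ hθ x
  simp [h] at this

include hB

theorem Bounds.stronglyMeasurable_q {θ : EuclideanSpace ℝ (Fin d)} (hθ : θ ∈ M.Θ) :
    StronglyMeasurable (Function.uncurry fun x z => logGrad M.Θ (fun θ => M.q θ x z) θ) ∧
    StronglyMeasurable (Function.uncurry fun x z => logHess M.Θ (fun θ => M.q θ x z) θ) :=
  HasLogJet.stronglyMeasurable (Ω := 𝒳 × 𝒳) M.uniqueDiffOn_Θ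
    (f := fun θ p => M.q θ p.1 p.2) (A := fun θ p => logGrad M.Θ (fun θ => M.q θ p.1 p.2) θ)
    (B := fun θ p => logHess M.Θ (fun θ => M.q θ p.1 p.2) θ)
    (fun p => hB.hasLogJet_q p.1 p.2) (fun θ hθ => (M.measurable_q θ hθ).stronglyMeasurable)
    (fun θ hθ p h => absurd h (hB.pos.trans_le (hB.q_lower θ hθ p.1 p.2)).ne') hθ

include hG hε

theorem Bounds.stronglyMeasurable_pert {θ : EuclideanSpace ℝ (Fin d)} (hθ : θ ∈ M.Θ)
    {y : EuclideanSpace ℝ (Fin m)} (hy : y ∈ G) :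
    StronglyMeasurable (fun x => M.pertGrad ε θ x y) ∧
    StronglyMeasurable (fun x => M.pertHess ε θ x y) :=
  HasLogJet.stronglyMeasurable M.uniqueDiffOn_Θ
    (f := fun θ x => M.gPert ε θ x y) (A := fun θ x => M.pertGrad ε θ x y)
    (B := fun θ x => M.pertHess ε θ x y)
    (fun x => hB.hasLogJet_gPert hG hε x hy)
    (fun _ hθ => (measurable_gPert_left hθ y).stronglyMeasurable)
    (fun _ hθ x h => hB.pert_zero hG hε hθ x hy h) hθ

include hK hϰ hC

theorem Bounds.kernelJet_good {θ : EuclideanSpace ℝ (Fin d)} (hθ : θ ∈ M.Θ)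
    (y : EuclideanSpace ℝ (Fin m)) :
    (M.kernelJet G ε θ y).Good M.μ ϰ (obsScale D s₁ s₂ y) := by
  have h1 := hG.nonneg₁ y
  have h2 := hG.nonneg₂ y
  have hD := le_abs_self D
  have hD0 := abs_nonneg D
  by_cases hy : y ∈ G
  · rw [kernelJet, if_pos hy]
    have hq := hB.stronglyMeasurable_q hθ
    have hp := hB.stronglyMeasurable_pert hG hε hθ hy
    have hg0 : ∀ z, 0 ≤ M.gPert ε θ z y := fun z => gPert_nonneg hθ z (hG.subset hy)
    have hq0 : ∀ x z, 0 < M.q θ x z := fun x z => hB.pos.trans_le (hB.q_lower θ hθ x z)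
    have hmg : Measurable fun z => M.gPert ε θ z y := measurable_gPert_left hθ y
    have hLm : Measurable (Function.uncurry fun x z => M.q θ x z * M.gPert ε θ z y) :=
      (M.measurable_q θ hθ).mul (hmg.comp measurable_snd)
    have hLb : ∀ x z, M.q θ x z * M.gPert ε θ z y ≤ C * C := fun x z =>
      mul_le_mul (hB.q_upper θ hθ x z) (hB.gPert_le hG hε hθ z hy) (hg0 z)
        ((hq0 x z).le.trans (hB.q_upper θ hθ x z))
    refine ⟨hLm, hq.1.add (hp.1.comp_measurable measurable_snd),
      hq.2.add (hp.2.comp_measurable measurable_snd), fun x z => mul_nonneg (hq0 x z).le (hg0 z),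
      ⟨C * C, hLb⟩, fun x => ?_, fun x x' z => ?_, fun x z => ?_, fun x z => ?_⟩
    · obtain ⟨hi, hpos⟩ := hB.integral_gPert_pos hG hε hθ hy
      have hLi : Integrable (fun z => M.q θ x z * M.gPert ε θ z y) M.μ :=
        Integrable.of_bound hLm.of_uncurry_left.aestronglyMeasurable (C * C) (.of_forall fun z => by
          rw [Real.norm_of_nonneg (mul_nonneg (hq0 x z).le (hg0 z))]
          exact hLb x z)
      calc 0 < c * ∫ z, M.gPert ε θ z y ∂M.μ := mul_pos hB.pos hpos
        _ = ∫ z, c * M.gPert ε θ z y ∂M.μ := (integral_const_mul _ _).symm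
        _ ≤ _ := integral_mono (hi.const_mul c) hLi fun z =>
            mul_le_mul_of_nonneg_right (hB.q_lower θ hθ x z) (hg0 z)
    · dsimp only
      rw [← mul_assoc]
      refine mul_le_mul_of_nonneg_right ?_ (hg0 z)
      calc M.q θ x z ≤ C := hB.q_upper θ hθ x z
        _ ≤ ϰ * c := hC
        _ ≤ _ := mul_le_mul_of_nonneg_left (hB.q_lower θ hθ x' z) (by linarith)
    · refine (norm_add_le _ _).trans ((add_le_add (hB.grad_q θ hθ x z)
        (hB.norm_pertGrad_le hG hε hK hθ z hy)).trans ?_)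
      rw [obsScale]
      linarith
    · refine (norm_add_le _ _).trans ((add_le_add (hB.hess_q θ hθ x z)
        (hB.norm_pertHess_le hG hε hK hθ z hy)).trans ?_)
      rw [obsScale]
      nlinarith [mul_nonneg hD0 h1, mul_nonneg hD0 h2, mul_nonneg h1 h2, sq_nonneg (s₂ y),
        sq_nonneg (s₁ y), sq_nonneg |D|]
  · rw [kernelJet, if_neg hy]
    refine ⟨measurable_const, stronglyMeasurable_const, stronglyMeasurable_const,
      fun _ _ => zero_le_one, ⟨1, fun _ _ => le_rfl⟩, fun x => ?_, fun _ _ _ => by simpa using hϰ,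
      fun _ _ => ?_, fun _ _ => ?_⟩
    · have : NeZero M.μ := ⟨μ_ne_zero hθ x⟩
      simp
    · simp only [norm_zero, obsScale]; positivity
    · simp only [norm_zero]; positivity

theorem Bounds.jetSystem : JetSystem M.Θ M.μ ϰ (obsScale D s₁ s₂) (M.kernelJet G ε) where
  one_le_ϰ := hϰ
  one_le_σ y := by
    have h1 := hG.nonneg₁ y
    have h2 := hG.nonneg₂ y
    have hD0 := abs_nonneg D
    rw [obsScale]
    linarith
  measurable_σ := (measurable_const.add (hG.measurable₁.const_mul 2)).add hG.measurable₂
  good θ hθ y := hB.kernelJet_good hG hε hK hϰ hC hθ y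
  jet y x z := by
    by_cases hy : y ∈ G
    · simp only [kernelJet, if_pos hy]
      exact (hB.hasLogJet_q x z).mul (hB.hasLogJet_gPert hG hε z hy)
    · simp only [kernelJet, if_neg hy]
      exact HasLogJet.one
  measurable θ hθ := measurable_kernelJet hG.measurableSet hθ
  bdd y := by
    by_cases hy : y ∈ G
    · refine ⟨C * C, fun θ hθ x z => ?_⟩
      rw [kernelJet, if_pos hy]
      have hq0 : 0 < M.q θ x z := hB.pos.trans_le (hB.q_lower θ hθ x z)
      exact mul_le_mul (hB.q_upper θ hθ x z) (hB.gPert_le hG hε hθ z hy)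
        (gPert_nonneg hθ z (hG.subset hy)) (hq0.le.trans (hB.q_upper θ hθ x z))
    · refine ⟨1, fun θ hθ x z => ?_⟩
      rw [kernelJet, if_neg hy]

theorem Bounds.likelihood_eq {θ : EuclideanSpace ℝ (Fin d)} (hθ : θ ∈ M.Θ) (x₀ : 𝒳) (n : ℕ)
    {ω : ℕ → EuclideanSpace ℝ (Fin m)} (hω : ∀ k, ω k ∈ G) :
    M.likelihood ε θ x₀ n ω = (JetSystem.lik M.μ (M.kernelJet G ε) n θ (shiftBy 1 ω)).p x₀ := by
  have hk := fun k => hB.kernelJet_good hG hε hK hϰ hC hθ (shiftBy 1 ω k)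
  rw [JetSystem.lik, ← integral_prod_path (outer _) n (fun k => (hk k).measurable_L)
    (fun k => (hk k).nonneg) (fun k => (hk k).bdd) x₀, likelihood]
  refine integral_congr_ae (.of_forall fun x => Finset.prod_congr rfl fun k _ => ?_)
  have h : shiftBy 1 ω k ∈ G := hω _
  rw [kernelJet, if_pos h]
  rfl

end HMMFamily

/-! ### The joint chain of a hidden Markov model -/

theorem lintegral_chainLaw_zero {Z : Type*} [MeasurableSpace Z] (J : Kernel Z Z) [IsMarkovKernel J]
    (init : Measure Z) [IsProbabilityMeasure init] {f : Z → ℝ≥0∞} (hf : Measurable f) :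
    ∫⁻ ω, f (ω 0) ∂chainLaw J init = ∫⁻ z, f z ∂init := by
  simpa [boxFun] using lintegral_box J (init := init) 0 (f := fun _ => f) fun _ => hf

namespace HMMFamily

variable {d m : ℕ} {𝒳 : Type*} [MeasurableSpace 𝒳] (M : HMMFamily d m 𝒳)

theorem lintegral_jointKernel (θ : M.Θ) (z : 𝒳 × EuclideanSpace ℝ (Fin m))
    {F : 𝒳 × EuclideanSpace ℝ (Fin m) → ℝ≥0∞} (hF : Measurable F) :
    ∫⁻ z', F z' ∂M.jointKernel θ z = ∫⁻ x, ENNReal.ofReal (M.q θ z.1 x) *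
      ∫⁻ y, ENNReal.ofReal (M.g θ x y) * F (x, y) ∂M.ν ∂M.μ := by
  have hq : Measurable (Function.uncurry fun x x' => ENNReal.ofReal (M.q θ x x')) :=
    (M.measurable_q θ θ.2).ennreal_ofReal
  have hg : Measurable (Function.uncurry fun x y => ENNReal.ofReal (M.g θ x y)) :=
    (M.measurable_g θ θ.2).ennreal_ofReal
  rw [jointKernel, Kernel.comap_apply, Kernel.lintegral_compProd _ _ _ hF]
  have hm : Measurable fun x => ∫⁻ y, ENNReal.ofReal (M.g θ x y) * F (x, y) ∂M.ν :=
    (hg.mul hF).lintegral_prod_right'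
  refine (lintegral_congr fun x => ?_).trans
    (Kernel.lintegral_withDensity (Kernel.const 𝒳 M.μ) hq z.1 hm)
  exact Kernel.lintegral_withDensity (Kernel.const 𝒳 M.ν) hg x (g := fun y => F (x, y))
    (hF.comp measurable_prodMk_left)

variable {M}

theorem Bounds.jointKernel_le {c C D : ℝ} (hB : M.Bounds c C D) (θ : M.Θ) {κ : ℝ≥0}
    (hκ : C ≤ κ * c) (z z' : 𝒳 × EuclideanSpace ℝ (Fin m)) :
    M.jointKernel θ z ≤ κ • M.jointKernel θ z' := by
  refine Measure.le_iff.2 fun s hs => ?_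
  have hi : Measurable (s.indicator (1 : 𝒳 × EuclideanSpace ℝ (Fin m) → ℝ≥0∞)) :=
    measurable_one.indicator hs
  have hg : Measurable (Function.uncurry fun x y => ENNReal.ofReal (M.g θ x y)) :=
    (M.measurable_g θ θ.2).ennreal_ofReal
  have hm : Measurable fun x => ∫⁻ y, ENNReal.ofReal (M.g θ x y) *
      s.indicator (1 : 𝒳 × EuclideanSpace ℝ (Fin m) → ℝ≥0∞) (x, y) ∂M.ν :=
    (hg.mul hi).lintegral_prod_right'
  have hq : Measurable fun x => ENNReal.ofReal (M.q θ z'.1 x) :=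
    ((M.measurable_q θ θ.2).comp measurable_prodMk_left).ennreal_ofReal
  rw [Measure.smul_apply, ← lintegral_indicator_one hs, ← lintegral_indicator_one hs,
    lintegral_jointKernel M θ z hi, lintegral_jointKernel M θ z' hi, ENNReal.smul_def, smul_eq_mul,
    ← lintegral_const_mul _ (by exact hq.mul hm)]
  refine lintegral_mono fun x => ?_
  rw [← mul_assoc]
  gcongr
  rw [← ENNReal.ofReal_coe_nnreal, ← ENNReal.ofReal_mul κ.coe_nonneg]
  refine ENNReal.ofReal_le_ofReal ((hB.q_upper θ θ.2 z.1 x).trans (hκ.trans ?_))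
  exact mul_le_mul_of_nonneg_left (hB.q_lower θ θ.2 _ _) κ.2

variable {θ : M.Θ} {π : Measure (𝒳 × EuclideanSpace ℝ (Fin m))} (hπ : M.IsStationary θ π)

include hπ

theorem IsStationary.nonempty : Nonempty 𝒳 := by
  have := hπ.1
  obtain ⟨z⟩ := Measure.nonempty_of_neZero π
  exact ⟨z.1⟩

theorem IsStationary.lintegral_eq {F : 𝒳 × EuclideanSpace ℝ (Fin m) → ℝ≥0∞} (hF : Measurable F) :
    ∫⁻ z, F z ∂π = ∫⁻ z, ∫⁻ z', F z' ∂M.jointKernel θ z ∂π := by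
  conv_lhs => rw [← hπ.2.def]
  exact Measure.lintegral_bind (Kernel.aemeasurable _) hF.aemeasurable

theorem IsStationary.absolutelyContinuous : π.snd ≪ M.ν := by
  refine Measure.AbsolutelyContinuous.mk fun s hs h0 => ?_
  have hi : Measurable ((Prod.snd ⁻¹' s).indicator (1 : 𝒳 × EuclideanSpace ℝ (Fin m) → ℝ≥0∞)) :=
    measurable_one.indicator (measurable_snd hs)
  rw [Measure.snd_apply hs, ← lintegral_indicator_one (measurable_snd hs), hπ.lintegral_eq hi]
  have : ∀ z, ∫⁻ z', (Prod.snd ⁻¹' s).indicator 1 z' ∂M.jointKernel θ z = 0 := fun z => by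
    rw [lintegral_jointKernel M θ z hi]
    have h1 : ∀ x, ∫⁻ y, ENNReal.ofReal (M.g θ x y) *
        (Prod.snd ⁻¹' s).indicator (1 : 𝒳 × EuclideanSpace ℝ (Fin m) → ℝ≥0∞) (x, y) ∂M.ν = 0 :=
      fun x => lintegral_eq_zero_of_ae_eq_zero (by
        filter_upwards [measure_eq_zero_iff_ae_notMem.1 h0] with y hy
        simp [indicator, hy])
    simp [h1]
  simp [this]

theorem IsStationary.isProbabilityMeasure_obsLaw : IsProbabilityMeasure (M.obsLaw θ π) := by
  have := hπ.1
  have : IsProbabilityMeasure (M.pathLaw θ π) :=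
    inferInstanceAs (IsProbabilityMeasure (chainLaw (M.jointKernel θ) π))
  exact Measure.isProbabilityMeasure_map (measurable_pi_lambda _ fun k =>
    measurable_snd.comp (measurable_pi_apply k)).aemeasurable

theorem IsStationary.measurePreserving_shiftBy :
    MeasurePreserving (shiftBy 1) (M.obsLaw θ π) (M.obsLaw θ π) := by
  have := hπ.1
  have hg : Measurable fun (p : ℕ → 𝒳 × EuclideanSpace ℝ (Fin m)) (k : ℕ) => (p k).2 :=
    measurable_pi_lambda _ fun k => measurable_snd.comp (measurable_pi_apply k)
  have h := measurePreserving_shiftBy_chainLaw (M.jointKernel θ) hπ.2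
  refine ⟨measurable_shiftBy 1, ?_⟩
  have e : M.pathLaw θ π = chainLaw (M.jointKernel θ) π := rfl
  rw [obsLaw, e, Measure.map_map (measurable_shiftBy 1) hg]
  conv_rhs => rw [← h.map_eq]
  rw [Measure.map_map hg h.measurable]
  rfl

theorem IsStationary.measurePreserving_eval_zero :
    MeasurePreserving (fun ω : ℕ → EuclideanSpace ℝ (Fin m) => ω 0) (M.obsLaw θ π) π.snd := by
  have := hπ.1
  have hg : Measurable fun (p : ℕ → 𝒳 × EuclideanSpace ℝ (Fin m)) (k : ℕ) => (p k).2 :=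
    measurable_pi_lambda _ fun k => measurable_snd.comp (measurable_pi_apply k)
  refine ⟨measurable_pi_apply 0, Measure.ext fun s hs => ?_⟩
  have e : M.pathLaw θ π = chainLaw (M.jointKernel θ) π := rfl
  have hi : Measurable ((Prod.snd ⁻¹' s).indicator (1 : 𝒳 × EuclideanSpace ℝ (Fin m) → ℝ≥0∞)) :=
    measurable_one.indicator (measurable_snd hs)
  have h0 := lintegral_chainLaw_zero (M.jointKernel θ) π hi
  rw [lintegral_indicator_one (measurable_snd hs)] at h0
  rw [Measure.snd_apply hs, ← h0, obsLaw, Measure.map_map (measurable_pi_apply 0) hg,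
    Measure.map_apply ((measurable_pi_apply 0).comp hg) hs, e]
  rw [← lintegral_indicator_one (((measurable_pi_apply 0).comp hg) hs)]
  rfl

theorem IsStationary.ae_mem {G : Set (EuclideanSpace ℝ (Fin m))} (hG : ∀ᵐ y ∂π.snd, y ∈ G) :
    ∀ᵐ ω ∂M.obsLaw θ π, ∀ k, ω k ∈ G := by
  refine ae_all_iff.2 fun k => ?_
  have h := hπ.measurePreserving_eval_zero.comp (_root_.measurePreserving_shiftBy
    hπ.measurePreserving_shiftBy k)
  have := h.quasiMeasurePreserving.ae hG
  simpa [shiftBy] using this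

theorem IsStationary.memLp {s : EuclideanSpace ℝ (Fin m) → ℝ} {p : ℝ≥0∞} (hs : MemLp s p π.snd) :
    MemLp (fun ω => s (ω 0)) p (M.obsLaw θ π) :=
  hs.comp_measurePreserving hπ.measurePreserving_eval_zero

theorem IsStationary.hasLLN {c C D : ℝ} (hB : M.Bounds c C D) : HasLLN (M.obsLaw θ π) := by
  have := hπ.1
  set κ : ℝ≥0 := (C / c).toNNReal + 2
  have hκ : C ≤ κ * c := by
    have h1 : C / c ≤ κ := by
      have := Real.le_coe_toNNReal (C / c)
      simp only [κ, NNReal.coe_add]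
      have h2 : (0 : ℝ) ≤ (2 : ℝ≥0) := NNReal.coe_nonneg _
      linarith
    rwa [div_le_iff₀ hB.pos] at h1
  have h1 : 1 < κ := lt_of_lt_of_le (by norm_num : (1 : ℝ≥0) < 2) le_add_self
  exact hasLLN_map (J := M.jointKernel θ) (π := π) hπ.2 (hB.jointKernel_le θ hκ) h1 measurable_snd

/-- Stationary observations are almost surely good. -/
theorem IsStationary.exists_goodObs {K : ℝ}
    (h₁ : FiniteMean π.snd fun y => M.supLogDeriv 1 K y ^ 3)
    (h₂ : FiniteMean π.snd fun y => M.supLogDeriv 2 K y ^ 2) :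
    ∃ s₁ s₂ G, M.GoodObs K s₁ s₂ G ∧ MemLp s₁ 3 π.snd ∧ MemLp s₂ 2 π.snd ∧
      ∀ᵐ y ∂π.snd, y ∈ G := by
  have := hπ.1
  obtain ⟨s₁, A₁, hs₁, h0₁, hL₁, hA₁, hae₁, hle₁⟩ := h₁.exists_majorant (by norm_num)
  obtain ⟨s₂, A₂, hs₂, h0₂, hL₂, hA₂, hae₂, hle₂⟩ := h₂.exists_majorant (by norm_num)
  refine ⟨s₁, s₂, A₁ ∩ A₂ ∩ M.𝒴 ∩ M.ν.support, ⟨((hA₁.inter hA₂).inter M.measurableSet_𝒴).inter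
    Measure.isClosed_support.measurableSet, fun y hy => hy.1.2, fun y hy r hr =>
      ((Measure.mem_support_iff_forall _).1 hy.2) _ (Metric.closedBall_mem_nhds y hr), hs₁, hs₂, h0₁,
      h0₂, fun y hy θ hθ x y' hy' => ?_, fun y hy θ hθ x y' hy' => ?_⟩, hL₁, hL₂, ?_⟩
  · have h := hle₁ y hy.1.1.1
    rw [norm_logGrad M.uniqueDiffOn_Θ _ hθ]
    refine (ENNReal.ofReal_le_ofReal_iff (h0₁ y)).1 ((ofReal_norm _).trans_le (le_trans ?_ h))
    exact le_iSup₂_of_le θ hθ (le_iSup_of_le x (le_iSup₂_of_le y' hy' le_rfl))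
  · have h := hle₂ y hy.1.1.2
    rw [norm_logHess M.uniqueDiffOn_Θ _ hθ]
    refine (ENNReal.ofReal_le_ofReal_iff (h0₂ y)).1 ((ofReal_norm _).trans_le (le_trans ?_ h))
    exact le_iSup₂_of_le θ hθ (le_iSup_of_le x (le_iSup₂_of_le y' hy' le_rfl))
  · have h3 : ∀ᵐ y ∂π.snd, y ∈ M.𝒴 :=
      hπ.absolutelyContinuous.ae_le (mem_ae_iff.2 M.ν_compl_𝒴 : M.𝒴 ∈ ae M.ν)
    have h4 : ∀ᵐ y ∂π.snd, y ∈ M.ν.support :=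
      hπ.absolutelyContinuous.ae_le (Measure.support_mem_ae : M.ν.support ∈ ae M.ν)
    filter_upwards [hae₁, hae₂, h3, h4] with y a1 a2 a3 a4 using ⟨⟨⟨a1, a2⟩, a3⟩, a4⟩

theorem IsStationary.memLp_obsScale {s₁ s₂ : EuclideanSpace ℝ (Fin m) → ℝ} (D : ℝ)
    (h₁ : MemLp s₁ 3 π.snd) (h₂ : MemLp s₂ 2 π.snd) :
    MemLp (fun ω => obsScale D s₁ s₂ (ω 0)) 2 (M.obsLaw θ π) := by
  have := hπ.1
  refine hπ.memLp (s := obsScale D s₁ s₂) ?_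
  exact ((memLp_const (1 + |D|)).add ((h₁.mono_exponent (by norm_num)).const_mul 2)).add h₂

/-- The limit of the mean log likelihoods is the limit surface. -/
theorem IsStationary.isLimitSurface {c C D : ℝ} (hB : M.Bounds c C D)
    {K : ℝ} {s₁ s₂ : EuclideanSpace ℝ (Fin m) → ℝ} {G : Set (EuclideanSpace ℝ (Fin m))}
    (hG : M.GoodObs K s₁ s₂ G) {ε : ℝ} (hε : ε ≤ K) (hK : 0 < K) {ϰ : ℝ} (hϰ : 1 ≤ ϰ)
    (hC : C ≤ ϰ * c) (h₁ : MemLp s₁ 3 π.snd) (h₂ : MemLp s₂ 2 π.snd) (hGae : ∀ᵐ y ∂π.snd, y ∈ G)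
    {r : ℝ} (hr0 : 0 < r) (hr1 : r < 1) (hr : 1 - (ϰ ^ 2)⁻¹ ≤ r ^ 4) {x : 𝒳}
    {l : EuclideanSpace ℝ (Fin d) → ℝ} {l' : EuclideanSpace ℝ (Fin d) → _}
    {l'' : EuclideanSpace ℝ (Fin d) → _}
    (hl : JetSystem.IsLimit M.Θ M.μ ϰ (obsScale D s₁ s₂) (M.kernelJet G ε) (M.obsLaw θ π) θ x r
      l l' l'') : M.IsLimitSurface θ π ε l := by
  have hP := hπ.isProbabilityMeasure_obsLaw
  refine ⟨contDiffOn_two_of_hasFDerivWithinAt M.uniqueDiffOn_Θ hl.d1 hl.d2 hl.cont, fun x₀ => ?_⟩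
  have h := (hB.jetSystem hG hε hK hϰ hC).ae_tendstoUniformlyOn θ.2 M.lengthQuasiconvex_Θ
    M.uniqueDiffOn_Θ hπ.measurePreserving_shiftBy (hπ.memLp_obsScale D h₁ h₂) hr0 hr1 hr
    M.isCompact_Θ (hπ.hasLLN hB) hl x₀
  filter_upwards [hπ.measurePreserving_shiftBy.quasiMeasurePreserving.ae h, hπ.ae_mem hGae]
    with ω hω hωG
  refine hω.congr (.of_forall fun n θ' hθ' => ?_)
  simp only [JetSystem.logRatio, hB.likelihood_eq hG hε hK hϰ hC hθ' x₀ n hωG,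
    hB.likelihood_eq hG hε hK hϰ hC θ.2 x₀ n hωG]

end HMMFamily

/-! ### Identification of the true parameter by the limit surface -/

theorem lintegral_chainKernel_consSeq {Z : Type*} [MeasurableSpace Z] (J : Kernel Z Z)
    [IsMarkovKernel J] (z : Z) {F : (ℕ → Z) → ℝ≥0∞} (hF : Measurable F) :
    ∫⁻ ω, F ω ∂chainKernel J z = ∫⁻ ω, F (consSeq z (shiftBy 1 ω)) ∂chainKernel J z := by
  have h : Measurable fun ω => F (consSeq z (shiftBy 1 ω)) :=
    hF.comp (measurable_consSeq.comp (measurable_const.prodMk (measurable_shiftBy 1)))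
  rw [lintegral_chainKernel J z hF, lintegral_chainKernel J z h]
  rfl

namespace HMMFamily

variable {d m : ℕ} {𝒳 : Type*} [MeasurableSpace 𝒳] (M : HMMFamily d m 𝒳)

/-- The density of the observations `Y_1, …, Y_n` given the hidden state `X_0`. -/
def obsDensity (θ : EuclideanSpace ℝ (Fin d)) :
    ℕ → 𝒳 → (ℕ → EuclideanSpace ℝ (Fin m)) → ℝ≥0∞
  | 0, _, _ => 1
  | n + 1, x, ω => ∫⁻ z, ENNReal.ofReal (M.q θ x z) * (ENNReal.ofReal (M.g θ z (ω 0)) *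
      obsDensity θ n z (shiftBy 1 ω)) ∂M.μ

/-- The law of a sequence whose first `n` entries range over `ν`. -/
def seqMeasure : ℕ → Measure (ℕ → EuclideanSpace ℝ (Fin m))
  | 0 => Measure.dirac 0
  | n + 1 => (M.ν.prod (seqMeasure n)).map fun p => consSeq p.1 p.2

instance instSFiniteSeqMeasure (n : ℕ) : SFinite (M.seqMeasure n) := by
  induction n with
  | zero => unfold seqMeasure; infer_instance
  | succ n ih => unfold seqMeasure; infer_instance

theorem measurable_obsDensity {θ : EuclideanSpace ℝ (Fin d)} (hθ : θ ∈ M.Θ) (n : ℕ) :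
    Measurable fun t : (ℕ → EuclideanSpace ℝ (Fin m)) × 𝒳 => M.obsDensity θ n t.2 t.1 := by
  induction n with
  | zero => exact measurable_const
  | succ n ih =>
    refine Measurable.lintegral_prod_right' (ν := M.μ)
      (f := fun t : ((ℕ → EuclideanSpace ℝ (Fin m)) × 𝒳) × 𝒳 =>
        ENNReal.ofReal (M.q θ t.1.2 t.2) * (ENNReal.ofReal (M.g θ t.2 (t.1.1 0)) *
          M.obsDensity θ n t.2 (shiftBy 1 t.1.1))) ?_
    refine Measurable.mul ?_ (Measurable.mul ?_ ?_)
    · exact ((M.measurable_q θ hθ).comp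
        ((measurable_snd.comp measurable_fst).prodMk measurable_snd)).ennreal_ofReal
    · exact ((M.measurable_g θ hθ).comp (measurable_snd.prodMk ((measurable_pi_apply 0).comp
        (measurable_fst.comp measurable_fst)))).ennreal_ofReal
    · exact ih.comp (((measurable_shiftBy 1).comp (measurable_fst.comp measurable_fst)).prodMk
        measurable_snd)

theorem measurable_obsDensity_left {θ : EuclideanSpace ℝ (Fin d)} (hθ : θ ∈ M.Θ) (n : ℕ) (x : 𝒳) :
    Measurable fun ω => M.obsDensity θ n x ω :=
  (M.measurable_obsDensity hθ n).comp measurable_prodMk_right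

theorem obsDensity_congr (θ : EuclideanSpace ℝ (Fin d)) (n : ℕ) (x : 𝒳)
    {ω ω' : ℕ → EuclideanSpace ℝ (Fin m)} (h : ∀ k < n, ω k = ω' k) :
    M.obsDensity θ n x ω = M.obsDensity θ n x ω' := by
  induction n generalizing x ω ω' with
  | zero => rfl
  | succ n ih =>
    simp only [obsDensity]
    rw [h 0 n.succ_pos]
    refine lintegral_congr fun z => ?_
    rw [ih z (ω := shiftBy 1 ω) (ω' := shiftBy 1 ω') fun k hk => h (k + 1) (by omega)]

theorem lintegral_seqMeasure_succ (n : ℕ) {H : (ℕ → EuclideanSpace ℝ (Fin m)) → ℝ≥0∞}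
    (hH : Measurable H) : ∫⁻ ω, H ω ∂M.seqMeasure (n + 1) =
      ∫⁻ p, H (consSeq p.1 p.2) ∂M.ν.prod (M.seqMeasure n) :=
  lintegral_map hH measurable_consSeq

theorem lintegral_obs (θ : M.Θ) (n : ℕ) {H : (ℕ → EuclideanSpace ℝ (Fin m)) → ℝ≥0∞}
    (hH : Measurable H) (hH' : ∀ ω ω', (∀ k < n, ω k = ω' k) → H ω = H ω')
    (z : 𝒳 × EuclideanSpace ℝ (Fin m)) :
    ∫⁻ p, H (fun k => (p (k + 1)).2) ∂chainKernel (M.jointKernel θ) z =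
      ∫⁻ ω, M.obsDensity θ n z.1 ω * H ω ∂M.seqMeasure n := by
  have hs : Measurable fun (p : ℕ → 𝒳 × EuclideanSpace ℝ (Fin m)) (k : ℕ) => (p k).2 :=
    measurable_pi_lambda _ fun k => measurable_snd.comp (measurable_pi_apply k)
  have hs1 : Measurable fun (p : ℕ → 𝒳 × EuclideanSpace ℝ (Fin m)) (k : ℕ) => (p (k + 1)).2 :=
    measurable_pi_lambda _ fun k => measurable_snd.comp (measurable_pi_apply (k + 1))
  induction n generalizing H z with
  | zero =>
    have h : ∀ ω, H ω = H 0 := fun ω => hH' ω 0 fun k hk => absurd hk (Nat.not_lt_zero k)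
    simp only [h, seqMeasure, obsDensity, one_mul, lintegral_const, measure_univ]
  | succ n ih =>
    have hc : ∀ y, Measurable fun ω : ℕ → EuclideanSpace ℝ (Fin m) => H (consSeq y ω) := fun y =>
      hH.comp (measurable_consSeq.comp measurable_prodMk_left)
    have h1 : ∀ z' : 𝒳 × EuclideanSpace ℝ (Fin m),
        ∫⁻ p, H (fun k => (p k).2) ∂chainKernel (M.jointKernel θ) z' =
          ∫⁻ ω, M.obsDensity θ n z'.1 ω * H (consSeq z'.2 ω) ∂M.seqMeasure n := fun z' => by
      rw [lintegral_chainKernel_consSeq _ z' (by exact hH.comp hs), ← ih (hc z'.2)]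
      · refine lintegral_congr fun p => congrArg H (funext fun k => ?_)
        cases k <;> rfl
      · refine fun ω ω' h => hH' _ _ fun k hk => ?_
        cases k with
        | zero => rfl
        | succ k => exact h k (by omega)
    rw [lintegral_chainKernel _ z (by exact hH.comp hs1)]
    refine (lintegral_congr h1).trans ?_
    have hm : Measurable fun t : (𝒳 × EuclideanSpace ℝ (Fin m)) × (ℕ → EuclideanSpace ℝ (Fin m)) =>
        M.obsDensity θ n t.1.1 t.2 * H (consSeq t.1.2 t.2) :=
      ((M.measurable_obsDensity θ.2 n).comp
        (measurable_snd.prodMk (measurable_fst.comp measurable_fst))).mul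
      (hH.comp (measurable_consSeq.comp ((measurable_snd.comp measurable_fst).prodMk
        measurable_snd)))
    rw [lintegral_jointKernel M θ z hm.lintegral_prod_right',
      lintegral_seqMeasure_succ _ _ (by exact (M.measurable_obsDensity_left θ.2 (n + 1) z.1).mul hH)]
    have hq : Measurable fun x => ENNReal.ofReal (M.q θ z.1 x) :=
      ((M.measurable_q θ θ.2).comp measurable_prodMk_left).ennreal_ofReal
    have hj : Measurable fun t : (EuclideanSpace ℝ (Fin m) × (ℕ → EuclideanSpace ℝ (Fin m))) × 𝒳 =>
        ENNReal.ofReal (M.g θ t.2 t.1.1) * (M.obsDensity θ n t.2 t.1.2 *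
          H (consSeq t.1.1 t.1.2)) :=
      ((M.measurable_g θ θ.2).comp (measurable_snd.prodMk
        (measurable_fst.comp measurable_fst))).ennreal_ofReal.mul
        (((M.measurable_obsDensity θ.2 n).comp
          ((measurable_snd.comp measurable_fst).prodMk measurable_snd)).mul
        (hH.comp (measurable_consSeq.comp measurable_fst)))
    calc _ = ∫⁻ x, ENNReal.ofReal (M.q θ z.1 x) * ∫⁻ p, ENNReal.ofReal (M.g θ x p.1) *
          (M.obsDensity θ n x p.2 * H (consSeq p.1 p.2)) ∂M.ν.prod (M.seqMeasure n) ∂M.μ := by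
          refine lintegral_congr fun x => congrArg _ ?_
          rw [lintegral_prod _ (by exact (hj.comp measurable_prodMk_right).aemeasurable)]
          refine lintegral_congr fun y => ?_
          exact (lintegral_const_mul' _ _ ENNReal.ofReal_ne_top).symm
      _ = ∫⁻ x, ∫⁻ p, ENNReal.ofReal (M.q θ z.1 x) * (ENNReal.ofReal (M.g θ x p.1) *
          (M.obsDensity θ n x p.2 * H (consSeq p.1 p.2))) ∂M.ν.prod (M.seqMeasure n) ∂M.μ :=
          lintegral_congr fun x => by
            rw [lintegral_const_mul _ (by exact hj.comp measurable_prodMk_right)]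
      _ = ∫⁻ p, ∫⁻ x, ENNReal.ofReal (M.q θ z.1 x) * (ENNReal.ofReal (M.g θ x p.1) *
          (M.obsDensity θ n x p.2 * H (consSeq p.1 p.2))) ∂M.μ ∂M.ν.prod (M.seqMeasure n) :=
          lintegral_lintegral_swap ((hq.comp measurable_fst).mul
            (hj.comp measurable_swap)).aemeasurable
      _ = _ := by
          refine lintegral_congr fun p => ?_
          have hd : Measurable fun x => ENNReal.ofReal (M.q θ z.1 x) *
              (ENNReal.ofReal (M.g θ x p.1) * M.obsDensity θ n x p.2) :=
            hq.mul (((M.measurable_g θ θ.2).comp measurable_prodMk_right).ennreal_ofReal.mul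
              ((M.measurable_obsDensity θ.2 n).comp measurable_prodMk_left))
          simp only [← mul_assoc]
          simp only [mul_assoc _ (ENNReal.ofReal (M.g θ _ _)) (M.obsDensity _ _ _ _)]
          rw [lintegral_mul_const _ (by exact hd)]
          rfl

variable {M} {c C D : ℝ} (hB : M.Bounds c C D) {ϰ : ℝ} (hϰ : 1 ≤ ϰ) (hC : C ≤ ϰ * c)

include hB hϰ hC

theorem Bounds.obsDensity_harnack {θ : EuclideanSpace ℝ (Fin d)} (hθ : θ ∈ M.Θ) (n : ℕ) (x x' : 𝒳)
    (ω : ℕ → EuclideanSpace ℝ (Fin m)) :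
    M.obsDensity θ n x ω ≤ ENNReal.ofReal ϰ * M.obsDensity θ n x' ω := by
  cases n with
  | zero => simpa [obsDensity] using hϰ
  | succ n =>
    rw [obsDensity, obsDensity, ← lintegral_const_mul' _ _ ENNReal.ofReal_ne_top]
    refine lintegral_mono fun z => ?_
    rw [← mul_assoc (ENNReal.ofReal ϰ), ← ENNReal.ofReal_mul (by linarith)]
    gcongr
    exact (hB.q_upper θ hθ x z).trans (hC.trans
      (mul_le_mul_of_nonneg_left (hB.q_lower θ hθ x' z) (by linarith)))

/-- The likelihood ratio of `θ` and `θs` under the law of `θs`, against a function of finitely many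
observations, is bounded by the mean of that function under the law of `θ`. -/
theorem Bounds.lintegral_ratio_le {θ θs : M.Θ} {π πs : Measure (𝒳 × EuclideanSpace ℝ (Fin m))}
    (hπ : M.IsStationary θ π) (hπs : M.IsStationary θs πs) (x : 𝒳) (n : ℕ)
    {H : (ℕ → EuclideanSpace ℝ (Fin m)) → ℝ≥0∞}
    (hH : Measurable H) (hH' : ∀ ω ω', (∀ k < n, ω k = ω' k) → H ω = H ω') :
    ∫⁻ ω, M.obsDensity θ n x ω / M.obsDensity θs n x ω * H ω ∂M.obsLaw θs πs ≤
      ENNReal.ofReal ϰ ^ 2 * ∫⁻ ω, H ω ∂M.obsLaw θ π := by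
  have := hπ.1
  have := hπs.1
  have hs : Measurable fun (p : ℕ → 𝒳 × EuclideanSpace ℝ (Fin m)) (k : ℕ) => (p k).2 :=
    measurable_pi_lambda _ fun k => measurable_snd.comp (measurable_pi_apply k)
  have key : ∀ (θ : M.Θ) (π : Measure (𝒳 × EuclideanSpace ℝ (Fin m))), M.IsStationary θ π →
      ∀ F : (ℕ → EuclideanSpace ℝ (Fin m)) → ℝ≥0∞, Measurable F →
      (∀ ω ω', (∀ k < n, ω k = ω' k) → F ω = F ω') → ∫⁻ ω, F ω ∂M.obsLaw θ π =
        ∫⁻ z, ∫⁻ ω, M.obsDensity θ n z.1 ω * F ω ∂M.seqMeasure n ∂π := by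
    intro θ π hπ F hF hF'
    have e : M.obsLaw θ π = (chainLaw (M.jointKernel θ) π).map fun p k => (p k).2 := rfl
    rw [← hπ.measurePreserving_shiftBy.lintegral_comp hF, e,
      lintegral_map (by exact hF.comp (measurable_shiftBy 1)) hs,
      lintegral_chainLaw _ _ (by exact (hF.comp (measurable_shiftBy 1)).comp hs)]
    exact lintegral_congr fun z => M.lintegral_obs θ n hF hF' z
  have hm := M.measurable_obsDensity_left θ.2 n x
  have hms := M.measurable_obsDensity_left θs.2 n x
  have hr := key θs πs hπs _ ((hm.div hms).mul hH) fun ω ω' h => by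
    simp only [Pi.mul_apply, Pi.div_apply]
    rw [obsDensity_congr M θ n x h, obsDensity_congr M θs n x h, hH' ω ω' h]
  refine hr.trans_le ?_
  rw [key θ π hπ H hH hH']
  have h1 : ∀ z : 𝒳 × EuclideanSpace ℝ (Fin m), ∫⁻ ω, M.obsDensity θs n z.1 ω *
      (M.obsDensity θ n x ω / M.obsDensity θs n x ω * H ω) ∂M.seqMeasure n ≤
      ENNReal.ofReal ϰ * ∫⁻ ω, M.obsDensity θ n x ω * H ω ∂M.seqMeasure n := fun z => by
    rw [← lintegral_const_mul' _ _ ENNReal.ofReal_ne_top]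
    refine lintegral_mono fun ω => ?_
    calc _ ≤ ENNReal.ofReal ϰ * M.obsDensity θs n x ω *
          (M.obsDensity θ n x ω / M.obsDensity θs n x ω * H ω) := by
          gcongr
          exact hB.obsDensity_harnack hϰ hC θs.2 n z.1 x ω
      _ = ENNReal.ofReal ϰ * (M.obsDensity θs n x ω *
          (M.obsDensity θ n x ω / M.obsDensity θs n x ω) * H ω) := by ring
      _ ≤ _ := by
          gcongr
          exact ENNReal.mul_div_le
  have h2 : ∀ z : 𝒳 × EuclideanSpace ℝ (Fin m), ∫⁻ ω, M.obsDensity θ n x ω * H ω ∂M.seqMeasure n ≤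
      ENNReal.ofReal ϰ * ∫⁻ ω, M.obsDensity θ n z.1 ω * H ω ∂M.seqMeasure n := fun z => by
    rw [← lintegral_const_mul' _ _ ENNReal.ofReal_ne_top]
    refine lintegral_mono fun ω => ?_
    dsimp only
    rw [← mul_assoc]
    gcongr
    exact hB.obsDensity_harnack hϰ hC θ.2 n x z.1 ω
  calc _ ≤ ENNReal.ofReal ϰ * ∫⁻ ω, M.obsDensity θ n x ω * H ω ∂M.seqMeasure n := by
        refine (lintegral_mono h1).trans ?_
        simp
    _ ≤ ENNReal.ofReal ϰ * ∫⁻ z : 𝒳 × EuclideanSpace ℝ (Fin m), ENNReal.ofReal ϰ *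
        ∫⁻ ω, M.obsDensity θ n z.1 ω * H ω ∂M.seqMeasure n ∂π := by
        gcongr
        calc _ = ∫⁻ _ : 𝒳 × EuclideanSpace ℝ (Fin m),
              ∫⁻ ω, M.obsDensity θ n x ω * H ω ∂M.seqMeasure n ∂π := by simp
          _ ≤ _ := lintegral_mono h2
    _ = _ := by rw [lintegral_const_mul' _ _ ENNReal.ofReal_ne_top]; ring

end HMMFamily

theorem integral_le_of_lintegral_ofReal_le {Ω : Type*} [MeasurableSpace Ω] {P : Measure Ω}
    {f : Ω → ℝ} (hf : Measurable f) (h0 : ∀ ω, 0 ≤ f ω) {C : ℝ} (hC : 0 ≤ C)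
    (h : ∫⁻ ω, ENNReal.ofReal (f ω) ∂P ≤ ENNReal.ofReal C) :
    Integrable f P ∧ ∫ ω, f ω ∂P ≤ C := by
  refine ⟨⟨hf.aestronglyMeasurable, (hasFiniteIntegral_iff_ofReal (.of_forall h0)).2
    (h.trans_lt ENNReal.ofReal_lt_top)⟩, ?_⟩
  rw [integral_eq_lintegral_of_nonneg_ae (.of_forall h0) hf.aestronglyMeasurable]
  exact ENNReal.toReal_le_of_le_ofReal hC h

/-- Laws of large numbers with different limits separate two laws. -/
theorem HasLLN.tendsto_measureReal {Y : Type*} [MeasurableSpace Y] {P : Measure (ℕ → Y)}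
    [IsProbabilityMeasure P] (hP : HasLLN P) {N : ℕ} {F : (ℕ → Y) → ℝ} (hF : Measurable F)
    (hF' : ∀ ω ω', (∀ k < N, ω k = ω' k) → F ω = F ω') (hF2 : MemLp F 2 P) {δ : ℝ} (hδ : 0 < δ) :
    Tendsto (fun n : ℕ => P.real {ω | δ ≤
      ‖(1 / (n : ℝ)) * ∑ i ∈ Finset.range n, F (shiftBy i ω) - ∫ ω, F ω ∂P‖}) atTop (𝓝 0) := by
  have h := tendstoInMeasure_of_tendsto_ae (μ := P)
    (f := fun (n : ℕ) ω => (1 / (n : ℝ)) * ∑ i ∈ Finset.range n, F (shiftBy i ω))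
    (g := fun _ => ∫ ω, F ω ∂P) (fun n => ((Finset.measurable_fun_sum _ fun i _ =>
      hF.comp (measurable_shiftBy i)).const_mul _).aestronglyMeasurable) (hP N F hF hF' hF2)
  exact tendstoInMeasure_iff_measureReal_norm.1 h δ hδ

/-- Different laws of sequences are separated by a function of finitely many entries. -/
theorem exists_integral_ne {Y : Type*} [MeasurableSpace Y] {P Q : Measure (ℕ → Y)}
    [IsProbabilityMeasure P] [IsProbabilityMeasure Q] (h : P ≠ Q) :
    ∃ (N : ℕ) (F : (ℕ → Y) → ℝ), Measurable F ∧ (∀ ω ω', (∀ k < N, ω k = ω' k) → F ω = F ω') ∧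
      MemLp F 2 P ∧ MemLp F 2 Q ∧ ∫ ω, F ω ∂P ≠ ∫ ω, F ω ∂Q := by
  by_contra! hc
  refine h (measure_ext_of_boxes fun n t ht => ?_)
  set F : (ℕ → Y) → ℝ := fun ω => ∏ k ∈ Finset.range (n + 1), (t k).indicator 1 (ω k) with hF
  have hm : Measurable F := Finset.measurable_fun_prod _ fun k _ =>
    (measurable_one.indicator (ht k)).comp (measurable_pi_apply k)
  have h0 : ∀ (ω : ℕ → Y) k, 0 ≤ (t k).indicator (1 : Y → ℝ) (ω k) := fun ω k =>
    indicator_nonneg (fun _ _ => zero_le_one) _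
  have hF0 : ∀ ω, 0 ≤ F ω := fun ω => Finset.prod_nonneg fun k _ => h0 ω k
  have hF1 : ∀ ω, F ω ≤ 1 := fun ω => Finset.prod_le_one (fun k _ => h0 ω k) fun k _ =>
    indicator_le_self' (fun _ _ => zero_le_one) _
  have hb : ∀ ω, ‖F ω‖ ≤ 1 := fun ω => by rw [Real.norm_of_nonneg (hF0 ω)]; exact hF1 ω
  have e : ∀ ω, ∏ k ∈ Finset.range (n + 1), (t k).indicator (1 : Y → ℝ≥0∞) (ω k) =
      ENNReal.ofReal (F ω) := fun ω => by
    rw [hF, ENNReal.ofReal_prod_of_nonneg fun k _ => h0 ω k]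
    refine Finset.prod_congr rfl fun k _ => ?_
    by_cases hk : ω k ∈ t k <;> simp [hk]
  have hi : ∀ R : Measure (ℕ → Y), IsProbabilityMeasure R → MemLp F 2 R := fun R _ =>
    MemLp.of_bound hm.aestronglyMeasurable 1 (.of_forall hb)
  have := hc (n + 1) F hm (fun ω ω' h => Finset.prod_congr rfl fun k hk => by
    rw [h k (Finset.mem_range.1 hk)]) (hi P inferInstance) (hi Q inferInstance)
  simp only [e]
  rw [← ofReal_integral_eq_lintegral_ofReal ((hi P inferInstance).integrable (by norm_num))
    (.of_forall hF0), ← ofReal_integral_eq_lintegral_ofReal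
    ((hi Q inferInstance).integrable (by norm_num)) (.of_forall hF0), this]

theorem le_exp_mul_sub (u c : ℝ) : u ≤ Real.exp c * Real.exp u - c := by
  have := Real.add_one_le_exp (u + c)
  rw [← Real.exp_add, add_comm c u]
  linarith

namespace HMMFamily

variable {d m : ℕ} {𝒳 : Type*} [MeasurableSpace 𝒳] {M : HMMFamily d m 𝒳}
  {c C D : ℝ} (hB : M.Bounds c C D) {K : ℝ}
  {s₁ s₂ : EuclideanSpace ℝ (Fin m) → ℝ} {G : Set (EuclideanSpace ℝ (Fin m))}
  (hG : M.GoodObs K s₁ s₂ G) (hK : 0 < K) {ϰ : ℝ} (hϰ : 1 ≤ ϰ)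
  (hC : C ≤ ϰ * c)

include hB hG hK hϰ hC

theorem Bounds.obsDensity_eq {θ : EuclideanSpace ℝ (Fin d)} (hθ : θ ∈ M.Θ) (n : ℕ) (x : 𝒳)
    {ω : ℕ → EuclideanSpace ℝ (Fin m)} (hω : ∀ k, ω k ∈ G) :
    M.obsDensity θ n x ω =
      ENNReal.ofReal ((JetSystem.lik M.μ (M.kernelJet G 0) n θ ω).p x) := by
  have H := hB.jetSystem hG (ε := 0) hK.le hK hϰ hC
  induction n generalizing x ω with
  | zero => simp [obsDensity, JetSystem.lik, KernelJet.iter]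
  | succ n ih =>
    have hg := H.good θ hθ (ω 0)
    have hl := H.lik_good n hθ (shiftBy 1 ω)
    obtain ⟨b, hb⟩ := H.lik_le n (shiftBy 1 ω)
    rw [JetSystem.lik_succ, obsDensity]
    change _ = ENNReal.ofReal (∫ z, (M.kernelJet G 0 θ (ω 0)).L x z *
      (JetSystem.lik M.μ (M.kernelJet G 0) n θ (shiftBy 1 ω)).p z ∂M.μ)
    rw [ofReal_integral_eq_lintegral_ofReal (hg.integrable_mul hl.measurable_p
      (fun x => (hl.pos x).le) (hb θ hθ) x)
      (.of_forall fun z => mul_nonneg (hg.nonneg x z) (hl.pos z).le)]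
    refine lintegral_congr fun z => ?_
    rw [ih z (ω := shiftBy 1 ω) fun k => hω _, ENNReal.ofReal_mul (hg.nonneg x z), ← mul_assoc]
    congr 1
    rw [kernelJet, if_pos (hω 0), ← ENNReal.ofReal_mul (M.q_nonneg θ hθ x z)]
    simp [gPert]

/-- The limit surface of the unperturbed model is negative away from the true parameter. -/
theorem Bounds.limit_neg {θ θs : M.Θ} {π πs : Measure (𝒳 × EuclideanSpace ℝ (Fin m))}
    (hπ : M.IsStationary θ π) (hπs : M.IsStationary θs πs)
    (hne : M.obsLaw θ π ≠ M.obsLaw θs πs)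
    (h₁ : MemLp s₁ 3 πs.snd) (h₂ : MemLp s₂ 2 πs.snd) (hGae : ∀ᵐ y ∂πs.snd, y ∈ G)
    {r : ℝ} (hr0 : 0 < r) (hr1 : r < 1) (hr : 1 - (ϰ ^ 2)⁻¹ ≤ r ^ 4) {x : 𝒳}
    {l : EuclideanSpace ℝ (Fin d) → ℝ} {l' : EuclideanSpace ℝ (Fin d) → _}
    {l'' : EuclideanSpace ℝ (Fin d) → _}
    (hl : JetSystem.IsLimit M.Θ M.μ ϰ (obsScale D s₁ s₂) (M.kernelJet G 0) (M.obsLaw θs πs) θs x r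
      l l' l'') : l θ < 0 := by
  have := hπ.isProbabilityMeasure_obsLaw
  have := hπs.isProbabilityMeasure_obsLaw
  set P := M.obsLaw θ π
  set Q := M.obsLaw θs πs
  have H := hB.jetSystem hG (ε := 0) hK.le hK hϰ hC
  have hσ := hπs.memLp_obsScale D h₁ h₂
  by_contra! hl0
  obtain ⟨N, F, hF, hF', hFP, hFQ, hab⟩ := exists_integral_ne hne
  set a := ∫ ω, F ω ∂Q
  set δ := |∫ ω, F ω ∂P - a| / 2 with hδ
  have hδ0 : 0 < δ := half_pos (abs_pos.2 (sub_ne_zero.2 hab))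
  have tP := (hπ.hasLLN hB).tendsto_measureReal hF hF' hFP hδ0
  have tQ := (hπs.hasLLN hB).tendsto_measureReal hF hF' hFQ hδ0
  set κ := 2 * ϰ ^ 2 / (1 - r) / (1 - r)
  set b := 4 * ϰ ^ 2 + 2 * κ + 1
  obtain ⟨n, hn1, hn2⟩ := ((tP.eventually (ge_mem_nhds (Real.exp_pos (-b)))).and
    (tQ.eventually (ge_mem_nhds (by norm_num : (0 : ℝ) < 1 / 2)))).exists
  set f : (ℕ → EuclideanSpace ℝ (Fin m)) → ℝ :=
    fun ω => (1 / (n : ℝ)) * ∑ i ∈ Finset.range n, F (shiftBy i ω)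
  have hf : Measurable f := (Finset.measurable_fun_sum _ fun i _ =>
      hF.comp (measurable_shiftBy i)).const_mul _
  have hf' : ∀ ω ω', (∀ k < n + N, ω k = ω' k) → f ω = f ω' := fun ω ω' h => by
    refine congrArg (fun t => 1 / (n : ℝ) * t) (Finset.sum_congr rfl fun i hi => hF' _ _ fun k hk => h _ ?_)
    have := Finset.mem_range.1 hi
    omega
  set A : Set (ℕ → EuclideanSpace ℝ (Fin m)) := {ω | ‖f ω - a‖ < δ}
  have hA : MeasurableSet A := measurableSet_lt (hf.sub_const a).norm measurable_const
  have hPA : P.real A ≤ Real.exp (-b) := by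
    refine (measureReal_mono fun ω hω => ?_).trans hn1
    have h1 : ‖f ω - a‖ < δ := hω
    have h2 : |∫ ω, F ω ∂P - a| ≤ ‖f ω - ∫ ω, F ω ∂P‖ + ‖f ω - a‖ := by
      rw [Real.norm_eq_abs, Real.norm_eq_abs, abs_sub_comm (f ω)]
      exact abs_sub_le _ _ _
    show δ ≤ ‖f ω - ∫ ω, F ω ∂P‖
    linarith
  have hQA : 1 / 2 ≤ Q.real A := by
    have h1 := measureReal_compl (μ := Q) hA
    have h2 : Q.real Aᶜ ≤ 1 / 2 := by
      refine le_trans (le_of_eq (congrArg _ ?_)) hn2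
      ext ω
      simp only [A, mem_compl_iff, mem_ofPred_eq, not_lt]
      rfl
    rw [probReal_univ] at h1
    linarith
  set u := JetSystem.logRatio M.μ (M.kernelJet G 0) θs x (n + N) θ
  have hu : Measurable u := H.measurable_logRatio θs.2 x (n + N) θ.2
  have hui : Integrable u Q := (H.memLp_logRatio M.lengthQuasiconvex_Θ M.uniqueDiffOn_Θ
    hπs.measurePreserving_shiftBy hσ θs.2 x (n + N) θ.2).integrable (by norm_num)
  have hϰ2 : 0 ≤ ϰ ^ 2 := sq_nonneg _
  have key : ∀ B : Set (ℕ → EuclideanSpace ℝ (Fin m)), MeasurableSet B →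
      (∀ ω ω', (∀ k < n + N, ω k = ω' k) → (ω ∈ B ↔ ω' ∈ B)) →
      Integrable (B.indicator fun ω => Real.exp (u ω)) Q ∧
      ∫ ω, B.indicator (fun ω => Real.exp (u ω)) ω ∂Q ≤ ϰ ^ 2 * P.real B := by
    intro B hBm hB'
    refine integral_le_of_lintegral_ofReal_le (hu.exp.indicator hBm)
      (fun ω => indicator_nonneg (fun _ _ => (Real.exp_pos _).le) _)
      (mul_nonneg hϰ2 measureReal_nonneg) ?_
    have h := hB.lintegral_ratio_le hϰ hC hπ hπs x (n + N) (measurable_one.indicator hBm)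
      fun ω ω' h => by
        by_cases hω : ω ∈ B
        · rw [indicator_of_mem hω, indicator_of_mem ((hB' ω ω' h).1 hω)]; rfl
        · rw [indicator_of_notMem hω, indicator_of_notMem fun h' => hω ((hB' ω ω' h).2 h')]
    rw [lintegral_indicator_one hBm] at h
    refine (lintegral_congr_ae ?_).trans_le (h.trans_eq ?_)
    · filter_upwards [hπs.ae_mem hGae] with ω hω
      rw [hB.obsDensity_eq hG hK hϰ hC θ.2 _ x hω, hB.obsDensity_eq hG hK hϰ hC θs.2 _ x hω]
      have p1 := (H.lik_good (n + N) θ.2 ω).pos x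
      have p2 := (H.lik_good (n + N) θs.2 ω).pos x
      by_cases hωB : ω ∈ B
      · rw [indicator_of_mem hωB, indicator_of_mem hωB, Pi.one_apply, mul_one,
          ← ENNReal.ofReal_div_of_pos p2]
        simp only [u, JetSystem.logRatio]
        rw [Real.exp_sub, Real.exp_log p1, Real.exp_log p2]
      · simp [hωB]
    · rw [ENNReal.ofReal_mul hϰ2, ENNReal.ofReal_pow (by linarith), ofReal_measureReal]
  obtain ⟨i1, k1⟩ := key A hA fun ω ω' h => by simp only [A, mem_ofPred_eq, hf' ω ω' h]
  obtain ⟨i2, k2⟩ := key univ .univ fun _ _ _ => by simp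
  have hu_le : ∀ ω, u ω ≤ Real.exp b * A.indicator (fun ω => Real.exp (u ω)) ω -
      b * A.indicator 1 ω + univ.indicator (fun ω => Real.exp (u ω)) ω := fun ω => by
    have e0 := Real.exp_pos (u ω)
    rw [indicator_univ]
    by_cases hω : ω ∈ A
    · rw [indicator_of_mem hω, indicator_of_mem hω, Pi.one_apply]
      have := le_exp_mul_sub (u ω) b
      linarith
    · rw [indicator_of_notMem hω, indicator_of_notMem hω]
      have := Real.add_one_le_exp (u ω)
      linarith
  have hi1 : Integrable (A.indicator (1 : (ℕ → EuclideanSpace ℝ (Fin m)) → ℝ)) Q := (integrable_const (1 : ℝ)).indicator hA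
  have hint := integral_mono hui (((i1.const_mul (Real.exp b)).sub (hi1.const_mul b)).add i2) hu_le
  have e1 : ∫ ω, ((Real.exp b * A.indicator (fun ω => Real.exp (u ω)) ω -
      b * A.indicator 1 ω) + univ.indicator (fun ω => Real.exp (u ω)) ω) ∂Q =
      Real.exp b * ∫ ω, A.indicator (fun ω => Real.exp (u ω)) ω ∂Q - b * Q.real A +
      ∫ ω, univ.indicator (fun ω => Real.exp (u ω)) ω ∂Q := by
    rw [integral_add (by exact (i1.const_mul _).sub (hi1.const_mul b)) i2,
      integral_sub (i1.const_mul _) (hi1.const_mul b), integral_const_mul, integral_const_mul,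
      integral_indicator_one hA]
  have hint' := hint.trans_eq e1
  rw [probReal_univ] at k2
  have hlow := H.abs_meanLog_sub_le θs.2 M.lengthQuasiconvex_Θ M.uniqueDiffOn_Θ
    hπs.measurePreserving_shiftBy hσ hr0 hr1 hr hl (n + N) θ.2
  have hlow' := (abs_le.1 hlow).1
  have hml : JetSystem.meanLog M.μ (M.kernelJet G 0) Q θs x (n + N) θ = ∫ ω, u ω ∂Q := rfl
  rw [hml] at hlow'
  have hnl : 0 ≤ ((n + N : ℕ) : ℝ) * l θ := mul_nonneg (Nat.cast_nonneg _) hl0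
  have h3 : Real.exp b * ∫ ω, A.indicator (fun ω => Real.exp (u ω)) ω ∂Q ≤ ϰ ^ 2 := by
    calc _ ≤ Real.exp b * (ϰ ^ 2 * Real.exp (-b)) := by gcongr; exact k1.trans (by gcongr)
      _ = ϰ ^ 2 * (Real.exp b * Real.exp (-b)) := by ring
      _ = _ := by rw [← Real.exp_add]; simp
  have h1r : 0 < 1 - r := by linarith
  have hκ0 : 0 ≤ κ := by positivity
  have hb0 : 0 ≤ b := by positivity
  have h4 : b * (1 / 2) ≤ b * Q.real A := mul_le_mul_of_nonneg_left hQA hb0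
  have hb : b = 4 * ϰ ^ 2 + 2 * κ + 1 := rfl
  change -κ ≤ _ at hlow'
  linarith

end HMMFamily

/-! ### Convergence of the backward recursion -/

section Convergence

variable {𝒳 : Type*} [MeasurableSpace 𝒳] {μ : Measure 𝒳} [IsFiniteMeasure μ]
  {V W : Type*} [NormedAddCommGroup V] [NormedSpace ℝ V] [CompleteSpace V]
  [NormedAddCommGroup W] [NormedSpace ℝ W] [CompleteSpace W]

namespace KernelJet

variable {ι : Type*} {F : Filter ι} [F.IsCountablyGenerated] {ϰ : ℝ}

theorem tendsto_integral_mul {σ : ℝ} {K : ι → KernelJet 𝒳 V W} {K₀ : KernelJet 𝒳 V W}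
    {J : ι → FunJet 𝒳 V W} {J₀ : FunJet 𝒳 V W} (hK : ∀ᶠ i in F, (K i).Good μ ϰ σ)
    (hJ : ∀ᶠ i in F, (J i).Good ϰ) {B P : ℝ} (hB : ∀ᶠ i in F, ∀ x z, (K i).L x z ≤ B)
    (hP : ∀ᶠ i in F, ∀ z, (J i).p z ≤ P)
    (hL : ∀ x z, Tendsto (fun i => (K i).L x z) F (𝓝 (K₀.L x z)))
    (hp : ∀ z, Tendsto (fun i => (J i).p z) F (𝓝 (J₀.p z))) (x : 𝒳) :
    Tendsto (fun i => ∫ z, (K i).L x z * (J i).p z ∂μ) F (𝓝 (∫ z, K₀.L x z * J₀.p z ∂μ)) := by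
  refine tendsto_integral_filter_of_dominated_convergence (fun _ => B * P) ?_ ?_
    (integrable_const _) (.of_forall fun z => (hL x z).mul (hp z))
  · filter_upwards [hK, hJ] with i h1 h2
    exact (h1.measurable_mul h2.measurable_p x).aestronglyMeasurable
  · filter_upwards [hK, hJ, hB, hP] with i h1 h2 h3 h4
    refine .of_forall fun z => ?_
    rw [Real.norm_of_nonneg (mul_nonneg (h1.nonneg x z) (h2.pos z).le)]
    exact mul_le_mul (h3 x z) (h4 z) (h2.pos z).le ((h1.nonneg x z).trans (h3 x z))

theorem tendsto_integral_dens {U : Type*} [NormedAddCommGroup U] [NormedSpace ℝ U]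
    {σ : ℝ} {K : ι → KernelJet 𝒳 V W} {K₀ : KernelJet 𝒳 V W}
    {J : ι → FunJet 𝒳 V W} {J₀ : FunJet 𝒳 V W} (hK : ∀ᶠ i in F, (K i).Good μ ϰ σ)
    (hK₀ : K₀.Good μ ϰ σ) (hJ₀ : J₀.Good ϰ)
    (hJ : ∀ᶠ i in F, (J i).Good ϰ) {B P : ℝ} (hB : ∀ᶠ i in F, ∀ x z, (K i).L x z ≤ B)
    (hP : ∀ᶠ i in F, ∀ z, (J i).p z ≤ P)
    (hL : ∀ x z, Tendsto (fun i => (K i).L x z) F (𝓝 (K₀.L x z)))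
    (hp : ∀ z, Tendsto (fun i => (J i).p z) F (𝓝 (J₀.p z))) (x : 𝒳)
    {X : ι → 𝒳 → U} {X₀ : 𝒳 → U} {b : ℝ}
    (hX : ∀ᶠ i in F, StronglyMeasurable (X i) ∧ ∀ z, ‖X i z‖ ≤ b)
    (hlim : ∀ z, Tendsto (fun i => X i z) F (𝓝 (X₀ z))) :
    Tendsto (fun i => ∫ z, (K i).dens μ (J i).p x z • X i z ∂μ) F
      (𝓝 (∫ z, K₀.dens μ J₀.p x z • X₀ z ∂μ)) := by
  have h0 := tendsto_integral_mul hK hJ hB hP hL hp x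
  have hpos : 0 < ∫ z, K₀.L x z * J₀.p z ∂μ := (hK₀.step_good hJ₀ (β := 0)).pos x
  refine tendsto_integral_filter_of_dominated_convergence
    (fun _ => B * P / ((∫ z, K₀.L x z * J₀.p z ∂μ) / 2) * b) ?_ ?_
    (integrable_const _) (.of_forall fun z => (((hL x z).mul (hp z)).div h0 hpos.ne').smul (hlim z))
  · filter_upwards [hK, hJ, hX] with i h1 h2 h3
    exact (((h1.measurable_mul h2.measurable_p x).div_const _).stronglyMeasurable.smul
      h3.1).aestronglyMeasurable
  · filter_upwards [hK, hJ, hX, hB, hP, h0.eventually_const_le (half_lt_self hpos)]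
      with i h1 h2 h3 h4 h5 h6
    refine .of_forall fun z => ?_
    have hn := mul_nonneg (h1.nonneg x z) (h2.pos z).le
    have hle : (K i).L x z * (J i).p z ≤ B * P :=
      mul_le_mul (h4 x z) (h5 z) (h2.pos z).le ((h1.nonneg x z).trans (h4 x z))
    rw [norm_smul, dens, Real.norm_of_nonneg (div_nonneg hn ((half_pos hpos).le.trans h6))]
    exact mul_le_mul (div_le_div₀ (hn.trans hle) hle (half_pos hpos) h6) (h3.2 z) (norm_nonneg _)
      (div_nonneg (hn.trans hle) (half_pos hpos).le)

theorem tendsto_iter {β : V →L[ℝ] V →L[ℝ] W} (hβ : ‖β‖ ≤ 1) (hϰ : 1 ≤ ϰ) {r : ℝ} (hr0 : 0 < r)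
    (hr1 : r < 1) (hr : 1 - (ϰ ^ 2)⁻¹ ≤ r ^ 4) (n : ℕ) {σ B : ℕ → ℝ} (hσ : ∀ k, 1 ≤ σ k)
    {K : ι → ℕ → KernelJet 𝒳 V W} {K₀ : ℕ → KernelJet 𝒳 V W}
    (hK : ∀ᶠ i in F, ∀ k, (K i k).Good μ ϰ (σ k)) (hK₀ : ∀ k, (K₀ k).Good μ ϰ (σ k))
    (hB : ∀ᶠ i in F, ∀ k x z, (K i k).L x z ≤ B k)
    (hL : ∀ k x z, Tendsto (fun i => (K i k).L x z) F (𝓝 ((K₀ k).L x z)))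
    (ha : ∀ k x z, Tendsto (fun i => (K i k).a x z) F (𝓝 ((K₀ k).a x z)))
    (hb : ∀ k x z, Tendsto (fun i => (K i k).b x z) F (𝓝 ((K₀ k).b x z))) :
    (∃ P, ∀ᶠ i in F, ∀ x, (iter μ β n (K i)).p x ≤ P) ∧
    ∀ x, Tendsto (fun i => (iter μ β n (K i)).p x) F (𝓝 ((iter μ β n K₀).p x)) ∧
      Tendsto (fun i => (iter μ β n (K i)).u x) F (𝓝 ((iter μ β n K₀).u x)) ∧
      Tendsto (fun i => (iter μ β n (K i)).w x) F (𝓝 ((iter μ β n K₀).w x)) := by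
  induction n generalizing σ B K K₀ with
  | zero => exact ⟨⟨1, .of_forall fun i x => le_rfl⟩, fun x =>
      ⟨tendsto_const_nhds, tendsto_const_nhds, tendsto_const_nhds⟩⟩
  | succ n ih =>
    obtain ⟨⟨P, hP⟩, hlim⟩ := ih (K := fun i k => K i (k + 1)) (K₀ := fun k => K₀ (k + 1))
      (fun k => hσ (k + 1)) (hK.mono fun i h k => h (k + 1)) (fun k => hK₀ (k + 1))
      (hB.mono fun i h k => h (k + 1)) (fun k => hL (k + 1)) (fun k => ha (k + 1))
      fun k => hb (k + 1)
    have hJ : ∀ᶠ i in F, (iter μ β n fun k => K i (k + 1)).Good ϰ :=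
      hK.mono fun i h => iter_good hϰ n fun k => h (k + 1)
    have hJ₀ : (iter μ β n fun k => K₀ (k + 1)).Good ϰ := iter_good hϰ n fun k => hK₀ (k + 1)
    have hK0 : ∀ᶠ i in F, (K i 0).Good μ ϰ (σ 0) := hK.mono fun i h => h 0
    have hB0 : ∀ᶠ i in F, ∀ x z, (K i 0).L x z ≤ B 0 := hB.mono fun i h => h 0
    set S := ∑ k ∈ Finset.range n, σ (k + 1)
    have hN : ∀ᶠ i in F, ∀ z, ‖(iter μ β n fun k => K i (k + 1)).u z‖ ≤ S ∧
        ‖(iter μ β n fun k => K i (k + 1)).w z‖ ≤ 5 * n * S ^ 2 := hK.mono fun i h z =>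
      iter_norm_le hβ hϰ hr0 hr1 hr n (fun k => hσ (k + 1)) (fun k => h (k + 1)) z
    have hU : ∀ᶠ i in F, ∀ x,
        StronglyMeasurable (fun z => (K i 0).a x z + (iter μ β n fun k => K i (k + 1)).u z) ∧
        ∀ z, ‖(K i 0).a x z + (iter μ β n fun k => K i (k + 1)).u z‖ ≤ σ 0 + S := by
      filter_upwards [hK0, hJ, hN] with i h1 h2 h3 x
      exact ⟨(h1.bdd_a x).1.add h2.bdd_u.1, fun z =>
        (norm_add_le _ _).trans (add_le_add (h1.norm_a x z) (h3 z).1)⟩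
    have hu : ∀ x z, Tendsto (fun i => (K i 0).a x z + (iter μ β n fun k => K i (k + 1)).u z) F
        (𝓝 ((K₀ 0).a x z + (iter μ β n fun k => K₀ (k + 1)).u z)) := fun x z =>
      (ha 0 x z).add (hlim z).2.1
    have key : ∀ (x : 𝒳) {X : ι → 𝒳 → V} {X₀ : 𝒳 → V} {b : ℝ},
        (∀ᶠ i in F, StronglyMeasurable (X i) ∧ ∀ z, ‖X i z‖ ≤ b) →
        (∀ z, Tendsto (fun i => X i z) F (𝓝 (X₀ z))) →
        Tendsto (fun i => ∫ z, (K i 0).dens μ (iter μ β n fun k => K i (k + 1)).p x z • X i z ∂μ) F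
          (𝓝 (∫ z, (K₀ 0).dens μ (iter μ β n fun k => K₀ (k + 1)).p x z • X₀ z ∂μ)) :=
      fun x => tendsto_integral_dens hK0 (hK₀ 0) hJ₀ hJ hB0 hP (hL 0) (fun z => (hlim z).1) x
    have key2 : ∀ (x : 𝒳) {X : ι → 𝒳 → W} {X₀ : 𝒳 → W} {b : ℝ},
        (∀ᶠ i in F, StronglyMeasurable (X i) ∧ ∀ z, ‖X i z‖ ≤ b) →
        (∀ z, Tendsto (fun i => X i z) F (𝓝 (X₀ z))) →
        Tendsto (fun i => ∫ z, (K i 0).dens μ (iter μ β n fun k => K i (k + 1)).p x z • X i z ∂μ) F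
          (𝓝 (∫ z, (K₀ 0).dens μ (iter μ β n fun k => K₀ (k + 1)).p x z • X₀ z ∂μ)) :=
      fun x => tendsto_integral_dens hK0 (hK₀ 0) hJ₀ hJ hB0 hP (hL 0) (fun z => (hlim z).1) x
    have hβc : ∀ {u : ι → V} {u₀ : V}, Tendsto u F (𝓝 u₀) →
        Tendsto (fun i => β (u i) (u i)) F (𝓝 (β u₀ u₀)) := fun {u u₀} h => by
      have h1 := (β.continuous₂.tendsto (u₀, u₀)).comp (h.prodMk_nhds h)
      exact h1
    have hbil : ∀ v : V, ‖v‖ ≤ σ 0 + S → ‖β‖ * ‖v‖ * ‖v‖ ≤ ‖β‖ * (σ 0 + S) * (σ 0 + S) :=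
      fun v hv => by
        have h0 := (norm_nonneg v).trans hv
        exact mul_le_mul (mul_le_mul_of_nonneg_left hv (norm_nonneg _)) hv (norm_nonneg _)
          (mul_nonneg (norm_nonneg _) h0)
    refine ⟨⟨∫ _, B 0 * P ∂μ, ?_⟩, fun x => ⟨?_, ?_, ?_⟩⟩
    · filter_upwards [hK0, hJ, hB0, hP] with i h1 h2 h3 h4 x
      refine integral_mono (h1.integrable_mul' h2 x) (integrable_const _) fun z => ?_
      exact mul_le_mul (h3 x z) (h4 z) (h2.pos z).le ((h1.nonneg x z).trans (h3 x z))
    · exact tendsto_integral_mul hK0 hJ hB0 hP (hL 0) (fun z => (hlim z).1) x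
    · exact key x (hU.mono fun i h => h x) (hu x)
    · have w1 := key2 x (X := fun i z => (K i 0).b x z + (iter μ β n fun k => K i (k + 1)).w z)
        (b := σ 0 ^ 2 + 5 * n * S ^ 2) (by
          filter_upwards [hK0, hJ, hN] with i h1 h2 h3
          exact ⟨(h1.bdd_b x).1.add h2.bdd_w.1, fun z =>
            (norm_add_le _ _).trans (add_le_add (h1.norm_b x z) (h3 z).2)⟩)
        fun z => (hb 0 x z).add (hlim z).2.2
      have w2 := key2 x (X := fun i z => β ((K i 0).a x z + (iter μ β n fun k => K i (k + 1)).u z)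
          ((K i 0).a x z + (iter μ β n fun k => K i (k + 1)).u z))
        (X₀ := fun z => β ((K₀ 0).a x z + (iter μ β n fun k => K₀ (k + 1)).u z)
          ((K₀ 0).a x z + (iter μ β n fun k => K₀ (k + 1)).u z))
        (b := ‖β‖ * (σ 0 + S) * (σ 0 + S)) (by
          filter_upwards [hU] with i h
          refine ⟨(BddSM.bilin β ⟨(h x).1, _, (h x).2⟩ ⟨(h x).1, _, (h x).2⟩).1, fun z => ?_⟩
          exact (β.le_opNorm₂ _ _).trans (hbil _ ((h x).2 z)))
        fun z => hβc (hu x z)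
      have w3 := key x (hU.mono fun i h => h x) (hu x)
      exact w1.add (w2.sub (hβc w3))

end KernelJet

end Convergence

/-- A weighted average is close to `v` if all values are. -/
theorem norm_weighted_avg_sub_le {Ω V : Type*} [MeasurableSpace Ω] [NormedAddCommGroup V]
    [NormedSpace ℝ V] [CompleteSpace V] {m : Measure Ω} {f : Ω → ℝ} {X : Ω → V} {v : V} {κ : ℝ}
    (hf : Integrable f m) (h0 : 0 ≤ᵐ[m] f) (hI : 0 < ∫ ω, f ω ∂m)
    (hX : AEStronglyMeasurable X m) (h : ∀ᵐ ω ∂m, ‖X ω - v‖ ≤ κ) :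
    ‖(∫ ω, f ω ∂m)⁻¹ • ∫ ω, f ω • X ω ∂m - v‖ ≤ κ := by
  have hi : Integrable (fun ω => f ω • X ω) m := by
    refine hf.smul_bdd (κ + ‖v‖) hX ?_
    filter_upwards [h] with ω hω
    calc ‖X ω‖ = ‖X ω - v + v‖ := by rw [sub_add_cancel]
      _ ≤ _ := (norm_add_le _ _).trans (by gcongr)
  have e : (∫ ω, f ω ∂m)⁻¹ • ∫ ω, f ω • X ω ∂m - v =
      (∫ ω, f ω ∂m)⁻¹ • ∫ ω, f ω • (X ω - v) ∂m := by
    simp_rw [smul_sub]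
    rw [integral_sub hi (hf.smul_const v), integral_smul_const, smul_sub, inv_smul_smul₀ hI.ne']
  rw [e, norm_smul, norm_inv, Real.norm_of_nonneg hI.le, inv_mul_le_iff₀ hI, ← integral_mul_const]
  refine norm_integral_le_of_norm_le (hf.mul_const κ) ?_
  filter_upwards [h0, h] with ω h1 h2
  rw [norm_smul, Real.norm_of_nonneg h1]
  exact mul_le_mul_of_nonneg_left h2 h1

open KernelJet in
/-- The mean of the bound in `KernelJet.iter_perturb_u` grows linearly. -/
theorem integral_perturbSum_le {Y : Type*} [MeasurableSpace Y] {P : Measure (ℕ → Y)}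
    (hP : MeasurePreserving (shiftBy 1) P P) {σ δ η : Y → ℝ}
    (hσ : MemLp (fun ω => σ (ω 0)) 2 P) (hδ : MemLp (fun ω => δ (ω 0)) 2 P)
    (hη : Integrable (fun ω => η (ω 0)) P) (ϰ : ℝ) {r : ℝ} (hr0 : 0 < r) (hr1 : r < 1) {ε : ℝ}
    (hε : 0 < ε) (n : ℕ) :
    Integrable (fun ω => perturbSum ϰ r n (fun k => σ (ω k)) (fun k => δ (ω k))
      fun k => η (ω k)) P ∧
    ∫ ω, perturbSum ϰ r n (fun k => σ (ω k)) (fun k => δ (ω k)) (fun k => η (ω k)) ∂P ≤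
      n * (∫ ω, η (ω 0) ∂P +
        ε⁻¹ * ((2 * ((6 * ϰ ^ 2) ^ 2 / (1 - r) ^ 2) + 32) * ∫ ω, δ (ω 0) ^ 2 ∂P) +
        ε * ((2 * (2 ^ 2 / (1 - r) ^ 2) + 8) * ∫ ω, σ (ω 0) ^ 2 ∂P)) := by
  induction n with
  | zero => simp [perturbSum]
  | succ n ih =>
    set X : (ℕ → Y) → ℝ := fun ω => expSum r (6 * ϰ ^ 2) n fun k => δ (ω k)
    set Z : (ℕ → Y) → ℝ := fun ω => expSum r 2 n fun k => σ (ω k)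
    have hX : MemLp X 2 P := memLp_expSum hP hδ r _ n
    have hZ : MemLp Z 2 P := memLp_expSum hP hσ r _ n
    have hXs : MemLp (fun ω => X (shiftBy 1 ω)) 2 P := hX.comp_measurePreserving hP
    have hZs : MemLp (fun ω => Z (shiftBy 1 ω)) 2 P := hZ.comp_measurePreserving hP
    have iX : ∫ ω, X (shiftBy 1 ω) ^ 2 ∂P ≤ _ := (integral_comp_shiftBy hP 1
      (F := fun ω => X ω ^ 2) hX.integrable_sq.aestronglyMeasurable).trans_le
      (integral_expSum_sq_le hP hδ hr0 hr1 n)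
    have iZ : ∫ ω, Z (shiftBy 1 ω) ^ 2 ∂P ≤ _ := (integral_comp_shiftBy hP 1
      (F := fun ω => Z ω ^ 2) hZ.integrable_sq.aestronglyMeasurable).trans_le
      (integral_expSum_sq_le hP hσ hr0 hr1 n)
    have hi1 : Integrable (fun ω => perturbSum ϰ r n (fun k => σ (shiftBy 1 ω k))
        (fun k => δ (shiftBy 1 ω k)) fun k => η (shiftBy 1 ω k)) P :=
      (hP.integrable_comp ih.1.aestronglyMeasurable).2 ih.1
    have hmul : Integrable (fun ω => (X (shiftBy 1 ω) + 4 * δ (ω 0)) *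
        (2 * σ (ω 0) + Z (shiftBy 1 ω))) P :=
      (hXs.add (hδ.const_mul 4)).integrable_mul ((hσ.const_mul 2).add hZs)
    have e : ∀ ω : ℕ → Y, perturbSum ϰ r (n + 1) (fun k => σ (ω k)) (fun k => δ (ω k))
        (fun k => η (ω k)) = perturbSum ϰ r n (fun k => σ (shiftBy 1 ω k))
        (fun k => δ (shiftBy 1 ω k)) (fun k => η (shiftBy 1 ω k)) + η (ω 0) +
        (X (shiftBy 1 ω) + 4 * δ (ω 0)) * (2 * σ (ω 0) + Z (shiftBy 1 ω)) := fun ω => rfl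
    simp only [e]
    refine ⟨(hi1.add hη).add hmul, ?_⟩
    rw [integral_add (by exact hi1.add hη) hmul, integral_add hi1 hη, integral_comp_shiftBy hP 1
      (F := fun ω => perturbSum ϰ r n (fun k => σ (ω k)) (fun k => δ (ω k)) fun k => η (ω k))
      ih.1.aestronglyMeasurable]
    have q1 := hXs.integrable_sq.const_mul (ε⁻¹ * 2)
    have q2 := hδ.integrable_sq.const_mul (ε⁻¹ * 32)
    have q3 := hZs.integrable_sq.const_mul (ε * 2)
    have q4 := hσ.integrable_sq.const_mul (ε * 8)
    have hb : ∫ ω, (X (shiftBy 1 ω) + 4 * δ (ω 0)) * (2 * σ (ω 0) + Z (shiftBy 1 ω)) ∂P ≤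
        ∫ ω, ((ε⁻¹ * 2 * X (shiftBy 1 ω) ^ 2 + ε⁻¹ * 32 * δ (ω 0) ^ 2) +
          (ε * 2 * Z (shiftBy 1 ω) ^ 2 + ε * 8 * σ (ω 0) ^ 2)) ∂P := by
      refine integral_mono hmul ((q1.add q2).add (q3.add q4)) fun ω => ?_
      set A := X (shiftBy 1 ω)
      set b := δ (ω 0)
      set s := σ (ω 0)
      set z := Z (shiftBy 1 ω)
      have h1 : (A + 4 * b) * (2 * s + z) ≤ ε⁻¹ * (A + 4 * b) ^ 2 + ε * (2 * s + z) ^ 2 := by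
        have e1 : ε⁻¹ * (A + 4 * b) ^ 2 = ε * (ε⁻¹ * (A + 4 * b)) ^ 2 := by field_simp
        have e2 : A + 4 * b = ε * (ε⁻¹ * (A + 4 * b)) := by field_simp
        rw [e1]
        set t := ε⁻¹ * (A + 4 * b)
        rw [e2]
        nlinarith [mul_nonneg hε.le (sq_nonneg (t - (2 * s + z))), mul_nonneg hε.le (sq_nonneg t),
          mul_nonneg hε.le (sq_nonneg (2 * s + z))]
      have h2 : ε⁻¹ * (A + 4 * b) ^ 2 ≤ ε⁻¹ * (2 * A ^ 2 + 32 * b ^ 2) := by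
        gcongr; nlinarith [sq_nonneg (A - 4 * b)]
      have h3 : ε * (2 * s + z) ^ 2 ≤ ε * (8 * s ^ 2 + 2 * z ^ 2) := by
        gcongr; nlinarith [sq_nonneg (2 * s - z)]
      dsimp only
      linarith
    rw [integral_add (by exact q1.add q2) (by exact q3.add q4), integral_add q1 q2,
      integral_add q3 q4, integral_const_mul, integral_const_mul, integral_const_mul,
      integral_const_mul] at hb
    have iX' := mul_le_mul_of_nonneg_left iX (by positivity : 0 ≤ ε⁻¹ * 2)
    have iZ' := mul_le_mul_of_nonneg_left iZ (by positivity : 0 ≤ ε * 2)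
    have := ih.2
    push_cast
    linarith

/-- A second order Taylor bound from a bound for the Hessian. -/
theorem le_of_hessian_le {E : Type*} [NormedAddCommGroup E] [NormedSpace ℝ E] {s : Set E}
    (hs : Convex ℝ s) {f : E → ℝ} {f' : E → E →L[ℝ] ℝ} {f'' : E → E →L[ℝ] E →L[ℝ] ℝ}
    (h1 : ∀ x ∈ s, HasFDerivAt f (f' x) x) (h2 : ∀ x ∈ s, HasFDerivAt f' (f'' x) x) {κ : ℝ}
    (h3 : ∀ x ∈ s, ∀ v, f'' x v v ≤ -(2 * κ) * ‖v‖ ^ 2) {a b : E} (ha : a ∈ s) (hb : b ∈ s) :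
    f b ≤ f a + f' a (b - a) - κ * ‖b - a‖ ^ 2 := by
  set v := b - a
  have hm : ∀ t ∈ Icc (0 : ℝ) 1, a + t • v ∈ s := fun t ht => hs.add_smul_sub_mem ha hb ht
  have hl : ∀ t : ℝ, HasDerivAt (fun t : ℝ => a + t • v) v t := fun t => by
    simpa using ((hasDerivAt_id t).smul_const v).const_add a
  set φ : ℝ → ℝ := fun t => f (a + t • v) - t * f' a v + κ * ‖v‖ ^ 2 * t ^ 2
  set φ' : ℝ → ℝ := fun t => f' (a + t • v) v - f' a v + κ * ‖v‖ ^ 2 * (2 * t)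
  have hφ : ∀ t ∈ Icc (0 : ℝ) 1, HasDerivAt φ (φ' t) t := fun t ht => by
    have := (((h1 _ (hm t ht)).comp_hasDerivAt t (hl t)).sub
      ((hasDerivAt_id t).mul_const (f' a v))).add ((hasDerivAt_pow 2 t).const_mul (κ * ‖v‖ ^ 2))
    refine this.congr_deriv ?_
    simp only [φ', one_mul]
    norm_num
  have hφ' : ∀ t ∈ Icc (0 : ℝ) 1, HasDerivAt φ'
      (f'' (a + t • v) v v + κ * ‖v‖ ^ 2 * 2) t := fun t ht => by
    have e1 : HasDerivAt (fun t : ℝ => f' (a + t • v)) (f'' (a + t • v) v) t :=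
      (h2 _ (hm t ht)).comp_hasDerivAt t (hl t)
    have e2 : HasDerivAt (fun t : ℝ => f' (a + t • v) v) (f'' (a + t • v) v v) t := by
      have := e1.clm_apply (hasDerivAt_const t v)
      simpa using this
    have := (e2.sub_const (f' a v)).add (((hasDerivAt_id t).const_mul 2).const_mul (κ * ‖v‖ ^ 2))
    refine this.congr_deriv ?_
    norm_num
  have hanti : AntitoneOn φ' (Icc 0 1) := by
    refine antitoneOn_of_deriv_nonpos (convex_Icc 0 1)
      (fun t ht => (hφ' t ht).continuousAt.continuousWithinAt)
      (fun t ht => (hφ' t (interior_subset ht)).differentiableAt.differentiableWithinAt)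
      fun t ht => ?_
    rw [(hφ' t (interior_subset ht)).deriv]
    have := h3 _ (hm t (interior_subset ht)) v
    linarith
  have hanti' : AntitoneOn φ (Icc 0 1) := by
    refine antitoneOn_of_deriv_nonpos (convex_Icc 0 1)
      (fun t ht => (hφ t ht).continuousAt.continuousWithinAt)
      (fun t ht => (hφ t (interior_subset ht)).differentiableAt.differentiableWithinAt)
      fun t ht => ?_
    have ht' := interior_subset ht
    rw [(hφ t ht').deriv]
    have := hanti (left_mem_Icc.2 zero_le_one) ht' ht'.1
    simpa [φ'] using this
  have := hanti' (left_mem_Icc.2 zero_le_one) (right_mem_Icc.2 zero_le_one) zero_le_one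
  have hb' : a + v = b := add_sub_cancel a b
  have e1 : φ 1 = f b - f' a v + κ * ‖v‖ ^ 2 := by
    change f (a + (1 : ℝ) • v) - 1 * f' a v + κ * ‖v‖ ^ 2 * 1 ^ 2 = _
    rw [one_smul, hb', one_mul, one_pow, mul_one]
  have e0 : φ 0 = f a := by
    change f (a + (0 : ℝ) • v) - 0 * f' a v + κ * ‖v‖ ^ 2 * 0 ^ 2 = _
    rw [zero_smul, add_zero]
    ring
  rw [e0, e1] at this
  linarith

/-- Two functions that are close on a ball, with Lipschitz derivatives, have close derivatives. -/
theorem norm_fderiv_sub_le_of_norm_sub_le {E V : Type*} [NormedAddCommGroup E] [NormedSpace ℝ E]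
    [NormedAddCommGroup V] [NormedSpace ℝ V] {f g : E → V} {f' g' : E → E →L[ℝ] V} {a : E}
    {t s κ : ℝ} (ht : 0 < t) (hs : 0 ≤ s) (hκ : 0 ≤ κ)
    (hf : ∀ x ∈ Metric.closedBall a t, HasFDerivWithinAt f (f' x) (Metric.closedBall a t) x)
    (hg : ∀ x ∈ Metric.closedBall a t, HasFDerivWithinAt g (g' x) (Metric.closedBall a t) x)
    (hf' : ∀ x ∈ Metric.closedBall a t, ‖f' x - f' a‖ ≤ s * t)
    (hg' : ∀ x ∈ Metric.closedBall a t, ‖g' x - g' a‖ ≤ s * t)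
    (h : ∀ x ∈ Metric.closedBall a t, ‖f x - g x‖ ≤ κ) :
    ‖f' a - g' a‖ ≤ 2 * κ / t + 2 * s * t := by
  have ha : a ∈ Metric.closedBall a t := Metric.mem_closedBall_self ht.le
  refine ContinuousLinearMap.opNorm_le_bound _ (by positivity) fun v => ?_
  rcases eq_or_ne v 0 with rfl | hv
  · simp
  have hv' : 0 < ‖v‖ := norm_pos_iff.2 hv
  set w : E := (t / ‖v‖) • v
  have hw : ‖w‖ = t := by
    rw [norm_smul, Real.norm_of_nonneg (by positivity), div_mul_cancel₀ _ hv'.ne']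
  have hb : a + w ∈ Metric.closedBall a t := by simp [hw]
  have key : ∀ {φ : E → V} {φ' : E → E →L[ℝ] V},
      (∀ x ∈ Metric.closedBall a t, HasFDerivWithinAt φ (φ' x) (Metric.closedBall a t) x) →
      (∀ x ∈ Metric.closedBall a t, ‖φ' x - φ' a‖ ≤ s * t) →
      ‖φ (a + w) - φ a - φ' a w‖ ≤ s * t * t := fun h1 h2 => by
    have := (convex_closedBall a t).norm_image_sub_le_of_norm_hasFDerivWithin_le' h1 h2 ha hb
    rwa [add_sub_cancel_left, hw] at this
  have e : (f' a - g' a) w = (f (a + w) - g (a + w)) - (f a - g a) -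
      (f (a + w) - f a - f' a w) + (g (a + w) - g a - g' a w) := by
    rw [sub_apply]; abel
  have hle : ‖(f' a - g' a) w‖ ≤ 2 * κ + 2 * s * t * t := by
    rw [e]
    refine (norm_add_le _ _).trans ((add_le_add ((norm_sub_le _ _).trans (add_le_add
      ((norm_sub_le _ _).trans (add_le_add (h _ hb) (h _ ha))) (key hf hf'))) (key hg hg')).trans
      (le_of_eq (by ring)))
  have e2 : ‖(f' a - g' a) w‖ = t / ‖v‖ * ‖(f' a - g' a) v‖ := by
    rw [map_smul, norm_smul, Real.norm_of_nonneg (by positivity)]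
  rw [e2, div_mul_eq_mul_div, div_le_iff₀ hv'] at hle
  rw [div_add' _ _ _ ht.ne', div_mul_eq_mul_div, le_div_iff₀ ht]
  linarith

theorem norm_le_sqrt_mul_of_enorm_div_le {V : Type*} [NormedAddCommGroup V] {D : V} {g s : ℝ}
    (hg : 0 ≤ g) (hs : 0 ≤ s) (h : (‖D‖ₑ / ENNReal.ofReal g) ^ 2 ≤ ENNReal.ofReal s) :
    ‖D‖ ≤ √s * g := by
  rw [← Real.sq_sqrt hs, ENNReal.ofReal_pow (Real.sqrt_nonneg s),
    ENNReal.pow_le_pow_left_iff two_ne_zero, ENNReal.div_le_iff_le_mul (.inr ENNReal.ofReal_ne_top)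
    (.inl ENNReal.ofReal_ne_top), ← ENNReal.ofReal_mul (Real.sqrt_nonneg s), ← ofReal_norm] at h
  exact (ENNReal.ofReal_le_ofReal_iff (by positivity)).1 h

namespace HMMFamily

variable {d m : ℕ} {𝒳 : Type*} [MeasurableSpace 𝒳] (M : HMMFamily d m 𝒳)

/-- On the set `G` of observations, the densities and their gradients are Lipschitz relative to the
density on balls of radius `ρ`, and the third logarithmic derivatives are bounded there. -/
structure LipObs (ρ : ℝ) (b₁ b₂ s₃ : EuclideanSpace ℝ (Fin m) → ℝ)
    (G : Set (EuclideanSpace ℝ (Fin m))) : Prop where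
  nonneg₁ : ∀ y, 0 ≤ b₁ y
  nonneg₂ : ∀ y, 0 ≤ b₂ y
  nonneg₃ : ∀ y, 0 ≤ s₃ y
  lip₁ : ∀ y ∈ G, ∀ θ ∈ M.Θ, ∀ x, ∀ y' ∈ Metric.closedBall y ρ,
    |M.g θ x y' - M.g θ x y| ≤ b₁ y * M.g θ x y * dist y' y
  lip₂ : ∀ y ∈ G, ∀ θ ∈ M.Θ, ∀ x, ∀ y' ∈ Metric.closedBall y ρ,
    ‖M.gradTheta θ x y' - M.gradTheta θ x y‖ ≤ b₂ y * M.g θ x y * dist y' y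
  bound₃ : ∀ y ∈ G, ∀ θ ∈ M.Θ, ∀ x, ∀ y' ∈ Metric.closedBall y ρ ∩ M.𝒴,
    ‖iteratedFDerivWithin ℝ 3 (fun θ => Real.log (M.g θ x y')) M.Θ θ‖ ≤ s₃ y

variable {M}

theorem GoodObs.mono {K : ℝ} {s₁ s₂ : EuclideanSpace ℝ (Fin m) → ℝ}
    {G G' : Set (EuclideanSpace ℝ (Fin m))} (h : M.GoodObs K s₁ s₂ G) (hG' : MeasurableSet G')
    (hs : G' ⊆ G) : M.GoodObs K s₁ s₂ G' :=
  ⟨hG', hs.trans h.subset, fun y hy => h.measure_pos y (hs hy), h.measurable₁, h.measurable₂,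
    h.nonneg₁, h.nonneg₂, fun y hy => h.bound₁ y (hs hy), fun y hy => h.bound₂ y (hs hy)⟩

theorem exists_lipObs {π : Measure (𝒳 × EuclideanSpace ℝ (Fin m))} [IsFiniteMeasure π] {ρ : ℝ}
    (hρ : 0 < ρ) {K : ℝ} (hK : ρ ≤ K) (hd : ∀ᵐ y ∂π.snd, ∀ θ ∈ M.Θ, ∀ x,
      ∀ y' ∈ Metric.closedBall y ρ, DifferentiableAt ℝ (M.g θ x) y' ∧
        DifferentiableAt ℝ (M.gradTheta θ x) y')
    (h1 : FiniteMean π.snd fun y => ⨆ x : 𝒳, ⨆ θ ∈ M.Θ, ⨆ y' ∈ Metric.closedBall y ρ,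
      (‖fderiv ℝ (M.g θ x) y'‖ₑ / ENNReal.ofReal (M.g θ x y)) ^ 2)
    (h2 : FiniteMean π.snd fun y => ⨆ x : 𝒳, ⨆ θ ∈ M.Θ, ⨆ y' ∈ Metric.closedBall y ρ,
      (‖fderiv ℝ (M.gradTheta θ x) y'‖ₑ / ENNReal.ofReal (M.g θ x y)) ^ 2)
    (h3 : FiniteMean π.snd fun y => M.supLogDeriv 3 K y) :
    ∃ b₁ b₂ s₃ A, MeasurableSet A ∧ (∀ᵐ y ∂π.snd, y ∈ A) ∧ MemLp b₁ 2 π.snd ∧ MemLp b₂ 2 π.snd ∧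
      ∀ G ⊆ A ∩ M.𝒴, M.LipObs ρ b₁ b₂ s₃ G := by
  obtain ⟨t₁, A₁, ht₁, h0₁, hL₁, hA₁, hae₁, hle₁⟩ :=
    FiniteMean.exists_majorant (k := 1) one_ne_zero (by simpa only [pow_one] using h1)
  obtain ⟨t₂, A₂, ht₂, h0₂, hL₂, hA₂, hae₂, hle₂⟩ :=
    FiniteMean.exists_majorant (k := 1) one_ne_zero (by simpa only [pow_one] using h2)
  obtain ⟨t₃, A₃, ht₃, h0₃, hL₃, hA₃, hae₃, hle₃⟩ :=
    FiniteMean.exists_majorant (k := 1) one_ne_zero (by simpa only [pow_one] using h3)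
  obtain ⟨A₀, hA₀, hmA₀, hd⟩ := Filter.Eventually.exists_measurable_mem hd
  have hsq : ∀ {t : EuclideanSpace ℝ (Fin m) → ℝ}, Measurable t → (∀ y, 0 ≤ t y) →
      MemLp t ((1 : ℕ) : ℝ≥0∞) π.snd → MemLp (fun y => √(t y)) 2 π.snd := fun ht h0 hL => by
    rw [memLp_two_iff_integrable_sq ht.sqrt.aestronglyMeasurable]
    simp only [Real.sq_sqrt (h0 _)]
    exact memLp_one_iff_integrable.1 (by simpa using hL)
  have hself : ∀ y : EuclideanSpace ℝ (Fin m), y ∈ Metric.closedBall y ρ := fun y =>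
    Metric.mem_closedBall_self hρ.le
  refine ⟨fun y => √(t₁ y), fun y => √(t₂ y), t₃, A₁ ∩ A₂ ∩ A₃ ∩ A₀,
    ((hA₁.inter hA₂).inter hA₃).inter hmA₀, ?_, hsq ht₁ h0₁ hL₁, hsq ht₂ h0₂ hL₂, fun G hG =>
    ⟨fun y => Real.sqrt_nonneg _, fun y => Real.sqrt_nonneg _, h0₃, fun y hy θ hθ x y' hy' => ?_,
      fun y hy θ hθ x y' hy' => ?_, fun y hy θ hθ x y' hy' => ?_⟩⟩
  · filter_upwards [hae₁, hae₂, hae₃, hA₀] with y a b c d using ⟨⟨⟨a, b⟩, c⟩, d⟩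
  · have hA := (hG hy).1
    rw [← Real.norm_eq_abs, dist_eq_norm]
    refine (convex_closedBall y ρ).norm_image_sub_le_of_norm_fderiv_le
      (fun z hz => (hd y hA.2 θ hθ x z hz).1) (fun z hz => ?_) (hself y) hy'
    refine norm_le_sqrt_mul_of_enorm_div_le (M.g_nonneg θ hθ x y (hG hy).2) (h0₁ y)
      (le_trans ?_ (hle₁ y hA.1.1.1))
    exact le_iSup_of_le x (le_iSup₂_of_le θ hθ (le_iSup₂_of_le z hz le_rfl))
  · have hA := (hG hy).1
    rw [dist_eq_norm]
    refine (convex_closedBall y ρ).norm_image_sub_le_of_norm_fderiv_le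
      (fun z hz => (hd y hA.2 θ hθ x z hz).2) (fun z hz => ?_) (hself y) hy'
    refine norm_le_sqrt_mul_of_enorm_div_le (M.g_nonneg θ hθ x y (hG hy).2) (h0₂ y)
      (le_trans ?_ (hle₂ y hA.1.1.2))
    exact le_iSup_of_le x (le_iSup₂_of_le θ hθ (le_iSup₂_of_le z hz le_rfl))
  · have h := hle₃ y (hG hy).1.1.2
    refine (ENNReal.ofReal_le_ofReal_iff (h0₃ y)).1 ((ofReal_norm _).trans_le (le_trans ?_ h))
    exact le_iSup₂_of_le θ hθ (le_iSup_of_le x (le_iSup₂_of_le y'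
      ⟨Metric.closedBall_subset_closedBall hK hy'.1, hy'.2⟩ le_rfl))

variable {c C D : ℝ} (hB : M.Bounds c C D) {K ρ : ℝ}
  {s₁ s₂ b₁ b₂ s₃ : EuclideanSpace ℝ (Fin m) → ℝ} {G : Set (EuclideanSpace ℝ (Fin m))}
  (hG : M.GoodObs K s₁ s₂ G) (hLip : M.LipObs ρ b₁ b₂ s₃ G) {ε : ℝ} (hε : ε ≤ ρ) (hρ : ρ ≤ K)
  (hε0 : 0 < ε)

include hB in
theorem Bounds.gradTheta_eq {θ : EuclideanSpace ℝ (Fin d)} (hθ : θ ∈ M.Θ) (x : 𝒳)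
    {y : EuclideanSpace ℝ (Fin m)} (hy : y ∈ M.𝒴) :
    M.gradTheta θ x y = M.g θ x y • logGrad M.Θ (fun θ => M.g θ x y) θ :=
  ((hB.hasLogJet_g x hy).d1 θ hθ).fderivWithin (M.uniqueDiffOn_Θ θ hθ)

include hB hG hLip hε hρ hε0

theorem Bounds.norm_logGrad_sub_le {θ : EuclideanSpace ℝ (Fin d)} (hθ : θ ∈ M.Θ) (x : 𝒳)
    {y y' : EuclideanSpace ℝ (Fin m)} (hy : y ∈ G) (hy' : y' ∈ Metric.closedBall y ε ∩ M.𝒴) :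
    ‖logGrad M.Θ (fun θ => M.g θ x y') θ - logGrad M.Θ (fun θ => M.g θ x y) θ‖ ≤
      ε * (b₂ y + b₁ y * s₁ y) := by
  have hyρ := Metric.closedBall_subset_closedBall hε hy'.1
  have l1 := hLip.lip₁ y hy θ hθ x y' hyρ
  have l2 := hLip.lip₂ y hy θ hθ x y' hyρ
  have hd : dist y' y ≤ ε := hy'.1
  have n1 := hLip.nonneg₁ y
  have n2 := hLip.nonneg₂ y
  have n3 := hG.nonneg₁ y
  have hb := hG.bound₁ y hy θ hθ x y' ⟨Metric.closedBall_subset_closedBall hρ hyρ, hy'.2⟩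
  rcases hB.dichotomy x y (hG.subset hy) with h | h
  · rw [hB.gradTheta_eq hθ x hy'.2, hB.gradTheta_eq hθ x (hG.subset hy)] at l2
    have hp := h θ hθ
    set A := logGrad M.Θ (fun θ => M.g θ x y') θ
    set A₀ := logGrad M.Θ (fun θ => M.g θ x y) θ
    have e : M.g θ x y • (A - A₀) = (M.g θ x y' • A - M.g θ x y • A₀) -
        (M.g θ x y' - M.g θ x y) • A := by module
    have hn : M.g θ x y * ‖A - A₀‖ ≤ M.g θ x y * (ε * (b₂ y + b₁ y * s₁ y)) := by
      rw [← Real.norm_of_nonneg hp.le, ← norm_smul, Real.norm_of_nonneg hp.le, e]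
      refine (norm_sub_le _ _).trans ?_
      rw [norm_smul, Real.norm_eq_abs]
      have t1 : b₂ y * M.g θ x y * dist y' y ≤ b₂ y * M.g θ x y * ε := by gcongr
      have t2 : |M.g θ x y' - M.g θ x y| * ‖A‖ ≤ b₁ y * M.g θ x y * ε * s₁ y := by
        gcongr
        exact l1.trans (by gcongr)
      linarith
    exact le_of_mul_le_mul_left hn hp
  · have h' : ∀ θ ∈ M.Θ, M.g θ x y' = 0 := fun θ hθ => by
      have := hLip.lip₁ y hy θ hθ x y' hyρ
      rw [h θ hθ, mul_zero, zero_mul, sub_zero] at this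
      exact abs_nonpos_iff.1 this
    rw [logGrad_eq_zero h' hθ, logGrad_eq_zero h hθ]
    simp only [Pi.zero_apply, sub_zero, norm_zero]
    positivity

theorem Bounds.abs_gPert_sub_le {θ : EuclideanSpace ℝ (Fin d)} (hθ : θ ∈ M.Θ) (x : 𝒳)
    {y : EuclideanSpace ℝ (Fin m)} (hy : y ∈ G) :
    |M.gPert ε θ x y - M.g θ x y| ≤ ε * b₁ y * M.g θ x y := by
  have hpos : 0 < M.ν.real (Metric.closedBall y ε) :=
    ENNReal.toReal_pos (hG.measure_pos y hy ε hε0).ne' (isCompact_closedBall y ε).measure_lt_top.ne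
  have h := norm_weighted_avg_sub_le (m := M.ν.restrict (Metric.closedBall y ε)) (f := fun _ => 1)
    (X := M.g θ x) (v := M.g θ x y) (κ := ε * b₁ y * M.g θ x y) (integrable_const _)
    (.of_forall fun _ => zero_le_one) (by simpa [Measure.real] using hpos)
    (measurable_g_right hθ x).aestronglyMeasurable (by
      filter_upwards [ae_restrict_mem measurableSet_closedBall] with y' hy'
      refine (hLip.lip₁ y hy θ hθ x y' (Metric.closedBall_subset_closedBall hε hy')).trans ?_
      have n1 := hLip.nonneg₁ y
      have n2 := M.g_nonneg θ hθ x y (hG.subset hy)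
      have : dist y' y ≤ ε := hy'
      calc _ ≤ b₁ y * M.g θ x y * ε := by gcongr
        _ = _ := by ring)
  rw [gPert, if_pos hε0, setAverage_eq]
  simpa [Measure.real] using h

end HMMFamily

theorem norm_avgJet₂_sub_le {E : Type} [NormedAddCommGroup E] [NormedSpace ℝ E] {Ω : Type*}
    [MeasurableSpace Ω] {m : Measure Ω} {f : Ω → ℝ} {A : Ω → E →L[ℝ] ℝ}
    {B : Ω → E →L[ℝ] E →L[ℝ] ℝ} {A₀ : E →L[ℝ] ℝ} {B₀ : E →L[ℝ] E →L[ℝ] ℝ} {s η κ : ℝ}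
    (hf : Integrable f m) (h0 : 0 ≤ᵐ[m] f) (hI : 0 < ∫ ω, f ω ∂m) (hA : AEStronglyMeasurable A m)
    (hB : AEStronglyMeasurable B m) (hAs : ∀ᵐ ω ∂m, ‖A ω‖ ≤ s) (hA₀ : ‖A₀‖ ≤ s)
    (hAd : ∀ᵐ ω ∂m, ‖A ω - A₀‖ ≤ η) (hBd : ∀ᵐ ω ∂m, ‖B ω - B₀‖ ≤ κ) :
    ‖avgJet₂ m f A B - B₀‖ ≤ κ + 4 * s * η := by
  have hs : 0 ≤ s := (norm_nonneg _).trans hA₀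
  have hout : ∀ A : E →L[ℝ] ℝ, ‖A‖ ≤ s → ‖A - A₀‖ ≤ η →
      ‖outer E A A - outer E A₀ A₀‖ ≤ 2 * s * η := fun A hA hd => by
    have e : outer E A A - outer E A₀ A₀ = outer E (A - A₀) A + outer E A₀ (A - A₀) := by
      simp only [map_sub, sub_apply]
      abel
    rw [e]
    refine (norm_add_le _ _).trans ?_
    rw [norm_outer_apply, norm_outer_apply]
    have hη : 0 ≤ η := (norm_nonneg _).trans hd
    have t1 : ‖A - A₀‖ * ‖A‖ ≤ η * s := by gcongr
    have t2 : ‖A₀‖ * ‖A - A₀‖ ≤ s * η := by gcongr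
    linarith
  have hO : AEStronglyMeasurable (fun ω => outer E (A ω) (A ω)) m :=
    (outer E).continuous₂.comp_aestronglyMeasurable (hA.prodMk hA)
  have h1 := norm_weighted_avg_sub_le (v := B₀ + outer E A₀ A₀) hf h0 hI (hB.add hO)
    (κ := κ + 2 * s * η) (by
      filter_upwards [hAs, hAd, hBd] with ω a b c
      rw [Pi.add_apply, add_sub_add_comm]
      exact (norm_add_le _ _).trans (add_le_add c (hout _ a b)))
  have h2 := hout _ (norm_avgJet₁_le hs hf h0 hAs) (norm_weighted_avg_sub_le hf h0 hI hA hAd)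
  have e : avgJet₂ m f A B - B₀ = ((∫ ω, f ω ∂m)⁻¹ • ∫ ω, f ω • (B ω + outer E (A ω) (A ω)) ∂m -
      (B₀ + outer E A₀ A₀)) - (outer E (avgJet₁ m f A) (avgJet₁ m f A) - outer E A₀ A₀) := by
    rw [avgJet₂]
    abel
  rw [e]
  exact (norm_sub_le _ _).trans ((add_le_add h1 h2).trans (le_of_eq (by ring)))

namespace HMMFamily

variable {d m : ℕ} {𝒳 : Type*} [MeasurableSpace 𝒳] {M : HMMFamily d m 𝒳}
  {c C D : ℝ} (hB : M.Bounds c C D) {K ρ : ℝ}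
  {s₁ s₂ b₁ b₂ s₃ : EuclideanSpace ℝ (Fin m) → ℝ} {G : Set (EuclideanSpace ℝ (Fin m))}
  (hG : M.GoodObs K s₁ s₂ G) (hLip : M.LipObs ρ b₁ b₂ s₃ G) {ε : ℝ} (hε : ε ≤ ρ) (hρ : ρ ≤ K)
  (hε0 : 0 < ε)

include hB

open Classical in
theorem Bounds.aestronglyMeasurable_logGrad {θ : EuclideanSpace ℝ (Fin d)} (hθ : θ ∈ M.Θ) (x : 𝒳)
    (s : Set (EuclideanSpace ℝ (Fin m))) :
    AEStronglyMeasurable (fun y' => logGrad M.Θ (fun θ => M.g θ x y') θ) (M.ν.restrict s) ∧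
    AEStronglyMeasurable (fun y' => logHess M.Θ (fun θ => M.g θ x y') θ) (M.ν.restrict s) := by
  have h := HasLogJet.stronglyMeasurable M.uniqueDiffOn_Θ
    (f := fun θ y' => if y' ∈ M.𝒴 then M.g θ x y' else 0)
    (A := fun θ y' => if y' ∈ M.𝒴 then logGrad M.Θ (fun θ => M.g θ x y') θ else 0)
    (B := fun θ y' => if y' ∈ M.𝒴 then logHess M.Θ (fun θ => M.g θ x y') θ else 0)
    (fun y' => by
      by_cases hy : y' ∈ M.𝒴
      · simpa only [if_pos hy] using hB.hasLogJet_g x hy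
      · simpa only [if_neg hy] using HasLogJet.const 0)
    (fun θ hθ => (Measurable.ite M.measurableSet_𝒴 (measurable_g_right hθ x)
      measurable_const).stronglyMeasurable)
    (fun θ hθ y' h0 => by
      by_cases hy : y' ∈ M.𝒴
      · simp only [if_pos hy] at h0 ⊢
        rcases hB.dichotomy x y' hy with h' | h'
        · exact absurd h0 (h' θ hθ).ne'
        · exact ⟨logGrad_eq_zero h' hθ, logHess_eq_zero h' hθ⟩
      · simp only [if_neg hy, and_self]) hθ
  constructor
  · refine h.1.aestronglyMeasurable.congr ?_
    filter_upwards [M.ae_mem_𝒴 s] with y' hy' using if_pos hy'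
  · refine h.2.aestronglyMeasurable.congr ?_
    filter_upwards [M.ae_mem_𝒴 s] with y' hy' using if_pos hy'

theorem Bounds.continuousOn_logGrad (x : 𝒳) {y : EuclideanSpace ℝ (Fin m)} (hy : y ∈ M.𝒴) :
    (∀ θ ∈ M.Θ, HasFDerivWithinAt (logGrad M.Θ fun θ => M.g θ x y)
      (logHess M.Θ (fun θ => M.g θ x y) θ) M.Θ θ) ∧
    ContinuousOn (logHess M.Θ fun θ => M.g θ x y) M.Θ := by
  rcases hB.dichotomy x y hy with h | h
  · exact ((hB.hasLogJet_g x hy).log h).2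
  · refine ⟨fun θ hθ => ?_, continuousOn_const.congr (logHess_eq_zero h)⟩
    rw [logHess_eq_zero h hθ]
    exact (hasFDerivWithinAt_const (0 : EuclideanSpace ℝ (Fin d) →L[ℝ] ℝ) θ M.Θ).congr
      (logGrad_eq_zero h) (logGrad_eq_zero h hθ)

include hLip in
/-- The Hessian of `log g` is Lipschitz on balls inside `Θ`. -/
theorem Bounds.norm_logHess_sub_le_dist (x : 𝒳) {y y' : EuclideanSpace ℝ (Fin m)} (hy : y ∈ G)
    (hy' : y' ∈ Metric.closedBall y ρ ∩ M.𝒴) {θ θ' : EuclideanSpace ℝ (Fin d)} {t : ℝ}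
    (ht : Metric.closedBall θ t ⊆ M.Θ) (hθ' : θ' ∈ Metric.closedBall θ t) :
    ‖logHess M.Θ (fun θ => M.g θ x y') θ' - logHess M.Θ (fun θ => M.g θ x y') θ‖ ≤ s₃ y * t := by
  have ht0 : 0 ≤ t := dist_nonneg.trans hθ'
  have hθ : θ ∈ Metric.closedBall θ t := Metric.mem_closedBall_self ht0
  have h3 := hLip.nonneg₃ y
  rcases hB.dichotomy x y' hy'.2 with h | h
  · have hU := M.uniqueDiffOn_Θ
    have hs : ContDiffOn ℝ 3 (fun θ => Real.log (M.g θ x y')) M.Θ :=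
      (hB.smooth_g x y' hy'.2).log fun θ hθ => (h θ hθ).ne'
    have h1 : ContDiffOn ℝ 2 (logGrad M.Θ fun θ => M.g θ x y') M.Θ :=
      hs.fderivWithin hU (by norm_num)
    have h2 : ContDiffOn ℝ 1 (logHess M.Θ fun θ => M.g θ x y') M.Θ :=
      h1.fderivWithin hU (by norm_num)
    have hd : ∀ ϑ ∈ M.Θ, DifferentiableWithinAt ℝ (logHess M.Θ fun θ => M.g θ x y') M.Θ ϑ :=
      h2.differentiableOn (by norm_num)
    refine ((convex_closedBall θ t).norm_image_sub_le_of_norm_hasFDerivWithin_le (C := s₃ y)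
      (fun ϑ hϑ => (hd ϑ (ht hϑ)).hasFDerivWithinAt.mono ht) (fun ϑ hϑ => ?_) hθ hθ').trans ?_
    · rw [← norm_iteratedFDerivWithin_one _ (hU ϑ (ht hϑ)), logHess,
        norm_iteratedFDerivWithin_fderivWithin hU (ht hϑ), logGrad,
        norm_iteratedFDerivWithin_fderivWithin hU (ht hϑ)]
      exact hLip.bound₃ y hy ϑ (ht hϑ) x y' hy'
    · rw [← dist_eq_norm]
      exact mul_le_mul_of_nonneg_left hθ' h3
  · rw [logHess_eq_zero h (ht hθ), logHess_eq_zero h (ht hθ')]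
    simp only [Pi.zero_apply, sub_zero, norm_zero]
    positivity

include hG hLip hε hρ hε0

theorem Bounds.norm_logHess_sub_le (x : 𝒳) {y y' : EuclideanSpace ℝ (Fin m)} (hy : y ∈ G)
    (hy' : y' ∈ Metric.closedBall y ε ∩ M.𝒴) {θ : EuclideanSpace ℝ (Fin d)} {t : ℝ} (ht0 : 0 < t)
    (ht : Metric.closedBall θ t ⊆ M.Θ) :
    ‖logHess M.Θ (fun θ => M.g θ x y') θ - logHess M.Θ (fun θ => M.g θ x y) θ‖ ≤
      2 * (ε * (b₂ y + b₁ y * s₁ y)) / t + 2 * s₃ y * t := by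
  have n1 := hLip.nonneg₁ y
  have n2 := hLip.nonneg₂ y
  have n3 := hG.nonneg₁ y
  have hy'' : y' ∈ Metric.closedBall y ρ ∩ M.𝒴 :=
    ⟨Metric.closedBall_subset_closedBall hε hy'.1, hy'.2⟩
  exact norm_fderiv_sub_le_of_norm_sub_le ht0 (hLip.nonneg₃ y) (by positivity)
    (fun ϑ hϑ => ((hB.continuousOn_logGrad x hy'.2).1 ϑ (ht hϑ)).mono ht)
    (fun ϑ hϑ => ((hB.continuousOn_logGrad x (hG.subset hy)).1 ϑ (ht hϑ)).mono ht)
    (fun ϑ hϑ => hB.norm_logHess_sub_le_dist hLip x hy hy'' ht hϑ)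
    (fun ϑ hϑ => hB.norm_logHess_sub_le_dist hLip x hy
      ⟨Metric.mem_closedBall_self (hε0.le.trans hε), hG.subset hy⟩ ht hϑ)
    (fun ϑ hϑ => hB.norm_logGrad_sub_le hG hLip hε hρ hε0 (ht hϑ) x hy hy')

theorem Bounds.norm_pertGrad_sub_le {θ : EuclideanSpace ℝ (Fin d)} (hθ : θ ∈ M.Θ) (x : 𝒳)
    {y : EuclideanSpace ℝ (Fin m)} (hy : y ∈ G) :
    ‖M.pertGrad ε θ x y - logGrad M.Θ (fun θ => M.g θ x y) θ‖ ≤ ε * (b₂ y + b₁ y * s₁ y) := by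
  have n1 := hLip.nonneg₁ y
  have n2 := hLip.nonneg₂ y
  have n3 := hG.nonneg₁ y
  have h0 : 0 ≤ ∫ y', M.g θ x y' ∂M.ν.restrict (Metric.closedBall y ε) :=
    integral_nonneg_of_ae (by
      filter_upwards [hB.ae_bound₁ hG (hε.trans hρ) hθ x hy] with y' h' using h'.2.2)
  rcases h0.eq_or_lt with h0 | h0
  · have hp : M.gPert ε θ x y = 0 := by rw [gPert, if_pos hε0, setAverage_eq, ← h0, smul_zero]
    have h1 := hB.abs_gPert_sub_le hG hLip hε hρ hε0 hθ x hy
    rw [(hB.pert_zero hG (hε.trans hρ) hθ x hy hp).1, zero_sub, norm_neg]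
    rw [hp, zero_sub, abs_neg, abs_of_nonneg (M.g_nonneg θ hθ x y (hG.subset hy))] at h1
    rcases hB.dichotomy x y (hG.subset hy) with h | h
    · have h2 : 1 ≤ ε * b₁ y := by
        have := h θ hθ
        by_contra! h3
        nlinarith
      refine (hG.bound₁ y hy θ hθ x y ⟨Metric.mem_closedBall_self
        (hε0.le.trans (hε.trans hρ)), hG.subset hy⟩).trans ?_
      have := mul_le_mul_of_nonneg_right h2 n3
      have : 0 ≤ ε * b₂ y := by positivity
      linarith
    · rw [logGrad_eq_zero h hθ]
      simp only [Pi.zero_apply, norm_zero]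
      positivity
  · rw [pertGrad, if_pos hε0, avgJet₁]
    refine norm_weighted_avg_sub_le (hB.integrable_g hθ x y ε) ?_ h0
      (hB.aestronglyMeasurable_logGrad hθ x _).1 ?_
    · filter_upwards [hB.ae_bound₁ hG (hε.trans hρ) hθ x hy] with y' h' using h'.2.2
    · filter_upwards [M.ae_mem_𝒴 (Metric.closedBall y ε), ae_restrict_mem measurableSet_closedBall]
        with y' h1 h2 using hB.norm_logGrad_sub_le hG hLip hε hρ hε0 hθ x hy ⟨h2, h1⟩

theorem Bounds.norm_pertHess_sub_le (x : 𝒳) {y : EuclideanSpace ℝ (Fin m)} (hy : y ∈ G)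
    (hε1 : ε * b₁ y < 1) {θ : EuclideanSpace ℝ (Fin d)} {t : ℝ} (ht0 : 0 < t)
    (ht : Metric.closedBall θ t ⊆ M.Θ) :
    ‖M.pertHess ε θ x y - logHess M.Θ (fun θ => M.g θ x y) θ‖ ≤
      2 * (ε * (b₂ y + b₁ y * s₁ y)) / t + 2 * s₃ y * t +
        4 * s₁ y * (ε * (b₂ y + b₁ y * s₁ y)) := by
  have hθ : θ ∈ M.Θ := ht (Metric.mem_closedBall_self ht0.le)
  have n1 := hLip.nonneg₁ y
  have n2 := hLip.nonneg₂ y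
  have n3 := hG.nonneg₁ y
  have n4 := hLip.nonneg₃ y
  have h1 := hB.abs_gPert_sub_le hG hLip hε hρ hε0 hθ x hy
  rcases hB.dichotomy x y (hG.subset hy) with h | h
  · have h0 : 0 ≤ ∫ y', M.g θ x y' ∂M.ν.restrict (Metric.closedBall y ε) :=
      integral_nonneg_of_ae (by
        filter_upwards [hB.ae_bound₁ hG (hε.trans hρ) hθ x hy] with y' h' using h'.2.2)
    have hI : 0 < ∫ y', M.g θ x y' ∂M.ν.restrict (Metric.closedBall y ε) := by
      refine h0.lt_of_ne fun h0 => ?_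
      have hp : M.gPert ε θ x y = 0 := by rw [gPert, if_pos hε0, setAverage_eq, ← h0, smul_zero]
      have := h θ hθ
      rw [hp, zero_sub, abs_neg, abs_of_pos this] at h1
      nlinarith
    have hm := hB.aestronglyMeasurable_logGrad hθ x (Metric.closedBall y ε)
    have hae := hB.ae_bound₁ hG (hε.trans hρ) hθ x hy
    have hmem : ∀ᵐ y' ∂M.ν.restrict (Metric.closedBall y ε), y' ∈ Metric.closedBall y ε ∩ M.𝒴 := by
      filter_upwards [M.ae_mem_𝒴 (Metric.closedBall y ε), ae_restrict_mem measurableSet_closedBall]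
        with y' h1 h2 using ⟨h2, h1⟩
    rw [pertHess, if_pos hε0]
    exact norm_avgJet₂_sub_le (hB.integrable_g hθ x y ε)
      (by filter_upwards [hae] with y' h' using h'.2.2) hI hm.1 hm.2
      (by filter_upwards [hae] with y' h' using h'.1)
      (hG.bound₁ y hy θ hθ x y
        ⟨Metric.mem_closedBall_self (hε0.le.trans (hε.trans hρ)), hG.subset hy⟩)
      (by
        filter_upwards [hmem] with y' h'
          using hB.norm_logGrad_sub_le hG hLip hε hρ hε0 hθ x hy h')
      (by
        filter_upwards [hmem] with y' h'
          using hB.norm_logHess_sub_le hG hLip hε hρ hε0 x hy h' ht0 ht)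
  · have hp : M.gPert ε θ x y = 0 := by
      rw [h θ hθ, mul_zero, sub_zero] at h1
      exact abs_nonpos_iff.1 h1
    rw [(hB.pert_zero hG (hε.trans hρ) hθ x hy hp).2, logHess_eq_zero h hθ]
    simp only [Pi.zero_apply, sub_zero, norm_zero]
    positivity

end HMMFamily

namespace JetSystem

variable {E : Type} [NormedAddCommGroup E] [NormedSpace ℝ E] [FiniteDimensional ℝ E]
  {𝒳 Y : Type*} [MeasurableSpace 𝒳] [MeasurableSpace Y] {Θ : Set E} {μ : Measure 𝒳}
  [IsFiniteMeasure μ] {ϰ : ℝ} {σ : Y → ℝ}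
  {K₀ : E → Y → KernelJet 𝒳 (E →L[ℝ] ℝ) (E →L[ℝ] E →L[ℝ] ℝ)} {P : Measure (ℕ → Y)}
  [IsProbabilityMeasure P] (H₀ : JetSystem Θ μ ϰ σ K₀) {θ₀ : E} (hθ₀ : θ₀ ∈ Θ)
  (hS : LengthQuasiconvex Θ) (hU : UniqueDiffOn ℝ Θ) (hP : MeasurePreserving (shiftBy 1) P P)
  (hσ : MemLp (fun ω => σ (ω 0)) 2 P)
  {r : ℝ} (hr0 : 0 < r) (hr1 : r < 1) (hr : 1 - (ϰ ^ 2)⁻¹ ≤ r ^ 4) {x : 𝒳}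
  {l₀ : E → ℝ} {l₀' : E → E →L[ℝ] ℝ} {l₀'' : E → E →L[ℝ] E →L[ℝ] ℝ}
  (hl₀ : IsLimit Θ μ ϰ σ K₀ P θ₀ x r l₀ l₀' l₀'')

include H₀ hθ₀ hS hU hP hσ hr0 hr1 hr hl₀

/-- The gradients of the limits of two systems that are close are close. -/
theorem norm_limit_grad_sub_le {K : E → Y → KernelJet 𝒳 (E →L[ℝ] ℝ) (E →L[ℝ] E →L[ℝ] ℝ)}
    (H : JetSystem Θ μ ϰ σ K) {l : E → ℝ} {l' : E → E →L[ℝ] ℝ} {l'' : E → E →L[ℝ] E →L[ℝ] ℝ}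
    (hl : IsLimit Θ μ ϰ σ K P θ₀ x r l l' l'') {δ η : Y → ℝ} (hδ0 : ∀ y, 0 ≤ δ y)
    (hδ : MemLp (fun ω => δ (ω 0)) 2 P) (hη : Integrable (fun ω => η (ω 0)) P)
    (hL : ∀ θ ∈ Θ, ∀ y x z, |(K θ y).L x z - (K₀ θ y).L x z| ≤ δ y * (K₀ θ y).L x z)
    (ha : ∀ θ ∈ Θ, ∀ y x z, ‖(K θ y).a x z - (K₀ θ y).a x z‖ ≤ η y) {ε : ℝ} (hε : 0 < ε) {θ : E}
    (hθ : θ ∈ Θ) : ‖l' θ - l₀' θ‖ ≤ ∫ ω, η (ω 0) ∂P +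
      ε⁻¹ * ((2 * ((6 * ϰ ^ 2) ^ 2 / (1 - r) ^ 2) + 32) * ∫ ω, δ (ω 0) ^ 2 ∂P) +
      ε * ((2 * (2 ^ 2 / (1 - r) ^ 2) + 8) * ∫ ω, σ (ω 0) ^ 2 ∂P) := by
  set Q := ∫ ω, η (ω 0) ∂P +
      ε⁻¹ * ((2 * ((6 * ϰ ^ 2) ^ 2 / (1 - r) ^ 2) + 32) * ∫ ω, δ (ω 0) ^ 2 ∂P) +
      ε * ((2 * (2 ^ 2 / (1 - r) ^ 2) + 8) * ∫ ω, σ (ω 0) ^ 2 ∂P)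
  set A := memoryConst ϰ r (∫ ω, σ (ω 0) ^ 2 ∂P) / (1 - r) / (1 - r)
  have key : ∀ n : ℕ, n * ‖l' θ - l₀' θ‖ ≤ n * Q + 2 * A := fun n => by
    have hp := integral_perturbSum_le hP hσ hδ hη ϰ hr0 hr1 hε n
    have h1 : ‖meanGrad μ K P x n θ - meanGrad μ K₀ P x n θ‖ ≤ n * Q := by
      rw [meanGrad, meanGrad, ← integral_sub (H.hasFDerivWithinAt_meanLog hS hU hP hσ hθ₀ x n hθ).1
        (H₀.hasFDerivWithinAt_meanLog hS hU hP hσ hθ₀ x n hθ).1]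
      refine (norm_integral_le_of_norm_le hp.1 (.of_forall fun ω => ?_)).trans hp.2
      exact KernelJet.iter_perturb_u norm_outer_le H.one_le_ϰ hr0 hr1 hr n
        (fun k => H.one_le_σ (ω k)) (fun k => hδ0 (ω k)) (fun k => H₀.good θ hθ (ω k))
        (fun k => H.good θ hθ (ω k)) (fun k => hL θ hθ (ω k)) (fun k => ha θ hθ (ω k)) x
    have h2 := H.norm_meanGrad_sub_le hθ₀ hS hU hP hσ hr0 hr1 hr hl n hθ
    have h3 := H₀.norm_meanGrad_sub_le hθ₀ hS hU hP hσ hr0 hr1 hr hl₀ n hθ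
    have e : (n : ℝ) • (l' θ - l₀' θ) = (meanGrad μ K P x n θ - meanGrad μ K₀ P x n θ) -
        (meanGrad μ K P x n θ - (n : ℝ) • l' θ) + (meanGrad μ K₀ P x n θ - (n : ℝ) • l₀' θ) := by
      module
    calc n * ‖l' θ - l₀' θ‖ = ‖(n : ℝ) • (l' θ - l₀' θ)‖ := by
          rw [norm_smul, Real.norm_of_nonneg n.cast_nonneg]
      _ ≤ n * Q + A + A := by
          rw [e]
          exact (norm_add_le _ _).trans (add_le_add ((norm_sub_le _ _).trans (add_le_add h1 h2)) h3)
      _ = _ := by ring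
  by_contra! h
  obtain ⟨n, hn⟩ := exists_nat_gt (2 * A / (‖l' θ - l₀' θ‖ - Q))
  rw [div_lt_iff₀ (by linarith)] at hn
  linarith [key n]

/-- The Hessians of the limits of converging systems converge. -/
theorem tendsto_limit_hess {ι : Type*} {F : Filter ι} [F.IsCountablyGenerated]
    {K : ι → E → Y → KernelJet 𝒳 (E →L[ℝ] ℝ) (E →L[ℝ] E →L[ℝ] ℝ)}
    {l : ι → E → ℝ} {l' : ι → E → E →L[ℝ] ℝ} {l'' : ι → E → E →L[ℝ] E →L[ℝ] ℝ} {ϑ : ι → E}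
    {ϑ₀ : E} (hϑ₀ : ϑ₀ ∈ Θ) (hϑ : ∀ᶠ i in F, ϑ i ∈ Θ) (H : ∀ᶠ i in F, JetSystem Θ μ ϰ σ (K i))
    (hl : ∀ᶠ i in F, IsLimit Θ μ ϰ σ (K i) P θ₀ x r (l i) (l' i) (l'' i)) {B : Y → ℝ}
    (hB : ∀ᶠ i in F, ∀ y x z, (K i (ϑ i) y).L x z ≤ B y)
    (hL : ∀ y x z, Tendsto (fun i => (K i (ϑ i) y).L x z) F (𝓝 ((K₀ ϑ₀ y).L x z)))
    (ha : ∀ y x z, Tendsto (fun i => (K i (ϑ i) y).a x z) F (𝓝 ((K₀ ϑ₀ y).a x z)))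
    (hb : ∀ y x z, Tendsto (fun i => (K i (ϑ i) y).b x z) F (𝓝 ((K₀ ϑ₀ y).b x z))) :
    Tendsto (fun i => l'' i (ϑ i)) F (𝓝 (l₀'' ϑ₀)) := by
  have hmean : ∀ n, Tendsto (fun i => meanHess μ (K i) P x n (ϑ i)) F
      (𝓝 (meanHess μ K₀ P x n ϑ₀)) := fun n => by
    refine tendsto_integral_filter_of_dominated_convergence
      (fun ω => 5 * n * (∑ k ∈ Finset.range n, σ (ω k)) ^ 2) ?_ ?_
      ((memLp_sum_coord hP hσ n).integrable_sq.const_mul _) (.of_forall fun ω => ?_)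
    · filter_upwards [H, hϑ] with i hi hϑi
        using (hi.hasFDerivWithinAt_meanGrad hS hU hP hσ x n hϑi).1.aestronglyMeasurable
    · filter_upwards [H, hϑ] with i hi hϑi using .of_forall fun ω => (hi.lik_norm_le n hϑi ω x).2
    · refine ((KernelJet.tendsto_iter norm_outer_le H₀.one_le_ϰ hr0 hr1 hr n
        (σ := fun k => σ (ω k)) (B := fun k => B (ω k)) (fun k => H₀.one_le_σ (ω k)) ?_
        (fun k => H₀.good ϑ₀ hϑ₀ (ω k)) (hB.mono fun i h k => h (ω k)) (fun k => hL (ω k))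
        (fun k => ha (ω k)) fun k => hb (ω k)).2 x).2.2
      filter_upwards [H, hϑ] with i hi hϑi k using hi.good _ hϑi (ω k)
  rw [Metric.tendsto_nhds]
  intro e he
  set A := memoryConst ϰ r (∫ ω, σ (ω 0) ^ 2 ∂P) / (1 - r)
  have hA : Tendsto (fun n : ℕ => A * r ^ n) atTop (𝓝 0) := by
    simpa using (tendsto_pow_atTop_nhds_zero_of_lt_one hr0.le hr1).const_mul A
  obtain ⟨n, hn⟩ := (hA.eventually (gt_mem_nhds (by positivity : 0 < e / 3))).exists
  filter_upwards [(Metric.tendsto_nhds.1 ((hmean (n + 1)).sub (hmean n))) (e / 3) (by positivity),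
    hϑ, hl] with i h1 hϑi hli
  have h2 := hli.incr₂ n _ hϑi
  have h3 := hl₀.incr₂ n _ hϑ₀
  rw [← dist_eq_norm] at h2 h3
  rw [dist_comm] at h2
  linarith [dist_triangle4 (l'' i (ϑ i)) (meanHess μ (K i) P x (n + 1) (ϑ i) -
    meanHess μ (K i) P x n (ϑ i)) (meanHess μ K₀ P x (n + 1) ϑ₀ - meanHess μ K₀ P x n ϑ₀) (l₀'' ϑ₀)]

end JetSystem

theorem tendsto_prod_of_norm_sub_le {E V : Type*} [TopologicalSpace E] [NormedAddCommGroup V]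
    {f : ℝ × E → V} {h : E → V} {φ : ℝ → ℝ} {a : E}
    (hf : ∀ᶠ p in 𝓝[>] (0 : ℝ) ×ˢ 𝓝 a, ‖f p - h p.2‖ ≤ φ p.1) (hφ : Continuous φ) (h0 : φ 0 = 0)
    (hh : ContinuousAt h a) : Tendsto f (𝓝[>] (0 : ℝ) ×ˢ 𝓝 a) (𝓝 (h a)) := by
  have h1 : Tendsto (fun p : ℝ × E => φ p.1) (𝓝[>] (0 : ℝ) ×ˢ 𝓝 a) (𝓝 0) := by
    have := (hφ.tendsto 0).comp (tendsto_nhdsWithin_iff.1 (tendsto_fst (f := 𝓝[>] (0 : ℝ))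
      (g := 𝓝 a))).1
    rwa [h0] at this
  have h2 := (squeeze_zero_norm' hf h1).add (hh.tendsto.comp (tendsto_snd (f := 𝓝[>] (0 : ℝ))))
  rw [zero_add] at h2
  exact h2.congr fun p => sub_add_cancel _ _

theorem eventually_fst_prod {E : Type*} [TopologicalSpace E] {a : E} {p : ℝ → Prop}
    (h : ∀ᶠ ε in 𝓝[>] (0 : ℝ), p ε) : ∀ᶠ q in 𝓝[>] (0 : ℝ) ×ˢ 𝓝 a, p q.1 :=
  tendsto_fst.eventually h

theorem eventually_snd_prod {E : Type*} [TopologicalSpace E] {a : E} {p : E → Prop}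
    (h : ∀ᶠ x in 𝓝 a, p x) : ∀ᶠ q in 𝓝[>] (0 : ℝ) ×ˢ 𝓝 a, p q.2 :=
  tendsto_snd.eventually h

namespace HMMFamily

variable {d m : ℕ} {𝒳 : Type*} [MeasurableSpace 𝒳] {M : HMMFamily d m 𝒳}
  {c C D : ℝ} (hB : M.Bounds c C D) {K ρ : ℝ}
  {s₁ s₂ b₁ b₂ s₃ : EuclideanSpace ℝ (Fin m) → ℝ} {G : Set (EuclideanSpace ℝ (Fin m))}
  (hG : M.GoodObs K s₁ s₂ G) (hLip : M.LipObs ρ b₁ b₂ s₃ G) (hρ0 : 0 < ρ) (hρ : ρ ≤ K)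

section Tendsto

variable {θs : EuclideanSpace ℝ (Fin d)} (hθs : θs ∈ interior M.Θ)

include hB hG hLip hρ0 hρ hθs

theorem Bounds.tendsto_pert (x : 𝒳) {y : EuclideanSpace ℝ (Fin m)} (hy : y ∈ G) :
    Tendsto (fun p : ℝ × EuclideanSpace ℝ (Fin d) => M.gPert p.1 p.2 x y)
      (𝓝[>] 0 ×ˢ 𝓝 θs) (𝓝 (M.g θs x y)) ∧
    Tendsto (fun p : ℝ × EuclideanSpace ℝ (Fin d) => M.pertGrad p.1 p.2 x y)
      (𝓝[>] 0 ×ˢ 𝓝 θs) (𝓝 (logGrad M.Θ (fun θ => M.g θ x y) θs)) ∧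
    Tendsto (fun p : ℝ × EuclideanSpace ℝ (Fin d) => M.pertHess p.1 p.2 x y)
      (𝓝[>] 0 ×ˢ 𝓝 θs) (𝓝 (logHess M.Θ (fun θ => M.g θ x y) θs)) := by
  have hnhds : M.Θ ∈ 𝓝 θs := mem_interior_iff_mem_nhds.1 hθs
  have hy' := hG.subset hy
  have hc := hB.continuousOn_logGrad x hy'
  have hε : ∀ᶠ q in 𝓝[>] (0 : ℝ) ×ˢ 𝓝 θs, 0 < q.1 ∧ q.1 ≤ ρ ∧ q.2 ∈ M.Θ :=
    (eventually_fst_prod self_mem_nhdsWithin).and ((eventually_fst_prod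
      (nhdsWithin_le_nhds (Iic_mem_nhds hρ0))).and (eventually_snd_prod hnhds))
  have n1 := hLip.nonneg₁ y
  have n2 := hLip.nonneg₂ y
  have n3 := hG.nonneg₁ y
  refine ⟨tendsto_prod_of_norm_sub_le (φ := fun ε => ε * b₁ y * C) ?_ (by fun_prop) (by simp)
      ((hB.hasLogJet_g x hy').continuousOn.continuousAt hnhds),
    tendsto_prod_of_norm_sub_le (φ := fun ε => ε * (b₂ y + b₁ y * s₁ y)) ?_ (by fun_prop) (by simp)
      (ContinuousOn.continuousAt (fun θ hθ => (hc.1 θ hθ).continuousWithinAt) hnhds),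
    tendsto_prod_of_norm_sub_le (φ := fun ε => 2 * (√ε * (b₂ y + b₁ y * s₁ y)) + 2 * s₃ y * √ε +
      4 * s₁ y * (ε * (b₂ y + b₁ y * s₁ y))) ?_ (by fun_prop) (by simp)
      (hc.2.continuousAt hnhds)⟩
  · filter_upwards [hε] with q ⟨h1, h2, h3⟩
    refine (hB.abs_gPert_sub_le hG hLip h2 hρ h1 h3 x hy).trans ?_
    have := hB.g_upper q.2 h3 x y hy'
    gcongr
  · filter_upwards [hε] with q ⟨h1, h2, h3⟩
      using hB.norm_pertGrad_sub_le hG hLip h2 hρ h1 h3 x hy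
  · obtain ⟨r, hr, hball⟩ := Metric.mem_nhds_iff.1 hnhds
    have e1 : ∀ᶠ q in 𝓝[>] (0 : ℝ) ×ˢ 𝓝 θs, √q.1 < r / 2 :=
      eventually_fst_prod (nhdsWithin_le_nhds ((Real.continuous_sqrt.tendsto 0).eventually
        (gt_mem_nhds (by rw [Real.sqrt_zero]; positivity))))
    have e2 : ∀ᶠ q in 𝓝[>] (0 : ℝ) ×ˢ 𝓝 θs, q.1 * b₁ y < 1 :=
      eventually_fst_prod (nhdsWithin_le_nhds (((continuous_mul_const (b₁ y)).tendsto 0).eventually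
        (gt_mem_nhds (by simp))))
    have e3 : ∀ᶠ q in 𝓝[>] (0 : ℝ) ×ˢ 𝓝 θs, q.2 ∈ Metric.ball θs (r / 2) :=
      eventually_snd_prod (Metric.ball_mem_nhds _ (by positivity))
    filter_upwards [hε, e1, e2, e3] with q ⟨h1, h2, _⟩ h4 h5 h6
    have hs : 0 < √q.1 := Real.sqrt_pos.2 h1
    refine (hB.norm_pertHess_sub_le hG hLip h2 hρ h1 x hy h5 hs fun ϑ hϑ => hball ?_).trans
      (le_of_eq ?_)
    · rw [Metric.mem_ball] at h6 ⊢
      rw [Metric.mem_closedBall] at hϑ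
      linarith [dist_triangle ϑ q.2 θs]
    · congr 2
      rw [div_eq_iff hs.ne']
      nth_rewrite 1 [← Real.mul_self_sqrt h1.le]
      ring

theorem Bounds.tendsto_kernelJet (x z : 𝒳) (y : EuclideanSpace ℝ (Fin m)) :
    Tendsto (fun p : ℝ × EuclideanSpace ℝ (Fin d) => (M.kernelJet G p.1 p.2 y).L x z)
      (𝓝[>] 0 ×ˢ 𝓝 θs) (𝓝 ((M.kernelJet G 0 θs y).L x z)) ∧
    Tendsto (fun p : ℝ × EuclideanSpace ℝ (Fin d) => (M.kernelJet G p.1 p.2 y).a x z)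
      (𝓝[>] 0 ×ˢ 𝓝 θs) (𝓝 ((M.kernelJet G 0 θs y).a x z)) ∧
    Tendsto (fun p : ℝ × EuclideanSpace ℝ (Fin d) => (M.kernelJet G p.1 p.2 y).b x z)
      (𝓝[>] 0 ×ˢ 𝓝 θs) (𝓝 ((M.kernelJet G 0 θs y).b x z)) := by
  have hnhds : M.Θ ∈ 𝓝 θs := mem_interior_iff_mem_nhds.1 hθs
  by_cases hy : y ∈ G
  · have hq := hB.hasLogJet_q x z
    have hl := hq.log fun θ hθ => hB.pos.trans_le (hB.q_lower θ hθ x z)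
    have h := hB.tendsto_pert hG hLip hρ0 hρ hθs z hy
    have s : ∀ {V : Type} [TopologicalSpace V] {f : EuclideanSpace ℝ (Fin d) → V},
        ContinuousOn f M.Θ → Tendsto (fun p : ℝ × EuclideanSpace ℝ (Fin d) => f p.2)
          (𝓝[>] 0 ×ˢ 𝓝 θs) (𝓝 (f θs)) := fun hf =>
      (hf.continuousAt hnhds).tendsto.comp tendsto_snd
    simp only [kernelJet, if_pos hy]
    rw [gPert, pertGrad, pertHess, if_neg (lt_irrefl _), if_neg (lt_irrefl _),
      if_neg (lt_irrefl _)]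
    exact ⟨(s hq.continuousOn).mul h.1,
      (s fun θ hθ => (hl.2.1 θ hθ).continuousWithinAt).add h.2.1, (s hl.2.2).add h.2.2⟩
  · simp only [kernelJet, if_neg hy]
    exact ⟨tendsto_const_nhds, tendsto_const_nhds, tendsto_const_nhds⟩

end Tendsto

variable {ε : ℝ} (hε : ε ≤ ρ) (hε0 : 0 < ε)

include hB hG hε

theorem Bounds.kernelJet_le (hρ : ρ ≤ K) {θ : EuclideanSpace ℝ (Fin d)} (hθ : θ ∈ M.Θ) (x z : 𝒳)
    (y : EuclideanSpace ℝ (Fin m)) : (M.kernelJet G ε θ y).L x z ≤ max (C * C) 1 := by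
  by_cases hy : y ∈ G
  · simp only [kernelJet, if_pos hy]
    refine le_max_of_le_left (mul_le_mul (hB.q_upper θ hθ x z) (hB.gPert_le hG (hε.trans hρ) hθ z hy)
      (gPert_nonneg hθ z (hG.subset hy)) ?_)
    exact (hB.pos.trans_le (hB.q_lower θ hθ x z)).le.trans (hB.q_upper θ hθ x z)
  · simp only [kernelJet, if_neg hy]
    exact le_max_right _ _

include hLip hρ hε0

theorem Bounds.kernelJet_sub_le {θ : EuclideanSpace ℝ (Fin d)} (hθ : θ ∈ M.Θ) (x z : 𝒳)
    (y : EuclideanSpace ℝ (Fin m)) :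
    |(M.kernelJet G ε θ y).L x z - (M.kernelJet G 0 θ y).L x z| ≤
      ε * b₁ y * (M.kernelJet G 0 θ y).L x z ∧
    ‖(M.kernelJet G ε θ y).a x z - (M.kernelJet G 0 θ y).a x z‖ ≤
      ε * (b₂ y + b₁ y * s₁ y) := by
  have n1 := hLip.nonneg₁ y
  have n2 := hLip.nonneg₂ y
  have n3 := hG.nonneg₁ y
  by_cases hy : y ∈ G
  · simp only [kernelJet, if_pos hy]
    have e1 : M.gPert 0 θ z y = M.g θ z y := if_neg (lt_irrefl _)
    have e2 : M.pertGrad 0 θ z y = logGrad M.Θ (fun θ => M.g θ z y) θ := if_neg (lt_irrefl _)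
    rw [e1, e2, add_sub_add_left_eq_sub, ← mul_sub, abs_mul]
    have hq : 0 < M.q θ x z := hB.pos.trans_le (hB.q_lower θ hθ x z)
    refine ⟨?_, hB.norm_pertGrad_sub_le hG hLip hε hρ hε0 hθ z hy⟩
    rw [abs_of_pos hq, mul_left_comm]
    exact mul_le_mul_of_nonneg_left (hB.abs_gPert_sub_le hG hLip hε hρ hε0 hθ z hy) hq.le
  · simp only [kernelJet, if_neg hy, sub_self, abs_zero, norm_zero]
    constructor <;> positivity

end HMMFamily

section Maximiser

variable {E : Type} [NormedAddCommGroup E] [NormedSpace ℝ E] [FiniteDimensional ℝ E]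

/-- A negative definite bilinear form is uniformly negative. -/
theorem exists_neg_definite_bound {B : E →L[ℝ] E →L[ℝ] ℝ} (hB : ∀ v, v ≠ 0 → B v v < 0) :
    ∃ κ, 0 < κ ∧ ∀ v, B v v ≤ -κ * ‖v‖ ^ 2 := by
  have hc : Continuous fun v => B v v := by fun_prop
  obtain ⟨κ, hκ, h⟩ : ∃ κ, 0 < κ ∧ ∀ v ∈ Metric.sphere (0 : E) 1, B v v ≤ -κ := by
    rcases (Metric.sphere (0 : E) 1).eq_empty_or_nonempty with he | hne
    · exact ⟨1, one_pos, by simp [he]⟩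
    · obtain ⟨v, hv, hmax⟩ := (isCompact_sphere (0 : E) 1).exists_isMaxOn hne hc.continuousOn
      refine ⟨-B v v, neg_pos.2 (hB v fun h => ?_), fun w hw => by simpa using hmax hw⟩
      simp [h] at hv
  refine ⟨κ, hκ, fun v => ?_⟩
  rcases eq_or_ne v 0 with rfl | hv
  · simp
  · have hv' : 0 < ‖v‖ := norm_pos_iff.2 hv
    have h1 := h (‖v‖⁻¹ • v) (by simp [norm_smul, hv'.ne'])
    simp only [map_smul, smul_apply, smul_eq_mul] at h1
    rw [← mul_assoc, ← mul_inv, ← sq, inv_mul_le_iff₀ (by positivity)] at h1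
    linarith

/-- A continuous function that is negative on a compact set, except at a point, is bounded away
from zero outside a ball around this point. -/
theorem exists_gap {S : Set E} (hS : IsCompact S) {f : E → ℝ} (hf : ContinuousOn f S) {a : E}
    {b : ℝ} (h : ∀ x ∈ S, x ≠ a → f x < b) {s : ℝ} (hs : 0 < s) :
    ∃ e, 0 < e ∧ ∀ x ∈ S, s ≤ dist x a → f x ≤ b - e := by
  have hK : IsCompact (S \ Metric.ball a s) := hS.diff Metric.isOpen_ball
  rcases (S \ Metric.ball a s).eq_empty_or_nonempty with he | hne
  · refine ⟨1, one_pos, fun x hx hd => ?_⟩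
    have : x ∈ S \ Metric.ball a s := ⟨hx, by simpa using hd⟩
    simp [he] at this
  · obtain ⟨v, hv, hmax⟩ := hK.exists_isMaxOn hne (hf.mono sdiff_subset)
    refine ⟨b - f v, sub_pos.2 (h v hv.1 ?_), fun x hx hd => ?_⟩
    · rintro rfl
      exact hv.2 (Metric.mem_ball_self hs)
    · have : f x ≤ f v := hmax ⟨hx, by simpa using hd⟩
      linarith

/-- Approximate maximisers of functions that converge uniformly converge to the maximiser of the
limit. -/
theorem tendsto_of_approx_max {S : Set E} (hS : IsCompact S) {f : ℕ → E → ℝ} {l : E → ℝ}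
    (hl : ContinuousOn l S) (hf : TendstoUniformlyOn f l atTop S) {a : E} (ha : a ∈ S)
    (hmax : ∀ x ∈ S, x ≠ a → l x < l a) {u : ℕ → E} (hu : ∀ n, u n ∈ S) {e : ℕ → ℝ}
    (he : Tendsto e atTop (𝓝 0)) (h : ∀ᶠ n in atTop, f n a ≤ f n (u n) + e n) :
    Tendsto u atTop (𝓝 a) := by
  rw [Metric.tendsto_nhds]
  intro s hs
  obtain ⟨η, hη, hgap⟩ := exists_gap hS hl hmax hs
  filter_upwards [Metric.tendstoUniformlyOn_iff.1 hf (η / 3) (by positivity),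
    he.eventually (gt_mem_nhds (by positivity : 0 < η / 3)), h] with n h1 h2 h3
  by_contra! hd
  have h4 := h1 a ha
  have h5 := h1 (u n) (hu n)
  rw [Real.dist_eq, abs_lt] at h4 h5
  linarith [hgap (u n) (hu n) hd]

/-- If the functions `l ε` are, with their first derivatives, within `O(ε)` of a function `l 0`
with a nondegenerate maximiser `a`, near which their second derivatives converge, then they have
unique maximisers, which are within `O(ε)` of `a`. -/
theorem exists_maximisers {S : Set E} {a : E} {l : ℝ → E → ℝ} {l' : ℝ → E → E →L[ℝ] ℝ}
    {l'' : ℝ → E → E →L[ℝ] E →L[ℝ] ℝ} {ρ A : ℝ}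
    (hS : IsCompact S) (ha : a ∈ interior S) (hρ : 0 < ρ)
    (d1 : ∀ ε, 0 ≤ ε → ε ≤ ρ → ∀ x ∈ S, HasFDerivWithinAt (l ε) (l' ε x) S x)
    (d2 : ∀ ε, 0 ≤ ε → ε ≤ ρ → ∀ x ∈ S, HasFDerivWithinAt (l' ε) (l'' ε x) S x)
    (hl : ∀ ε, 0 < ε → ε ≤ ρ → ∀ x ∈ S, |l ε x - l 0 x| ≤ A * ε)
    (hl' : ∀ ε, 0 < ε → ε ≤ ρ → ∀ x ∈ S, ‖l' ε x - l' 0 x‖ ≤ A * ε)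
    (hmax : ∀ x ∈ S, x ≠ a → l 0 x < l 0 a)
    (hl'' : Tendsto (fun p : ℝ × E => l'' p.1 p.2) (𝓝[>] 0 ×ˢ 𝓝 a) (𝓝 (l'' 0 a)))
    (hneg : ∀ v, v ≠ 0 → l'' 0 a v v < 0) :
    ∃ t : ℝ → E, (∀ᶠ ε in 𝓝[>] (0 : ℝ), t ε ∈ S ∧ ∀ x ∈ S, x ≠ t ε → l ε x < l ε (t ε)) ∧
      (fun ε => t ε - a) =O[𝓝[>] (0 : ℝ)] fun ε => ε := by
  have haS : a ∈ S := interior_subset ha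
  obtain ⟨κ, hκ, hκv⟩ := exists_neg_definite_bound hneg
  obtain ⟨p, hp, q, hq, hpq⟩ := Filter.eventually_prod_iff.1
    ((Metric.tendsto_nhds.1 hl'') (κ / 2) (by positivity))
  obtain ⟨s, hs, hball⟩ := Metric.mem_nhds_iff.1
    (Filter.inter_mem hq (mem_interior_iff_mem_nhds.1 ha))
  have hcont : ∀ ε, 0 ≤ ε → ε ≤ ρ → ContinuousOn (l ε) S := fun ε h0 h1 x hx =>
    (d1 ε h0 h1 x hx).continuousWithinAt
  obtain ⟨e, he, hgap⟩ := exists_gap hS (hcont 0 le_rfl hρ.le) hmax hs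
  have hnhds : ∀ x ∈ Metric.ball a s, S ∈ 𝓝 x := fun x hx =>
    Filter.mem_of_superset (Metric.isOpen_ball.mem_nhds hx) fun y hy => (hball hy).2
  have hd0 : l' 0 a = 0 := by
    have hloc : IsLocalMax (l 0) a := by
      filter_upwards [hnhds a (Metric.mem_ball_self hs)] with x hx
      rcases eq_or_ne x a with rfl | hxa
      · exact le_rfl
      · exact (hmax x hx hxa).le
    exact hloc.hasFDerivAt_eq_zero
      ((d1 0 le_rfl hρ.le a haS).hasFDerivAt (hnhds a (Metric.mem_ball_self hs)))
  have hsmall : ∀ᶠ ε in 𝓝[>] (0 : ℝ), 2 * A * ε < e := nhdsWithin_le_nhds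
    (((continuous_const_mul (2 * A)).tendsto 0).eventually (gt_mem_nhds (by simpa using he)))
  have key : ∀ᶠ ε in 𝓝[>] (0 : ℝ), ∃ t ∈ S, (∀ x ∈ S, x ≠ t → l ε x < l ε t) ∧
      ‖t - a‖ ≤ 2 * A / (κ / 2) * ε := by
    filter_upwards [hp, self_mem_nhdsWithin, nhdsWithin_le_nhds (Iic_mem_nhds hρ), hsmall]
      with ε hpε h0 hερ hε
    have hε0 : (0 : ℝ) < ε := h0
    have hA : 0 ≤ A * ε := (abs_nonneg _).trans (hl ε h0 hερ a haS)
    have hD1 : ∀ x ∈ Metric.ball a s, HasFDerivAt (l ε) (l' ε x) x := fun x hx =>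
      (d1 ε hε0.le hερ x (hball hx).2).hasFDerivAt (hnhds x hx)
    have hD2 : ∀ x ∈ Metric.ball a s, HasFDerivAt (l' ε) (l'' ε x) x := fun x hx =>
      (d2 ε hε0.le hερ x (hball hx).2).hasFDerivAt (hnhds x hx)
    have hD3 : ∀ x ∈ Metric.ball a s, ∀ v, l'' ε x v v ≤ -(2 * (κ / 4)) * ‖v‖ ^ 2 := by
      intro x hx v
      have h1 := hpq hpε (hball hx).1
      rw [dist_eq_norm] at h1
      have h2 : (l'' ε x - l'' 0 a) v v ≤ κ / 2 * ‖v‖ ^ 2 :=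
        (le_abs_self _).trans (((l'' ε x - l'' 0 a).le_opNorm₂ v v).trans (by
          rw [mul_assoc, ← sq]; gcongr))
      have h3 := hκv v
      simp only [sub_apply] at h2
      linarith
    have hle := fun x hx y hy => le_of_hessian_le (convex_ball a s) hD1 hD2 hD3 (a := x) (b := y)
      hx hy
    have hfar : ∀ x ∈ S, s ≤ dist x a → l ε x < l ε a := fun x hx hd => by
      have h1 := abs_le.1 (hl ε h0 hερ x hx)
      have h2 := abs_le.1 (hl ε h0 hερ a haS)
      linarith [hgap x hx hd]
    obtain ⟨t, htS, ht⟩ := hS.exists_isMaxOn ⟨a, haS⟩ (hcont ε hε0.le hερ)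
    have hta : l ε a ≤ l ε t := ht haS
    have htb : t ∈ Metric.ball a s := by
      by_contra h
      exact (hfar t htS (by simpa using h)).not_ge hta
    have hdt : l' ε t = 0 :=
      (IsMaxOn.isLocalMax ht (hnhds t htb)).hasFDerivAt_eq_zero (hD1 t htb)
    refine ⟨t, htS, fun x hx hxt => ?_, ?_⟩
    · by_cases hxb : x ∈ Metric.ball a s
      · have h1 := hle t htb x hxb
        rw [hdt, zero_apply, add_zero] at h1
        have : 0 < κ / 4 * ‖x - t‖ ^ 2 := by
          have := norm_pos_iff.2 (sub_ne_zero.2 hxt)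
          positivity
        linarith
      · exact (hfar x hx (by simpa using hxb)).trans_le hta
    · have h1 := hle a (Metric.mem_ball_self hs) t htb
      have h2 : l' ε a (t - a) ≤ A * ε * ‖t - a‖ :=
        (le_abs_self _).trans (((l' ε a).le_opNorm _).trans (mul_le_mul_of_nonneg_right
          (by simpa [hd0] using hl' ε h0 hερ a haS) (norm_nonneg _)))
      have h3 : κ / 4 * ‖t - a‖ ^ 2 ≤ A * ε * ‖t - a‖ := by linarith
      rw [div_mul_eq_mul_div, le_div_iff₀ (by positivity)]
      rcases (norm_nonneg (t - a)).eq_or_lt with h4 | h4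
      · rw [← h4]
        linarith
      · have h5 : κ / 4 * ‖t - a‖ ≤ A * ε := by
          rw [sq, ← mul_assoc] at h3
          exact le_of_mul_le_mul_right h3 h4
        linarith
  classical
  choose! t ht using fun (ε : ℝ) (h : ∃ t ∈ S, (∀ x ∈ S, x ≠ t → l ε x < l ε t) ∧
      ‖t - a‖ ≤ 2 * A / (κ / 2) * ε) => h
  refine ⟨t, key.mono fun ε h => ⟨(ht ε h).1, (ht ε h).2.1⟩, ?_⟩
  refine Asymptotics.IsBigO.of_bound (2 * A / (κ / 2)) ?_
  filter_upwards [key, self_mem_nhdsWithin] with ε h h0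
  rw [Real.norm_of_nonneg (le_of_lt h0)]
  exact (ht ε h).2.2

end Maximiser

namespace HMMFamily

variable {d m : ℕ} {𝒳 : Type*} [MeasurableSpace 𝒳] {M : HMMFamily d m 𝒳}
  {c C D : ℝ} (hB : M.Bounds c C D) {K : ℝ}
  {s₁ s₂ : EuclideanSpace ℝ (Fin m) → ℝ} {G : Set (EuclideanSpace ℝ (Fin m))}
  (hG : M.GoodObs K s₁ s₂ G) {ε : ℝ} (hε : ε ≤ K) (hε0 : 0 < ε) {ϰ : ℝ} (hϰ : 1 ≤ ϰ)
  (hC : C ≤ ϰ * c)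

include hB hG hε0

theorem Bounds.lintegral_closedBall {θ : EuclideanSpace ℝ (Fin d)} (hθ : θ ∈ M.Θ) (x : 𝒳)
    {y : EuclideanSpace ℝ (Fin m)} (hy : y ∈ G) :
    ∫⁻ y', ENNReal.ofReal (M.g θ x y') * (Metric.closedBall y ε).indicator 1 y' ∂M.ν =
      M.ν (Metric.closedBall y ε) * ENNReal.ofReal (M.gPert ε θ x y) := by
  have hpos := hG.measure_pos y hy ε hε0
  have hfin : M.ν (Metric.closedBall y ε) ≠ ∞ := (isCompact_closedBall y ε).measure_lt_top.ne
  have e : ∀ y', ENNReal.ofReal (M.g θ x y') * (Metric.closedBall y ε).indicator 1 y' =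
      (Metric.closedBall y ε).indicator (fun y' => ENNReal.ofReal (M.g θ x y')) y' := fun y' => by
    by_cases h : y' ∈ Metric.closedBall y ε <;> simp [h]
  simp only [e]
  rw [lintegral_indicator measurableSet_closedBall, gPert, if_pos hε0, setAverage_eq, smul_eq_mul,
    ENNReal.ofReal_mul (by positivity), Measure.real, ENNReal.ofReal_inv_of_pos
    (ENNReal.toReal_pos hpos.ne' hfin), ENNReal.ofReal_toReal hfin, ← mul_assoc,
    ENNReal.mul_inv_cancel hpos.ne' hfin, one_mul,
    ofReal_integral_eq_lintegral_ofReal (hB.integrable_g hθ x y ε)]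
  filter_upwards [M.ae_mem_𝒴 (Metric.closedBall y ε)] with y' hy' using M.g_nonneg θ hθ x y' hy'

include hε hϰ hC

theorem Bounds.boxFun_eq (θ : M.Θ) (n : ℕ) {f : ℕ → 𝒳 × EuclideanSpace ℝ (Fin m) → ℝ≥0∞}
    {y : ℕ → EuclideanSpace ℝ (Fin m)} (hy : ∀ k, y k ∈ G)
    (hf : ∀ k z, f (k + 1) z = (Metric.closedBall (y k) ε).indicator 1 z.2)
    (z : 𝒳 × EuclideanSpace ℝ (Fin m)) :
    boxFun (M.jointKernel θ) n f z = f 0 z *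
      ((∏ k ∈ Finset.range n, M.ν (Metric.closedBall (y k) ε)) *
        ENNReal.ofReal ((JetSystem.lik M.μ (M.kernelJet G ε) n θ y).p z.1)) := by
  have hK : 0 < K := hε0.trans_le hε
  induction n generalizing f y z with
  | zero => simp [boxFun, JetSystem.lik, KernelJet.iter]
  | succ n ih =>
    set P := (JetSystem.lik M.μ (M.kernelJet G ε) n θ fun k => y (k + 1)).p
    set N := ∏ k ∈ Finset.range n, M.ν (Metric.closedBall (y (k + 1)) ε)
    have H := hB.jetSystem hG hε hK hϰ hC
    have hPg := H.lik_good n θ.2 fun k => y (k + 1)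
    have hgood := hB.kernelJet_good hG hε hK hϰ hC θ.2 (y 0)
    have hPm : Measurable P := hPg.measurable_p
    have hind : Measurable fun y' => (Metric.closedBall (y 0) ε).indicator (1 : EuclideanSpace ℝ (Fin m) → ℝ≥0∞) y' :=
      measurable_one.indicator measurableSet_closedBall
    rw [boxFun]
    congr 1
    have e1 : ∀ z', boxFun (M.jointKernel θ) n (fun k => f (k + 1)) z' =
        (Metric.closedBall (y 0) ε).indicator 1 z'.2 * (N * ENNReal.ofReal (P z'.1)) := fun z' => by
      rw [ih (f := fun k => f (k + 1)) (y := fun k => y (k + 1)) (fun k => hy (k + 1))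
        (fun k z => hf (k + 1) z) z', hf 0]
    simp only [e1]
    rw [M.lintegral_jointKernel θ z (by
      exact (hind.comp measurable_snd).mul (measurable_const.mul
        (hPm.comp measurable_fst).ennreal_ofReal))]
    have e2 : ∀ x, ENNReal.ofReal (M.q θ z.1 x) * ∫⁻ y', ENNReal.ofReal (M.g θ x y') *
        ((Metric.closedBall (y 0) ε).indicator 1 y' * (N * ENNReal.ofReal (P x))) ∂M.ν =
        M.ν (Metric.closedBall (y 0) ε) * N *
          ENNReal.ofReal ((M.kernelJet G ε θ (y 0)).L z.1 x * P x) := fun x => by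
      have hm : Measurable fun y' => ENNReal.ofReal (M.g θ x y') *
          (Metric.closedBall (y 0) ε).indicator (1 : EuclideanSpace ℝ (Fin m) → ℝ≥0∞) y' :=
        (measurable_g_right θ.2 x).ennreal_ofReal.mul hind
      simp only [← mul_assoc]
      rw [lintegral_mul_const _ (hm.mul_const N), lintegral_mul_const _ hm,
        hB.lintegral_closedBall hG hε0 θ.2 x (hy 0)]
      simp only [kernelJet, if_pos (hy 0)]
      have hq := M.q_nonneg θ θ.2 z.1 x
      rw [ENNReal.ofReal_mul (mul_nonneg hq (gPert_nonneg θ.2 x (hG.subset (hy 0)))),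
        ENNReal.ofReal_mul hq]
      ring
    have hLm : Measurable fun x => (M.kernelJet G ε θ (y 0)).L z.1 x * P x :=
      (hgood.measurable_L.of_uncurry_left).mul hPm
    have e3 : (JetSystem.lik M.μ (M.kernelJet G ε) (n + 1) θ y).p z.1 =
        ∫ x, (M.kernelJet G ε θ (y 0)).L z.1 x * P x ∂M.μ := rfl
    simp only [e2]
    rw [lintegral_const_mul _ hLm.ennreal_ofReal, Finset.prod_range_succ', e3,
      ofReal_integral_eq_lintegral_ofReal (hgood.integrable_mul' hPg z.1)
        (.of_forall fun x => mul_nonneg (hgood.nonneg z.1 x) (hPg.pos x).le)]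
    ring

theorem Bounds.abcProb_eq (θ : M.Θ) (π₀ : Measure 𝒳) [IsProbabilityMeasure π₀] (n : ℕ)
    {ω : ℕ → EuclideanSpace ℝ (Fin m)} (hω : ∀ k, ω k ∈ G) :
    M.abcProb θ π₀ ε n ω = (∏ k ∈ Finset.range n, M.ν (Metric.closedBall (ω (k + 1)) ε)) *
      ∫⁻ x, ENNReal.ofReal ((JetSystem.lik M.μ (M.kernelJet G ε) n θ (shiftBy 1 ω)).p x) ∂π₀ := by
  classical
  set f : ℕ → 𝒳 × EuclideanSpace ℝ (Fin m) → ℝ≥0∞ := fun k z =>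
    if k = 0 then 1 else (Metric.closedBall (ω k) ε).indicator 1 z.2
  have hf : ∀ k, Measurable (f k) := fun k => by
    by_cases h : k = 0
    · simp only [f, if_pos h]
      exact measurable_const
    · simp only [f, if_neg h]
      exact (measurable_one.indicator measurableSet_closedBall).comp measurable_snd
  have hs : MeasurableSet {p : ℕ → 𝒳 × EuclideanSpace ℝ (Fin m) |
      ∀ k ∈ Finset.Icc 1 n, (p k).2 ∈ Metric.closedBall (ω k) ε} := by
    have e : {p : ℕ → 𝒳 × EuclideanSpace ℝ (Fin m) |
        ∀ k ∈ Finset.Icc 1 n, (p k).2 ∈ Metric.closedBall (ω k) ε} =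
        ⋂ k ∈ Finset.Icc 1 n, (fun p : ℕ → 𝒳 × EuclideanSpace ℝ (Fin m) => (p k).2) ⁻¹'
          Metric.closedBall (ω k) ε := by
      ext p; simp
    rw [e]
    exact Finset.measurableSet_biInter _ fun k _ =>
      (measurable_snd.comp (measurable_pi_apply k)) measurableSet_closedBall
  have hprod : ∀ p : ℕ → 𝒳 × EuclideanSpace ℝ (Fin m),
      {p : ℕ → 𝒳 × EuclideanSpace ℝ (Fin m) |
        ∀ k ∈ Finset.Icc 1 n, (p k).2 ∈ Metric.closedBall (ω k) ε}.indicator (1 : (ℕ → 𝒳 × EuclideanSpace ℝ (Fin m)) → ℝ≥0∞) p =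
        ∏ k ∈ Finset.range (n + 1), f k (p k) := fun p => by
    rw [Finset.prod_range_succ']
    simp only [f, if_neg (Nat.succ_ne_zero _), ↓reduceIte, mul_one]
    by_cases h : ∀ k ∈ Finset.Icc 1 n, (p k).2 ∈ Metric.closedBall (ω k) ε
    · rw [indicator_of_mem (by exact h), Pi.one_apply, eq_comm]
      refine Finset.prod_eq_one fun k hk => ?_
      rw [indicator_of_mem (h (k + 1) (by simp at hk ⊢; omega)), Pi.one_apply]
    · rw [indicator_of_notMem (by exact h), eq_comm]
      push Not at h
      obtain ⟨k, hk, hkp⟩ := h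
      rw [Finset.mem_Icc] at hk
      refine Finset.prod_eq_zero (i := k - 1) (by simp; omega) ?_
      rw [Nat.sub_add_cancel hk.1, indicator_of_notMem hkp]
  have H := hB.jetSystem hG hε (hε0.trans_le hε) hϰ hC
  have hm : Measurable fun x =>
      ENNReal.ofReal ((JetSystem.lik M.μ (M.kernelJet G ε) n θ (shiftBy 1 ω)).p x) :=
    (H.lik_good n θ.2 _).measurable_p.ennreal_ofReal
  have hbox : ∀ z, boxFun (M.jointKernel θ) n f z =
      (∏ k ∈ Finset.range n, M.ν (Metric.closedBall (ω (k + 1)) ε)) *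
        ENNReal.ofReal ((JetSystem.lik M.μ (M.kernelJet G ε) n θ (shiftBy 1 ω)).p z.1) := fun z => by
    rw [hB.boxFun_eq hG hε hε0 hϰ hC θ n (y := shiftBy 1 ω) (fun k => hω (k + 1))
      (fun k z => by simp [f, shiftBy]) z]
    simp [f, shiftBy]
  have e0 : M.pathLaw θ (π₀ ⊗ₘ M.obsKernel θ) =
      chainLaw (M.jointKernel θ) (π₀ ⊗ₘ M.obsKernel θ) := rfl
  rw [abcProb, ← lintegral_indicator_one hs, e0]
  simp only [hprod]
  rw [lintegral_box _ n hf]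
  simp only [hbox]
  rw [lintegral_const_mul _ (by exact hm.comp measurable_fst),
    Measure.lintegral_compProd (by exact hm.comp measurable_fst)]
  simp

/-- An ABC maximum likelihood estimate almost maximises the likelihood given an initial state. -/
theorem Bounds.log_lik_le_of_isABCMLE {θ : M.Θ} {π₀ : Measure 𝒳} [IsProbabilityMeasure π₀] {n : ℕ}
    {ω : ℕ → EuclideanSpace ℝ (Fin m)} (hω : ∀ k, ω k ∈ G) (h : M.IsABCMLE π₀ ε n ω θ) (θ' : M.Θ)
    (x : 𝒳) :
    Real.log ((JetSystem.lik M.μ (M.kernelJet G ε) n θ' (shiftBy 1 ω)).p x) ≤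
      Real.log ((JetSystem.lik M.μ (M.kernelJet G ε) n θ (shiftBy 1 ω)).p x) +
        2 * Real.log ϰ := by
  have H := hB.jetSystem hG hε (hε0.trans_le hε) hϰ hC
  have hϰ0 : 0 < ϰ := by linarith
  have g1 := H.lik_good n θ.2 (shiftBy 1 ω)
  have g2 := H.lik_good n θ'.2 (shiftBy 1 ω)
  set p := (JetSystem.lik M.μ (M.kernelJet G ε) n θ (shiftBy 1 ω)).p
  set p' := (JetSystem.lik M.μ (M.kernelJet G ε) n θ' (shiftBy 1 ω)).p
  have h1 := h θ'
  rw [hB.abcProb_eq hG hε hε0 hϰ hC θ' π₀ n hω, hB.abcProb_eq hG hε hε0 hϰ hC θ π₀ n hω,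
    ENNReal.mul_le_mul_iff_right (Finset.prod_ne_zero_iff.2 fun k _ =>
      (hG.measure_pos _ (hω _) ε hε0).ne') (ENNReal.prod_ne_top fun k _ =>
      (isCompact_closedBall _ ε).measure_lt_top.ne)] at h1
  have h2 : ENNReal.ofReal (p' x / ϰ) ≤ ENNReal.ofReal (ϰ * p x) := by
    calc ENNReal.ofReal (p' x / ϰ) = ∫⁻ _, ENNReal.ofReal (p' x / ϰ) ∂π₀ := by simp
      _ ≤ ∫⁻ z, ENNReal.ofReal (p' z) ∂π₀ := lintegral_mono fun z =>
          ENNReal.ofReal_le_ofReal ((div_le_iff₀' hϰ0).2 (g2.harnack x z))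
      _ ≤ ∫⁻ z, ENNReal.ofReal (p z) ∂π₀ := h1
      _ ≤ ∫⁻ _, ENNReal.ofReal (ϰ * p x) ∂π₀ := lintegral_mono fun z =>
          ENNReal.ofReal_le_ofReal (g1.harnack z x)
      _ = _ := by simp
  rw [ENNReal.ofReal_le_ofReal_iff (mul_nonneg hϰ0.le (g1.pos x).le), div_le_iff₀ hϰ0] at h2
  have h3 := Real.log_le_log (g2.pos x) h2
  rw [Real.log_mul (mul_pos hϰ0 (g1.pos x)).ne' hϰ0.ne', Real.log_mul hϰ0.ne' (g1.pos x).ne'] at h3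
  linarith

end HMMFamily

theorem iteratedFDeriv_two_eq {E : Type*} [NormedAddCommGroup E] [NormedSpace ℝ E] {S : Set E}
    {f : E → ℝ} {f' : E → E →L[ℝ] ℝ} {f'' : E → E →L[ℝ] E →L[ℝ] ℝ} {a : E} (ha : a ∈ interior S)
    (d1 : ∀ x ∈ S, HasFDerivWithinAt f (f' x) S x) (d2 : HasFDerivWithinAt f' (f'' a) S a) (v : E) :
    iteratedFDeriv ℝ 2 f a ![v, v] = f'' a v v := by
  have h1 : fderiv ℝ f =ᶠ[𝓝 a] f' := by
    filter_upwards [isOpen_interior.mem_nhds ha] with x hx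
    exact ((d1 x (interior_subset hx)).hasFDerivAt (mem_interior_iff_mem_nhds.1 hx)).fderiv
  rw [iteratedFDeriv_two_apply, h1.fderiv_eq,
    (d2.hasFDerivAt (mem_interior_iff_mem_nhds.1 ha)).fderiv]
  rfl

namespace JetSystem

theorem IsLimit.apply_self {E : Type} [NormedAddCommGroup E] [NormedSpace ℝ E]
    [FiniteDimensional ℝ E] {𝒳 Y : Type*} [MeasurableSpace 𝒳] [MeasurableSpace Y] {Θ : Set E}
    {μ : Measure 𝒳} [IsFiniteMeasure μ] {ϰ : ℝ} {σ : Y → ℝ}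
    {K : E → Y → KernelJet 𝒳 (E →L[ℝ] ℝ) (E →L[ℝ] E →L[ℝ] ℝ)} {P : Measure (ℕ → Y)}
    {θ₀ : E} {x : 𝒳} {r : ℝ} {l : E → ℝ} {l' : E → E →L[ℝ] ℝ} {l'' : E → E →L[ℝ] E →L[ℝ] ℝ}
    (hl : IsLimit Θ μ ϰ σ K P θ₀ x r l l' l'') (hθ₀ : θ₀ ∈ Θ) (hr0 : 0 ≤ r) (hr1 : r < 1) :
    l θ₀ = 0 := by
  have h : ∀ n : ℕ, |l θ₀| ≤ 2 * ϰ ^ 2 / (1 - r) * r ^ n := fun n => by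
    simpa [meanLog, logRatio] using hl.incr n θ₀ hθ₀
  have ht : Tendsto (fun n : ℕ => 2 * ϰ ^ 2 / (1 - r) * r ^ n) atTop (𝓝 0) := by
    simpa using (tendsto_pow_atTop_nhds_zero_of_lt_one hr0 hr1).const_mul (2 * ϰ ^ 2 / (1 - r))
  exact abs_nonpos_iff.1 (ge_of_tendsto' ht h)

end JetSystem

namespace HMMFamily

variable {d m : ℕ} {𝒳 : Type*} [MeasurableSpace 𝒳] {M : HMMFamily d m 𝒳}
  {c C D : ℝ} (hB : M.Bounds c C D) {K ρ : ℝ}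
  {s₁ s₂ b₁ b₂ s₃ : EuclideanSpace ℝ (Fin m) → ℝ} {G : Set (EuclideanSpace ℝ (Fin m))}
  (hG : M.GoodObs K s₁ s₂ G) {ϰ : ℝ} (hϰ : 1 ≤ ϰ) (hC : C ≤ ϰ * c)
  {θs : M.Θ} {π : Measure (𝒳 × EuclideanSpace ℝ (Fin m))} (hπ : M.IsStationary θs π)
  (h₁ : MemLp s₁ 3 π.snd) (h₂ : MemLp s₂ 2 π.snd) (hGae : ∀ᵐ y ∂π.snd, y ∈ G)
  {r : ℝ} (hr0 : 0 < r) (hr1 : r < 1) (hr : 1 - (ϰ ^ 2)⁻¹ ≤ r ^ 4) {x : 𝒳}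

include hB hG hϰ hC hπ h₁ h₂ hr0 hr1 hr

theorem Bounds.exists_isLimit (x : 𝒳) {ε : ℝ} (hε : ε ≤ K) (hK : 0 < K) :
    ∃ l l' l'', JetSystem.IsLimit M.Θ M.μ ϰ (obsScale D s₁ s₂) (M.kernelJet G ε) (M.obsLaw θs π) θs
      x r l l' l'' := by
  have := hπ.isProbabilityMeasure_obsLaw
  exact (hB.jetSystem hG hε hK hϰ hC).exists_isLimit θs.2 M.lengthQuasiconvex_Θ
    M.uniqueDiffOn_Θ hπ.measurePreserving_shiftBy (hπ.memLp_obsScale D h₁ h₂) hr0 hr1 hr x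

/-- ABC maximum likelihood estimates converge to the maximiser of the limit surface. -/
theorem Bounds.tendsto_of_isABCMLE (hGae : ∀ᵐ y ∂π.snd, y ∈ G) {ε : ℝ} (hε0 : 0 < ε) (hε : ε ≤ K)
    {l : EuclideanSpace ℝ (Fin d) → ℝ} (hl : M.IsLimitSurface θs π ε l) {t : M.Θ}
    (ht : ∀ θ' : M.Θ, θ' ≠ t → l θ' < l t) : M.IsABCLimitPoint θs π ε l t := by
  refine ⟨ht, fun π₀ hπ₀ => ?_⟩
  obtain ⟨x₀⟩ := hπ.nonempty
  filter_upwards [hl.2 x₀, hπ.ae_mem hGae] with ω hω hωG θhat hθ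
  have hlik := fun (θ : M.Θ) n => hB.likelihood_eq hG hε (hε0.trans_le hε) hϰ hC θ.2 x₀ n hωG
  rw [tendsto_subtype_rng]
  refine tendsto_of_approx_max M.isCompact_Θ hl.1.continuousOn hω t.2
    (fun θ hθ hne => ht ⟨θ, hθ⟩ fun h => hne (congrArg Subtype.val h)) (fun n => (θhat n).2)
    (e := fun n : ℕ => (1 / (n : ℝ)) * (2 * Real.log ϰ)) ?_ (.of_forall fun n => ?_)
  · simpa using tendsto_one_div_atTop_nhds_zero_nat.mul_const (2 * Real.log ϰ)
  · have h := hB.log_lik_le_of_isABCMLE hG hε hε0 hϰ hC hωG (hθ n) t x₀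
    rw [← hlik, ← hlik] at h
    rw [← mul_add]
    refine mul_le_mul_of_nonneg_left ?_ (by positivity)
    linarith

variable (hLip : M.LipObs ρ b₁ b₂ s₃ G) (hρ0 : 0 < ρ) (hρ : ρ ≤ K)
  {l : ℝ → EuclideanSpace ℝ (Fin d) → ℝ} {l' : ℝ → EuclideanSpace ℝ (Fin d) → _}
  {l'' : ℝ → EuclideanSpace ℝ (Fin d) → _}
  (hl : ∀ ε, 0 ≤ ε → ε ≤ K → JetSystem.IsLimit M.Θ M.μ ϰ (obsScale D s₁ s₂) (M.kernelJet G ε)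
    (M.obsLaw θs π) θs x r (l ε) (l' ε) (l'' ε))

include hLip hρ0 hρ hl

/-- The limit surfaces, and their gradients, depend on `ε` in a Lipschitz manner. -/
theorem Bounds.exists_limit_sub_le (hb₁ : MemLp b₁ 2 π.snd) (hb₂ : MemLp b₂ 2 π.snd) :
    ∃ A, ∀ ε, 0 < ε → ε ≤ ρ → ∀ θ ∈ M.Θ, |l ε θ - l 0 θ| ≤ A * ε ∧ ‖l' ε θ - l' 0 θ‖ ≤ A * ε := by
  have hK : 0 < K := hρ0.trans_le hρ
  have := hπ.1
  have := hπ.isProbabilityMeasure_obsLaw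
  have hσ := hπ.memLp_obsScale D h₁ h₂
  set P := M.obsLaw θs π
  have hs₁ : MemLp s₁ 2 π.snd := h₁.mono_exponent (by norm_num)
  have hδ : MemLp (fun ω : ℕ → EuclideanSpace ℝ (Fin m) => b₁ (ω 0)) 2 P := hπ.memLp hb₁
  have hη : Integrable (fun ω : ℕ → EuclideanSpace ℝ (Fin m) => b₂ (ω 0) + b₁ (ω 0) * s₁ (ω 0)) P :=
    ((hπ.memLp hb₂).integrable one_le_two).add (hδ.integrable_mul (hπ.memLp hs₁))
  set A₁ := ∫ ω, (b₂ (ω 0) + b₁ (ω 0) * s₁ (ω 0)) ∂P +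
    (2 * ((6 * ϰ ^ 2) ^ 2 / (1 - r) ^ 2) + 32) * ∫ ω, b₁ (ω 0) ^ 2 ∂P +
    (2 * (2 ^ 2 / (1 - r) ^ 2) + 8) * ∫ ω, obsScale D s₁ s₂ (ω 0) ^ 2 ∂P
  have hgrad : ∀ ε, 0 < ε → ε ≤ ρ → ∀ θ ∈ M.Θ, ‖l' ε θ - l' 0 θ‖ ≤ A₁ * ε := by
    intro ε h0 hε θ hθ
    have h := (hB.jetSystem hG hK.le hK hϰ hC).norm_limit_grad_sub_le θs.2 M.lengthQuasiconvex_Θ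
      M.uniqueDiffOn_Θ hπ.measurePreserving_shiftBy hσ hr0 hr1 hr (hl 0 le_rfl hK.le)
      (hB.jetSystem hG (hε.trans hρ) hK hϰ hC) (hl ε h0.le (hε.trans hρ))
      (δ := fun y => ε * b₁ y) (η := fun y => ε * (b₂ y + b₁ y * s₁ y))
      (fun y => mul_nonneg h0.le (hLip.nonneg₁ y)) (hδ.const_mul ε) (hη.const_mul ε)
      (fun θ hθ y x z => (hB.kernelJet_sub_le hG hLip hρ hε h0 hθ x z y).1)
      (fun θ hθ y x z => (hB.kernelJet_sub_le hG hLip hρ hε h0 hθ x z y).2) h0 hθ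
    refine h.trans (le_of_eq ?_)
    simp only [mul_pow, integral_const_mul]
    simp only [A₁, P]
    field_simp
  obtain ⟨L, hL1, hL⟩ := M.lengthQuasiconvex_Θ.exists_mvt
  obtain ⟨R, hR⟩ := M.isCompact_Θ.isBounded.subset_closedBall (θs : EuclideanSpace ℝ (Fin d))
  have hR0 : 0 ≤ R := dist_nonneg.trans (hR θs.2)
  have hA0 : ∀ ε, 0 < ε → ε ≤ ρ → 0 ≤ A₁ * ε := fun ε h0 hε =>
    (norm_nonneg _).trans (hgrad ε h0 hε θs θs.2)
  refine ⟨A₁ * max 1 (L * R), fun ε h0 hε θ hθ => ⟨?_, ?_⟩⟩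
  · have i0 := hl 0 le_rfl hK.le
    have i1 := hl ε h0.le (hε.trans hρ)
    have h := hL (fun θ => l ε θ - l 0 θ) (fun θ => l' ε θ - l' 0 θ)
      (fun θ hθ => (i1.d1 θ hθ).sub (i0.d1 θ hθ)) θs θs.2 θ hθ 0 (A₁ * ε) fun θ hθ _ => by
        rw [sub_zero]
        exact hgrad ε h0 hε θ hθ
    rw [i0.apply_self θs.2 hr0.le hr1, i1.apply_self θs.2 hr0.le hr1, sub_zero, sub_zero,
      zero_apply, sub_zero, Real.norm_eq_abs] at h
    refine h.trans ?_
    have h2 : ‖θ - θs‖ ≤ R := by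
      rw [← dist_eq_norm]
      exact hR hθ
    calc A₁ * ε * (L * ‖θ - θs‖) ≤ A₁ * ε * max 1 (L * R) :=
          mul_le_mul_of_nonneg_left ((mul_le_mul_of_nonneg_left h2 (by linarith)).trans
            (le_max_right _ _)) (hA0 ε h0 hε)
      _ = _ := by ring
  · calc ‖l' ε θ - l' 0 θ‖ ≤ A₁ * ε * 1 := (hgrad ε h0 hε θ hθ).trans_eq (mul_one _).symm
      _ ≤ A₁ * ε * max 1 (L * R) := mul_le_mul_of_nonneg_left (le_max_left _ _) (hA0 ε h0 hε)
      _ = _ := by ring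

theorem Bounds.tendsto_limit_hess (hθs : (θs : EuclideanSpace ℝ (Fin d)) ∈ interior M.Θ) :
    Tendsto (fun p : ℝ × EuclideanSpace ℝ (Fin d) => l'' p.1 p.2)
      (𝓝[>] 0 ×ˢ 𝓝 (θs : EuclideanSpace ℝ (Fin d))) (𝓝 (l'' 0 θs)) := by
  have hK : 0 < K := hρ0.trans_le hρ
  have := hπ.isProbabilityMeasure_obsLaw
  have hε : ∀ᶠ q in 𝓝[>] (0 : ℝ) ×ˢ 𝓝 (θs : EuclideanSpace ℝ (Fin d)),
      0 < q.1 ∧ q.1 ≤ ρ ∧ q.2 ∈ M.Θ :=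
    (eventually_fst_prod self_mem_nhdsWithin).and ((eventually_fst_prod
      (nhdsWithin_le_nhds (Iic_mem_nhds hρ0))).and
      (eventually_snd_prod (mem_interior_iff_mem_nhds.1 hθs)))
  have ht := fun y x z => hB.tendsto_kernelJet hG hLip hρ0 hρ hθs x z y
  exact (hB.jetSystem hG hK.le hK hϰ hC).tendsto_limit_hess θs.2 M.lengthQuasiconvex_Θ
    M.uniqueDiffOn_Θ hπ.measurePreserving_shiftBy (hπ.memLp_obsScale D h₁ h₂) hr0 hr1 hr
    (hl 0 le_rfl hK.le) (K := fun p => M.kernelJet G p.1) (l := fun p => l p.1)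
    (l' := fun p => l' p.1) (l'' := fun p => l'' p.1) (ϑ := Prod.snd) θs.2
    (hε.mono fun q h => h.2.2) (hε.mono fun q h => hB.jetSystem hG (h.2.1.trans hρ) hK hϰ hC)
    (hε.mono fun q h => hl q.1 h.1.le (h.2.1.trans hρ)) (B := fun _ => max (C * C) 1)
    (hε.mono fun q h y x z => hB.kernelJet_le hG h.2.1 hρ h.2.2 x z y)
    (fun y x z => (ht y x z).1) (fun y x z => (ht y x z).2.1) fun y x z => (ht y x z).2.2

end HMMFamily

end

theorem theorem5 {d m : ℕ} {𝒳 : Type*} [TopologicalSpace 𝒳] [PolishSpace 𝒳] [MeasurableSpace 𝒳]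
    [BorelSpace 𝒳] (M : HMMFamily d m 𝒳)
    (π : M.Θ → Measure (𝒳 × EuclideanSpace ℝ (Fin m))) (hπ : ∀ θ, M.IsStationary θ (π θ))
    (θs : M.Θ) (h1 : M.A1 θs π) (h2 : M.A2) (h3 : M.A3) (h4 : M.A4) (h5 : M.A5)
    (h6 : M.A6 (π θs)) (h7 : M.A7 (π θs)) :
    ∃ l : ℝ → EuclideanSpace ℝ (Fin d) → ℝ,
      (∀ ε : ℝ, 0 ≤ ε → M.IsLimitSurface θs (π θs) ε (l ε)) ∧
      ((∀ v : EuclideanSpace ℝ (Fin d), v ≠ 0 →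
          iteratedFDeriv ℝ 2 (l 0) (θs : EuclideanSpace ℝ (Fin d)) ![v, v] < 0) →
        ∃ θlim : ℝ → M.Θ,
          (∀ᶠ ε in 𝓝[>] (0 : ℝ), M.IsABCLimitPoint θs (π θs) ε (l ε) (θlim ε)) ∧
          (fun ε => (θlim ε : EuclideanSpace ℝ (Fin d)) - θs) =O[𝓝[>] (0 : ℝ)] fun ε => ε) := by
  obtain ⟨c, C, D, hB⟩ := HMMFamily.exists_bounds h2 h3 h4 h5 h6.1
  set ϰ := max 1 (C / c)
  have hϰ : 1 ≤ ϰ := le_max_left _ _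
  have hC : C ≤ ϰ * c := (div_le_iff₀ hB.pos).1 (le_max_right _ _)
  obtain ⟨r, hr0, hr1, hr⟩ := JetSystem.exists_rate hϰ
  have hs := hπ θs
  have := hs.1
  obtain ⟨x⟩ := hs.nonempty
  obtain ⟨s₁, s₂, G₁, hG₁, hL₁, hL₂, hae₁⟩ := hs.exists_goodObs (h6.2 1 one_pos).1
    (h6.2 1 one_pos).2.1
  obtain ⟨R, hR, h7⟩ := h7
  have hρ0 : 0 < min R 1 := lt_min hR one_pos
  obtain ⟨hd, hm₁, hm₂⟩ := h7 (min R 1) hρ0 (min_le_left _ _)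
  obtain ⟨b₁, b₂, s₃, A, hA, haeA, hb₁, hb₂, hLip⟩ := HMMFamily.exists_lipObs hρ0
    (min_le_right R 1) hd hm₁ hm₂ (h6.2 1 one_pos).2.2
  have hG := hG₁.mono (hG₁.measurableSet.inter hA) inter_subset_left
  have hLip := hLip (G₁ ∩ A) fun y hy => ⟨hy.2, hG₁.subset hy.1⟩
  have hae : ∀ᵐ y ∂(π θs).snd, y ∈ G₁ ∩ A := hae₁.and haeA
  have hex : ∀ ε : ℝ, ∃ l l' l'', ε ≤ 1 → JetSystem.IsLimit M.Θ M.μ ϰ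
      (HMMFamily.obsScale D s₁ s₂) (M.kernelJet (G₁ ∩ A) ε) (M.obsLaw θs (π θs)) θs x r l l' l'' :=
    fun ε => by
      by_cases hε : ε ≤ 1
      · obtain ⟨l, l', l'', h⟩ := hB.exists_isLimit hG hϰ hC hs hL₁ hL₂ hr0 hr1 hr x hε one_pos
        exact ⟨l, l', l'', fun _ => h⟩
      · exact ⟨0, 0, 0, fun h => absurd h hε⟩
  choose l l' l'' hl using hex
  have hbig : ∀ ε : ℝ, ∃ l, 1 < ε → M.IsLimitSurface θs (π θs) ε l := fun ε => by
    by_cases hε : 1 < ε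
    · have hK : 0 < ε := one_pos.trans hε
      obtain ⟨s₁, s₂, G, hG, hL₁, hL₂, hae⟩ := hs.exists_goodObs (h6.2 ε hK).1 (h6.2 ε hK).2.1
      obtain ⟨l, l', l'', h⟩ := hB.exists_isLimit hG hϰ hC hs hL₁ hL₂ hr0 hr1 hr x le_rfl hK
      exact ⟨l, fun _ => hs.isLimitSurface hB hG le_rfl hK hϰ hC hL₁ hL₂ hae hr0 hr1 hr h⟩
    · exact ⟨0, fun h => absurd h hε⟩
  choose lbig hlbig using hbig
  have hsurf : ∀ ε ≤ 1, M.IsLimitSurface θs (π θs) ε (l ε) := fun ε hε =>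
    hs.isLimitSurface hB hG hε one_pos hϰ hC hL₁ hL₂ hae hr0 hr1 hr (hl ε hε)
  refine ⟨fun ε => if ε ≤ 1 then l ε else lbig ε, fun ε _ => ?_, fun hneg => ?_⟩
  · dsimp only
    split_ifs with hε
    · exact hsurf ε hε
    · exact hlbig ε (not_le.1 hε)
  · simp only [if_pos zero_le_one] at hneg
    have hl0 := hl 0 zero_le_one
    obtain ⟨B, hBd⟩ := hB.exists_limit_sub_le hG hϰ hC hs hL₁ hL₂ hr0 hr1 hr hLip hρ0
      (min_le_right R 1) (fun ε _ hε => hl ε hε) hb₁ hb₂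
    have hhess := hB.tendsto_limit_hess hG hϰ hC hs hL₁ hL₂ hr0 hr1 hr hLip hρ0
      (min_le_right R 1) (fun ε _ hε => hl ε hε) h1.1
    obtain ⟨t, ht, hO⟩ := exists_maximisers M.isCompact_Θ h1.1 hρ0
      (fun ε _ hε => (hl ε (hε.trans (min_le_right R 1))).d1)
      (fun ε _ hε => (hl ε (hε.trans (min_le_right R 1))).d2)
      (fun ε h0 hε θ hθ => (hBd ε h0 hε θ hθ).1) (fun ε h0 hε θ hθ => (hBd ε h0 hε θ hθ).2)
      (fun θ hθ hne => by
        rw [hl0.apply_self θs.2 hr0.le hr1]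
        exact hB.limit_neg (θ := ⟨θ, hθ⟩) hG one_pos hϰ hC (hπ ⟨θ, hθ⟩) hs
          (fun h => hne (congrArg Subtype.val ((h1.2 ⟨θ, hθ⟩).2 h))) hL₁ hL₂ hae hr0 hr1 hr hl0)
      hhess
      (fun v hv => by
        rw [← iteratedFDeriv_two_eq h1.1 hl0.d1 (hl0.d2 θs θs.2)]
        exact hneg v hv)
    classical
    have hval : ∀ᶠ ε in 𝓝[>] (0 : ℝ),
        ((if h : t ε ∈ M.Θ then ⟨t ε, h⟩ else θs : M.Θ) : EuclideanSpace ℝ (Fin d)) = t ε :=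
      ht.mono fun ε h => by rw [dif_pos h.1]
    refine ⟨fun ε => if h : t ε ∈ M.Θ then ⟨t ε, h⟩ else θs, ?_, ?_⟩
    · filter_upwards [ht, hval, self_mem_nhdsWithin, nhdsWithin_le_nhds (Iic_mem_nhds one_pos)]
        with ε h hv h0 hε
      rw [if_pos (show ε ≤ 1 from hε)]
      refine hB.tendsto_of_isABCMLE hG hϰ hC hs hL₁ hL₂ hr0 hr1 hr hae h0 hε (hsurf ε hε)
        fun θ' hθ' => ?_
      rw [hv]
      exact h.2 θ' θ'.2 fun e => hθ' (Subtype.ext (e.trans hv.symm))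
    · refine hO.congr' ?_ .rfl
      filter_upwards [hval] with ε hv
      rw [hv]
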